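/- **Conventions.** Sheaves on a scheme are sheaves on its small étale site. A prelog structure on a scheme $S$ is a sheaf of commutative monoids $M$ with a homomorphism $\alpha : M \to (\mathcal O_S, \cdot)$; it is a log structure if $\alpha^{-1}\mathcal O_S^* \to \mathcal O_S^*$ is an isomorphism, and it is integral if $M$ is cancellative. The log structure associated to a prelog structure $(M,\alpha)$ is $(M,\alpha)^a = M \oplus_{\alpha^{-1}\mathcal O_S^*} \mathcal O_S^*$. $\mathbf{LogSch}$ is the category of integral log schemes $Y = (\underline Y, M_Y)$, and $Y \mapsto \underline Y$ is the forgetful functor to the category $\mathbf{Sch}$ of schemes; a morphism $f : Y \to X$ consists of $\underline f : \underline Y \to \underline X$ and a map $f^\dagger : f^{-1}M_X \to M_Y$ compatible with the structure maps. "Cartesian" for a morphism of log schemes means cartesian over $\mathbf{Sch}$ (equivalently, strict). A functor is a groupoid fibration if it is a fibered category all of whose arrows are cartesian. **Log points.** Let $P$ be a sharp integral (i.e. cancellative) commutative monoid, written additively. Let $G(Y) = \operatorname{Hom}(P, \Gamma(\underline Y, \mathcal O_{\underline Y}^*))$. For a log scheme $Y$ let $Y_P$ be the log scheme with the same underlying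 scheme and log structure $M_Y \oplus \underline P$, with structure map $(m,p) \mapsto \alpha_Y(m)$ if $p = 0$ and $(m,p)\mapsto 0$ if $p \neq 0$. The group $G(Y)$ acts on $Y_P$ over $Y$ by $u\cdot(m,p) = (u(p)m,p)$. A *$P$ log point* is a morphism of log schemes $\pi : Y' \to Y$ with $\underline\pi = \mathrm{Id}$, together with a trivialization $\phi : U_P \cong Y' \times_Y U$ over $U$ for some strict étale cover $U \to Y$, such that the two pullbacks of $\phi$ to $U \times_Y U$ differ by the action of an element of $G(U \times_Y U)$. A *$P$ log point in $X$* is a $P$ log point with a morphism $f : Y' \to X$. A *morphism* $(Z' \to Z) \to (Y' \to Y)$ of $P$ log points in $X$ is a cartesian square of log schemes ($h' : Z' \to Y'$ over $h : Z \to Y$) with $\underline h = \underline h'$, compatible with the maps to $X$, such that étale locally $h'$, viewed via the trivializations as a map $Z_P \to Y_P$, differs from the natural map $h_P$ by the action of some section $u$ of $G$. (Thus replacing $\phi$ by a trivialization that differs from it locally by the action of $G$ gives an isomorphic object.) The $P$ log points in $X$ form a category $\mathcal Z$ over $\mathbf{LogSch}$ by $F : (Y' \to Y, f, \phi) \mapsto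 Y$. **Basic and minimal.** Over the cover $U$, $\phi$ gives a decomposition $f^\dagger = (a,h) : f^{-1}M_X \to M_Y \oplus \underline P$. The basic log structure is locally $N_Y = (f^{-1}M_X, \alpha_Y a)^a$, with the map $z^\dagger : N_Y \to M_Y$ of log structures induced by $a$. The log point in $X$ is *basic* if $z^\dagger$ is an isomorphism. An object $z$ of a category $F : \mathcal Z \to \mathbf{LogSch}$ is *minimal* if for all arrows $i : w' \to w$, $j : w' \to z$ with $\underline{F i} = \mathrm{Id}$, $\underline{F j} = \mathrm{Id}$ there is a unique $k : w \to z$ with $k i = j$. **Theorem.** Let $P$ be a sharp integral monoid and $X$ an integral log scheme. The functor $F : \mathcal Z \to \mathbf{LogSch}$ from $P$ log points in $X$ is a groupoid fibration, and: 1. A $P$ log point in $X$ is minimal if and only if it is basic. 2. (B1) For every $w \in \mathcal Z$ there are a minimal object $z$ and an arrow $i : w \to z$ with $\underline{F i} = \mathrm{Id}$. 3. (B2) For every arrow $i : w \to z$ of $\mathcal Z$ with $z$ minimal, $F i$ is cartesian if and only if $w$ is minimal. 4. There are a groupoid fibration $\mathcal X \to \mathbf{Sch}$ and a functor $M$ over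 $\mathbf{Sch}$ from $\mathcal X$ to the category of integral log schemes and cartesian morphisms, such that $\mathcal Z$ is equivalent over $\mathbf{LogSch}$ to the category $(\mathcal X, M)$. The objects of $(\mathcal X, M)$ are the pairs $(x, f : T \to M x)$ with $x\in\mathcal X$ and $f$ a morphism of log schemes with $\underline f = \mathrm{Id}$, its morphisms $(x,f)\to(y,g)$ are the pairs $(a : x \to y,\ b : T \to T')$ with $M(a)\, f = g\, b$, where $g : T' \to M y$, and it lies over $\mathbf{LogSch}$ by $(x, f : T \to Mx) \mapsto T$. (Equivalence over $\mathbf{LogSch}$: the functors commute strictly with the projections to $\mathbf{LogSch}$, and the natural isomorphisms lie over identities.) -/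

import Mathlib

universe u
open CategoryTheory Limits AlgebraicGeometry Opposite

namespace LogGeom
noncomputable section

/-- The abelianization congruence of a monoid. -/
def abCon (M : Type u) [Monoid M] : Con M := conGen fun x y => ∃ a b, x = a * b ∧ y = b * a

/-- The abelianization of a monoid. -/
def Ab (M : Type u) [Monoid M] : Type u := (abCon M).Quotient

instance (M : Type u) [Monoid M] : CommMonoid (Ab M) :=
  { (inferInstance : Monoid (abCon M).Quotient) with
    mul_comm := fun a b => by
      induction a using Con.induction_on with | _ a
      induction b using Con.induction_on with | _ b
      exact ((abCon M).eq).2 (ConGen.Rel.of _ _ ⟨a, b, rfl, rfl⟩) }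

/-- The projection to the abelianization. -/
def abMk (M : Type u) [Monoid M] : M →* Ab M := (abCon M).mk'

/-- The universal property of the abelianization. -/
def abLift {M : Type u} [Monoid M] {N : Type u} [CommMonoid N] (f : M →* N) : Ab M →* N :=
  Con.lift (abCon M) f (Con.conGen_le.2 (by
    rintro x y ⟨a, b, rfl, rfl⟩
    change f _ = f _
    rw [map_mul, map_mul, mul_comm]))

instance : (forget₂ CommMonCat.{u} MonCat.{u}).IsRightAdjoint := by
  have : ∀ M : MonCat.{u}, HasInitial (StructuredArrow M (forget₂ CommMonCat.{u} MonCat.{u})) := by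
    intro M
    refine IsInitial.hasInitial (X := StructuredArrow.mk (Y := CommMonCat.of (Ab M))
      (MonCat.ofHom (abMk M))) ?_
    refine IsInitial.ofUniqueHom (fun N => StructuredArrow.homMk
      (CommMonCat.ofHom (abLift N.hom.hom)) ?_) ?_
    · ext x; rfl
    · intro N g
      ext x
      obtain ⟨x, rfl⟩ := Con.mk'_surjective x
      exact congr($(StructuredArrow.w g) x)
  exact isRightAdjointOfStructuredArrowInitials _

instance : HasColimits CommMonCat.{u} := by
  have : Reflective (forget₂ CommMonCat.{u} MonCat.{u}) :=
    { L := (forget₂ CommMonCat.{u} MonCat.{u}).leftAdjoint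
      adj := Adjunction.ofIsRightAdjoint _ }
  exact hasColimits_of_reflective (forget₂ CommMonCat.{u} MonCat.{u})

instance (S : Scheme.{u}) : HasPushouts (Sheaf S.smallEtaleTopology CommMonCat.{u}) := by
  have : HasSheafify S.smallEtaleTopology CommMonCat.{u} := inferInstance
  infer_instance
instance : ReflectsLimitsOfSize.{u, u + 1} (forget CommMonCat.{u}) := by
  have h : ReflectsLimitsOfSize.{u, u + 1}
      (forget₂ CommMonCat.{u} MonCat.{u} ⋙ forget MonCat.{u}) := comp_reflectsLimits _ _
  exact h

section EtaleSite
variable {S T : Scheme.{u}}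

/-- The scheme underlying an object `V → S` of the small étale site of `S`. -/
def dom (V : S.Etale) : Scheme.{u} := V.left
/-- The structure morphism `V → S` of an object of the small étale site of `S`. -/
def str (V : S.Etale) : dom V ⟶ S := V.hom
/-- The morphism of schemes underlying a morphism of the small étale site. -/
def mor {V W : S.Etale} (g : V ⟶ W) : dom V ⟶ dom W := g.left
/-- An étale `S`-scheme as an object of the small étale site. -/
def etMk {V : Scheme.{u}} (p : V ⟶ S) (hp : Etale p) : S.Etale := Scheme.Etale.mk p

lemma etale_comp {X Y Z : Scheme.{u}} {f : X ⟶ Y} {g : Y ⟶ Z} (hf : Etale f) (hg : Etale g) :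
    Etale (f ≫ g) := inferInstance
lemma etale_snd {X Y Z : Scheme.{u}} {f : X ⟶ Z} (g : Y ⟶ Z) (hf : Etale f) :
    Etale (pullback.snd f g) := inferInstance
lemma etale_fst {X Y Z : Scheme.{u}} (f : X ⟶ Z) {g : Y ⟶ Z} (hg : Etale g) :
    Etale (pullback.fst f g) := inferInstance
lemma str_etale (V : S.Etale) : Etale (str V) := V.prop
lemma mor_etale {V W : S.Etale} (g : V ⟶ W) : Etale (mor g) :=
  inferInstanceAs (Etale g.left)

lemma mor_str {V W : S.Etale} (g : V ⟶ W) : mor g ≫ str W = str V :=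
  CategoryTheory.Over.w ((Scheme.Etale.forget S).map g)

lemma et_ext {V W : S.Etale} {f g : V ⟶ W} (h : mor f = mor g) : f = g :=
  (Scheme.Etale.forget S).map_injective (CategoryTheory.Over.OverMorphism.ext h)

/-- An `S`-morphism of étale `S`-schemes as a morphism of the small étale site. -/
def etHom {V W : S.Etale} (g : dom V ⟶ dom W) (h : g ≫ str W = str V) : V ⟶ W :=
  (Scheme.Etale.forgetFullyFaithful S).preimage (CategoryTheory.Over.homMk g h)

lemma mor_etHom {V W : S.Etale} (g : dom V ⟶ dom W) (h : g ≫ str W = str V) :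
    mor (etHom g h) = g := rfl
lemma mor_id (V : S.Etale) : mor (𝟙 V) = 𝟙 (dom V) := rfl
lemma mor_comp {U V W : S.Etale} (f : U ⟶ V) (g : V ⟶ W) : mor (f ≫ g) = mor f ≫ mor g := rfl

/-- The base change `V ×_T S`, étale over `S`, of an étale `T`-scheme `V` along `f : S ⟶ T`. -/
def etPb (f : S ⟶ T) (V : T.Etale) : S.Etale :=
  etMk (pullback.snd (str V) f) (etale_snd _ (str_etale V))

/-- The projection `V ×_T S → V`. -/
def etFst (f : S ⟶ T) (V : T.Etale) : dom (etPb f V) ⟶ dom V := pullback.fst (str V) f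

lemma etFst_str (f : S ⟶ T) (V : T.Etale) :
    etFst f V ≫ str V = str (etPb f V) ≫ f := pullback.condition

/-- The morphism `U → V ×_T S` given by a morphism `U → V` over `f`. -/
def etLift (f : S ⟶ T) {U : S.Etale} {V : T.Etale} (k : dom U ⟶ dom V)
    (h : k ≫ str V = str U ≫ f) : U ⟶ etPb f V :=
  etHom (pullback.lift k (str U) h) (pullback.lift_snd _ _ _)

lemma etLift_fst (f : S ⟶ T) {U : S.Etale} {V : T.Etale} (k : dom U ⟶ dom V)
    (h : k ≫ str V = str U ≫ f) : mor (etLift f k h) ≫ etFst f V = k := pullback.lift_fst _ _ _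

lemma etPb_hom_ext (f : S ⟶ T) {U : S.Etale} {V : T.Etale}
    {a b : U ⟶ etPb f V} (h : mor a ≫ etFst f V = mor b ≫ etFst f V) : a = b :=
  et_ext (pullback.hom_ext h ((mor_str a).trans (mor_str b).symm))

/-- The morphism `V ×_T S → W ×_T S` induced by `V → W`. -/
def etPbMap (f : S ⟶ T) {V W : T.Etale} (g : V ⟶ W) : etPb f V ⟶ etPb f W :=
  etLift f (etFst f V ≫ mor g) (by rw [Category.assoc, mor_str, etFst_str])

lemma map_etFst (f : S ⟶ T) {V W : T.Etale} (g : V ⟶ W) :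
    mor (etPbMap f g) ≫ etFst f W = etFst f V ≫ mor g := etLift_fst _ _ _

/-- Base change `V ↦ V ×_T S` of étale schemes along `f : S ⟶ T`. -/
def etPullback (f : S ⟶ T) : T.Etale ⥤ S.Etale where
  obj V := etPb f V
  map g := etPbMap f g
  map_id V := etPb_hom_ext f (by
    rw [map_etFst, mor_id, mor_id, Category.comp_id, Category.id_comp])
  map_comp {U V W} g h := etPb_hom_ext f (by
    rw [map_etFst, mor_comp, mor_comp, Category.assoc, map_etFst, ← Category.assoc,
      ← Category.assoc, map_etFst])

/-- Composition `(V → S) ↦ (V → S → T)` with an étale morphism `f : S ⟶ T`. -/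
def etMap (f : S ⟶ T) (hf : Etale f) : S.Etale ⥤ T.Etale where
  obj V := etMk (str V ≫ f) (etale_comp (str_etale V) hf)
  map {V W} g := etHom (V := etMk (str V ≫ f) _) (W := etMk (str W ≫ f) _)
    (mor (V := V) (W := W) g) (by
    refine (Category.assoc _ _ _).symm.trans ?_
    exact congrArg (· ≫ f) (mor_str g))

lemma mor_etMap (f : S ⟶ T) (hf : Etale f) {V W : S.Etale} (g : V ⟶ W) :
    mor ((etMap f hf).map g) = mor (V := V) (W := W) g := rfl

lemma mem_smallEtale_iff {X : S.Etale} (R : Sieve X) :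
    R ∈ S.smallEtaleTopology X ↔
      ∀ x : dom X, ∃ (Y : S.Etale) (f : Y ⟶ X) (y : dom Y), R f ∧ mor f y = x := by
  obtain ⟨ι, Y, f, rfl⟩ := R.exists_eq_ofArrows
  rw [Scheme.ofArrows_mem_smallEtaleTopology_iff]
  constructor
  · intro h x
    obtain ⟨i, y, hy⟩ := Set.mem_iUnion.1 (h.ge (Set.mem_univ x))
    exact ⟨Y i, f i, y, Sieve.ofArrows_mk _ _ _, hy⟩
  · intro h
    refine Set.eq_univ_of_forall fun x => ?_
    obtain ⟨Z, g, y, ⟨W, a, b, ⟨i⟩, rfl⟩, hy⟩ := h x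
    refine Set.mem_iUnion.2 ⟨i, mor a y, ?_⟩
    rw [← hy]
    rfl

lemma etPullback_coverPreserving (f : S ⟶ T) :
    CoverPreserving T.smallEtaleTopology S.smallEtaleTopology (etPullback f) where
  cover_preserve {V R} hR := by
    rw [mem_smallEtale_iff] at hR ⊢
    intro (x : dom (etPb f V))
    obtain ⟨Y, g, y, hg, hy⟩ := hR (etFst f V x)
    obtain ⟨z, hz1, hz2⟩ := Scheme.Pullback.exists_preimage_pullback (f := mor g)
      (g := etFst f V) y x hy
    let W : S.Etale := etMk (pullback.snd (mor g) (etFst f V) ≫ str _)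
      (etale_comp (etale_snd _ (mor_etale g)) (str_etale _))
    let q : W ⟶ etPb f V := etHom (pullback.snd (mor g) (etFst f V)) rfl
    let k' : dom W ⟶ dom Y := pullback.fst (mor g) (etFst f V)
    have hk' : k' ≫ mor g = mor q ≫ etFst f V := pullback.condition
    let k : W ⟶ etPb f Y := etLift f k' (by
      rw [← mor_str g, ← Category.assoc, hk', Category.assoc, etFst_str,
        ← Category.assoc, mor_str])
    have hk : k ≫ etPbMap f g = q := etPb_hom_ext f (by
      rw [mor_comp, Category.assoc, map_etFst, ← Category.assoc, etLift_fst, hk'])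
    refine ⟨etPb f Y, etPbMap f g, mor k z,
      Sieve.image_mem_functorPushforward _ _ hg, ?_⟩
    rw [← hz2]
    exact congr(mor $hk z)

instance etPullback_isContinuous (f : S ⟶ T) :
    (etPullback f).IsContinuous T.smallEtaleTopology S.smallEtaleTopology := by
  refine Functor.isContinuous_of_coverPreserving ⟨?_⟩ (etPullback_coverPreserving f)
  intro G Z R x hx Y₁ Y₂ X (f₁ : X ⟶ etPb f Y₁) (f₂ : X ⟶ etPb f Y₂)
    g₁ g₂ h1 h2 (he : f₁ ≫ etPbMap f g₁ = f₂ ≫ etPbMap f g₂)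
  let W : T.Etale := etMk (pullback.fst (mor g₁) (mor g₂) ≫ str Y₁)
      (etale_comp (etale_fst _ (mor_etale g₂)) (str_etale _))
  let q₁ : W ⟶ Y₁ := etHom (pullback.fst (mor g₁) (mor g₂)) rfl
  let q₂ : W ⟶ Y₂ := etHom (pullback.snd (mor g₁) (mor g₂)) (by
    refine .trans ?_ (show pullback.fst (mor g₁) (mor g₂) ≫ str Y₁ = _ from rfl)
    rw [← mor_str g₁, ← mor_str g₂]
    exact (pullback.condition_assoc _).symm)
  have he' : (mor f₁ ≫ etFst f Y₁) ≫ mor g₁ = (mor f₂ ≫ etFst f Y₂) ≫ mor g₂ := by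
    rw [Category.assoc, Category.assoc, ← map_etFst, ← map_etFst, ← Category.assoc,
      ← Category.assoc, ← mor_comp, ← mor_comp, he]
  let k : dom X ⟶ dom W := pullback.lift (mor f₁ ≫ etFst f Y₁) (mor f₂ ≫ etFst f Y₂) he'
  have hk₁ : k ≫ mor q₁ = mor f₁ ≫ etFst f Y₁ := pullback.lift_fst _ _ _
  have hk₂ : k ≫ mor q₂ = mor f₂ ≫ etFst f Y₂ := pullback.lift_snd _ _ _
  let l : X ⟶ etPb f W := etLift f k (by
    rw [← mor_str q₁, ← Category.assoc, hk₁, Category.assoc, etFst_str, ← Category.assoc, mor_str])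
  have e₁ : l ≫ etPbMap f q₁ = f₁ := etPb_hom_ext f (by
    rw [mor_comp, Category.assoc, map_etFst, ← Category.assoc, etLift_fst, hk₁])
  have e₂ : l ≫ etPbMap f q₂ = f₂ := etPb_hom_ext f (by
    rw [mor_comp, Category.assoc, map_etFst, ← Category.assoc, etLift_fst, hk₂])
  have hc := hx q₁ q₂ h1 h2 (et_ext pullback.condition)
  have key := congrArg (G.obj.map l.op) hc
  refine Eq.trans ?_ (key.trans ?_)
  · change G.obj.map f₁.op _ = G.obj.map l.op (G.obj.map (etPbMap f q₁).op _)
    rw [← e₁, op_comp, Functor.map_comp]; rfl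
  · change G.obj.map l.op (G.obj.map (etPbMap f q₂).op _) = G.obj.map f₂.op _
    rw [← e₂, op_comp, Functor.map_comp]; rfl

lemma etMap_coverPreserving (f : S ⟶ T) (hf : Etale f) :
    CoverPreserving S.smallEtaleTopology T.smallEtaleTopology (etMap f hf) where
  cover_preserve {V R} hR := by
    rw [mem_smallEtale_iff] at hR ⊢
    intro x
    obtain ⟨Y, g, y, hg, hy⟩ := hR (show dom V from x)
    refine ⟨(etMap f hf).obj Y, (etMap f hf).map g, y,
      Sieve.image_mem_functorPushforward _ _ hg, ?_⟩
    exact hy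

instance etMap_isContinuous (f : S ⟶ T) (hf : Etale f) :
    (etMap f hf).IsContinuous S.smallEtaleTopology T.smallEtaleTopology := by
  refine Functor.isContinuous_of_coverPreserving ⟨?_⟩ (etMap_coverPreserving f hf)
  intro G Z R x hx Y₁ Y₂ X f₁ f₂ g₁ g₂ h1 h2 he
  let f₁' : dom X ⟶ dom Y₁ := mor f₁
  let f₂' : dom X ⟶ dom Y₂ := mor f₂
  have he' : f₁' ≫ mor g₁ = f₂' ≫ mor g₂ := by
    have : mor (f₁ ≫ (etMap f hf).map g₁) = mor (f₂ ≫ (etMap f hf).map g₂) := congrArg mor he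
    exact this
  have hs : f₂' ≫ str Y₂ = f₁' ≫ str Y₁ := by
    rw [← mor_str g₁, ← mor_str g₂, ← Category.assoc, ← Category.assoc, he']
  let X' : S.Etale := etMk (f₁' ≫ str Y₁) (etale_comp (mor_etale f₁) (str_etale _))
  let q₁ : X' ⟶ Y₁ := etHom f₁' rfl
  let q₂ : X' ⟶ Y₂ := etHom f₂' hs
  let l : X ⟶ (etMap f hf).obj X' := etHom (𝟙 _) ((Category.id_comp _).trans
    ((Category.assoc _ _ _).trans (mor_str f₁)))
  have e₁ : l ≫ (etMap f hf).map q₁ = f₁ := et_ext (by exact Category.id_comp f₁')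
  have e₂ : l ≫ (etMap f hf).map q₂ = f₂ := et_ext (by exact Category.id_comp f₂')
  have hc := hx q₁ q₂ h1 h2 (et_ext he')
  rw [← e₁, ← e₂]
  have := congrArg (G.obj.map l.op) hc
  simpa using this
end EtaleSite

section Inv
variable {S T : Scheme.{u}} (f : S ⟶ T)

instance : ∀ (F : T.AffineEtaleᵒᵖ ⥤ CommMonCat.{u}),
    (Scheme.AffineEtale.Spec T ⋙ etPullback f).op.HasLeftKanExtension F := by
  intro F
  have h (Y) : EssentiallySmall.{u} (CostructuredArrow (Scheme.AffineEtale.Spec T ⋙ etPullback f).op Y) := inferInstance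
  have h (Y) : HasColimitsOfShape (CostructuredArrow (Scheme.AffineEtale.Spec T ⋙ etPullback f).op Y) CommMonCat.{u} := 
    hasColimitsOfShape_of_essentiallySmall.{u} _ _
  infer_instance

instance : ((etPullback f).sheafPushforwardContinuous CommMonCat.{u} T.smallEtaleTopology
    S.smallEtaleTopology).IsRightAdjoint := by
  let G := Scheme.AffineEtale.Spec T
  have : HasSheafify S.smallEtaleTopology CommMonCat.{u} := inferInstance
  have : G.IsContinuous (Scheme.AffineEtale.topology T) T.smallEtaleTopology := inferInstance
  have : (G ⋙ etPullback f).IsContinuous (Scheme.AffineEtale.topology T) S.smallEtaleTopology :=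
    Functor.isContinuous_comp _ _ _ T.smallEtaleTopology _
  have : ((G ⋙ etPullback f).sheafPushforwardContinuous CommMonCat.{u} (Scheme.AffineEtale.topology T)
    S.smallEtaleTopology).IsRightAdjoint := inferInstance
  have e : (etPullback f).sheafPushforwardContinuous CommMonCat.{u} T.smallEtaleTopology
    S.smallEtaleTopology ⋙ G.sheafPushforwardContinuous CommMonCat.{u} (Scheme.AffineEtale.topology T) T.smallEtaleTopology ≅ (G ⋙ etPullback f).sheafPushforwardContinuous CommMonCat.{u} (Scheme.AffineEtale.topology T)
    S.smallEtaleTopology := Iso.refl _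
  have : (G.sheafPushforwardContinuous CommMonCat.{u} (Scheme.AffineEtale.topology T) T.smallEtaleTopology).IsEquivalence := inferInstance
  have h2 := Functor.isRightAdjoint_of_iso e.symm
  let E := (G.sheafPushforwardContinuous CommMonCat.{u} (Scheme.AffineEtale.topology T) T.smallEtaleTopology)
  have e2 : ((etPullback f).sheafPushforwardContinuous CommMonCat.{u} T.smallEtaleTopology
    S.smallEtaleTopology ⋙ E) ⋙ E.inv ≅ (etPullback f).sheafPushforwardContinuous CommMonCat.{u} T.smallEtaleTopology
    S.smallEtaleTopology := Functor.associator _ _ _ ≪≫ Functor.isoWhiskerLeft _ E.asEquivalence.unitIso.symm ≪≫ Functor.rightUnitor _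
  exact Functor.isRightAdjoint_of_iso e2
end Inv
section Sheaves
variable (S : Scheme.{u})

/-- The functor `(V → S) ↦ V`. -/
def domFunctor : S.Etale ⥤ Scheme.{u} where
  obj V := dom V
  map g := mor g

lemma domFunctor_coverPreserving :
    CoverPreserving S.smallEtaleTopology Scheme.etaleTopology (domFunctor S) where
  cover_preserve {V R} hR := by
    rw [mem_smallEtale_iff] at hR
    choose Y f y hf hy using hR
    refine Scheme.mem_grothendieckTopology_iff.2 ?_
    let 𝒰 : Scheme.Cover.{u} (Scheme.precoverage @Etale) (dom V) :=
      Scheme.Cover.mkOfCovers (dom V) (fun x => dom (Y x))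
        (fun x => mor (f x)) (fun x => ⟨x, y x, hy x⟩) (fun x => mor_etale (f x))
    refine ⟨𝒰, ?_⟩
    rintro _ _ ⟨x⟩
    exact Sieve.image_mem_functorPushforward _ _ (hf x)

instance domFunctor_isContinuous :
    (domFunctor S).IsContinuous S.smallEtaleTopology Scheme.etaleTopology := by
  refine Functor.isContinuous_of_coverPreserving ⟨?_⟩ (domFunctor_coverPreserving S)
  intro G Z R x hx Y₁ Y₂ X (f₁ : X ⟶ dom Y₁) (f₂ : X ⟶ dom Y₂) g₁ g₂ h1 h2
    (he : f₁ ≫ mor g₁ = f₂ ≫ mor g₂)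
  let W : S.Etale := etMk (pullback.fst (mor g₁) (mor g₂) ≫ str Y₁)
      (etale_comp (etale_fst _ (mor_etale g₂)) (str_etale _))
  let q₁ : W ⟶ Y₁ := etHom (pullback.fst (mor g₁) (mor g₂)) rfl
  let q₂ : W ⟶ Y₂ := etHom (pullback.snd (mor g₁) (mor g₂)) (by
    refine .trans ?_ (show pullback.fst (mor g₁) (mor g₂) ≫ str Y₁ = _ from rfl)
    rw [← mor_str g₁, ← mor_str g₂]
    exact (pullback.condition_assoc _).symm)
  let l : X ⟶ dom W := pullback.lift f₁ f₂ he
  have e₁ : l ≫ mor q₁ = f₁ := pullback.lift_fst _ _ _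
  have e₂ : l ≫ mor q₂ = f₂ := pullback.lift_snd _ _ _
  have hc := hx q₁ q₂ h1 h2 (et_ext pullback.condition)
  have key := congrArg (G.obj.map l.op) hc
  refine Eq.trans ?_ (key.trans ?_)
  · change G.obj.map f₁.op _ = G.obj.map l.op (G.obj.map (mor q₁).op _)
    rw [← e₁, op_comp, Functor.map_comp]; rfl
  · change G.obj.map l.op (G.obj.map (mor q₂).op _) = G.obj.map f₂.op _
    rw [← e₂, op_comp, Functor.map_comp]; rfl

lemma isSheaf_dom {F : Scheme.{u}ᵒᵖ ⥤ Type u} (hF : Presheaf.IsSheaf Scheme.fpqcTopology F) :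
    Presheaf.IsSheaf S.smallEtaleTopology ((domFunctor S).op ⋙ F) := by
  refine Functor.op_comp_isSheaf_of_isSheaf _ _ Scheme.etaleTopology _ ?_
  exact .of_le (Scheme.etaleTopology_le_proetaleTopology.trans Scheme.proetaleTopology_le_fpqcTopology) hF

/-- The presheaf `V ↦ Γ(V, 𝒪_V)` of multiplicative monoids. -/
def strPsh : S.Etaleᵒᵖ ⥤ CommMonCat.{u} where
  obj V := CommMonCat.of Γ(dom V.unop, ⊤)
  map g := CommMonCat.ofHom (mor g.unop).appTop.hom.toMonoidHom
  map_id V := by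
    ext x
    exact congr($((Scheme.Hom.id_appTop (X := dom V.unop))) x)
  map_comp f g := by
    ext x
    exact congr($(Scheme.Hom.comp_appTop (mor g.unop) (mor f.unop)) x)

lemma strPsh_isSheaf : Presheaf.IsSheaf S.smallEtaleTopology (strPsh S) := by
  refine Presheaf.isSheaf_of_isSheaf_comp _ _ (forget CommMonCat.{u}) ?_
  let A := Spec (.of (MvPolynomial PUnit.{u+1} (ULift.{u} ℤ)))
  have h := isSheaf_dom S ((isSheaf_iff_isSheaf_of_type _ _).2 
    (GrothendieckTopology.Subcanonical.isSheaf_of_isRepresentable (J := Scheme.fpqcTopology.{u}) (yoneda.obj A)))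
  refine (Presheaf.isSheaf_of_iso_iff ?_).1 h
  refine NatIso.ofComponents (fun V => ((AffineSpace.toSpecMvPolyIntEquiv PUnit).trans
    (Equiv.funUnique PUnit _)).toIso) ?_
  intro V W f
  ext k
  exact AffineSpace.toSpecMvPolyIntEquiv_comp _ (mor f.unop) k default
end Sheaves


/- The functor of units preserves limits, so it preserves sheaves. -/
section Units

instance : ReflectsLimitsOfSize.{u+1, u + 1} (forget CommMonCat.{u}) := by
  have h : ReflectsLimitsOfSize.{u+1, u + 1}
      (forget₂ CommMonCat.{u} MonCat.{u} ⋙ forget MonCat.{u}) := comp_reflectsLimits _ _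
  exact h
instance : PreservesLimitsOfSize.{u+1,u+1} (forget₂ CommGrpCat.{u} CommMonCat.{u}) := by
  have : PreservesLimitsOfSize.{u+1,u+1} (forget₂ CommGrpCat.{u} CommMonCat.{u} ⋙ forget CommMonCat.{u}) :=
    inferInstanceAs (PreservesLimitsOfSize.{u+1,u+1} (forget CommGrpCat.{u}))
  exact preservesLimits_of_reflects_of_preserves _ (forget CommMonCat.{u})
/-- The functor `M ↦ Mˣ`. -/
def unitsFunctor : CommMonCat.{u} ⥤ CommMonCat.{u} := CommMonCat.units ⋙ forget₂ CommGrpCat.{u} CommMonCat.{u}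
instance : PreservesLimitsOfSize.{u+1,u+1} (unitsFunctor.{u}) := by
  have : PreservesLimitsOfSize.{u+1,u+1} CommMonCat.units.{u} := inferInstance
  unfold unitsFunctor
  infer_instance
end Units

section LogStructures
/-- Sheaves of commutative monoids on the small étale site of `S`. -/
abbrev MSheaf (S : Scheme.{u}) := Sheaf S.smallEtaleTopology CommMonCat.{u}

/-- The structure sheaf `𝒪_S` on the étale site, as a sheaf of multiplicative monoids. -/
def strSheaf (S : Scheme.{u}) : Sheaf S.smallEtaleTopology CommMonCat.{u} :=
  ⟨strPsh S, strPsh_isSheaf S⟩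

/-- The sheaf `𝒪_S^*` of units. -/
def unitSheaf (S : Scheme.{u}) : Sheaf S.smallEtaleTopology CommMonCat.{u} :=
  (sheafCompose S.smallEtaleTopology unitsFunctor.{u}).obj (strSheaf S)

/-- The inclusion `𝒪_S^* ⟶ 𝒪_S`. -/
def unitIncl (S : Scheme.{u}) : unitSheaf S ⟶ strSheaf S :=
  ⟨{ app := fun V => CommMonCat.ofHom (Units.coeHom ((strPsh S).obj V)), naturality := fun _ _ _ => rfl }⟩

/-- The sections of `M` over `V`. -/
abbrev sec {S : Scheme.{u}} (M : MSheaf S) (V : S.Etale) : Type u := M.obj.obj (op V)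

/-- The restriction of sections along `g : V ⟶ W`. -/
def rs {S : Scheme.{u}} (M : MSheaf S) {V W : S.Etale} (g : V ⟶ W) : sec M W →* sec M V :=
  (M.obj.map g.op).hom

/-- The global functions on a scheme. -/
abbrev fn (X : Scheme.{u}) : Type u := Γ(X, ⊤)

/-- Pullback of functions. -/
def fnMap {X Y : Scheme.{u}} (t : X ⟶ Y) : fn Y →+* fn X := t.appTop.hom

lemma fnMap_id (X : Scheme.{u}) (x : fn X) : fnMap (𝟙 X) x = x :=
  congr($(Scheme.Hom.id_appTop (X := X)) x)
lemma fnMap_comp {X Y Z : Scheme.{u}} (f : X ⟶ Y) (g : Y ⟶ Z) (x : fn Z) :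
   fnMap (f ≫ g) x = fnMap f (fnMap g x) := congr($(Scheme.Hom.comp_appTop f g) x)

/-- A morphism of sheaves on sections over `V`. -/
def ap {S : Scheme.{u}} {M N : MSheaf S} (f : M ⟶ N) (V : S.Etale) : sec M V →* sec N V := (f.hom.app (op V)).hom

lemma rs_id {S : Scheme.{u}} (M : MSheaf S) {V : S.Etale} (m : sec M V) : rs M (𝟙 V) m = m := by
  simp [rs]
lemma rs_comp {S : Scheme.{u}} (M : MSheaf S) {U V W : S.Etale} (f : U ⟶ V) (g : V ⟶ W) (m : sec M W) : 
   rs M (f ≫ g) m = rs M f (rs M g m) := by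
  simp [rs]
lemma rs_ap {S : Scheme.{u}} {M N : MSheaf S} (f : M ⟶ N) {V W : S.Etale} (g : V ⟶ W) (m : sec M W) :
  rs N g (ap f W m) = ap f V (rs M g m) := (NatTrans.naturality_apply f.hom g.op m).symm

/-- A map `α : M ⟶ 𝒪_S` on sections over `V`. -/
def alphaAt {S : Scheme.{u}} {M : MSheaf S} (α : M ⟶ strSheaf S) (V : S.Etale) :
    sec M V →* fn (dom V) := ap α V

/-- An integral log structure on `S`: a sheaf of commutative monoids `M` on the étale site with a
map `α : M ⟶ 𝒪_S` inducing an isomorphism `α⁻¹(𝒪_S^*) ≅ 𝒪_S^*`, and such that `M` is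
cancellative. -/
structure IntLog (S : Scheme.{u}) where
  M : MSheaf S
  α : M ⟶ strSheaf S
  existsUnique_unit : ∀ (V : S.Etale) (v : (fn (dom V))ˣ), ∃! m : sec M V, alphaAt α V m = v
  integral : ∀ V : S.Etale, IsCancelMul (sec M V)

namespace IntLog
variable {S : Scheme.{u}} (L : IntLog S)

/-- The structure map `α` on sections over `V`. -/
def al (V : S.Etale) : sec L.M V →* fn (dom V) := alphaAt L.α V

lemma al_rs {V W : S.Etale} (g : V ⟶ W) (m : sec L.M W) :
   L.al V (rs L.M g m) = fnMap (mor g) (L.al W m) := (rs_ap L.α g m).symm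

/-- The inclusion `𝒪_S^* ⊆ M` on sections over `V`. -/
def unit (V : S.Etale) : (fn (dom V))ˣ →* sec L.M V where
  toFun v := (L.existsUnique_unit V v).choose
  map_one' := ((L.existsUnique_unit V 1).choose_spec.2 1 (map_one (L.al V))).symm
  map_mul' v w := by
    refine ((L.existsUnique_unit V (v * w)).choose_spec.2 _ ?_).symm
    refine (map_mul (L.al V) _ _).trans ?_
    rw [Units.val_mul]
    exact congr_arg₂ _ (L.existsUnique_unit V v).choose_spec.1 (L.existsUnique_unit V w).choose_spec.1

lemma al_unit (V : S.Etale) (v : (fn (dom V))ˣ) : L.al V (L.unit V v) = v :=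
  (L.existsUnique_unit V v).choose_spec.1

lemma eq_unit {V : S.Etale} {v : (fn (dom V))ˣ} {m : sec L.M V} (h : L.al V m = v) : m = L.unit V v :=
  (L.existsUnique_unit V v).choose_spec.2 m h

lemma rs_unit {V W : S.Etale} (g : V ⟶ W) (v : (fn (dom W))ˣ) :
    rs L.M g (L.unit W v) = L.unit V (Units.map (fnMap (mor g)) v) :=
  L.eq_unit (by rw [al_rs, al_unit]; rfl)

/-- The inclusion `𝒪_S^* ⊆ M`. -/
def unitHom : unitSheaf S ⟶ L.M :=
  ⟨{ app := fun V => CommMonCat.ofHom (L.unit V.unop)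
     naturality := fun V W g => by
      ext v
      exact (L.rs_unit g.unop v).symm }⟩
 
end IntLog

/-- An integral log scheme. -/
structure IntLogSch where
  base : Scheme.{u}
  log : IntLog base

/-- A morphism of log schemes `f : Y ⟶ X`: a morphism `base` of schemes and a map of sheaves of
monoids `base⁻¹ M_X ⟶ M_Y` compatible with the structure maps to `𝒪_Y` (equivalently, a map of log
structures `f^* M_X ⟶ M_Y`). The map of sheaves is given in the form of a natural family of maps
`map t : M_X(V) ⟶ M_Y(U)`, one for each morphism `t : U ⟶ V` over `base` from an étale `Y`-scheme
to an étale `X`-scheme. -/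
structure LogMap (Y X : IntLogSch.{u}) where
  base : Y.base ⟶ X.base
  map : ∀ {U : Y.base.Etale} {V : X.base.Etale} (t : dom U ⟶ dom V)
    (_ : t ≫ str V = str U ≫ base), sec X.log.M V →* sec Y.log.M U
  map_left : ∀ {U' U : Y.base.Etale} {V : X.base.Etale} (g : U' ⟶ U) (t : dom U ⟶ dom V)
    (h : t ≫ str V = str U ≫ base) (m : sec X.log.M V),
    map (mor g ≫ t) (by rw [Category.assoc, h, ← Category.assoc, mor_str]) m = rs Y.log.M g (map t h m)
  map_right : ∀ {U : Y.base.Etale} {V V' : X.base.Etale} (t : dom U ⟶ dom V) (g : V ⟶ V')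
    (h : t ≫ str V = str U ≫ base) (m : sec X.log.M V'),
    map (t ≫ mor g) (by rw [Category.assoc, mor_str, h]) m = map t h (rs X.log.M g m)
  map_al : ∀ {U : Y.base.Etale} {V : X.base.Etale} (t : dom U ⟶ dom V)
    (h : t ≫ str V = str U ≫ base) (m : sec X.log.M V),
    Y.log.al U (map t h m) = fnMap t (X.log.al V m)

namespace LogMap
variable {Z Y X W : IntLogSch.{u}}

lemma ext' {f g : LogMap Y X} (hb : f.base = g.base)
    (h : ∀ {U : Y.base.Etale} {V : X.base.Etale} (t : dom U ⟶ dom V)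
      (h₁ : t ≫ str V = str U ≫ f.base) (h₂ : t ≫ str V = str U ≫ g.base) (m : sec X.log.M V),
      f.map t h₁ m = g.map t h₂ m) : f = g := by
  cases f with | _ fb fm
  cases g with | _ gb gm
  obtain rfl : fb = gb := hb
  have : @fm = @gm := by
    funext U V t ht
    ext m
    exact h t ht ht m
  subst this
  rfl

lemma map_congr (f : LogMap Y X) {U : Y.base.Etale} {V : X.base.Etale} {t t' : dom U ⟶ dom V}
    (h : t = t') (ht : t ≫ str V = str U ≫ f.base) (m : sec X.log.M V) :
    f.map t ht m = f.map t' (h ▸ ht) m := by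
  subst h; rfl

/-- The morphism to `V ×_T S` given by its two components. -/
def toPb {S T Q : Scheme.{u}} (f : S ⟶ T) (V : T.Etale) (k : Q ⟶ dom V) (j : Q ⟶ S)
    (h : k ≫ str V = j ≫ f) : Q ⟶ dom (etPb f V) := pullback.lift k j h
lemma toPb_fst {S T Q : Scheme.{u}} (f : S ⟶ T) (V : T.Etale) (k : Q ⟶ dom V) (j : Q ⟶ S)
    (h : k ≫ str V = j ≫ f) : toPb f V k j h ≫ etFst f V = k := pullback.lift_fst _ _ _
lemma toPb_str {S T Q : Scheme.{u}} (f : S ⟶ T) (V : T.Etale) (k : Q ⟶ dom V) (j : Q ⟶ S)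
    (h : k ≫ str V = j ≫ f) : toPb f V k j h ≫ str (etPb f V) = j := pullback.lift_snd _ _ _
lemma toPb_ext {S T Q : Scheme.{u}} (f : S ⟶ T) (V : T.Etale) {a b : Q ⟶ dom (etPb f V)}
    (h₁ : a ≫ etFst f V = b ≫ etFst f V) (h₂ : a ≫ str (etPb f V) = b ≫ str (etPb f V)) :
    a = b := pullback.hom_ext h₁ h₂

/-- The identity: `map t` is the restriction along `t`. -/
def id (X : IntLogSch.{u}) : LogMap X X where
  base := 𝟙 _
  map t h := rs X.log.M (etHom t (h.trans (Category.comp_id _)))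
  map_left g t _ m := rs_comp X.log.M g (etHom t _) m
  map_right t g _ m := rs_comp X.log.M (etHom t _) g m
  map_al _ _ m := X.log.al_rs _ m

/-- Composition: a section is first pulled back to `V ×_X Y`, then further. -/
def comp (f : LogMap Z Y) (g : LogMap Y X) : LogMap Z X where
  base := f.base ≫ g.base
  map {U V} t h := (f.map (toPb g.base V t (str U ≫ f.base) (h.trans (Category.assoc _ _ _).symm))
      (toPb_str _ _ _ _ _)).comp (g.map (etFst g.base V) (etFst_str _ _))
  map_left {U' U V} g' t h m := by
    simp only [MonoidHom.comp_apply]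
    rw [← f.map_left]
    refine f.map_congr (toPb_ext _ _ ?_ ?_) _ _
    · rw [toPb_fst, Category.assoc, toPb_fst]
    · rw [toPb_str, Category.assoc, toPb_str, ← Category.assoc, mor_str]
  map_right {U V V'} t g' h m := by
    simp only [MonoidHom.comp_apply]
    rw [← g.map_right, g.map_congr (map_etFst g.base g').symm, g.map_left _ _ (etFst_str _ _),
      ← f.map_right]
    refine f.map_congr (toPb_ext _ _ ?_ ?_) _ _
    · rw [toPb_fst, Category.assoc, map_etFst, ← Category.assoc, toPb_fst]
    · rw [toPb_str, Category.assoc, mor_str, toPb_str]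
  map_al t h m := by
    simp only [MonoidHom.comp_apply]
    rw [f.map_al, g.map_al, ← fnMap_comp, toPb_fst]

lemma comp_map (f : LogMap Z Y) (g : LogMap Y X) {U : Z.base.Etale} {W : Y.base.Etale}
    {V : X.base.Etale} (t : dom U ⟶ dom W) (s : dom W ⟶ dom V)
    (ht : t ≫ str W = str U ≫ f.base) (hs : s ≫ str V = str W ≫ g.base)
    (h : (t ≫ s) ≫ str V = str U ≫ (comp f g).base) (m : sec X.log.M V) :
    (comp f g).map (t ≫ s) h m = f.map t ht (g.map s hs m) := by
  have e₁ : g.map s hs m =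
      rs Y.log.M (etLift g.base s hs) (g.map (etFst g.base V) (etFst_str _ _) m) := by
    rw [← g.map_left, g.map_congr (etLift_fst _ _ _)]
  rw [e₁, ← f.map_right]
  refine f.map_congr (toPb_ext _ _ ?_ ?_) _ _
  · rw [toPb_fst, Category.assoc, etLift_fst]
  · rw [toPb_str, Category.assoc, mor_str, ht]

lemma exists_factor (f : LogMap Z Y) (g : LogMap Y X) {U : Z.base.Etale}
    {V : X.base.Etale} (t : dom U ⟶ dom V) (h : t ≫ str V = str U ≫ (comp f g).base) :
    ∃ (W : Y.base.Etale) (t₁ : dom U ⟶ dom W) (s : dom W ⟶ dom V)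
      (_ : t₁ ≫ str W = str U ≫ f.base) (_ : s ≫ str V = str W ≫ g.base), t = t₁ ≫ s :=
  ⟨etPb g.base V, toPb g.base V t (str U ≫ f.base) (h.trans (Category.assoc _ _ _).symm),
    etFst g.base V, toPb_str _ _ _ _ _, etFst_str _ _, (toPb_fst _ _ _ _ _).symm⟩
end LogMap

instance : Category IntLogSch.{u} where
  Hom := LogMap
  id := LogMap.id
  comp := LogMap.comp
  id_comp {Y X} f := by
    refine LogMap.ext' (Category.id_comp _) ?_
    intro U V t h₁ h₂ m
    obtain ⟨W, t, s, ht, hs, rfl⟩ := LogMap.exists_factor (LogMap.id Y) f t h₁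
    rw [LogMap.comp_map _ _ _ _ ht hs]
    exact (f.map_left (etHom t (ht.trans (Category.comp_id _))) s hs m).symm
  comp_id {Y X} f := by
    refine LogMap.ext' (Category.comp_id _) ?_
    intro U V t h₁ h₂ m
    obtain ⟨W, t, s, ht, hs, rfl⟩ := LogMap.exists_factor f (LogMap.id X) t h₁
    rw [LogMap.comp_map _ _ _ _ ht hs]
    exact (f.map_right t (etHom s (hs.trans (Category.comp_id _))) ht m).symm
  assoc {X₁ X₂ X₃ X₄} f g k := by
    refine LogMap.ext' (Category.assoc _ _ _) ?_
    intro U V t h₁ h₂ m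
    obtain ⟨W, t, s, ht, hs, rfl⟩ := LogMap.exists_factor (LogMap.comp f g) k t h₁
    obtain ⟨W', t, r, ht', hr, rfl⟩ := LogMap.exists_factor f g t ht
    have e : (r ≫ s) ≫ str V = str W' ≫ (LogMap.comp g k).base := by
      rw [Category.assoc, hs, ← Category.assoc, hr]
      exact Category.assoc _ _ _
    rw [LogMap.comp_map _ _ _ _ ht hs, LogMap.comp_map _ _ _ _ ht' hr]
    rw [LogMap.map_congr _ (Category.assoc t r s)]
    rw [LogMap.comp_map _ _ _ _ ht' e, LogMap.comp_map _ _ _ _ hr hs]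

/-- The underlying scheme. -/
def underlying : IntLogSch.{u} ⥤ Scheme.{u} where
  obj X := X.base
  map f := f.base
end LogStructures

section LogPoints
variable (P : Type u) [CommMonoid P]

/-- Restriction of locally constant functions. -/
def lcRes {X Y : Scheme.{u}} (t : X ⟶ Y) : LocallyConstant Y P →* LocallyConstant X P :=
  LocallyConstant.comapMonoidHom ⟨t.base.hom, t.continuous⟩

/-- A trivialization over the étale `S`-scheme `U` of a map `π : M ⟶ M'` of log structures: an
isomorphism `M ⊕ P ≅ M'` of log structures over `U`, under `M`. Here `P` is the constant sheaf
and the structure map of `M ⊕ P` sends `(m, p)` to `α m` if `p = 1` and to `0` if `p ≠ 1` (the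
monoid `P` is written multiplicatively). As `M` and `M'` are sheaves, it suffices to prescribe the
structure map on sections `(m, p)` with `p` constant; the case `p = 1` follows from `iso_one`. -/
structure Triv (P : Type u) [CommMonoid P] {S : Scheme.{u}} {L L' : IntLog S} (π : L.M ⟶ L'.M) (U : S.Etale) where
  iso : ∀ {V : S.Etale} (_ : V ⟶ U), sec L.M V × LocallyConstant (dom V) P ≃* sec L'.M V
  iso_res : ∀ {V V' : S.Etale} (g : V' ⟶ V) (a : V ⟶ U) (m : sec L.M V) (p : LocallyConstant (dom V) P),
    rs L'.M g (iso a (m, p)) = iso (g ≫ a) (rs L.M g m, lcRes P (mor g) p)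
  iso_one : ∀ {V : S.Etale} (a : V ⟶ U) (m : sec L.M V), iso a (m, 1) = ap π V m
  al_iso : ∀ {V : S.Etale} (a : V ⟶ U) (m : sec L.M V) (p : P), p ≠ 1 →
    L'.al V (iso a (m, LocallyConstant.const _ p)) = 0

namespace Triv
variable {P} {S : Scheme.{u}} {L L' : IntLog S} {π : L.M ⟶ L'.M} {U : S.Etale} (φ : Triv P π U)

/-- The image in `M'` of the section `(1, p)` of `M ⊕ P`. As `(m, p) = (m, 1) * (1, p)`, a
trivialization is determined by these sections. -/
def frame {V : S.Etale} (a : V ⟶ U) (p : P) : sec L'.M V := φ.iso a (1, LocallyConstant.const _ p)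

lemma rs_frame {V V' : S.Etale} (g : V' ⟶ V) (a : V ⟶ U) (p : P) :
    rs L'.M g (φ.frame a p) = φ.frame (g ≫ a) p := by
  unfold frame
  rw [φ.iso_res, map_one]
  rfl

end Triv

/-- The sections over `X` of the group sheaf `G = Hom(P, 𝒪^*)`. The element `u` acts on `M ⊕ P` by
`(m, p) ↦ (u(p) m, p)`. -/
abbrev GSec (X : Scheme.{u}) := P →* (fn X)ˣ

/-- A `P` log point `π : Y' ⟶ Y`. The log schemes `Y = (base, log)` and `Y' = (base, log')` have the
same underlying scheme and `π` lies over its identity; `φ` is a trivialization `U_P ≅ Y' ×_Y U` over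
an étale cover `U` (`cover`) whose transition function lies in `G(U ×_Y U)`: any two pullbacks of
`φ` to an étale `Y`-scheme `V` differ by the action of an element of `G(V)`.
The trivialization makes `Y'` the twist of `Y_P` by a `G`-torsor. Morphisms
are defined below so that replacing `φ` by another choice of trivialization differing from it,
locally, by the action of `G` gives an isomorphic object. -/
structure PLogPoint where
  base : Scheme.{u}
  log : IntLog base
  log' : IntLog base
  π : log.M ⟶ log'.M
  π_α : π ≫ log'.α = log.α
  cover : base.Etale
  cover_surj : Function.Surjective (str cover)
  φ : Triv P π cover
  transition : ∀ {V : base.Etale} (a b : V ⟶ cover), ∃ u : GSec P (dom V),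
    ∀ p, φ.frame a p = log'.unit V (u p) * φ.frame b p

namespace PLogPoint
variable {P} (z : PLogPoint P)

/-- The log scheme `Y` of a `P` log point `Y' ⟶ Y`. -/
abbrev lower : IntLogSch.{u} := ⟨z.base, z.log⟩
/-- The log scheme `Y'` of a `P` log point `Y' ⟶ Y`. -/
abbrev upper : IntLogSch.{u} := ⟨z.base, z.log'⟩
/-- The morphism `π : Y' ⟶ Y`. -/
def proj : z.upper ⟶ z.lower where
  base := 𝟙 z.base
  map {U V} t h := (ap z.π U).comp (rs z.log.M (etHom t (h.trans (Category.comp_id _))))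
  map_left g t h m := by
    simp only [MonoidHom.comp_apply]
    refine Eq.trans ?_ (rs_ap z.π g _).symm
    rw [← rs_comp]; rfl
  map_right t g h m := by
    simp only [MonoidHom.comp_apply]
    rw [← rs_comp]; rfl
  map_al {U V} t h m := by
    have e (x : sec z.log.M U) : z.log'.al U (ap z.π U x) = z.log.al U x :=
      congr(ap $z.π_α U x)
    simp only [MonoidHom.comp_apply]
    rw [e]
    exact z.log.al_rs _ m
end PLogPoint

/-- A `P` log point in `X`: a `P` log point `Y' ⟶ Y` with a morphism `f : Y' ⟶ X`. -/
structure PLogPointIn (X : IntLogSch.{u}) extends PLogPoint P where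
  f : toPLogPoint.upper ⟶ X

namespace LogMap
lemma map_unit {Y X : IntLogSch.{u}} (f : LogMap Y X) {U : Y.base.Etale} {V : X.base.Etale} (t : dom U ⟶ dom V)
    (h : t ≫ str V = str U ≫ f.base) (v : (fn (dom V))ˣ) :
    f.map t h (X.log.unit V v) = Y.log.unit U (Units.map (fnMap t) v) :=
  Y.log.eq_unit (by rw [f.map_al, IntLog.al_unit]; rfl)
end LogMap

namespace PLogPointIn
variable {P} {X : IntLogSch.{u}}

/-- A morphism `(Z' ⟶ Z) ⟶ (Y' ⟶ Y)` of `P` log points in `X`: a cartesian square of log schemes,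
compatible with the maps to `X`, such that étale locally the map `up : Z' ⟶ Y'`, viewed as a map
`Z_P ⟶ Y_P` via the trivializations, differs from the natural map, which on monoids is
`(m, p) ↦ (low m, p)`, by the action of some `u` in `G`, that is, it is
`(m, p) ↦ (u(p) * low m, p)`. By commutativity of the square it suffices to say this for the
sections `(1, p)`. (The square also forces `up` and `low` to have the same underlying morphism.) -/
structure Hom (z y : PLogPointIn P X) where
  up : z.upper ⟶ y.upper
  low : z.lower ⟶ y.lower
  isPullback : IsPullback up z.proj y.proj low
  f : up ≫ y.f = z.f
  loc : ∀ x : z.base, ∃ (V : z.base.Etale) (v : dom V) (_ : str V v = x) (a : V ⟶ z.cover)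
    (t : dom V ⟶ dom y.cover) (h : t ≫ str y.cover = str V ≫ up.base) (u : GSec P (dom V)),
    ∀ p, up.map t h (y.φ.frame (𝟙 _) p) = z.log'.unit V (u p) * z.φ.frame a p

attribute [ext] Hom

lemma Hom.base_eq {z y : PLogPointIn P X} (h : Hom z y) : h.up.base = h.low.base := by
  have := congrArg LogMap.base h.isPullback.w
  exact (Category.comp_id _).symm.trans (this.trans (Category.id_comp _))

/-- The identity morphism. -/
def Hom.id (z : PLogPointIn P X) : Hom z z where
  up := 𝟙 _
  low := 𝟙 _
  isPullback := IsPullback.of_horiz_isIso ⟨by simp⟩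
  f := Category.id_comp _
  loc x := by
    obtain ⟨v, hv⟩ := z.cover_surj x
    refine ⟨z.cover, v, hv, 𝟙 _, 𝟙 _, by simp; rfl, 1, fun p => ?_⟩
    rw [MonoidHom.one_apply, map_one, one_mul]
    exact rs_id z.log'.M _

/-- Composition of morphisms. -/
def Hom.comp {z y w : PLogPointIn P X} (h : Hom z y) (k : Hom y w) : Hom z w where
  up := h.up ≫ k.up
  low := h.low ≫ k.low
  isPullback := h.isPullback.paste_horiz k.isPullback
  f := by rw [Category.assoc, k.f, h.f]
  loc x := by
    obtain ⟨V₁, v₁, hv₁, a₁, t₁, ht₁, u₁, e₁⟩ := h.loc x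
    obtain ⟨V₂, v₂, hv₂, a₂, t₂, ht₂, u₂, e₂⟩ := k.loc (str y.cover (t₁ v₁))
    obtain ⟨q, hq₁, -⟩ := Scheme.Pullback.exists_preimage_pullback (f := str y.cover)
      (g := str V₂) (t₁ v₁) v₂ hv₂.symm
    let W : y.base.Etale := etMk (pullback.fst (str y.cover) (str V₂) ≫ str y.cover)
      (etale_comp (etale_fst _ (str_etale _)) (str_etale _))
    let p₁ : W ⟶ y.cover := etHom (pullback.fst (str y.cover) (str V₂)) rfl
    let p₂ : W ⟶ V₂ := etHom (pullback.snd (str y.cover) (str V₂)) pullback.condition.symm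
    obtain ⟨u₁₂, e₁₂⟩ := y.transition (p₂ ≫ a₂) p₁
    obtain ⟨v, hv, -⟩ := Scheme.Pullback.exists_preimage_pullback (f := t₁)
      (g := mor p₁) v₁ q hq₁.symm
    let V : z.base.Etale := etMk (pullback.fst t₁ (mor p₁) ≫ str V₁)
      (etale_comp (etale_fst _ (mor_etale _)) (str_etale _))
    let b : V ⟶ V₁ := etHom (pullback.fst t₁ (mor p₁)) rfl
    let c : dom V ⟶ dom W := pullback.snd t₁ (mor p₁)
    have hc : c ≫ mor p₁ = mor b ≫ t₁ := pullback.condition.symm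
    have hcW : c ≫ str W = str V ≫ h.up.base := by
      rw [← mor_str p₁, ← Category.assoc, hc, Category.assoc, ht₁, ← Category.assoc, mor_str]
    have hs : (c ≫ mor p₂) ≫ str V₂ = str V ≫ h.up.base := by
      rw [Category.assoc, mor_str, hcW]
    have hst : ((c ≫ mor p₂) ≫ t₂) ≫ str w.cover = str V ≫ (h.up ≫ k.up).base := by
      rw [Category.assoc, ht₂, ← Category.assoc, hs]
      exact Category.assoc _ _ _
    let u : GSec P (dom V) :=
      (((Units.map (fnMap (c ≫ mor p₂)).toMonoidHom).comp u₂) *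
        ((Units.map (fnMap c).toMonoidHom).comp u₁₂)) *
        ((Units.map (fnMap (mor b)).toMonoidHom).comp u₁)
    refine ⟨V, v, ?_, b ≫ a₁, (c ≫ mor p₂) ≫ t₂, hst, u, fun p => ?_⟩
    · rw [← hv₁, ← hv]; rfl
    have hp : rs y.log'.M p₁ (y.φ.frame (𝟙 _) p) = y.φ.frame p₁ p :=
      (y.φ.rs_frame p₁ (𝟙 _) p).trans (by rw [Category.comp_id])
    refine (LogMap.comp_map h.up k.up _ t₂ hs ht₂ hst _).trans ?_
    rw [e₂, map_mul, LogMap.map_unit, h.up.map_right _ _ hcW, y.φ.rs_frame, e₁₂, map_mul,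
      LogMap.map_unit, ← hp, ← h.up.map_right, h.up.map_congr hc, h.up.map_left b t₁ ht₁, e₁,
      map_mul, IntLog.rs_unit, z.φ.rs_frame, ← mul_assoc, ← mul_assoc, ← map_mul, ← map_mul]
    rfl

instance : Category (PLogPointIn P X) where
  Hom := Hom
  id := Hom.id
  comp := Hom.comp
  id_comp _ := Hom.ext (Category.id_comp _) (Category.id_comp _)
  comp_id _ := Hom.ext (Category.comp_id _) (Category.comp_id _)
  assoc _ _ _ := Hom.ext (Category.assoc _ _ _) (Category.assoc _ _ _)

end PLogPointIn

/-- The category of `P` log points in `X` over integral log schemes: `(Y' ⟶ Y, f) ↦ Y`. -/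
def logPoints (X : IntLogSch.{u}) : PLogPointIn P X ⥤ IntLogSch.{u} where
  obj z := z.lower
  map h := PLogPointIn.Hom.low h
end LogPoints

section Assoc
variable {S : Scheme.{u}} {F : MSheaf S} (α : F ⟶ strSheaf S)

/-- The associated log structure `F ⊕_{α⁻¹𝒪^*} 𝒪^*` of a prelog structure `α : F ⟶ 𝒪_S`: the
pushout, in sheaves of commutative monoids, of the two projections from
`α⁻¹𝒪^* = F ×_𝒪 𝒪^*`. -/
def assocLog : MSheaf S := pushout (pullback.fst α (unitIncl S)) (pullback.snd α (unitIncl S))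

lemma IntLog.unitHom_α (L : IntLog S) : L.unitHom ≫ L.α = unitIncl S := by
  ext V v
  exact L.al_unit V.unop v

lemma IntLog.eq_unitHom (L : IntLog S) {T : MSheaf S} (m : T ⟶ L.M) (v : T ⟶ unitSheaf S)
    (h : m ≫ L.α = v ≫ unitIncl S) : m = v ≫ L.unitHom := by
  ext V x
  exact L.eq_unit (m := ap m V.unop x) (v := ap v V.unop x) congr(ap $h V.unop x)

/-- The map of log structures `(F, α a)^a ⟶ M` induced by a map of sheaves of monoids `a : F ⟶ M`
to a log structure `(M, α)`. -/
def assocLogDesc (L : IntLog S) (a : F ⟶ L.M) : assocLog (a ≫ L.α) ⟶ L.M :=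
  pushout.desc a L.unitHom (L.eq_unitHom _ _ (by rw [Category.assoc, pullback.condition]))
end Assoc

section Basic

/-- Restriction of a sheaf to an étale `S`-scheme `U`. -/
def resSheaf {S : Scheme.{u}} (U : S.Etale) : MSheaf S ⥤ MSheaf (dom U) :=
  (etMap (str U) (str_etale U)).sheafPushforwardContinuous CommMonCat.{u}
    (dom U).smallEtaleTopology S.smallEtaleTopology

/-- An étale scheme over `U`, viewed as an étale scheme over `S`. -/
def overObj {S : Scheme.{u}} (U : S.Etale) (V : (dom U).Etale) : S.Etale := etMk (str V ≫ str U) (etale_comp (str_etale V) (str_etale U))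
/-- The map to `U` of an étale scheme over `U`. -/
def overHom {S : Scheme.{u}} (U : S.Etale) (V : (dom U).Etale) : overObj U V ⟶ U :=
  etHom (str V) rfl

/-- Restriction of a log structure to an étale `S`-scheme `U`. -/
def IntLog.res {S : Scheme.{u}} (L : IntLog S) (U : S.Etale) : IntLog (dom U) where
  M := (resSheaf U).obj L.M
  α := (resSheaf U).map L.α
  existsUnique_unit V v := L.existsUnique_unit (overObj U V) v
  integral V := L.integral (overObj U V)

/-- The inverse image functor `f⁻¹` on étale sheaves of monoids, left adjoint to `f_*`. -/
def invImage {S T : Scheme.{u}} (f : S ⟶ T) : MSheaf T ⥤ MSheaf S :=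
  (etPullback f).sheafPullback CommMonCat.{u} T.smallEtaleTopology S.smallEtaleTopology

/-- The direct image functor `f_*` on étale sheaves of monoids. -/
def dirImage {S T : Scheme.{u}} (f : S ⟶ T) : MSheaf S ⥤ MSheaf T :=
  (etPullback f).sheafPushforwardContinuous CommMonCat.{u} T.smallEtaleTopology S.smallEtaleTopology

/-- The adjunction between inverse and direct image. -/
def invImageAdj {S T : Scheme.{u}} (f : S ⟶ T) : invImage f ⊣ dirImage f :=
  (etPullback f).sheafAdjunctionContinuous CommMonCat.{u} T.smallEtaleTopology S.smallEtaleTopology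

/-- The map `M_X ⟶ f_* M_Y` of a morphism of log schemes. -/
def LogMap.toDirImage {Y X : IntLogSch.{u}} (f : LogMap Y X) : X.log.M ⟶ (dirImage f.base).obj Y.log.M :=
  ⟨{ app V := CommMonCat.ofHom (f.map (etFst f.base V.unop) (etFst_str _ _))
     naturality V W g := by
      ext m
      exact (f.map_right (etFst f.base _) g.unop (etFst_str _ _) m).symm.trans
       ((f.map_congr (map_etFst f.base g.unop).symm _ m).trans (f.map_left (etPbMap f.base g.unop) _ (etFst_str _ _) m)) }⟩

/-- The map `f† : f⁻¹ M_X ⟶ M_Y` of a morphism of log schemes. -/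
def LogMap.dagger {Y X : IntLogSch.{u}} (f : LogMap Y X) : (invImage f.base).obj X.log.M ⟶ Y.log.M :=
  ((invImageAdj f.base).homEquiv _ _).symm f.toDirImage

variable {P : Type u} [CommMonoid P] 

/-- The first projection `M' ≅ M ⊕ P ⟶ M` over `U` determined by a trivialization. -/
def Triv.fst {S : Scheme.{u}} {L L' : IntLog S} {π : L.M ⟶ L'.M} {U : S.Etale}
    (φ : Triv P π U) : (resSheaf U).obj L'.M ⟶ (resSheaf U).obj L.M :=
  ⟨{ app V := CommMonCat.ofHom ((MonoidHom.fst _ _).comp (φ.iso (overHom U V.unop)).symm.toMonoidHom)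
     naturality V W g := by
      ext x
      obtain ⟨⟨m, p⟩, rfl⟩ := (φ.iso (overHom U V.unop)).surjective x
      let g' : overObj U W.unop ⟶ overObj U V.unop := (etMap (str U) (str_etale U)).map g.unop
      have hg : g' ≫ overHom U V.unop = overHom U W.unop := et_ext (mor_str g.unop)
      change ((φ.iso (overHom U W.unop)).symm (rs L'.M g' (φ.iso (overHom U V.unop) (m, p)))).1 = 
         rs L.M g' ((φ.iso (overHom U V.unop)).symm (φ.iso (overHom U V.unop) (m, p))).1
      rw [φ.iso_res, hg, MulEquiv.symm_apply_apply, MulEquiv.symm_apply_apply] }⟩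

/-- The first component `a : f⁻¹ M_X ⟶ M_Y` over the cover `U` of the decomposition `f† = (a, h)` of
`f† : f⁻¹ M_X ⟶ M_{Y'} ≅ M_Y ⊕ P`. -/
def PLogPointIn.a {X : IntLogSch.{u}} (z : PLogPointIn P X) :
   (resSheaf z.cover).obj ((invImage z.f.base).obj X.log.M) ⟶ (z.log.res z.cover).M :=
  (resSheaf z.cover).map z.f.dagger ≫ z.φ.fst

/-- A `P` log point in `X` is basic if `z† : N_Y ⟶ M_Y` is an isomorphism, where `N_Y` is the basic
log structure. Over the cover `U`, the trivialization identifies `N_Y` with the log structure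
associated to the prelog structure `α_Y a : f⁻¹ M_X ⟶ 𝒪` and `z†` with the map induced by `a`; that
`z†` is an isomorphism can be checked over `U`. -/
def PLogPointIn.IsBasic {X : IntLogSch.{u}} (z : PLogPointIn P X) : Prop :=
  IsIso (assocLogDesc (z.log.res z.cover) z.a)
end Basic

section Fibred
variable {𝒵 : Type*} [Category* 𝒵] {𝒮 : Type*} [Category* 𝒮]

/-- A fibered category in which every arrow is cartesian. -/
structure IsGroupoidFibration (F : 𝒵 ⥤ 𝒮) : Prop where
  exists_lift : ∀ (z : 𝒵) {s : 𝒮} (f : s ⟶ F.obj z), ∃ (w : 𝒵) (φ : w ⟶ z), F.IsStronglyCartesian f φ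
  cartesian : ∀ {w z : 𝒵} (φ : w ⟶ z), F.IsStronglyCartesian (F.map φ) φ

/-- The arrow `i` lies over an identity morphism of schemes. -/
def OverId (F : 𝒵 ⥤ IntLogSch.{u}) {w z : 𝒵} (i : w ⟶ z) : Prop :=
  (F ⋙ underlying).IsHomLift (𝟙 ((F ⋙ underlying).obj w)) i

/-- `z` is minimal: for all `i : w' ⟶ w` and `j : w' ⟶ z` over identity morphisms of schemes there is
a unique `k : w ⟶ z` with `i ≫ k = j`. -/
def IsMinimal (F : 𝒵 ⥤ IntLogSch.{u}) (z : 𝒵) : Prop :=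
  ∀ {w w' : 𝒵} (i : w' ⟶ w) (j : w' ⟶ z), OverId F i → OverId F j → ∃! k : w ⟶ z, i ≫ k = j

/-- Enough minimal objects: every object has an arrow to a minimal object over an identity of schemes. -/
def EnoughMinimals (F : 𝒵 ⥤ IntLogSch.{u}) : Prop :=
  ∀ w : 𝒵, ∃ (z : 𝒵) (i : w ⟶ z), IsMinimal F z ∧ OverId F i

/-- A morphism of log schemes is strict if it is cartesian over schemes. -/
def IsStrict {Y X : IntLogSch.{u}} (f : Y ⟶ X) : Prop :=
  underlying.IsStronglyCartesian (underlying.map f) f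

/-- Compatibility of minimal objects and strict maps: for every arrow `i : w ⟶ z` with `z` minimal, `F i` is cartesian over schemes iff
`w` is minimal. -/
def StrictMinimalCompat (F : 𝒵 ⥤ IntLogSch.{u}) : Prop :=
  ∀ {w z : 𝒵} (i : w ⟶ z), IsMinimal F z → (IsStrict (F.map i) ↔ IsMinimal F w)
end Fibred

/-- A groupoid fibration `𝒳 ⟶ Sch` with a log structure: a functor `M` from `𝒳` to the category of
integral log schemes and strict morphisms, such that the composite `𝒳 ⟶ Sch` of `M` with the
functor taking underlying schemes is a groupoid fibration. -/
structure LogFibration where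
  obj : Type (u+1)
  [cat : Category.{u+1} obj]
  M : obj ⥤ IntLogSch.{u}
  strict : ∀ {x y : obj} (f : x ⟶ y), IsStrict (M.map f)
  fibration : IsGroupoidFibration (M ⋙ underlying)

namespace LogFibration
attribute [instance] LogFibration.cat
variable (𝒳 : LogFibration.{u})

/-- The condition on `(x, f : X ⟶ M x)` that `f` lies over the identity of the underlying scheme. -/
def overId : ObjectProperty (Comma (𝟭 IntLogSch.{u}) 𝒳.M) := 
  fun c => underlying.IsHomLift (𝟙 (underlying.obj c.left)) c.hom

/-- The category `(𝒳, M)` over log schemes. Its objects are the pairs `(x, f : X ⟶ M x)` with `f` over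
the identity of the underlying scheme, its morphisms `(x, f) ⟶ (y, g)` are the pairs
`b : X ⟶ Y`, `a : x ⟶ y` with `f ≫ M a = b ≫ g`, and it lies over log schemes by
`(x, f : X ⟶ M x) ↦ X`. -/
def proj : 𝒳.overId.FullSubcategory ⥤ IntLogSch.{u} := 𝒳.overId.ι ⋙ Comma.fst _ _
end LogFibration

/-- Equivalence of categories over log schemes: functors in both directions commuting strictly with
the projections, and inverse up to natural isomorphisms lying over identities. -/
def FibEquiv {𝒵 𝒲 : Type (u + 1)} [Category.{u+1} 𝒵] [Category.{u+1} 𝒲] (F : 𝒵 ⥤ IntLogSch.{u})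
   (G : 𝒲 ⥤ IntLogSch.{u}) : Prop :=
  Nonempty (Bicategory.Equivalence (BasedCategory.ofFunctor F) (BasedCategory.ofFunctor G))
end
end LogGeom

/-! The splitting `M_{Y'} = M_Y ⊕ P` of a log point `Y' → Y` exists only locally and only up to `G`.
Two things survive the ambiguity: the degree in `P`, and the subsheaf `Q ⊆ M_{Y'}` of sections
locally of the form `(u, p)` with `u` invertible (`IsDeg`, `IsQ`). `Q` is an extension of `P` by
`𝒪^*`, and `M_{Y'}` is the amalgamated sum of `M_Y` and `Q` over `𝒪^*`: every section is locally `n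
q`, uniquely up to a unit passed from one factor to the other (`IsQ.cancel`). So a morphism to `Y'`
is a morphism to `Y` together with compatible values on `Q` (`exists_family`). It follows that a
commutative square of log points whose upper arrow preserves degrees is already cartesian and is a
morphism of log points (`isPullback_of_preservesDeg`, `homMk`), while every morphism of log points
preserves degrees. This makes all arrows cartesian over log schemes, and base changes exist by
twisting `M ⊕ P` with the pulled back transition cocycle (`twistPoint`). Sharpness of `P` is what
makes the structure map of a twist multiplicative.

For a log point in `X` write `f†(m) = n q` locally. The component `n` is defined up to units, and
the point is basic if `m ↦ n` presents `M_Y` as an associated log structure; `LocBasic` says this on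
sections. Basic implies minimal: let `i : w' ⟶ w` and `j : w' ⟶ z` lie over identities of schemes.
Such arrows change neither units nor degrees, so the sheaves `Q` of `w'`, `w` and `z` are identified
(`Match`). An arrow `w ⟶ z` extending `j` must follow this identification on `Q`, and must send the
component `n` in `f_z(m) = n q` to the component `y` in `f_w(m) = y r`, where `r` matches `q`.
Basicness of `z` says that such `n` generate `M_Z` and that the rule is well defined (`LowRel.uniq`,
`exists_extend`, `hom_ext_of_locBasic`).

Every log point factors through a basic one over the same scheme (`exists_factorization`). The log
structure `N` is associated to the presheaf of triples `(x, n, q)` with `f†(x) = n q`, which records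
the choice of a decomposition instead of fixing one; the transition cocycle is transported to `N`,
and `f` lifts by sending `m` to the class of `(m, n, q)` times `q`. An arrow of minimal objects over
an identity is an isomorphism, so minimal objects are basic. Sources of strict arrows to basic
points are basic (`LocBasic.of_locStrict`); conversely an arrow of minimal objects factors through a
strict one by an arrow over an identity, which is an isomorphism. The last assertion is then formal:
take `𝒳` to be the minimal objects and `M` the restriction of `F`, and send `w` to its structure
arrow to a minimal object.

Sheaves are handled through sections up to étale refinement: maps are built by exhibiting a relation
on sections that is stable under restriction, single valued and locally solvable
(`Family.exists_of_rel`). -/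

namespace LogGeom
noncomputable section

/-! ### Étale sheaves on sections: local equality, gluing, refinements and products. -/

section Tools
variable {S T : Scheme.{u}}

lemma isSheaf_forget (M : MSheaf S) :
    Presieve.IsSheaf S.smallEtaleTopology (M.obj ⋙ forget CommMonCat.{u}) :=
  (isSheaf_iff_isSheaf_of_type _ _).1
    ((sheafCompose S.smallEtaleTopology (forget CommMonCat.{u})).obj M).property

/-- Sections of a sheaf that agree locally are equal. -/
lemma sec_ext (M : MSheaf S) {V : S.Etale} {m m' : sec M V}
    (h : ∀ x : dom V, ∃ (W : S.Etale) (g : W ⟶ V) (w : dom W), mor g w = x ∧ rs M g m = rs M g m') :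
    m = m' := by
  let R : Sieve V :=
    { arrows := fun W g => rs M g m = rs M g m'
      downward_closed := fun {W W'} g hg k => by rw [rs_comp, rs_comp, hg] }
  have hR : R ∈ S.smallEtaleTopology V := (mem_smallEtale_iff R).2 fun x => by
    obtain ⟨W, g, w, hw, e⟩ := h x
    exact ⟨W, g, w, e, hw⟩
  exact ((isSheaf_forget M).isSeparated R hR).ext fun W g hg => hg

/-- Gluing: a relation on the sections of a sheaf which is stable under restriction, has at most
one solution, and locally has a solution, determines a section. -/
lemma exists_glue (M : MSheaf S) {V : S.Etale} (R : ∀ {W : S.Etale}, (W ⟶ V) → sec M W → Prop)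
    (res : ∀ {W' W : S.Etale} (k : W' ⟶ W) (g : W ⟶ V) (s : sec M W), R g s → R (k ≫ g) (rs M k s))
    (uniq : ∀ {W : S.Etale} (g : W ⟶ V) (s s' : sec M W), R g s → R g s' → s = s')
    (ex : ∀ x : dom V, ∃ (W : S.Etale) (g : W ⟶ V) (w : dom W) (s : sec M W),
      mor g w = x ∧ R g s) :
    ∃ s : sec M V, ∀ {W : S.Etale} (g : W ⟶ V) (s' : sec M W), R g s' → rs M g s = s' := by
  let Q : Sieve V :=
    { arrows := fun W g => ∃ s, R g s
      downward_closed := fun {W W'} g ⟨s, hs⟩ k => ⟨_, res k g s hs⟩ }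
  have hQ : Q ∈ S.smallEtaleTopology V := (mem_smallEtale_iff Q).2 fun x => by
    obtain ⟨W, g, w, s, hw, e⟩ := ex x
    exact ⟨W, g, w, ⟨s, e⟩, hw⟩
  let x : Presieve.FamilyOfElements (M.obj ⋙ forget CommMonCat.{u}) Q.arrows :=
    fun W g hg => hg.choose
  -- Although chosen arbitrarily, the local solutions agree on overlaps, since `uniq` leaves no
  -- choice there.
  have hx : x.Compatible := by
    intro Y₁ Y₂ Z g₁ g₂ f₁ f₂ h₁ h₂ e
    refine uniq (g₁ ≫ f₁) _ _ (res _ _ _ h₁.choose_spec) ?_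
    rw [e]
    exact res _ _ _ h₂.choose_spec
  obtain ⟨t, ht, -⟩ := isSheaf_forget M Q hQ x hx
  refine ⟨t, fun {W} g s' hs' => ?_⟩
  have hg : Q g := ⟨s', hs'⟩
  exact (ht g hg).trans (uniq g _ _ hg.choose_spec hs')

/-- A sheaf of commutative monoids from a presheaf with elementwise gluing. -/
lemma isSheaf_of_glue (F : S.Etaleᵒᵖ ⥤ CommMonCat.{u})
    (sep : ∀ {V : S.Etale} (m m' : F.obj (op V)), (∀ x : dom V, ∃ (W : S.Etale) (g : W ⟶ V)
      (w : dom W), mor g w = x ∧ F.map g.op m = F.map g.op m') → m = m')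
    (glue : ∀ {V : S.Etale} (R : Sieve V) (_ : R ∈ S.smallEtaleTopology V)
      (x : ∀ {W : S.Etale} (g : W ⟶ V), R g → F.obj (op W))
      (_ : ∀ {W W' : S.Etale} (g : W ⟶ V) (hg : R g) (k : W' ⟶ W),
        F.map k.op (x g hg) = x (k ≫ g) (R.downward_closed hg k)),
      ∃ s : F.obj (op V), ∀ {W : S.Etale} (g : W ⟶ V) (hg : R g), F.map g.op s = x g hg) :
    Presheaf.IsSheaf S.smallEtaleTopology F := by
  refine Presheaf.isSheaf_of_isSheaf_comp _ _ (forget CommMonCat.{u}) ?_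
  rw [isSheaf_iff_isSheaf_of_type]
  intro V R hR x hx
  obtain ⟨s, hs⟩ := glue R hR (fun g hg => x g hg) (by
    intro W W' g hg k
    have := (Presieve.compatible_iff_sieveCompatible x).1 hx g k hg
    exact this.symm)
  refine ⟨s, fun W g hg => hs g hg, fun s' hs' => sep _ _ fun y => ?_⟩
  obtain ⟨W, g, w, hg, hw⟩ := (mem_smallEtale_iff R).1 hR y
  exact ⟨W, g, w, hw, (hs' g hg).trans (hs g hg).symm⟩

/-- A neighbourhood in the target lifts to a neighbourhood in the source. -/
lemma exists_lift {V : S.Etale} {W W' : T.Etale} (t : dom V ⟶ dom W) (g : W' ⟶ W) (x : dom V)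
    (w : dom W') (hw : mor g w = t x) :
    ∃ (V' : S.Etale) (k : V' ⟶ V) (v : dom V') (t' : dom V' ⟶ dom W'),
      mor k v = x ∧ t' v = w ∧ t' ≫ mor g = mor k ≫ t := by
  obtain ⟨v, hv, hv'⟩ := Scheme.Pullback.exists_preimage_pullback (f := t) (g := mor g) x w hw.symm
  exact ⟨etMk (pullback.fst t (mor g) ≫ str V) (etale_comp (etale_fst _ (mor_etale _)) (str_etale _)),
    etHom (pullback.fst t (mor g)) rfl, v, pullback.snd t (mor g), hv, hv', pullback.condition.symm⟩

/-- Two neighbourhoods of a point have a common refinement. -/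
lemma exists_refine {V W W' : S.Etale} (g : W ⟶ V) (g' : W' ⟶ V) {w : dom W} {w' : dom W'}
    (h : mor g w = mor g' w') :
    ∃ (W'' : S.Etale) (k : W'' ⟶ W) (k' : W'' ⟶ W') (w'' : dom W''),
      mor k w'' = w ∧ mor k' w'' = w' ∧ k ≫ g = k' ≫ g' := by
  obtain ⟨W'', k, v, t, h₁, h₂, e⟩ := exists_lift (mor g) g' w w' h.symm
  exact ⟨W'', k, etHom t (by rw [← mor_str g', ← Category.assoc, e, Category.assoc, mor_str,
    mor_str]), v, h₁, h₂, et_ext (by rw [mor_comp, mor_comp, mor_etHom, e])⟩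

/-- The product of two étale `S`-schemes. -/
def prod (V U : S.Etale) : S.Etale := (etMap (str U) (str_etale U)).obj (etPb (str U) V)
/-- The first projection. -/
def pr₁ (V U : S.Etale) : prod V U ⟶ V := etHom (etFst (str U) V) (etFst_str _ _)
/-- The second projection. -/
def pr₂ (V U : S.Etale) : prod V U ⟶ U := etHom (str (etPb (str U) V)) rfl

/-- The pair of two morphisms of schemes as a morphism to the product. -/
def pairS {Q : Scheme.{u}} {V U : S.Etale} (f : Q ⟶ dom V) (g : Q ⟶ dom U)
    (h : f ≫ str V = g ≫ str U) : Q ⟶ dom (prod V U) := LogMap.toPb (str U) V f g h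
lemma pairS_fst {Q : Scheme.{u}} {V U : S.Etale} (f : Q ⟶ dom V) (g : Q ⟶ dom U)
    (h : f ≫ str V = g ≫ str U) : pairS f g h ≫ mor (pr₁ V U) = f := LogMap.toPb_fst _ _ _ _ _
lemma pairS_snd {Q : Scheme.{u}} {V U : S.Etale} (f : Q ⟶ dom V) (g : Q ⟶ dom U)
    (h : f ≫ str V = g ≫ str U) : pairS f g h ≫ mor (pr₂ V U) = g := LogMap.toPb_str _ _ _ _ _
lemma pairS_str {Q : Scheme.{u}} {V U : S.Etale} (f : Q ⟶ dom V) (g : Q ⟶ dom U)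
    (h : f ≫ str V = g ≫ str U) : pairS f g h ≫ str (prod V U) = f ≫ str V := by
  rw [← mor_str (pr₁ V U), ← Category.assoc, pairS_fst]
lemma prodS_ext {Q : Scheme.{u}} {V U : S.Etale} {a b : Q ⟶ dom (prod V U)}
    (h₁ : a ≫ mor (pr₁ V U) = b ≫ mor (pr₁ V U)) (h₂ : a ≫ mor (pr₂ V U) = b ≫ mor (pr₂ V U)) :
    a = b := LogMap.toPb_ext _ _ h₁ h₂

/-- The pair of two morphisms as a morphism to the product. -/
def pair {W V U : S.Etale} (f : W ⟶ V) (g : W ⟶ U) : W ⟶ prod V U :=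
  etHom (pairS (mor f) (mor g) ((mor_str f).trans (mor_str g).symm))
    ((pairS_str _ _ _).trans (mor_str f))
lemma pair_fst {W V U : S.Etale} (f : W ⟶ V) (g : W ⟶ U) : pair f g ≫ pr₁ V U = f :=
  et_ext (pairS_fst _ _ _)
lemma pair_snd {W V U : S.Etale} (f : W ⟶ V) (g : W ⟶ U) : pair f g ≫ pr₂ V U = g :=
  et_ext (pairS_snd _ _ _)
lemma prod_ext {W V U : S.Etale} {a b : W ⟶ prod V U} (h₁ : a ≫ pr₁ V U = b ≫ pr₁ V U)
    (h₂ : a ≫ pr₂ V U = b ≫ pr₂ V U) : a = b :=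
  et_ext (prodS_ext congr(mor $h₁) congr(mor $h₂))
lemma comp_pair {W' W V U : S.Etale} (k : W' ⟶ W) (f : W ⟶ V) (g : W ⟶ U) :
    k ≫ pair f g = pair (k ≫ f) (k ≫ g) :=
  prod_ext (by rw [Category.assoc, pair_fst, pair_fst]) (by rw [Category.assoc, pair_snd, pair_snd])

/-- Multiplication by `U`. -/
def prodFunctor (U : S.Etale) : S.Etale ⥤ S.Etale := etPullback (str U) ⋙ etMap (str U) (str_etale U)

lemma prodFunctor_map (U : S.Etale) {V W : S.Etale} (g : V ⟶ W) :
    (prodFunctor U).map g = pair (pr₁ V U ≫ g) (pr₂ V U) :=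
  prod_ext
    ((et_ext (map_etFst (str U) g)).trans (pair_fst (pr₁ V U ≫ g) (pr₂ V U)).symm)
    ((et_ext (mor_str (etPbMap (str U) g))).trans (pair_snd (pr₁ V U ≫ g) (pr₂ V U)).symm)

/-- An étale cover has local sections. -/
lemma exists_section {U : S.Etale} (hU : Function.Surjective (str U)) {V : S.Etale} (x : dom V) :
    ∃ (W : S.Etale) (g : W ⟶ V) (w : dom W) (_ : W ⟶ U), mor g w = x := by
  obtain ⟨y, hy⟩ := hU (str V x)
  obtain ⟨v, hv, -⟩ := Scheme.Pullback.exists_preimage_pullback (f := str V) (g := str U) x y hy.symm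
  exact ⟨prod V U, pr₁ V U, v, pr₂ V U, hv⟩

end Tools

/-! ### The constant sheaf `P` as locally constant functions. -/

section LocConst
variable {P : Type u} [CommMonoid P] {S : Scheme.{u}}

/-- The constant section. -/
abbrev lc (X : Scheme.{u}) (p : P) : LocallyConstant X P := LocallyConstant.const _ p

/-- An open subscheme as an étale scheme. -/
def opn (V : S.Etale) (O : (dom V).Opens) : S.Etale :=
  etMk (O.ι ≫ str V) (etale_comp inferInstance (str_etale V))
/-- The inclusion of an open subscheme. -/
def opnHom (V : S.Etale) (O : (dom V).Opens) : opn V O ⟶ V := etHom O.ι rfl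
lemma exists_opn (V : S.Etale) (O : (dom V).Opens) (x : dom V) (hx : x ∈ O) :
    ∃ w : dom (opn V O), mor (opnHom V O) w = x := ⟨⟨x, hx⟩, rfl⟩

lemma lcRes_const {X Y : Scheme.{u}} (t : X ⟶ Y) (p : P) : lcRes P t (lc Y p) = lc X p := rfl
lemma lcRes_apply {X Y : Scheme.{u}} (t : X ⟶ Y) (p : LocallyConstant Y P) (x : X) :
    lcRes P t p x = p (t x) := rfl
lemma lcRes_comp {X Y Z : Scheme.{u}} (s : X ⟶ Y) (t : Y ⟶ Z) (p : LocallyConstant Z P) :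
    lcRes P (s ≫ t) p = lcRes P s (lcRes P t p) := by
  ext x; rfl
lemma lcRes_id {X : Scheme.{u}} (p : LocallyConstant X P) : lcRes P (𝟙 X) p = p := by
  ext x; rfl

/-- The fibre of `p` through `x` is open, hence an étale neighbourhood of `x`. -/
lemma exists_const {V : S.Etale} (p : LocallyConstant (dom V) P) (x : dom V) :
    ∃ (W : S.Etale) (g : W ⟶ V) (w : dom W), mor g w = x ∧ lcRes P (mor g) p = lc _ (p x) := by
  let O : (dom V).Opens := ⟨p ⁻¹' {p x}, p.isLocallyConstant {p x}⟩
  obtain ⟨w, hw⟩ := exists_opn V O x rfl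
  refine ⟨_, opnHom V O, w, hw, ?_⟩
  ext y
  exact y.2

/-- The value at `v` is read off at any point above `v`. Independence of that point is compatibility
on a common refinement, and local constancy descends because étale maps are open. -/
lemma lc_glue {V : S.Etale} (R : Sieve V) (hR : R ∈ S.smallEtaleTopology V)
    (x : ∀ {W : S.Etale} (g : W ⟶ V), R g → LocallyConstant (dom W) P)
    (hx : ∀ {W W' : S.Etale} (g : W ⟶ V) (hg : R g) (k : W' ⟶ W),
      lcRes P (mor k) (x g hg) = x (k ≫ g) (R.downward_closed hg k)) :
    ∃ s : LocallyConstant (dom V) P, ∀ {W : S.Etale} (g : W ⟶ V) (hg : R g),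
      lcRes P (mor g) s = x g hg := by
  rw [mem_smallEtale_iff] at hR
  choose Y f y hf hy using hR
  have key : ∀ {W : S.Etale} (g : W ⟶ V) (hg : R g) (w : dom W),
      x (f (mor g w)) (hf _) (y (mor g w)) = x g hg w := by
    intro W g hg w
    obtain ⟨W'', k, k', w'', h₁, h₂, e⟩ := exists_refine (f (mor g w)) g (hy (mor g w))
    have e₃ : lcRes P (mor k) (x (f (mor g w)) (hf _)) = lcRes P (mor k') (x g hg) := by
      rw [hx, hx]
      congr 1
    have := congr($e₃ w'')
    rwa [lcRes_apply, lcRes_apply, h₁, h₂] at this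
  refine ⟨⟨fun v => x (f v) (hf v) (y v), ?_⟩, ?_⟩
  · intro s
    rw [isOpen_iff_forall_mem_open]
    intro v hv
    have := mor_etale (f v)
    refine ⟨mor (f v) '' (x (f v) (hf v) ⁻¹' s), ?_,
      (mor (f v)).isOpenMap _ ((x (f v) (hf v)).isLocallyConstant s), ⟨y v, hv, hy v⟩⟩
    rintro _ ⟨w, hw, rfl⟩
    change x (f (mor (f v) w)) (hf _) (y _) ∈ s
    rw [key (f v) (hf v) w]
    exact hw
  · intro W g hg
    ext w
    exact key g hg w

lemma lc_sep {V : S.Etale} {m m' : LocallyConstant (dom V) P} (h : ∀ x : dom V, ∃ (W : S.Etale)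
    (g : W ⟶ V) (w : dom W), mor g w = x ∧ lcRes P (mor g) m = lcRes P (mor g) m') : m = m' := by
  ext x
  obtain ⟨W, g, w, rfl, e⟩ := h x
  exact congr($e w)

end LocConst
end
end LogGeom

namespace LogGeom
noncomputable section

/-! ### Maps of sheaves along a morphism of schemes, built from relations on sections. -/

section Families
variable {S T : Scheme.{u}}

/-- `Q` need not be étale over `T`: in use it is étale over another base, and only the targets are
refined. -/
lemma exists_pb_lift {Q : Scheme.{u}} {Y Y₁ Y₂ : T.Etale} (k₁ : Y₁ ⟶ Y) (k₂ : Y₂ ⟶ Y)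
    (t₁ : Q ⟶ dom Y₁) (t₂ : Q ⟶ dom Y₂) (h : t₁ ≫ mor k₁ = t₂ ≫ mor k₂) :
    ∃ (Y₃ : T.Etale) (l₁ : Y₃ ⟶ Y₁) (l₂ : Y₃ ⟶ Y₂) (t₃ : Q ⟶ dom Y₃),
      l₁ ≫ k₁ = l₂ ≫ k₂ ∧ t₃ ≫ mor l₁ = t₁ ∧ t₃ ≫ mor l₂ = t₂ := by
  let Y₃ : T.Etale := etMk (pullback.fst (mor k₁) (mor k₂) ≫ str Y₁)
    (etale_comp (etale_fst _ (mor_etale k₂)) (str_etale _))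
  let l₁ : Y₃ ⟶ Y₁ := etHom (pullback.fst (mor k₁) (mor k₂)) rfl
  let l₂ : Y₃ ⟶ Y₂ := etHom (pullback.snd (mor k₁) (mor k₂)) (by
    refine .trans ?_ (show pullback.fst (mor k₁) (mor k₂) ≫ str Y₁ = _ from rfl)
    rw [← mor_str k₁, ← mor_str k₂]
    exact (pullback.condition_assoc _).symm)
  exact ⟨Y₃, l₁, l₂, pullback.lift t₁ t₂ h, et_ext pullback.condition, pullback.lift_fst _ _ _,
    pullback.lift_snd _ _ _⟩

lemma exists_prod_lift {Q : Scheme.{u}} {Y₁ Y₂ : T.Etale}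
    (t₁ : Q ⟶ dom Y₁) (t₂ : Q ⟶ dom Y₂) (h : t₁ ≫ str Y₁ = t₂ ≫ str Y₂) :
    ∃ (Y₃ : T.Etale) (l₁ : Y₃ ⟶ Y₁) (l₂ : Y₃ ⟶ Y₂) (t₃ : Q ⟶ dom Y₃),
      t₃ ≫ mor l₁ = t₁ ∧ t₃ ≫ mor l₂ = t₂ ∧ t₃ ≫ str Y₃ = t₁ ≫ str Y₁ :=
  ⟨_, pr₁ _ _, pr₂ _ _, pairS t₁ t₂ h, pairS_fst _ _ _, pairS_snd _ _ _, pairS_str _ _ _⟩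

/-- A map of sheaves `b⁻¹ B ⟶ A`, as a natural family of maps of sections. -/
structure Family (b : S ⟶ T) (B : MSheaf T) (A : MSheaf S) where
  map : ∀ {U : S.Etale} {V : T.Etale} (t : dom U ⟶ dom V)
    (_ : t ≫ str V = str U ≫ b), sec B V →* sec A U
  map_left : ∀ {U' U : S.Etale} {V : T.Etale} (g : U' ⟶ U) (t : dom U ⟶ dom V)
    (h : t ≫ str V = str U ≫ b) (m : sec B V),
    map (mor g ≫ t) (by rw [Category.assoc, h, ← Category.assoc, mor_str]) m = rs A g (map t h m)
  map_right : ∀ {U : S.Etale} {V V' : T.Etale} (t : dom U ⟶ dom V) (g : V ⟶ V')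
    (h : t ≫ str V = str U ≫ b) (m : sec B V'),
    map (t ≫ mor g) (by rw [Category.assoc, mor_str, h]) m = map t h (rs B g m)

lemma over_square {b : S ⟶ T} {V V' : S.Etale} {Y Y' : T.Etale} {t : dom V ⟶ dom Y}
    {t' : dom V' ⟶ dom Y'} {g : V' ⟶ V} {k : Y' ⟶ Y} (e : t' ≫ mor k = mor g ≫ t)
    (h : t ≫ str Y = str V ≫ b) : t' ≫ str Y' = str V' ≫ b := by
  rw [← mor_str k, ← Category.assoc, e, Category.assoc, h, ← Category.assoc, mor_str]

namespace Family
variable {b : S ⟶ T} {B : MSheaf T} {A : MSheaf S}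

lemma map_congr (f : Family b B A) {U : S.Etale} {V : T.Etale} {t t' : dom U ⟶ dom V}
    (h : t = t') (ht : t ≫ str V = str U ≫ b) (m : sec B V) :
    f.map t ht m = f.map t' (h ▸ ht) m := by
  subst h; rfl

lemma map_square (f : Family b B A) {V V' : S.Etale} {Y Y' : T.Etale} {t : dom V ⟶ dom Y}
    {t' : dom V' ⟶ dom Y'} {g : V' ⟶ V} {k : Y' ⟶ Y} (e : t' ≫ mor k = mor g ≫ t)
    (h : t ≫ str Y = str V ≫ b) (h' : t' ≫ str Y' = str V' ≫ b) (m : sec B Y) :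
    f.map t' h' (rs B k m) = rs A g (f.map t h m) := by
  rw [← f.map_right, ← f.map_left, f.map_congr e]

/-- A family of maps is determined by a relation on sections that is stable under restriction and
multiplicative, has at most one solution, and locally has a solution. -/
theorem exists_of_rel (R : ∀ {V : S.Etale} {Y : T.Etale} (t : dom V ⟶ dom Y),
      t ≫ str Y = str V ≫ b → sec B Y → sec A V → Prop)
    (res : ∀ {V V' : S.Etale} {Y Y' : T.Etale} (t : dom V ⟶ dom Y) (t' : dom V' ⟶ dom Y')
      (g : V' ⟶ V) (k : Y' ⟶ Y) (h : t ≫ str Y = str V ≫ b) (h' : t' ≫ str Y' = str V' ≫ b)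
      (x : sec B Y) (y : sec A V), t' ≫ mor k = mor g ≫ t → R t h x y →
      R t' h' (rs B k x) (rs A g y))
    (ex : ∀ {V : S.Etale} {Y : T.Etale} (t : dom V ⟶ dom Y) (_ : t ≫ str Y = str V ≫ b)
      (x : sec B Y) (v : dom V), ∃ (V' : S.Etale) (g : V' ⟶ V) (v' : dom V') (Y' : T.Etale)
      (k : Y' ⟶ Y) (t' : dom V' ⟶ dom Y') (h' : t' ≫ str Y' = str V' ≫ b) (y : sec A V'),
      mor g v' = v ∧ t' ≫ mor k = mor g ≫ t ∧ R t' h' (rs B k x) y)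
    (uniq : ∀ {V : S.Etale} {Y : T.Etale} (t : dom V ⟶ dom Y) (h : t ≫ str Y = str V ≫ b)
      (x : sec B Y) (y y' : sec A V), R t h x y → R t h x y' → y = y')
    (one : ∀ {V : S.Etale} {Y : T.Etale} (t : dom V ⟶ dom Y) (h : t ≫ str Y = str V ≫ b)
      (y : sec A V), R t h 1 y → y = 1)
    (mul : ∀ {V : S.Etale} {Y : T.Etale} (t : dom V ⟶ dom Y) (h : t ≫ str Y = str V ≫ b)
      (x x' : sec B Y) (y y' : sec A V), R t h x y → R t h x' y' → R t h (x * x') (y * y')) :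
    ∃ F : Family b B A, ∀ {V : S.Etale} {Y : T.Etale} (t : dom V ⟶ dom Y)
      (h : t ≫ str Y = str V ≫ b) (x : sec B Y) (y : sec A V), R t h x y → F.map t h x = y := by
  -- A solution may require shrinking the target `Y` too. `R₂` absorbs this into a condition on
  -- sections over étale `V`-schemes alone, so that `exists_glue` applies with `t` and `x` fixed.
  let R₂ {V : S.Etale} {Y : T.Etale} (t : dom V ⟶ dom Y) (x : sec B Y) {V' : S.Etale}
      (g : V' ⟶ V) (y : sec A V') : Prop :=
    ∃ (Y' : T.Etale) (k : Y' ⟶ Y) (t' : dom V' ⟶ dom Y') (h' : t' ≫ str Y' = str V' ≫ b),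
      t' ≫ mor k = mor g ≫ t ∧ R t' h' (rs B k x) y
  have uniq₂ : ∀ {V : S.Etale} {Y : T.Etale} (t : dom V ⟶ dom Y) (x : sec B Y) {V' : S.Etale}
      (g : V' ⟶ V) (y y' : sec A V'), R₂ t x g y → R₂ t x g y' → y = y' := by
    rintro V Y t x V' g y y' ⟨Y₁, k₁, t₁, h₁, e₁, r₁⟩ ⟨Y₂, k₂, t₂, h₂, e₂, r₂⟩
    -- Different shrinkings of `Y` are compared on their fibre product over `Y`.
    obtain ⟨Y₃, l₁, l₂, t₃, e, e₁', e₂'⟩ := exists_pb_lift k₁ k₂ t₁ t₂ (e₁.trans e₂.symm)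
    have a₁ := res t₁ t₃ (𝟙 _) l₁ h₁ (by rw [← mor_str l₁, ← Category.assoc, e₁', h₁]) _ _
      (by rw [mor_id, Category.id_comp, e₁']) r₁
    have a₂ := res t₂ t₃ (𝟙 _) l₂ h₂ (by rw [← mor_str l₁, ← Category.assoc, e₁', h₁]) _ _
      (by rw [mor_id, Category.id_comp, e₂']) r₂
    rw [rs_id, ← rs_comp] at a₁ a₂
    rw [e] at a₁
    exact uniq _ _ _ _ _ a₁ a₂
  have key : ∀ {V : S.Etale} {Y : T.Etale} (t : dom V ⟶ dom Y) (h : t ≫ str Y = str V ≫ b)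
      (x : sec B Y), ∃ s : sec A V, ∀ {W : S.Etale} (g : W ⟶ V) (s' : sec A W),
        R₂ t x g s' → rs A g s = s' := by
    intro V Y t h x
    refine exists_glue A (R₂ t x) ?_ (uniq₂ t x) ?_
    · rintro W' W k g s ⟨Y₁, k₁, t₁, h₁, e₁, r₁⟩
      refine ⟨Y₁, k₁, mor k ≫ t₁, by rw [Category.assoc, h₁, ← Category.assoc, mor_str],
        by rw [Category.assoc, e₁, mor_comp, Category.assoc], ?_⟩
      have := res t₁ (mor k ≫ t₁) k (𝟙 _) h₁
        (by rw [Category.assoc, h₁, ← Category.assoc, mor_str]) _ _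
        (by rw [mor_id, Category.comp_id]) r₁
      rwa [rs_id] at this
    · intro v
      obtain ⟨V', g, v', Y', k, t', h', y, e, e', r⟩ := ex t h x v
      exact ⟨V', g, v', y, e, Y', k, t', h', e', r⟩
  let F {V : S.Etale} {Y : T.Etale} (t : dom V ⟶ dom Y) (h : t ≫ str Y = str V ≫ b)
    (x : sec B Y) : sec A V := (key t h x).choose
  have hF : ∀ {V : S.Etale} {Y : T.Etale} (t : dom V ⟶ dom Y) (h : t ≫ str Y = str V ≫ b)
      (x : sec B Y) {W : S.Etale} (g : W ⟶ V) (s' : sec A W), R₂ t x g s' →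
      rs A g (F t h x) = s' := fun t h x => (key t h x).choose_spec
  refine ⟨⟨fun {V Y} t h => ⟨⟨F t h, ?_⟩, ?_⟩, ?_, ?_⟩, ?_⟩
  · refine sec_ext A fun v => ?_
    obtain ⟨V', g, v', Y', k, t', h', y, e, e', r⟩ := ex t h 1 v
    refine ⟨V', g, v', e, ?_⟩
    rw [hF t h 1 g y ⟨Y', k, t', h', e', r⟩, map_one]
    rw [map_one] at r
    exact one _ _ _ r
  · intro x x'
    refine sec_ext A fun v => ?_
    obtain ⟨V₁, g₁, v₁, Y₁, k₁, t₁, h₁, y, e₁, e₁', r₁⟩ := ex t h x v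
    -- The second solution is sought inside the neighbourhood of the first, so that both end up over
    -- the same refinement.
    obtain ⟨V₂, g₂, v₂, Y₂, k₂, t₂, h₂, y', e₂, e₂', r₂⟩ := ex t₁ h₁ (rs B k₁ x') v₁
    have r₁' := res _ _ g₂ k₂ h₁ h₂ _ _ e₂' r₁
    rw [← rs_comp] at r₁' r₂
    have r₃ := mul _ _ _ _ _ _ r₁' r₂
    rw [← map_mul] at r₃
    have e₃ : t₂ ≫ mor (k₂ ≫ k₁) = mor (g₂ ≫ g₁) ≫ t := by
      rw [mor_comp, mor_comp, ← Category.assoc, e₂', Category.assoc, e₁', Category.assoc]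
    refine ⟨V₂, g₂ ≫ g₁, v₂, ?_, ?_⟩
    · rw [← e₁, ← e₂]; rfl
    · change rs A (g₂ ≫ g₁) (F t h (x * x')) = rs A (g₂ ≫ g₁) (F t h x * F t h x')
      rw [map_mul, hF t h x _ _ ⟨_, _, _, h₂, e₃, r₁'⟩, hF t h x' _ _ ⟨_, _, _, h₂, e₃, r₂⟩,
        hF t h (x * x') _ _ ⟨_, _, _, h₂, e₃, r₃⟩]
  · intro U' U V g t h x
    have hg : (mor g ≫ t) ≫ str V = str U' ≫ b := by
      rw [Category.assoc, h, ← Category.assoc, mor_str]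
    refine sec_ext A fun v => ?_
    obtain ⟨V', g', v', Y', k, t', h', y, e, e', r⟩ := ex (mor g ≫ t) hg x v
    refine ⟨V', g', v', e, (hF (mor g ≫ t) hg x g' y ⟨Y', k, t', h', e', r⟩).trans ?_⟩
    rw [← rs_comp]
    exact (hF t h x (g' ≫ g) y ⟨Y', k, t', h', by rw [e', mor_comp, Category.assoc], r⟩).symm
  · intro U V V' t g h x
    have hg : (t ≫ mor g) ≫ str V' = str U ≫ b := by rw [Category.assoc, mor_str, h]
    refine sec_ext A fun v => ?_
    obtain ⟨W', g', v', Y', k, t', h', y, e, e', r⟩ := ex t h (rs B g x) v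
    refine ⟨W', g', v', e, Eq.trans ?_ (hF t h (rs B g x) g' y ⟨Y', k, t', h', e', r⟩).symm⟩
    rw [← rs_comp] at r
    exact hF (t ≫ mor g) hg x g' y ⟨Y', k ≫ g, t', h',
      by rw [mor_comp, ← Category.assoc, e', Category.assoc], r⟩
  · intro V Y t h x y r
    have := hF t h x (𝟙 V) y ⟨Y, 𝟙 _, t, h, by rw [mor_id, mor_id, Category.id_comp,
      Category.comp_id], by rwa [rs_id]⟩
    rwa [rs_id] at this

/-- The map of sheaves on `S` given by a family over the identity. -/
def hom {B A : MSheaf S} (f : Family (𝟙 S) B A) : B ⟶ A :=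
  ⟨{ app V := CommMonCat.ofHom (f.map (U := V.unop) (V := V.unop) (𝟙 _)
      (by rw [Category.id_comp, Category.comp_id]))
     naturality V W g := by
      ext m
      exact f.map_square (t := 𝟙 _) (t' := 𝟙 _) (g := g.unop) (k := g.unop)
        (by rw [Category.comp_id, Category.id_comp]) _ _ m }⟩

end Family

lemma hom_ext_sec {B A : MSheaf S} {f g : B ⟶ A} (h : ∀ (V : S.Etale) (m : sec B V),
    ap f V m = ap g V m) : f = g := by
  ext V m
  exact h V.unop m

lemma etHom_square {V V' Y Y' : S.Etale} {t : dom V ⟶ dom Y} {t' : dom V' ⟶ dom Y'} {g : V' ⟶ V}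
    {k : Y' ⟶ Y} (e : t' ≫ mor k = mor g ≫ t) (h : t ≫ str Y = str V ≫ 𝟙 S)
    (h' : t' ≫ str Y' = str V' ≫ 𝟙 S) :
    etHom t' (h'.trans (Category.comp_id _)) ≫ k = g ≫ etHom t (h.trans (Category.comp_id _)) :=
  et_ext e

/-- The case of `Family.exists_of_rel` of sheaves on the same scheme. -/
theorem exists_hom_of_rel {B A : MSheaf S} (R : ∀ {V : S.Etale}, sec B V → sec A V → Prop)
    (res : ∀ {V W : S.Etale} (g : W ⟶ V) (x : sec B V) (y : sec A V), R x y →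
      R (rs B g x) (rs A g y))
    (ex : ∀ {V : S.Etale} (x : sec B V) (v : dom V), ∃ (W : S.Etale) (g : W ⟶ V) (w : dom W)
      (y : sec A W), mor g w = v ∧ R (rs B g x) y)
    (uniq : ∀ {V : S.Etale} (x : sec B V) (y y' : sec A V), R x y → R x y' → y = y')
    (one : ∀ {V : S.Etale} (y : sec A V), R 1 y → y = 1)
    (mul : ∀ {V : S.Etale} (x x' : sec B V) (y y' : sec A V), R x y → R x' y' →
      R (x * x') (y * y')) :
    ∃ f : B ⟶ A, ∀ {V : S.Etale} (x : sec B V) (y : sec A V), R x y → ap f V x = y := by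
  obtain ⟨F, hF⟩ := Family.exists_of_rel (b := 𝟙 S) (B := B) (A := A)
    (fun {V Y} t h x y => R (rs B (etHom t (h.trans (Category.comp_id _))) x) y)
    (by
      intro V V' Y Y' t t' g k h h' x y e r
      rw [← rs_comp, etHom_square e h h', rs_comp]
      exact res g _ _ r)
    (by
      intro V Y t h x v
      obtain ⟨W, g, w, y, e, r⟩ := ex (rs B (etHom t (h.trans (Category.comp_id _))) x) v
      refine ⟨W, g, w, W, g ≫ etHom t (h.trans (Category.comp_id _)), 𝟙 _, by simp, y, e,
        Category.id_comp _, ?_⟩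
      rw [← rs_comp] at r ⊢
      exact r)
    (fun t h x y y' r r' => uniq _ _ _ r r')
    (fun t h y r => one y (by rwa [map_one] at r))
    (fun t h x x' y y' r r' => by
      rw [map_mul]
      exact mul _ _ _ _ r r')
  refine ⟨F.hom, fun {V} x y r => hF _ _ x y ?_⟩
  change R (rs B (𝟙 V) x) y
  rwa [rs_id]

end Families

section LogMaps
variable {Y X : IntLogSch.{u}}

/-- The family of maps of sections of a morphism of log schemes. -/
def LogMap.family (f : LogMap Y X) : Family f.base X.log.M Y.log.M :=
  ⟨f.map, f.map_left, f.map_right⟩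

/-- A morphism of log schemes from a family of maps of sections. -/
def Family.logMap {b : Y.base ⟶ X.base} (f : Family b X.log.M Y.log.M)
    (al : ∀ {U : Y.base.Etale} {V : X.base.Etale} (t : dom U ⟶ dom V)
      (h : t ≫ str V = str U ≫ b) (m : sec X.log.M V),
      Y.log.al U (f.map t h m) = fnMap t (X.log.al V m)) : LogMap Y X :=
  ⟨b, f.map, f.map_left, f.map_right, al⟩

lemma LogMap.map_square (f : LogMap Y X) {V V' : Y.base.Etale} {U U' : X.base.Etale}
    {t : dom V ⟶ dom U}
    {t' : dom V' ⟶ dom U'} {g : V' ⟶ V} {k : U' ⟶ U} (e : t' ≫ mor k = mor g ≫ t)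
    (h : t ≫ str U = str V ≫ f.base) (h' : t' ≫ str U' = str V' ≫ f.base) (m : sec X.log.M U) :
    f.map t' h' (rs X.log.M k m) = rs Y.log.M g (f.map t h m) := f.family.map_square e h h' m
end LogMaps

end
end LogGeom

namespace LogGeom
noncomputable section

/-! ### The group sheaf `Hom(P, 𝒪^*)` and its Čech cocycles. -/

section Cocycles
variable {P : Type u} [CommMonoid P] {S T : Scheme.{u}}

/-- Restriction of invertible functions. -/
abbrev unitsMap {X Y : Scheme.{u}} (t : X ⟶ Y) : (fn Y)ˣ →* (fn X)ˣ :=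
  Units.map (fnMap t)

lemma unitsMap_id {X : Scheme.{u}} (v : (fn X)ˣ) : unitsMap (𝟙 X) v = v :=
  Units.ext (fnMap_id X _)
lemma unitsMap_comp {X Y Z : Scheme.{u}} (s : X ⟶ Y) (t : Y ⟶ Z) (v : (fn Z)ˣ) :
    unitsMap (s ≫ t) v = unitsMap s (unitsMap t v) := Units.ext (fnMap_comp s t _)

lemma units_ext {V : S.Etale} {v v' : (fn (dom V))ˣ} (h : ∀ x : dom V, ∃ (W : S.Etale) (g : W ⟶ V)
    (w : dom W), mor g w = x ∧ unitsMap (mor g) v = unitsMap (mor g) v') : v = v' :=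
  sec_ext (unitSheaf S) (m := v) (m' := v') h

/-- Where `p` is constant with value `p₀` the unit has to be `u p₀`; these pieces cover `V`. -/
lemma exists_units_glue {V : S.Etale} (u : GSec P (dom V)) (p : LocallyConstant (dom V) P) :
    ∃ w : (fn (dom V))ˣ, ∀ {W : S.Etale} (g : W ⟶ V) (p₀ : P), lcRes P (mor g) p = lc _ p₀ →
      unitsMap (mor g) w = unitsMap (mor g) (u p₀) := by
  obtain ⟨s, hs⟩ := exists_glue (unitSheaf S) (V := V)
    (fun {W} g (s : (fn (dom W))ˣ) => ∃ p₀, lcRes P (mor g) p = lc _ p₀ ∧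
      s = unitsMap (mor g) (u p₀))
    (by
      rintro W' W k g _ ⟨p₀, h, rfl⟩
      refine ⟨p₀, by rw [mor_comp, lcRes_comp, h, lcRes_const], ?_⟩
      exact (unitsMap_comp (mor k) (mor g) _).symm)
    (by
      rintro W g _ _ ⟨p₀, h, rfl⟩ ⟨p₁, h', rfl⟩
      -- Equality of the constant functions gives `p₀ = p₁` only in the presence of a point of `W`;
      -- over the empty scheme there is nothing to compare.
      refine units_ext fun x => ⟨W, 𝟙 _, x, rfl, ?_⟩
      rw [show p₀ = p₁ from congr($(h.symm.trans h') x)])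
    (by
      intro x
      obtain ⟨W, g, w, e, h⟩ := exists_const p x
      exact ⟨W, g, w, unitsMap (mor g) (u (p x)), e, _, h, rfl⟩)
  exact ⟨s, fun g p₀ h => hs g _ ⟨p₀, h, rfl⟩⟩

/-- The value of `u` in `Hom(P, 𝒪^*)` at a locally constant section of `P`. -/
def extU {V : S.Etale} (u : GSec P (dom V)) (p : LocallyConstant (dom V) P) : (fn (dom V))ˣ :=
  (exists_units_glue u p).choose

lemma extU_spec {V W : S.Etale} (u : GSec P (dom V)) (p : LocallyConstant (dom V) P) (g : W ⟶ V)
    (p₀ : P) (h : lcRes P (mor g) p = lc _ p₀) :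
    unitsMap (mor g) (extU u p) = unitsMap (mor g) (u p₀) :=
  (exists_units_glue u p).choose_spec g p₀ h

lemma extU_eq {V : S.Etale} (u : GSec P (dom V)) (p : LocallyConstant (dom V) P)
    (v : (fn (dom V))ˣ) (h : ∀ {W : S.Etale} (g : W ⟶ V) (p₀ : P), lcRes P (mor g) p = lc _ p₀ →
      unitsMap (mor g) v = unitsMap (mor g) (u p₀)) : extU u p = v :=
  units_ext fun x => by
    obtain ⟨W, g, w, e, hp⟩ := exists_const p x
    exact ⟨W, g, w, e, (extU_spec u p g _ hp).trans (h g _ hp).symm⟩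

lemma extU_const {V : S.Etale} (u : GSec P (dom V)) (p : P) : extU u (lc _ p) = u p :=
  units_ext fun x => ⟨V, 𝟙 _, x, rfl, extU_spec _ _ _ _ rfl⟩

lemma extU_one {V : S.Etale} (u : GSec P (dom V)) : extU u 1 = 1 :=
  (extU_const u 1).trans (map_one u)

lemma extU_mul {V : S.Etale} (u : GSec P (dom V)) (p q : LocallyConstant (dom V) P) :
    extU u (p * q) = extU u p * extU u q :=
  units_ext fun x => by
    obtain ⟨W, g, w, e, hp⟩ := exists_const p x
    obtain ⟨W', g', w', e', hq⟩ := exists_const (lcRes P (mor g) q) w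
    have hp' : lcRes P (mor (g' ≫ g)) p = lc _ (p x) := by
      rw [mor_comp, lcRes_comp, hp, lcRes_const]
    have hq' : lcRes P (mor (g' ≫ g)) q = lc _ (lcRes P (mor g) q w) := by
      rw [mor_comp, lcRes_comp, hq]
    refine ⟨W', g' ≫ g, w', by rw [← e, ← e']; rfl, ?_⟩
    rw [map_mul, extU_spec u p _ _ hp', extU_spec u q _ _ hq',
      extU_spec u (p * q) _ (p x * lcRes P (mor g) q w), map_mul, map_mul]
    rw [map_mul, hp', hq']
    rfl

lemma extU_mul_left {V : S.Etale} (u u' : GSec P (dom V)) (p : LocallyConstant (dom V) P) :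
    extU (u * u') p = extU u p * extU u' p :=
  extU_eq _ _ _ fun g p₀ h => by
    rw [map_mul, extU_spec u p g _ h, extU_spec u' p g _ h, MonoidHom.mul_apply, map_mul]

lemma extU_res {V W : S.Etale} (u : GSec P (dom V)) (p : LocallyConstant (dom V) P) (g : W ⟶ V) :
    extU ((unitsMap (mor g)).comp u) (lcRes P (mor g) p) = unitsMap (mor g) (extU u p) :=
  extU_eq _ _ _ fun k p₀ h => by
    rw [← lcRes_comp, ← mor_comp] at h
    rw [← unitsMap_comp, ← mor_comp, extU_spec u p _ _ h, mor_comp, unitsMap_comp]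
    rfl

/-- A Čech cocycle of the group sheaf `Hom(P, 𝒪^*)` on an étale scheme `U`. -/
structure Cocycle (P : Type u) [CommMonoid P] (U : S.Etale) where
  u : ∀ {V : S.Etale} (_ _ : V ⟶ U), GSec P (dom V)
  res : ∀ {V W : S.Etale} (g : W ⟶ V) (a b : V ⟶ U),
    u (g ≫ a) (g ≫ b) = (unitsMap (mor g)).comp (u a b)
  mul : ∀ {V : S.Etale} (a b c : V ⟶ U), u a b * u b c = u a c

namespace Cocycle
variable {U : S.Etale} (c : Cocycle P U)

lemma self {V : S.Etale} (a : V ⟶ U) : c.u a a = 1 := by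
  ext1 p
  have := congr($(c.mul a a a) p)
  exact mul_eq_left.1 this

/-- The value of a cocycle on two morphisms of schemes to `U` over `S`. -/
def uS {Q : Scheme.{u}} (s t : Q ⟶ dom U) (h : s ≫ str U = t ≫ str U) : GSec P Q :=
  (unitsMap (pairS s t h)).comp (c.u (pr₁ U U) (pr₂ U U))

lemma uS_mor {V : S.Etale} (a b : V ⟶ U) (h) : c.uS (mor a) (mor b) h = c.u a b := by
  conv_rhs => rw [← pair_fst a b]
  conv_rhs => enter [3]; rw [← pair_snd a b]
  rw [c.res]
  rfl

lemma uS_comp {Q Q' : Scheme.{u}} (k : Q' ⟶ Q) (s t : Q ⟶ dom U) (h h') :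
    c.uS (k ≫ s) (k ≫ t) h' = (unitsMap k).comp (c.uS s t h) := by
  ext1 p
  have : pairS (k ≫ s) (k ≫ t) h' = k ≫ pairS s t h :=
    prodS_ext (by rw [pairS_fst, Category.assoc, pairS_fst])
      (by rw [pairS_snd, Category.assoc, pairS_snd])
  simp only [uS, this, MonoidHom.comp_apply, unitsMap_comp]

lemma uS_of {Q : Scheme.{u}} {W : S.Etale} (q : Q ⟶ dom W) (a b : W ⟶ U) {s t : Q ⟶ dom U}
    (ha : q ≫ mor a = s) (hb : q ≫ mor b = t) (h) :
    c.uS s t h = (unitsMap q).comp (c.u a b) := by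
  subst ha hb
  rw [c.uS_comp _ _ _ (by rw [mor_str, mor_str]), uS_mor]

lemma uS_mul {Q : Scheme.{u}} (r s t : Q ⟶ dom U) (h : r ≫ str U = s ≫ str U)
    (h' : s ≫ str U = t ≫ str U) : c.uS r s h * c.uS s t h' = c.uS r t (h.trans h') := by
  -- The cocycle identity is given on étale schemes only; the triple `(r, s, t)` factors through the
  -- étale scheme `U × U × U`, where it can be applied to the three projections.
  let q : Q ⟶ dom (prod (prod U U) U) :=
    pairS (pairS r s h) t (by rw [pairS_str, h, h'])
  let a := pr₁ (prod U U) U ≫ pr₁ U U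
  let b := pr₁ (prod U U) U ≫ pr₂ U U
  let d := pr₂ (prod U U) U
  have ha : q ≫ mor a = r := by
    rw [mor_comp, ← Category.assoc, pairS_fst, pairS_fst]
  have hb : q ≫ mor b = s := by
    rw [mor_comp, ← Category.assoc, pairS_fst, pairS_snd]
  have hd : q ≫ mor d = t := pairS_snd _ _ _
  rw [c.uS_of q a b ha hb, c.uS_of q b d hb hd, c.uS_of q a d ha hd, ← c.mul a b d]
  ext1 p
  exact (map_mul (unitsMap q) _ _).symm

/-- The pullback of a cocycle along a morphism of schemes. -/
def pb (f : T ⟶ S) : Cocycle P (etPb f U) where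
  u a b := c.uS (mor a ≫ etFst f U) (mor b ≫ etFst f U) (by
    rw [Category.assoc, etFst_str, ← Category.assoc, mor_str, Category.assoc, etFst_str,
      ← Category.assoc, mor_str])
  res g a b := by
    simp only [mor_comp, Category.assoc]
    exact c.uS_comp _ _ _ _ _
  mul a b d := c.uS_mul _ _ _ _ _

end Cocycle
end Cocycles

/-! ### The twist of the sheaf `M ⊕ P` by a cocycle. -/

section Twist
variable {P : Type u} [CommMonoid P] {S : Scheme.{u}} (L : IntLog S) {U : S.Etale}
  (c : Cocycle P U)

instance (V : S.Etale) : IsCancelMul (sec L.M V) := L.integral V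

lemma IntLog.unit_injective (V : S.Etale) : Function.Injective (L.unit V) := fun v v' h =>
  Units.ext (by rw [← L.al_unit, h, L.al_unit])

/-- Sections over `V` of the twist of `M ⊕ P` by a cocycle. -/
def twistSub (V : S.Etale) :
    Submonoid (sec L.M (prod V U) × LocallyConstant (dom (prod V U)) P) where
  -- Descent from `V × U`: if one section reads `m_a · frame_a = m_b · frame_b` with `frame_a = u(a,
  -- b) · frame_b`, then `m_b = u(a, b) m_a`, while the degree does not depend on the frame.
  carrier := { x | ∀ {W : S.Etale} (g : W ⟶ V) (a b : W ⟶ U),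
    lcRes P (mor (pair g a)) x.2 = lcRes P (mor (pair g b)) x.2 ∧
    rs L.M (pair g b) x.1 =
      L.unit W (extU (c.u a b) (lcRes P (mor (pair g a)) x.2)) * rs L.M (pair g a) x.1 }
  one_mem' g a b := by
    refine ⟨by rw [Prod.snd_one, map_one, map_one], ?_⟩
    rw [Prod.snd_one, Prod.fst_one, map_one, map_one, map_one, extU_one, map_one, one_mul]
  mul_mem' := by
    intro x y hx hy W g a b
    obtain ⟨h₁, h₂⟩ := hx g a b
    obtain ⟨h₃, h₄⟩ := hy g a b
    refine ⟨by rw [Prod.snd_mul, map_mul, map_mul, h₁, h₃], ?_⟩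
    rw [Prod.fst_mul, Prod.snd_mul, map_mul, map_mul, map_mul, extU_mul, map_mul, h₂, h₄]
    exact mul_mul_mul_comm _ _ _ _

/-- The morphism `V × U ⟶ W × U` induced by `V ⟶ W`. -/
def prodMap (U : S.Etale) {V W : S.Etale} (g : V ⟶ W) : prod V U ⟶ prod W U :=
  (prodFunctor U).map g

lemma prodMap_pr₁ {U V W : S.Etale} (g : V ⟶ W) : prodMap U g ≫ pr₁ W U = pr₁ V U ≫ g :=
  (congrArg (· ≫ pr₁ W U) (prodFunctor_map U g)).trans (pair_fst _ _)
lemma prodMap_pr₂ {U V W : S.Etale} (g : V ⟶ W) : prodMap U g ≫ pr₂ W U = pr₂ V U :=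
  (congrArg (· ≫ pr₂ W U) (prodFunctor_map U g)).trans (pair_snd _ _)

lemma pair_prodMap {U V V' W : S.Etale} (g : V ⟶ V') (k : W ⟶ V) (a : W ⟶ U) :
    pair k a ≫ prodMap U g = pair (k ≫ g) a :=
  prod_ext (by rw [Category.assoc, prodMap_pr₁, ← Category.assoc, pair_fst, pair_fst])
    (by rw [Category.assoc, prodMap_pr₂, pair_snd, pair_snd])

/-- Restriction in the twist. -/
def twistMap {V W : S.Etale} (g : W ⟶ V) : twistSub L c V →* twistSub L c W where
  toFun x := ⟨(rs L.M (prodMap U g) x.1.1, lcRes P (mor (prodMap U g)) x.1.2), by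
    intro W' k a b
    obtain ⟨h₁, h₂⟩ := x.2 (k ≫ g) a b
    simp only [← rs_comp, ← lcRes_comp, ← mor_comp, pair_prodMap]
    exact ⟨h₁, h₂⟩⟩
  map_one' := Subtype.ext (Prod.ext (map_one _) (map_one _))
  map_mul' x y := Subtype.ext (Prod.ext (map_mul _ _ _) (map_mul _ _ _))

lemma prodMap_id (V : S.Etale) : prodMap U (𝟙 V) = 𝟙 _ := (prodFunctor U).map_id V
lemma prodMap_comp {V W X : S.Etale} (f : V ⟶ W) (g : W ⟶ X) :
    prodMap U (f ≫ g) = prodMap U f ≫ prodMap U g := (prodFunctor U).map_comp f g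

/-- The presheaf of sections of the twist. -/
def twistPsh : S.Etaleᵒᵖ ⥤ CommMonCat.{u} where
  obj V := CommMonCat.of (twistSub L c V.unop)
  map g := CommMonCat.ofHom (twistMap L c g.unop)
  map_id V := by
    refine CommMonCat.hom_ext (MonoidHom.ext fun x => Subtype.ext (Prod.ext ?_ ?_))
    · exact (congr(rs L.M $(prodMap_id (U := U) V.unop) x.1.1)).trans (rs_id _ _)
    · exact (congr(lcRes P (mor $(prodMap_id (U := U) V.unop)) x.1.2)).trans (lcRes_id _)
  map_comp f g := by
    refine CommMonCat.hom_ext (MonoidHom.ext fun x => Subtype.ext (Prod.ext ?_ ?_))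
    · exact (congr(rs L.M $(prodMap_comp (U := U) g.unop f.unop) x.1.1)).trans (rs_comp _ _ _ _)
    · exact (congr(lcRes P (mor $(prodMap_comp (U := U) g.unop f.unop)) x.1.2)).trans
        (lcRes_comp _ _ _)

/-- The constant sheaf. -/
def lcSheaf (P : Type u) [CommMonoid P] (S : Scheme.{u}) : MSheaf S :=
  ⟨{ obj V := CommMonCat.of (LocallyConstant (dom V.unop) P)
     map g := CommMonCat.ofHom (lcRes P (mor g.unop)) },
    isSheaf_of_glue _ (fun _ _ h => lc_sep h) fun R hR x hx => lc_glue R hR x hx⟩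

/-- The sheaf `V ↦ M(V × U)`. -/
def prodSheaf (U : S.Etale) (M : MSheaf S) : MSheaf S :=
  have : (prodFunctor U).IsContinuous S.smallEtaleTopology S.smallEtaleTopology :=
    Functor.isContinuous_comp _ _ _ (dom U).smallEtaleTopology _
  ((prodFunctor U).sheafPushforwardContinuous CommMonCat.{u} S.smallEtaleTopology
    S.smallEtaleTopology).obj M

lemma exists_amalg (M : MSheaf S) {V : S.Etale} (R : Sieve V) (hR : R ∈ S.smallEtaleTopology V)
    (x : ∀ {W : S.Etale} (g : W ⟶ V), R g → sec M W)
    (hx : ∀ {W W' : S.Etale} (g : W ⟶ V) (hg : R g) (k : W' ⟶ W),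
      rs M k (x g hg) = x (k ≫ g) (R.downward_closed hg k)) :
    ∃ s : sec M V, ∀ {W : S.Etale} (g : W ⟶ V) (hg : R g), rs M g s = x g hg := by
  obtain ⟨t, ht, -⟩ := isSheaf_forget M R hR (fun W g hg => x g hg)
    ((Presieve.compatible_iff_sieveCompatible _).2 fun W W' g k hg => (hx g hg k).symm)
  exact ⟨t, fun g hg => ht g hg⟩

/-- The components are sections of the sheaves `V ↦ M(V × U)` and `V ↦ P(V × U)`, and the descent
condition is local on `V`. -/
lemma twist_isSheaf : Presheaf.IsSheaf S.smallEtaleTopology (twistPsh L c) := by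
  refine isSheaf_of_glue _ ?_ ?_
  · intro V m m' h
    refine Subtype.ext (Prod.ext ?_ ?_)
    · refine sec_ext (prodSheaf U L.M) (V := V) (m := m.1.1) (m' := m'.1.1) fun x => ?_
      obtain ⟨W, g, w, e, h⟩ := h x
      exact ⟨W, g, w, e, congr(($h).1.1)⟩
    · refine sec_ext (prodSheaf U (lcSheaf P S)) (V := V) (m := m.1.2) (m' := m'.1.2) fun x => ?_
      obtain ⟨W, g, w, e, h⟩ := h x
      exact ⟨W, g, w, e, congr(($h).1.2)⟩
  · intro V R hR x hx
    obtain ⟨m, hm⟩ : ∃ m : sec L.M (prod V U), ∀ {W : S.Etale} (g : W ⟶ V) (hg : R g),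
        rs L.M (prodMap U g) m = (x g hg).1.1 :=
      exists_amalg (prodSheaf U L.M) R hR (fun g hg => (x g hg).1.1)
        (fun g hg k => congr($(hx g hg k).1.1))
    obtain ⟨p, hp⟩ : ∃ p : LocallyConstant (dom (prod V U)) P, ∀ {W : S.Etale} (g : W ⟶ V)
        (hg : R g), lcRes P (mor (prodMap U g)) p = (x g hg).1.2 :=
      exists_amalg (prodSheaf U (lcSheaf P S)) R hR (fun g hg => (x g hg).1.2)
        (fun g hg k => congr($(hx g hg k).1.2))
    have loc : ∀ {W : S.Etale} (g : W ⟶ V) (a b : W ⟶ U) (y : dom W), ∃ (W' : S.Etale) (k : W' ⟶ W)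
        (w : dom W'), mor k w = y ∧ R (k ≫ g) := by
      intro W g a b y
      obtain ⟨W', k, w, e, hw⟩ := (mem_smallEtale_iff R).1 hR (mor g y)
      obtain ⟨W'', l, l', w'', e₁, -, e₂⟩ := exists_refine g k hw.symm
      exact ⟨W'', l, w'', e₁, by rw [e₂]; exact R.downward_closed e l'⟩
    refine ⟨⟨(m, p), ?_⟩, fun g hg => Subtype.ext (Prod.ext (hm g hg) (hp g hg))⟩
    intro W g a b
    have hpp : lcRes P (mor (pair g a)) p = lcRes P (mor (pair g b)) p := by
      refine lc_sep fun y => ?_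
      obtain ⟨W', k, w, e, hk⟩ := loc g a b y
      refine ⟨W', k, w, e, ?_⟩
      have := ((x (k ≫ g) hk).2 (𝟙 W') (k ≫ a) (k ≫ b)).1
      rw [← hp, ← lcRes_comp, ← lcRes_comp, ← mor_comp, ← mor_comp, pair_prodMap, pair_prodMap,
        Category.id_comp, ← comp_pair, ← comp_pair, mor_comp, mor_comp, lcRes_comp, lcRes_comp] at this
      exact this
    refine ⟨hpp, sec_ext L.M fun y => ?_⟩
    obtain ⟨W', k, w, e, hk⟩ := loc g a b y
    refine ⟨W', k, w, e, ?_⟩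
    have := ((x (k ≫ g) hk).2 (𝟙 W') (k ≫ a) (k ≫ b)).2
    rw [← hp, ← hm, ← lcRes_comp, ← rs_comp, ← rs_comp, ← mor_comp, pair_prodMap, pair_prodMap,
      Category.id_comp, ← comp_pair, ← comp_pair, mor_comp, lcRes_comp, rs_comp, rs_comp,
      c.res, extU_res] at this
    rw [map_mul, L.rs_unit]
    exact this

/-- The twist of `M ⊕ P` by a cocycle. -/
def twist : MSheaf S := ⟨twistPsh L c, twist_isSheaf L c⟩

/-- The local trivialization of the twist. -/
def twistIso {V : S.Etale} (a : V ⟶ U) :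
    sec L.M V × LocallyConstant (dom V) P ≃* sec (twist L c) V where
  -- Over `V × U` the section `m · frame_a` is rewritten in the tautological frame `pr₂`, at the
  -- cost of the factor `u(pr₁ ≫ a, pr₂)`. The inverse restricts along `(id, a)`, where this factor
  -- is `u(a, a) = 1`.
  toFun x := ⟨(L.unit _ (extU (c.u (pr₁ V U ≫ a) (pr₂ V U)) (lcRes P (mor (pr₁ V U)) x.2)) *
    rs L.M (pr₁ V U) x.1, lcRes P (mor (pr₁ V U)) x.2), by
      intro W g d b
      simp only [← lcRes_comp, ← mor_comp, pair_fst, map_mul, ← rs_comp, L.rs_unit, true_and,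
        ← extU_res, ← c.res]
      simp only [← Category.assoc, pair_fst, pair_snd]
      rw [← mul_assoc, ← map_mul, ← extU_mul_left, mul_comm (c.u d b), c.mul]⟩
  invFun x := (rs L.M (pair (𝟙 V) a) x.1.1, lcRes P (mor (pair (𝟙 V) a)) x.1.2)
  left_inv x := by
    simp only [← lcRes_comp, ← mor_comp, pair_fst, map_mul, ← rs_comp, L.rs_unit,
        ← extU_res, ← c.res]
    simp only [← Category.assoc, pair_fst, pair_snd, Category.id_comp, c.self]
    rw [mor_id, lcRes_id, rs_id, extU_eq 1 x.2 1 (fun _ _ _ => rfl), map_one, one_mul]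
  right_inv x := by
    have e := x.2 (pr₁ V U) (pr₁ V U ≫ a) (pr₂ V U)
    have e₁ : pair (pr₁ V U) (pr₂ V U) = 𝟙 _ :=
      prod_ext (by rw [pair_fst, Category.id_comp]) (by rw [pair_snd, Category.id_comp])
    have e₂ : pr₁ V U ≫ pair (𝟙 V) a = pair (pr₁ V U) (pr₁ V U ≫ a) := by
      rw [comp_pair, Category.comp_id]
    rw [e₁, mor_id, lcRes_id, rs_id] at e
    refine Subtype.ext (Prod.ext ?_ ?_)
    · simp only [← rs_comp, ← lcRes_comp, ← mor_comp, e₂]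
      exact e.2.symm
    · simp only [← lcRes_comp, ← mor_comp, e₂]
      exact e.1
  map_mul' x y := by
    refine Subtype.ext (Prod.ext ?_ ?_)
    · simp only [Prod.fst_mul, Prod.snd_mul, map_mul, extU_mul]
      exact mul_mul_mul_comm _ _ _ _
    · exact map_mul _ _ _

lemma twistIso_res {V V' : S.Etale} (g : V' ⟶ V) (a : V ⟶ U) (m : sec L.M V)
    (p : LocallyConstant (dom V) P) : rs (twist L c) g (twistIso L c a (m, p)) =
      twistIso L c (g ≫ a) (rs L.M g m, lcRes P (mor g) p) := by
  refine Subtype.ext (Prod.ext ?_ ?_)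
  · change rs L.M (prodMap U g) (L.unit _ (extU (c.u (pr₁ V U ≫ a) (pr₂ V U))
      (lcRes P (mor (pr₁ V U)) p)) * rs L.M (pr₁ V U) m) =
      L.unit _ (extU (c.u (pr₁ V' U ≫ g ≫ a) (pr₂ V' U)) (lcRes P (mor (pr₁ V' U))
      (lcRes P (mor g) p))) * rs L.M (pr₁ V' U) (rs L.M g m)
    simp only [map_mul, ← rs_comp, L.rs_unit, ← extU_res, ← c.res, ← lcRes_comp, ← mor_comp,
      prodMap_pr₁, prodMap_pr₂]
    simp only [← Category.assoc, prodMap_pr₁]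
  · change lcRes P (mor (prodMap U g)) (lcRes P (mor (pr₁ V U)) p) =
      lcRes P (mor (pr₁ V' U)) (lcRes P (mor g) p)
    rw [← lcRes_comp, ← lcRes_comp, ← mor_comp, ← mor_comp, prodMap_pr₁]

end Twist
end
end LogGeom

namespace LogGeom
noncomputable section

/-! ### The twist as a log structure and as a log point. -/

section TwistLog
variable {P : Type u} [CommMonoid P] {S : Scheme.{u}} (L : IntLog S) {U : S.Etale}
  (c : Cocycle P U)

/-- The map from `M` to the twist of `M ⊕ P`. -/
def twistπ : L.M ⟶ twist L c :=
  ⟨{ app V := CommMonCat.ofHom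
      { toFun := fun m => ⟨(rs L.M (pr₁ V.unop U) m, 1), by
          intro W g a b
          simp only [← rs_comp, pair_fst, map_one, extU_one, one_mul, and_self]⟩
        map_one' := Subtype.ext (Prod.ext (map_one _) rfl)
        map_mul' := fun x y => Subtype.ext (Prod.ext (map_mul _ _ _) (mul_one _).symm) }
     naturality V W g := by
      refine CommMonCat.hom_ext (MonoidHom.ext fun x => Subtype.ext (Prod.ext ?_ ?_))
      · change rs L.M (pr₁ W.unop U) (rs L.M g.unop x) =
          rs L.M (prodMap U g.unop) (rs L.M (pr₁ V.unop U) x)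
        rw [← rs_comp, ← rs_comp, prodMap_pr₁]
      · exact (map_one (lcRes P (mor (prodMap U g.unop)))).symm }⟩

lemma twistIso_one {V : S.Etale} (a : V ⟶ U) (m : sec L.M V) :
    twistIso L c a (m, 1) = ap (twistπ L c) V m := by
  refine Subtype.ext (Prod.ext ?_ ?_)
  · change L.unit _ (extU _ (lcRes P _ 1)) * rs L.M _ m = rs L.M _ m
    rw [map_one, extU_one, map_one, one_mul]
  · exact map_one (lcRes P _)

/-- Change of frame, by the cocycle identity `u(a, ·) = u(a, b) u(b, ·)`. -/
lemma twistIso_change {V : S.Etale} (a b : V ⟶ U) (m : sec L.M V)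
    (p : LocallyConstant (dom V) P) :
    twistIso L c a (m, p) = twistIso L c b (L.unit V (extU (c.u a b) p) * m, p) := by
  refine Subtype.ext (Prod.ext ?_ rfl)
  change L.unit _ (extU (c.u (pr₁ V U ≫ a) (pr₂ V U)) (lcRes P (mor (pr₁ V U)) p)) *
    rs L.M (pr₁ V U) m = L.unit _ (extU (c.u (pr₁ V U ≫ b) (pr₂ V U)) (lcRes P (mor (pr₁ V U)) p)) *
    rs L.M (pr₁ V U) (L.unit V (extU (c.u a b) p) * m)
  rw [map_mul, L.rs_unit, ← extU_res, ← c.res, ← mul_assoc, ← map_mul, ← extU_mul_left,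
    mul_comm (c.u _ (pr₂ V U)), c.mul]

/-- Separates the degrees `p ≠ 1`, where structure maps vanish, from the units. -/
lemma unit_ne_zero {X : Scheme.{u}} (x : X) (v : (fn X)ˣ) : (v : fn X) ≠ 0 := by
  have : Nonempty (⊤ : X.Opens) := ⟨⟨x, trivial⟩⟩
  have : Nontrivial Γ(X, ⊤) := Scheme.component_nontrivial X ⊤
  exact v.ne_zero

lemma twistπ_injective (hU : Function.Surjective (str U)) {V : S.Etale} : Function.Injective (ap (twistπ L c) V) := by
  intro m m' h
  refine sec_ext _ fun x => ?_
  obtain ⟨W, g, w, a, e⟩ := exists_section hU x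
  refine ⟨W, g, w, e, ?_⟩
  have := congrArg (rs _ g) h
  rw [rs_ap, rs_ap, ← twistIso_one L c a, ← twistIso_one L c a] at this
  exact congr($((twistIso L c a).injective this).1)

lemma exists_twistIso (hU : Function.Surjective (str U)) {V : S.Etale}
    (x : sec (twist L c) V) (v : dom V) :
    ∃ (W : S.Etale) (g : W ⟶ V) (w : dom W) (a : W ⟶ U) (m : sec L.M W) (p : P),
      mor g w = v ∧ rs (twist L c) g x = twistIso L c a (m, lc _ p) := by
  obtain ⟨W, g, w, a, e⟩ := exists_section hU v
  obtain ⟨⟨m, p⟩, h⟩ := (twistIso L c a).surjective (rs (twist L c) g x)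
  obtain ⟨W', g', w', e', hp⟩ := exists_const p w
  refine ⟨W', g' ≫ g, w', g' ≫ a, rs L.M g' m, p w, by rw [← e, ← e']; rfl, ?_⟩
  rw [rs_comp, ← h, twistIso_res, hp]

variable [Subsingleton Pˣ]

/-- The map is `α` on `M` and zero in the other degrees. For multiplicativity the degrees `p ≠ 1`
have to be closed under products, which is sharpness: `p p' = 1` would make `p` invertible. -/
lemma exists_twistα (hU : Function.Surjective (str U)) :
     ∃ α : twist L c ⟶ strSheaf S,
    (∀ {V : S.Etale} (m : sec L.M V), alphaAt α V (ap (twistπ L c) V m) = L.al V m) ∧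
    ∀ {V : S.Etale} (a : V ⟶ U) (m : sec L.M V) (p : P), p ≠ 1 →
      alphaAt α V (twistIso L c a (m, lc _ p)) = 0 := by
  obtain ⟨α, hα⟩ := exists_hom_of_rel (B := twist L c) (A := strSheaf S)
    (fun {V} x (f : fn (dom V)) => (∃ m, x = ap (twistπ L c) V m ∧ f = L.al V m) ∨
      (f = 0 ∧ ∃ (a : V ⟶ U) (m : sec L.M V) (p : P), p ≠ 1 ∧ x = twistIso L c a (m, lc _ p)))
    (by
      rintro V W g _ f (⟨m, rfl, rfl⟩ | ⟨rfl, a, m, p, hp, rfl⟩)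
      · exact .inl ⟨rs L.M g m, rs_ap _ _ _, (L.al_rs g m).symm⟩
      · exact .inr ⟨map_zero (fnMap (mor g)), _, _, p, hp, twistIso_res _ _ _ _ _ _⟩)
    (by
      intro V x v
      obtain ⟨W, g, w, a, m, p, e, h⟩ := exists_twistIso L c hU x v
      by_cases hp : p = 1
      · refine ⟨W, g, w, L.al W m, e, .inl ⟨m, ?_, rfl⟩⟩
        rw [h, hp, ← twistIso_one L c a]
        rfl
      · exact ⟨W, g, w, (0 : fn (dom W)), e, .inr ⟨rfl, a, m, p, hp, h⟩⟩)
    (by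
      -- A section of both kinds has degree `1` and degree `p ≠ 1` at every point, so `V` is empty
      -- and any two functions on it agree.
      have key : ∀ {V : S.Etale} (m m' : sec L.M V) (a : V ⟶ U) (p : P), p ≠ 1 →
          ap (twistπ L c) V m = twistIso L c a (m', lc _ p) → ∀ y y' : sec (strSheaf S) V, y = y' := by
        intro V m m' a p hp h y y'
        rw [← twistIso_one L c a] at h
        have := congr($((twistIso L c a).injective h).2)
        refine sec_ext _ fun x => (hp ?_).elim
        exact congr($this x).symm
      rintro V x y y' (⟨m, rfl, rfl⟩ | ⟨rfl, a, m, p, hp, rfl⟩)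
        (⟨m', h, rfl⟩ | ⟨rfl, a', m', p', hp', h⟩)
      · rw [twistπ_injective L c hU h]
      · exact key _ _ _ _ hp' h _ _
      · exact key _ _ _ _ hp h.symm _ _
      · rfl)
    (by
      rintro V y (⟨m, h, rfl⟩ | ⟨rfl, a, m, p, hp, h⟩)
      · rw [← twistπ_injective L c hU ((map_one _).trans h), map_one]
        rfl
      · rw [← map_one (twistIso L c a)] at h
        have := congr($((twistIso L c a).injective h).2)
        refine sec_ext (strSheaf S) fun x => (hp ?_).elim
        exact congr($this x).symm)
    (by
      have key : ∀ {V : S.Etale} (m m' : sec L.M V) (a : V ⟶ U) (p : P),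
          ap (twistπ L c) V m * twistIso L c a (m', lc _ p) = twistIso L c a (m * m', lc _ p) := by
        intro V m m' a p
        rw [← twistIso_one L c a, ← map_mul]
        rw [Prod.mk_mul_mk, one_mul]
      rintro V x x' y y' (⟨m, rfl, rfl⟩ | ⟨rfl, a, m, p, hp, rfl⟩)
        (⟨m', rfl, rfl⟩ | ⟨rfl, a', m', p', hp', rfl⟩)
      · exact .inl ⟨m * m', (map_mul _ _ _).symm, (map_mul _ _ _).symm⟩
      · exact .inr ⟨mul_zero (M₀ := fn (dom V)) _, a', _, p', hp', key _ _ _ _⟩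
      · exact .inr ⟨zero_mul (M₀ := fn (dom V)) _, a, _, p, hp, (mul_comm _ _).trans (key _ _ _ _)⟩
      -- The two factors may be given in different frames; the first is rewritten in the frame `a'`
      -- before multiplying.
      · refine .inr ⟨zero_mul (M₀ := fn (dom V)) _, a',
          L.unit V (extU (c.u a a') (lc _ p)) * m * m', p * p', fun h => hp ?_, ?_⟩
        · exact congrArg Units.val
            (Subsingleton.elim (⟨p, p', h, (mul_comm _ _).trans h⟩ : Pˣ) 1)
        · rw [twistIso_change L c a a', ← map_mul]
          rfl)
  refine ⟨α, fun m => hα _ _ (.inl ⟨m, rfl, rfl⟩), fun a m p hp => ?_⟩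
  exact hα _ (0 : fn (dom _)) (.inr ⟨rfl, a, m, p, hp, rfl⟩)

variable [IsCancelMul P]

/-- The twist of `M ⊕ P` by a cocycle, as a log structure. -/
def twistLog (hU : Function.Surjective (str U)) : IntLog S where
  M := twist L c
  α := (exists_twistα L c hU).choose
  existsUnique_unit V v := by
    refine ⟨ap (twistπ L c) V (L.unit V v), ?_, fun x hx => ?_⟩
    · exact ((exists_twistα L c hU).choose_spec.1 _).trans (L.al_unit V v)
    · refine sec_ext (twist L c) fun y => ?_
      obtain ⟨W, g, w, a, m, p, e, h⟩ := exists_twistIso L c hU x y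
      refine ⟨W, g, w, e, ?_⟩
      have h' : alphaAt (exists_twistα L c hU).choose W (rs (twist L c) g x) =
          unitsMap (mor g) v := by
        refine (rs_ap (exists_twistα L c hU).choose g x).symm.trans ?_
        exact congrArg (fnMap (mor g)) hx
      rw [h] at h'
      rw [h, rs_ap, L.rs_unit]
      -- A preimage of a unit can have no degree `p ≠ 1` at a point, because `α` vanishes there; so
      -- it comes from `M`, where uniqueness is known.
      by_cases hp : p = 1
      · have h'' : twistIso L c a (m, lc _ p) = ap (twistπ L c) W m := by
          rw [hp, ← twistIso_one L c a]
          rfl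
        rw [h''] at h' ⊢
        congr 1
        exact L.eq_unit (((exists_twistα L c hU).choose_spec.1 m).symm.trans h')
      · rw [(exists_twistα L c hU).choose_spec.2 a m p hp] at h'
        exact (unit_ne_zero w _ h'.symm).elim
  integral V := by
    have h : IsCancelMul (twistSub L c V) := by
      have : IsCancelMul (LocallyConstant (dom (prod V U)) P) :=
        { mul_left_cancel := fun a b d h => by
            ext x
            exact mul_left_cancel (congr($h x))
          mul_right_cancel := fun a b d h => by
            ext x
            exact mul_right_cancel (congr($h x)) }
      refine { mul_left_cancel := fun a b d h => ?_, mul_right_cancel := fun a b d h => ?_ }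
      · exact Subtype.ext (Prod.ext (mul_left_cancel (congr(($h).1.1)))
          (mul_left_cancel (congr(($h).1.2))))
      · exact Subtype.ext (Prod.ext (mul_right_cancel (congr(($h).1.1)))
          (mul_right_cancel (congr(($h).1.2))))
    exact h

lemma twistIso_frame (hU : Function.Surjective (str U)) {V : S.Etale} (a b : V ⟶ U) (p : P) :
    twistIso L c a (1, lc _ p) = (twistLog L c hU).unit V (c.u a b p) *
      (show sec (twistLog L c hU).M V from twistIso L c b (1, lc _ p)) := by
  have h : (twistLog L c hU).unit V (c.u a b p) = ap (twistπ L c) V (L.unit V (c.u a b p)) := by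
    refine ((twistLog L c hU).eq_unit ?_).symm
    exact ((exists_twistα L c hU).choose_spec.1 _).trans (L.al_unit V _)
  rw [h, ← twistIso_one L c b, twistIso_change L c a b, extU_const]
  refine Eq.trans ?_ (map_mul (twistIso L c b) _ _)
  simp

/-- The twist of the standard log point by a cocycle. -/
def twistPoint (hU : Function.Surjective (str U)) : PLogPoint P where
  base := S
  log := L
  log' := twistLog L c hU
  π := twistπ L c
  π_α := hom_ext_sec fun _ m => (exists_twistα L c hU).choose_spec.1 m
  cover := U
  cover_surj := hU
  φ :=
    { iso := twistIso L c
      iso_res := twistIso_res L c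
      iso_one := twistIso_one L c
      al_iso := fun a m p hp => (exists_twistα L c hU).choose_spec.2 a m p hp }
  transition a b := ⟨c.u a b, twistIso_frame L c hU a b⟩

lemma twistPoint_frame (hU : Function.Surjective (str U)) {V : (twistPoint L c hU).base.Etale}
    (a b : V ⟶ (twistPoint L c hU).cover) (p : P) : (twistPoint L c hU).φ.frame a p =
      (twistPoint L c hU).log'.unit V (c.u a b p) * (twistPoint L c hU).φ.frame b p :=
  twistIso_frame L c hU a b p

end TwistLog
end
end LogGeom

namespace LogGeom
noncomputable section

/-! ### The subsheaf `Q` of sections `(u, p)` in a log point. -/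

namespace PLogPoint
variable {P : Type u} [CommMonoid P] (z : PLogPoint P)

lemma al_π {V : z.base.Etale} (n : sec z.log.M V) :
    z.log'.al V (ap z.π V n) = z.log.al V n := congr(ap $z.π_α V n)

lemma π_unit {V : z.base.Etale} (v : (fn (dom V))ˣ) :
    ap z.π V (z.log.unit V v) = z.log'.unit V v :=
  z.log'.eq_unit (by rw [al_π, z.log.al_unit])

lemma iso_eq {V : z.base.Etale} (a : V ⟶ z.cover) (m : sec z.log.M V)
    (p : LocallyConstant (dom V) P) :
    z.φ.iso a (m, p) = ap z.π V m * z.φ.iso a (1, p) := by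
  rw [← z.φ.iso_one a, ← map_mul]
  simp

lemma iso_const {V : z.base.Etale} (a : V ⟶ z.cover) (m : sec z.log.M V) (p : P) :
    z.φ.iso a (m, lc _ p) = ap z.π V m * z.φ.frame a p := z.iso_eq a m _

lemma frame_one {V : z.base.Etale} (a : V ⟶ z.cover) : z.φ.frame a 1 = 1 :=
  (z.φ.iso_one a 1).trans (map_one _)

lemma frame_mul {V : z.base.Etale} (a : V ⟶ z.cover) (p q : P) :
    z.φ.frame a (p * q) = z.φ.frame a p * z.φ.frame a q := by
  unfold Triv.frame
  rw [← map_mul, Prod.mk_mul_mk, mul_one]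
  rfl

lemma π_injective {V : z.base.Etale} : Function.Injective (ap z.π V) := by
  intro m m' h
  refine sec_ext _ fun x => ?_
  obtain ⟨W, g, w, a, e⟩ := exists_section z.cover_surj x
  refine ⟨W, g, w, e, ?_⟩
  have := congrArg (rs _ g) h
  rw [rs_ap, rs_ap, ← z.φ.iso_one a, ← z.φ.iso_one a] at this
  exact congr($((z.φ.iso a).injective this).1)

/-- The point `x` is there because different constants define the same function on the empty scheme.
-/
lemma iso_cancel {V : z.base.Etale} (a : V ⟶ z.cover) {m m' : sec z.log.M V} {p p' : P}
    (h : ap z.π V m * z.φ.frame a p = ap z.π V m' * z.φ.frame a p') (x : dom V) :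
    p = p' ∧ m = m' := by
  rw [← iso_const, ← iso_const] at h
  have := (z.φ.iso a).injective h
  exact ⟨congr($this.2 x), congr($this.1)⟩

lemma exists_iso {V : z.base.Etale} (x : sec z.log'.M V) (v : dom V) :
    ∃ (W : z.base.Etale) (g : W ⟶ V) (w : dom W) (a : W ⟶ z.cover) (m : sec z.log.M W) (p : P),
      mor g w = v ∧ rs z.log'.M g x = ap z.π W m * z.φ.frame a p := by
  obtain ⟨W, g, w, a, e⟩ := exists_section z.cover_surj v
  obtain ⟨⟨m, p⟩, h⟩ := (z.φ.iso a).surjective (rs z.log'.M g x)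
  obtain ⟨W', g', w', e', hp⟩ := exists_const p w
  refine ⟨W', g' ≫ g, w', g' ≫ a, rs z.log.M g' m, p w, by rw [← e, ← e']; rfl, ?_⟩
  rw [rs_comp, ← h, z.φ.iso_res, hp, iso_const]

/-- Cancellation in `M_{Y'}` makes the transition elements unique, and uniqueness turns them into a
cocycle. -/
lemma frame_unique {V : z.base.Etale} (a b : V ⟶ z.cover) {u u' : GSec P (dom V)}
    (h : ∀ p, z.φ.frame a p = z.log'.unit V (u p) * z.φ.frame b p)
    (h' : ∀ p, z.φ.frame a p = z.log'.unit V (u' p) * z.φ.frame b p) : u = u' := by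
  ext1 p
  exact z.log'.unit_injective V (mul_right_cancel ((h p).symm.trans (h' p)))

/-- The transition cocycle of a log point. -/
def cocycle : Cocycle P z.cover where
  u a b := (z.transition a b).choose
  res g a b := by
    refine z.frame_unique _ _ (z.transition _ _).choose_spec fun p => ?_
    rw [← z.φ.rs_frame, (z.transition a b).choose_spec, map_mul, z.log'.rs_unit, z.φ.rs_frame]
    rfl
  mul a b d := by
    refine z.frame_unique a d (fun p => ?_) (z.transition _ _).choose_spec
    rw [(z.transition a b).choose_spec, (z.transition b d).choose_spec, ← mul_assoc, ← map_mul]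
    rfl

lemma frame_eq {V : z.base.Etale} (a b : V ⟶ z.cover) (p : P) :
    z.φ.frame a p = z.log'.unit V (z.cocycle.u a b p) * z.φ.frame b p :=
  (z.transition a b).choose_spec p

/-- The sections of `M_{Y'}` that are locally of the form `(u, p)` with `u` invertible. -/
def IsQ {V : z.base.Etale} (q : sec z.log'.M V) : Prop :=
  ∀ x : dom V, ∃ (W : z.base.Etale) (g : W ⟶ V) (w : dom W) (a : W ⟶ z.cover) (p : P)
    (v : (fn (dom W))ˣ), mor g w = x ∧ rs z.log'.M g q = z.log'.unit W v * z.φ.frame a p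

variable {z}

lemma IsQ.of_local {V : z.base.Etale} {q : sec z.log'.M V} (h : ∀ x : dom V, ∃ (W : z.base.Etale)
    (g : W ⟶ V) (w : dom W), mor g w = x ∧ z.IsQ (rs z.log'.M g q)) : z.IsQ q := by
  intro x
  obtain ⟨W, g, w, e, hq⟩ := h x
  obtain ⟨W', g', w', a, p, v, e', h⟩ := hq w
  refine ⟨W', g' ≫ g, w', a, p, v, by rw [← e, ← e']; rfl, by rw [rs_comp, h]⟩

lemma IsQ.res {V W : z.base.Etale} (g : W ⟶ V) {q : sec z.log'.M V} (h : z.IsQ q) :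
    z.IsQ (rs z.log'.M g q) := by
  intro x
  obtain ⟨W', g', w', a, p, v, e, h⟩ := h (mor g x)
  obtain ⟨W'', k, k', w'', e₁, e₂, e₃⟩ := exists_refine g g' (w := x) (w' := w') e.symm
  refine ⟨W'', k, w'', k' ≫ a, p, unitsMap (mor k') v, e₁, ?_⟩
  rw [← rs_comp, e₃, rs_comp, h, map_mul, z.log'.rs_unit, z.φ.rs_frame]

lemma isQ_frame {V : z.base.Etale} (a : V ⟶ z.cover) (p : P) (v : (fn (dom V))ˣ) :
    z.IsQ (z.log'.unit V v * z.φ.frame a p) :=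
  fun x => ⟨V, 𝟙 _, x, a, p, v, rfl, rs_id _ _⟩

lemma isQ_iso {V : z.base.Etale} (a : V ⟶ z.cover) (p : LocallyConstant (dom V) P) :
    z.IsQ (z.φ.iso a (1, p)) := by
  intro x
  obtain ⟨W, g, w, e, h⟩ := exists_const p x
  refine ⟨W, g, w, g ≫ a, p x, 1, e, ?_⟩
  rw [z.φ.iso_res, h, map_one, map_one, one_mul]
  rfl

lemma isQ_unit {V : z.base.Etale} (v : (fn (dom V))ˣ) : z.IsQ (z.log'.unit V v) := by
  intro x
  obtain ⟨W, g, w, a, e⟩ := exists_section z.cover_surj x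
  exact ⟨W, g, w, a, 1, unitsMap (mor g) v, e, by rw [z.log'.rs_unit, frame_one, mul_one]⟩

lemma isQ_one {V : z.base.Etale} : z.IsQ (1 : sec z.log'.M V) := by
  rw [← map_one (z.log'.unit V)]
  exact isQ_unit 1

lemma IsQ.mul {V : z.base.Etale} {q q' : sec z.log'.M V} (h : z.IsQ q) (h' : z.IsQ q') :
    z.IsQ (q * q') := by
  intro x
  obtain ⟨W, g, w, a, p, v, e, h⟩ := h x
  obtain ⟨W', g', w', a', p', v', e', h'⟩ := h'.res g w
  refine ⟨W', g' ≫ g, w', a', p * p', unitsMap (mor g') v * z.cocycle.u (g' ≫ a) a' p * v',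
    by rw [← e, ← e']; rfl, ?_⟩
  rw [map_mul, rs_comp, rs_comp, h, h', map_mul, z.log'.rs_unit, z.φ.rs_frame, frame_mul,
    frame_eq z (g' ≫ a) a' p, map_mul, map_mul]
  simp only [mul_assoc]
  congr 2
  exact mul_left_comm _ _ _

variable (z) in
lemma exists_isQ {V : z.base.Etale} (x : sec z.log'.M V) (v : dom V) :
    ∃ (W : z.base.Etale) (g : W ⟶ V) (w : dom W) (n : sec z.log.M W) (q : sec z.log'.M W),
      mor g w = v ∧ z.IsQ q ∧ rs z.log'.M g x = ap z.π W n * q := by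
  obtain ⟨W, g, w, a, n, p, e, h⟩ := z.exists_iso x v
  refine ⟨W, g, w, n, _, e, isQ_frame a p 1, ?_⟩
  rw [h, map_one, one_mul]

/-- A decomposition `n q` is unique up to a unit exchanged between its factors. In the local
splitting `M_Y × P` the two sides are `(n v, p)` and `(n' v', p')`, whence `p = p'` and `n v = n'
v'`. -/
lemma IsQ.cancel {V : z.base.Etale} {n n' : sec z.log.M V} {q q' : sec z.log'.M V} (hq : z.IsQ q)
    (hq' : z.IsQ q') (h : ap z.π V n * q = ap z.π V n' * q') (x : dom V) :
    ∃ (W : z.base.Etale) (g : W ⟶ V) (w : dom W) (v : (fn (dom W))ˣ), mor g w = x ∧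
      rs z.log'.M g q' = z.log'.unit W v * rs z.log'.M g q ∧
      rs z.log.M g n = z.log.unit W v * rs z.log.M g n' := by
  obtain ⟨W, g, w, a, p, v, e, hq⟩ := hq x
  obtain ⟨W', g', w', a', p', v', e', hq'⟩ := hq'.res g w
  have h₁ := congrArg (fun y => rs z.log'.M (g' ≫ g) y) h
  simp only [map_mul, rs_ap] at h₁
  rw [rs_comp _ g' g q, hq, rs_comp _ g' g q', hq', map_mul, z.log'.rs_unit, z.φ.rs_frame,
    frame_eq z (g' ≫ a) a' p, ← π_unit, ← π_unit, ← π_unit, ← mul_assoc, ← mul_assoc,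
    ← mul_assoc, ← map_mul, ← map_mul, ← map_mul] at h₁
  obtain ⟨rfl, h₂⟩ := z.iso_cancel a' h₁ w'
  -- In the frame `a'` the section `q` has coefficient `v u` and `q'` has coefficient `v'`, so the
  -- ratio is `v' (v u)⁻¹`.
  refine ⟨W', g' ≫ g, w', v' * (unitsMap (mor g') v * z.cocycle.u (g' ≫ a) a' p)⁻¹,
    by rw [← e, ← e']; rfl, ?_, ?_⟩
  · rw [rs_comp _ g' g q, hq, rs_comp _ g' g q', hq', map_mul (rs z.log'.M g'), z.log'.rs_unit,
      z.φ.rs_frame, frame_eq z (g' ≫ a) a' p, ← mul_assoc, ← mul_assoc, ← map_mul, ← map_mul]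
    congr 2
    rw [mul_assoc, mul_assoc, inv_mul_cancel, mul_one]
  · have h₃ : z.log.unit W' (unitsMap (mor g') v * z.cocycle.u (g' ≫ a) a' p) *
        rs z.log.M (g' ≫ g) n = z.log.unit W' v' * rs z.log.M (g' ≫ g) n' := by
      rw [mul_comm, map_mul, ← mul_assoc, h₂, mul_comm]
    rw [mul_comm v', map_mul, mul_assoc, ← h₃, ← mul_assoc, ← map_mul, inv_mul_cancel, map_one,
      one_mul]

/-- If `n q` is again of the form `(u, p)`, then `n` is invertible. -/
lemma IsQ.unit_of_mul {V : z.base.Etale} {n : sec z.log.M V} {q : sec z.log'.M V} (hq : z.IsQ q)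
    (h : z.IsQ (ap z.π V n * q)) (x : dom V) :
    ∃ (W : z.base.Etale) (g : W ⟶ V) (w : dom W) (v : (fn (dom W))ˣ), mor g w = x ∧
      rs z.log.M g n = z.log.unit W v := by
  obtain ⟨W, g, w, v, e, -, h⟩ := hq.cancel (n := n) (n' := 1) h (by rw [map_one, one_mul]) x
  exact ⟨W, g, w, v, e, by rw [h, map_one, mul_one]⟩

/-- A morphism `Y' ⟶ W` is given by a morphism `Y ⟶ W` together with values on the sections
`(u, p)`. -/
theorem exists_family (z : PLogPoint P) {W : IntLogSch.{u}} (c : LogMap W z.lower)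
    (R : ∀ {V : W.base.Etale} {Y : z.base.Etale} (t : dom V ⟶ dom Y), t ≫ str Y = str V ≫ c.base →
      sec z.log'.M Y → sec W.log.M V → Prop)
    (res : ∀ {V V' : W.base.Etale} {Y Y' : z.base.Etale} (t : dom V ⟶ dom Y)
      (t' : dom V' ⟶ dom Y') (g : V' ⟶ V) (k : Y' ⟶ Y) (h : t ≫ str Y = str V ≫ c.base)
      (h' : t' ≫ str Y' = str V' ≫ c.base) (q : sec z.log'.M Y) (r : sec W.log.M V),
      t' ≫ mor k = mor g ≫ t → R t h q r → R t' h' (rs z.log'.M k q) (rs W.log.M g r))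
    (isQ : ∀ {V : W.base.Etale} {Y : z.base.Etale} (t : dom V ⟶ dom Y)
      (h : t ≫ str Y = str V ≫ c.base) (q : sec z.log'.M Y) (r : sec W.log.M V),
      R t h q r → z.IsQ q)
    (ex : ∀ {V : W.base.Etale} {Y : z.base.Etale} (t : dom V ⟶ dom Y)
      (_ : t ≫ str Y = str V ≫ c.base) (q : sec z.log'.M Y) (_ : z.IsQ q) (v : dom V),
      ∃ (V' : W.base.Etale) (g : V' ⟶ V) (v' : dom V') (Y' : z.base.Etale)
      (k : Y' ⟶ Y) (t' : dom V' ⟶ dom Y') (h' : t' ≫ str Y' = str V' ≫ c.base)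
      (r : sec W.log.M V'), mor g v' = v ∧ t' ≫ mor k = mor g ≫ t ∧ R t' h' (rs z.log'.M k q) r)
    (uniq : ∀ {V : W.base.Etale} {Y : z.base.Etale} (t : dom V ⟶ dom Y)
      (h : t ≫ str Y = str V ≫ c.base) (q : sec z.log'.M Y) (r r' : sec W.log.M V),
      R t h q r → R t h q r' → r = r')
    (unit : ∀ {V : W.base.Etale} {Y : z.base.Etale} (t : dom V ⟶ dom Y)
      (h : t ≫ str Y = str V ≫ c.base) (v : (fn (dom Y))ˣ) (r : sec W.log.M V),
      R t h (z.log'.unit Y v) r → r = W.log.unit V (unitsMap t v))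
    (mul : ∀ {V : W.base.Etale} {Y : z.base.Etale} (t : dom V ⟶ dom Y)
      (h : t ≫ str Y = str V ≫ c.base) (q q' : sec z.log'.M Y) (r r' : sec W.log.M V),
      R t h q r → R t h q' r' → R t h (q * q') (r * r'))
    (al : ∀ {V : W.base.Etale} {Y : z.base.Etale} (t : dom V ⟶ dom Y)
      (h : t ≫ str Y = str V ≫ c.base) (q : sec z.log'.M Y) (r : sec W.log.M V),
      R t h q r → W.log.al V r = fnMap t (z.log'.al Y q)) :
    ∃ F : LogMap W z.upper, ∃ hb : F.base = c.base,
      (∀ {V : W.base.Etale} {Y : z.base.Etale} (t : dom V ⟶ dom Y)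
        (h : t ≫ str Y = str V ≫ c.base) (n : sec z.log.M Y),
        F.map t (by rw [hb]; exact h) (ap z.π Y n) = c.map t h n) ∧
      (∀ {V : W.base.Etale} {Y : z.base.Etale} (t : dom V ⟶ dom Y)
        (h : t ≫ str Y = str V ≫ c.base) (q : sec z.log'.M Y) (r : sec W.log.M V),
        R t h q r → F.map t (by rw [hb]; exact h) q = r) := by
  -- If `n q = n' q'`, then locally `q' = v q` and `n = v n'`. The relation sends `v` to the unit
  -- `v` and is multiplicative, so the candidate values `c(n) r` and `c(n') r'` coincide.
  have uniq₂ : ∀ {V : W.base.Etale} {Y : z.base.Etale} (t : dom V ⟶ dom Y)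
      (h : t ≫ str Y = str V ≫ c.base) (n n' : sec z.log.M Y) (q q' : sec z.log'.M Y)
      (r r' : sec W.log.M V), ap z.π Y n * q = ap z.π Y n' * q' → R t h q r → R t h q' r' →
      c.map t h n * r = c.map t h n' * r' := by
    intro V Y t h n n' q q' r r' e hr hr'
    refine sec_ext _ fun x => ?_
    obtain ⟨Y₁, k₁, y₁, v, e₁, e₂, e₃⟩ := (isQ _ _ _ _ hr).cancel (isQ _ _ _ _ hr') e (t x)
    obtain ⟨V₁, g₁, v₁, t₁, e₄, -, e₅⟩ := exists_lift t k₁ x y₁ e₁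
    have h₁ := over_square e₅ h
    obtain ⟨V₂, g₂, v₂, Y₂, k₂, t₂, h₂, r₀, e₆, e₇, hr₀⟩ := ex t₁ h₁ _ (isQ_unit v) v₁
    have e₈ : t₂ ≫ mor (k₂ ≫ k₁) = mor (g₂ ≫ g₁) ≫ t := by
      rw [mor_comp, ← Category.assoc, e₇, Category.assoc, e₅, mor_comp, Category.assoc]
    have hr₁ := res _ _ _ _ _ h₂ _ _ e₈ hr
    have hr₁' := res _ _ _ _ _ h₂ _ _ e₈ hr'
    have hr₂ := mul _ _ _ _ _ _ hr₀ hr₁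
    rw [rs_comp z.log'.M k₂ k₁ q, ← map_mul, ← e₂, ← rs_comp] at hr₂
    have e₉ := uniq _ _ _ _ _ hr₁' hr₂
    rw [z.log'.rs_unit] at hr₀
    rw [unit _ _ _ _ hr₀] at e₉
    refine ⟨V₂, g₂ ≫ g₁, v₂, by rw [← e₄, ← e₆]; rfl, ?_⟩
    rw [map_mul, map_mul, e₉, ← c.map_square e₈ h h₂, ← c.map_square e₈ h h₂, rs_comp _ k₂ k₁ n,
      e₃, map_mul, map_mul, z.log.rs_unit, c.map_unit, ← rs_comp, ← mul_assoc]
    congr 1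
    exact mul_comm _ _
  obtain ⟨F, hF⟩ := Family.exists_of_rel (b := c.base) (B := z.log'.M) (A := W.log.M)
    (fun t h x y => ∃ n q r, x = ap z.π _ n * q ∧ y = c.map t h n * r ∧ R t h q r)
    (by
      rintro V V' Y Y' t t' g k h h' _ _ e ⟨n, q, r, rfl, rfl, hr⟩
      refine ⟨rs z.log.M k n, rs z.log'.M k q, rs W.log.M g r, ?_, ?_, res t t' g k h h' q r e hr⟩
      · rw [map_mul, rs_ap]
      · rw [map_mul, c.map_square e])
    (by
      intro V Y t h x v
      obtain ⟨Y₁, k₁, y₁, n, q, e₁, hq, e₂⟩ := z.exists_isQ x (t v)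
      obtain ⟨V₁, g₁, v₁, t₁, e₄, -, e₅⟩ := exists_lift t k₁ v y₁ e₁
      obtain ⟨V₂, g₂, v₂, Y₂, k₂, t₂, h₂, r, e₆, e₇, hr⟩ := ex t₁ (over_square e₅ h) _ hq v₁
      refine ⟨V₂, g₂ ≫ g₁, v₂, Y₂, k₂ ≫ k₁, t₂, h₂, _, by rw [← e₄, ← e₆]; rfl, ?_,
        rs z.log.M k₂ n, _, r, ?_, rfl, hr⟩
      · rw [mor_comp, ← Category.assoc, e₇, Category.assoc, e₅, mor_comp, Category.assoc]
      · rw [rs_comp, e₂, map_mul, rs_ap])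
    (by
      rintro V Y t h x y y' ⟨n, q, r, rfl, rfl, hr⟩ ⟨n', q', r', e, rfl, hr'⟩
      exact uniq₂ t h n n' q q' r r' e hr hr')
    (by
      rintro V Y t h y ⟨n, q, r, e, rfl, hr⟩
      -- The relation is not assumed to hold at `1`. From `n q = 1` the candidate value `y`
      -- satisfies `y * y = y`, and cancellation gives `y = 1`.
      have e' : ap z.π _ (n * n) * (q * q) = ap z.π _ n * q := by
        rw [map_mul, mul_mul_mul_comm, ← e, mul_one]
      have := uniq₂ t h _ _ _ _ _ _ e' (mul _ _ _ _ _ _ hr hr) hr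
      rw [map_mul, mul_mul_mul_comm] at this
      exact mul_eq_left.1 this)
    (by
      rintro V Y t h _ _ _ _ ⟨n, q, r, rfl, rfl, hr⟩ ⟨n', q', r', rfl, rfl, hr'⟩
      exact ⟨n * n', q * q', r * r', by rw [map_mul, mul_mul_mul_comm],
        by rw [map_mul, mul_mul_mul_comm], mul _ _ _ _ _ _ hr hr'⟩)
  -- Locally the relation holds between `1` and `1`, as the case of the unit `1`. This lets a
  -- section of `M_Y` alone, or of `Q` alone, be treated as a product `n q`.
  have hone : ∀ {V : W.base.Etale} {Y : z.base.Etale} (t : dom V ⟶ dom Y)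
      (h : t ≫ str Y = str V ≫ c.base) (v : dom V),
      ∃ (V' : W.base.Etale) (g : V' ⟶ V) (v' : dom V') (Y' : z.base.Etale)
      (k : Y' ⟶ Y) (t' : dom V' ⟶ dom Y') (h' : t' ≫ str Y' = str V' ≫ c.base),
      mor g v' = v ∧ t' ≫ mor k = mor g ≫ t ∧ R t' h' 1 1 := by
    intro V Y t h v
    obtain ⟨V', g, v', Y', k, t', h', r, e, e', hr⟩ := ex t h _ (isQ_unit 1) v
    rw [z.log'.rs_unit, map_one] at hr
    have := unit _ _ _ _ hr
    rw [map_one, map_one] at this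
    rw [map_one, this] at hr
    exact ⟨V', g, v', Y', k, t', h', e, e', hr⟩
  refine ⟨Family.logMap (Y := W) (X := z.upper) F ?_, rfl, ?_, ?_⟩
  · intro V Y t h x
    refine sec_ext (strSheaf W.base) fun v => ?_
    obtain ⟨Y₁, k₁, y₁, n, q, e₁, hq, e₂⟩ := z.exists_isQ x (t v)
    obtain ⟨V₁, g₁, v₁, t₁, e₄, -, e₅⟩ := exists_lift t k₁ v y₁ e₁
    obtain ⟨V₂, g₂, v₂, Y₂, k₂, t₂, h₂, r, e₆, e₇, hr⟩ := ex t₁ (over_square e₅ h) _ hq v₁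
    have e₈ : t₂ ≫ mor (k₂ ≫ k₁) = mor (g₂ ≫ g₁) ≫ t := by
      rw [mor_comp, ← Category.assoc, e₇, Category.assoc, e₅, mor_comp, Category.assoc]
    refine ⟨V₂, g₂ ≫ g₁, v₂, by rw [← e₄, ← e₆]; rfl, ?_⟩
    have e₉ : rs z.log'.M (k₂ ≫ k₁) x = ap z.π _ (rs z.log.M k₂ n) * rs z.log'.M k₂ q := by
      rw [rs_comp, e₂, map_mul, rs_ap]
    have := hF t₂ h₂ _ _ ⟨_, _, r, e₉, rfl, hr⟩
    rw [F.map_square e₈ h h₂] at this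
    refine (W.log.al_rs (g₂ ≫ g₁) _).symm.trans ?_
    rw [this, map_mul, al _ _ _ _ hr, c.map_al]
    change _ = fnMap (mor (g₂ ≫ g₁)) (fnMap t (z.log'.al Y x))
    rw [← fnMap_comp, ← e₈, fnMap_comp, ← z.log'.al_rs, e₉, map_mul, map_mul, al_π]
  · intro V Y t h n
    refine sec_ext _ fun v => ?_
    obtain ⟨V', g, v', Y', k, t', h', e, e', hr⟩ := hone t h v
    have := hF t' h' _ _ ⟨rs z.log.M k n, _, _, rfl, rfl, hr⟩
    refine ⟨V', g, v', e, ?_⟩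
    rw [mul_one, mul_one, ← rs_ap, F.map_square e' h h', c.map_square e' h h'] at this
    exact this
  · intro V Y t h q r hr
    refine sec_ext _ fun v => ?_
    obtain ⟨V', g, v', Y', k, t', h', e, e', hr'⟩ := hone t h v
    have := hF t' h' _ _ ⟨1, _, _, rfl, rfl, res _ _ _ _ _ h' _ _ e' hr⟩
    refine ⟨V', g, v', e, ?_⟩
    rw [map_one, map_one, one_mul, one_mul, F.map_square e' h h'] at this
    exact this

end PLogPoint
end
end LogGeom

/-! ### Degrees in `P`, and cartesian squares of log points. -/

namespace LogGeom
noncomputable section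

/-- Gluing of units, determined by a relation. -/
lemma exists_unit_glue {S : Scheme.{u}} {V : S.Etale}
    (R : ∀ {W : S.Etale}, (W ⟶ V) → (fn (dom W))ˣ → Prop)
    (res : ∀ {W' W : S.Etale} (k : W' ⟶ W) (g : W ⟶ V) (s : (fn (dom W))ˣ), R g s →
      R (k ≫ g) (unitsMap (mor k) s))
    (uniq : ∀ {W : S.Etale} (g : W ⟶ V) (s s' : (fn (dom W))ˣ), R g s → R g s' → s = s')
    (ex : ∀ x : dom V, ∃ (W : S.Etale) (g : W ⟶ V) (w : dom W) (s : (fn (dom W))ˣ),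
      mor g w = x ∧ R g s) :
    ∃ s : (fn (dom V))ˣ, ∀ {W : S.Etale} (g : W ⟶ V) (s' : (fn (dom W))ˣ), R g s' →
      unitsMap (mor g) s = s' :=
  exists_glue (unitSheaf S) R res uniq ex

/-- Local sections of an étale cover, over a morphism of schemes. -/
lemma exists_cover_lift {S T : Scheme.{u}} (b : S ⟶ T) {U : T.Etale}
    (hU : Function.Surjective (str U)) {V : S.Etale} (x : dom V) :
    ∃ (W : S.Etale) (g : W ⟶ V) (w : dom W) (s : dom W ⟶ dom U),
      mor g w = x ∧ s ≫ str U = str W ≫ b := by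
  obtain ⟨u, hu⟩ := hU (b (str V x))
  obtain ⟨v, -, hv⟩ := Scheme.Pullback.exists_preimage_pullback (f := str U) (g := b) u _ hu
  obtain ⟨W, g, k, w, e, -, -⟩ := exists_refine (V := etMk (𝟙 S) inferInstance) (W := V)
    (W' := etPb b U) (etHom (str V) (Category.comp_id _))
    (etHom (str (etPb b U)) (Category.comp_id _)) (w := x) (w' := v) hv.symm
  exact ⟨W, g, w, mor k ≫ etFst b U, e, by rw [Category.assoc, etFst_str, ← Category.assoc,
    mor_str]⟩

lemma LogMap.congr_map {Y X : IntLogSch.{u}} {f g : LogMap Y X} (e : f = g) {U : Y.base.Etale}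
    {V : X.base.Etale} (t : dom U ⟶ dom V) (h : t ≫ str V = str U ≫ f.base) (m : sec X.log.M V) :
    f.map t h m = g.map t (e ▸ h) m := by
  subst e; rfl

namespace PLogPoint
variable {P : Type u} [CommMonoid P]

/-- The section `q` of `M_{Y'}` is locally of the form `(u, p)` with `u` invertible. -/
def IsDeg (z : PLogPoint P) (p : P) {V : z.base.Etale} (q : sec z.log'.M V) : Prop :=
  ∀ x : dom V, ∃ (W : z.base.Etale) (g : W ⟶ V) (w : dom W) (a : W ⟶ z.cover)
    (v : (fn (dom W))ˣ), mor g w = x ∧ rs z.log'.M g q = z.log'.unit W v * z.φ.frame a p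

variable {z : PLogPoint P}

lemma IsDeg.of_local {V : z.base.Etale} {p : P} {q : sec z.log'.M V} (h : ∀ x : dom V,
    ∃ (W : z.base.Etale) (g : W ⟶ V) (w : dom W), mor g w = x ∧ z.IsDeg p (rs z.log'.M g q)) :
    z.IsDeg p q := by
  intro x
  obtain ⟨W, g, w, e, hq⟩ := h x
  obtain ⟨W', g', w', a, v, e', h⟩ := hq w
  exact ⟨W', g' ≫ g, w', a, v, by rw [← e, ← e']; rfl, by rw [rs_comp, h]⟩

lemma isDeg_frame {V : z.base.Etale} (a : V ⟶ z.cover) (p : P) (v : (fn (dom V))ˣ) :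
    z.IsDeg p (z.log'.unit V v * z.φ.frame a p) :=
  fun x => ⟨V, 𝟙 _, x, a, v, rfl, rs_id _ _⟩

lemma isDeg_frame' {V : z.base.Etale} (a : V ⟶ z.cover) (p : P) : z.IsDeg p (z.φ.frame a p) := by
  have := isDeg_frame a p 1
  rwa [map_one, one_mul] at this

lemma IsDeg.res {V W : z.base.Etale} (g : W ⟶ V) {p : P} {q : sec z.log'.M V} (h : z.IsDeg p q) :
    z.IsDeg p (rs z.log'.M g q) := by
  intro x
  obtain ⟨W', g', w', a, v, e, h⟩ := h (mor g x)
  obtain ⟨W'', k, k', w'', e₁, e₂, e₃⟩ := exists_refine g g' (w := x) (w' := w') e.symm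
  refine ⟨W'', k, w'', k' ≫ a, unitsMap (mor k') v, e₁, ?_⟩
  rw [← rs_comp, e₃, rs_comp, h, map_mul, z.log'.rs_unit, z.φ.rs_frame]

lemma IsDeg.isQ {V : z.base.Etale} {p : P} {q : sec z.log'.M V} (h : z.IsDeg p q) : z.IsQ q := by
  intro x
  obtain ⟨W, g, w, a, v, e, h⟩ := h x
  exact ⟨W, g, w, a, p, v, e, h⟩

lemma IsQ.exists_isDeg {V : z.base.Etale} {q : sec z.log'.M V} (h : z.IsQ q) (x : dom V) :
    ∃ (W : z.base.Etale) (g : W ⟶ V) (w : dom W) (p : P), mor g w = x ∧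
      z.IsDeg p (rs z.log'.M g q) := by
  obtain ⟨W, g, w, a, p, v, e, h⟩ := h x
  exact ⟨W, g, w, p, e, h ▸ isDeg_frame a p v⟩

/-- Local form of two sections of degrees `p` and `p'`. -/
lemma IsDeg.exists_pair {V : z.base.Etale} {p p' : P} {q q' : sec z.log'.M V} (h : z.IsDeg p q)
    (h' : z.IsDeg p' q') (x : dom V) : ∃ (W : z.base.Etale) (g : W ⟶ V) (w : dom W)
      (a : W ⟶ z.cover) (v v' : (fn (dom W))ˣ), mor g w = x ∧
      rs z.log'.M g q = z.log'.unit W v * z.φ.frame a p ∧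
      rs z.log'.M g q' = z.log'.unit W v' * z.φ.frame a p' := by
  obtain ⟨W, g, w, a, v, e, h⟩ := h x
  obtain ⟨W', g', w', a', v', e', h'⟩ := h'.res g w
  refine ⟨W', g' ≫ g, w', a', unitsMap (mor g') v * z.cocycle.u (g' ≫ a) a' p, v',
    by rw [← e, ← e']; rfl, ?_, by rw [rs_comp, h']⟩
  rw [rs_comp, h, map_mul, z.log'.rs_unit, z.φ.rs_frame, frame_eq z (g' ≫ a) a' p, map_mul,
    mul_assoc]

lemma IsDeg.mul {V : z.base.Etale} {p p' : P} {q q' : sec z.log'.M V} (h : z.IsDeg p q)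
    (h' : z.IsDeg p' q') : z.IsDeg (p * p') (q * q') := by
  intro x
  obtain ⟨W, g, w, a, v, v', e, h, h'⟩ := h.exists_pair h' x
  refine ⟨W, g, w, a, v * v', e, ?_⟩
  rw [map_mul, h, h', frame_mul, map_mul]
  exact mul_mul_mul_comm _ _ _ _

lemma isDeg_unit {V : z.base.Etale} (v : (fn (dom V))ˣ) : z.IsDeg 1 (z.log'.unit V v) := by
  intro x
  obtain ⟨W, g, w, a, e⟩ := exists_section z.cover_surj x
  exact ⟨W, g, w, a, unitsMap (mor g) v, e, by rw [z.log'.rs_unit, frame_one, mul_one]⟩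

lemma isDeg_one {V : z.base.Etale} : z.IsDeg 1 (1 : sec z.log'.M V) := by
  rw [← map_one (z.log'.unit V)]
  exact isDeg_unit 1

lemma IsDeg.unit_mul {V : z.base.Etale} {p : P} {q : sec z.log'.M V} (h : z.IsDeg p q)
    (v : (fn (dom V))ˣ) : z.IsDeg p (z.log'.unit V v * q) := by
  have := (isDeg_unit v).mul h
  rwa [one_mul] at this

/-- The projection of `M_Y ⊕ P` to `P` is fixed by the action of `G`, so it makes sense on `M_{Y'}`;
the projection to `M_Y` is not fixed. -/
lemma IsDeg.deg_eq {V : z.base.Etale} {p p' : P} {n n' : sec z.log.M V} {q q' : sec z.log'.M V}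
    (h : z.IsDeg p q) (h' : z.IsDeg p' q') (e : ap z.π V n * q = ap z.π V n' * q') (x : dom V) :
    p = p' := by
  obtain ⟨W, g, w, a, v, v', -, h, h'⟩ := h.exists_pair h' x
  have := congrArg (rs z.log'.M g) e
  rw [map_mul, map_mul, rs_ap, rs_ap, h, h', ← π_unit, ← π_unit, ← mul_assoc, ← mul_assoc,
    ← map_mul, ← map_mul] at this
  exact (z.iso_cancel a this w).1

lemma IsDeg.unique {V : z.base.Etale} {p p' : P} {q : sec z.log'.M V} (h : z.IsDeg p q)
    (h' : z.IsDeg p' q) (x : dom V) : p = p' := h.deg_eq (n := 1) (n' := 1) h' rfl x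

/-- Two sections of the same degree differ by a unit. -/
lemma IsDeg.exists_unit {V : z.base.Etale} {p : P} {q q' : sec z.log'.M V} (h : z.IsDeg p q)
    (h' : z.IsDeg p q') : ∃ v : (fn (dom V))ˣ, q' = z.log'.unit V v * q := by
  -- Locally the ratio exists in a common frame; it glues because cancellation makes it unique.
  obtain ⟨v, hv⟩ := exists_unit_glue (V := V)
    (fun {W} g v => rs z.log'.M g q' = z.log'.unit W v * rs z.log'.M g q)
    (by
      intro W' W k g v h
      rw [rs_comp, h, map_mul, z.log'.rs_unit, rs_comp])
    (by
      intro W g v v' h h'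
      exact z.log'.unit_injective W (mul_right_cancel (h.symm.trans h')))
    (by
      intro x
      obtain ⟨W, g, w, a, v, v', e, h, h'⟩ := h.exists_pair h' x
      refine ⟨W, g, w, v' * v⁻¹, e, ?_⟩
      rw [h, h', ← mul_assoc, ← map_mul, inv_mul_cancel_right])
  refine ⟨v, sec_ext _ fun x => ?_⟩
  obtain ⟨W, g, w, a, v₁, v', e, h, h'⟩ := h.exists_pair h' x
  have e₁ : rs z.log'.M g q' = z.log'.unit W (v' * v₁⁻¹) * rs z.log'.M g q := by
    rw [h, h', ← mul_assoc, ← map_mul, inv_mul_cancel_right]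
  refine ⟨W, g, w, e, ?_⟩
  rw [map_mul (rs z.log'.M g), z.log'.rs_unit, hv g _ e₁, e₁]

lemma IsDeg.eq_unit {V : z.base.Etale} {q : sec z.log'.M V} (h : z.IsDeg 1 q) :
    ∃ v : (fn (dom V))ˣ, q = z.log'.unit V v := by
  obtain ⟨v, hv⟩ := isDeg_one.exists_unit h
  exact ⟨v, by rw [hv, mul_one]⟩

lemma IsDeg.al_eq_zero {V : z.base.Etale} {p : P} {q : sec z.log'.M V} (h : z.IsDeg p q)
    (hp : p ≠ 1) : z.log'.al V q = 0 := by
  refine sec_ext (strSheaf z.base) fun x => ?_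
  obtain ⟨W, g, w, a, v, e, h⟩ := h x
  refine ⟨W, g, w, e, ?_⟩
  refine (z.log'.al_rs g q).symm.trans (Eq.trans ?_ (map_zero (fnMap (mor g))).symm)
  rw [h, map_mul, show z.log'.al W (z.φ.frame a p) = 0 from z.φ.al_iso a 1 p hp, mul_zero]

variable (z) in
lemma exists_isDeg {V : z.base.Etale} (x : sec z.log'.M V) (v : dom V) :
    ∃ (W : z.base.Etale) (g : W ⟶ V) (w : dom W) (n : sec z.log.M W) (p : P) (q : sec z.log'.M W),
      mor g w = v ∧ z.IsDeg p q ∧ rs z.log'.M g x = ap z.π W n * q := by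
  obtain ⟨W, g, w, a, n, p, e, h⟩ := z.exists_iso x v
  exact ⟨W, g, w, n, p, _, e, isDeg_frame' a p, h⟩

/-- Morphisms to `Y'` are determined by their values on sections of `M_Y` and on sections that have
a degree. -/
lemma upper_hom_ext {W : IntLogSch.{u}} {F G : LogMap W z.upper} (hb : F.base = G.base)
    (hπ : ∀ {V : W.base.Etale} {Y : z.base.Etale} (t : dom V ⟶ dom Y)
      (h₁ : t ≫ str Y = str V ≫ F.base) (h₂ : t ≫ str Y = str V ≫ G.base) (n : sec z.log.M Y),
      F.map t h₁ (ap z.π Y n) = G.map t h₂ (ap z.π Y n))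
    (hq : ∀ {V : W.base.Etale} {Y : z.base.Etale} (t : dom V ⟶ dom Y)
      (h₁ : t ≫ str Y = str V ≫ F.base) (h₂ : t ≫ str Y = str V ≫ G.base) (p : P)
      (q : sec z.log'.M Y), z.IsDeg p q → ∀ x : dom V, ∃ (V' : W.base.Etale) (g : V' ⟶ V)
        (v : dom V') (_ : mor g v = x), rs W.log.M g (F.map t h₁ q) = rs W.log.M g (G.map t h₂ q)) :
    F = G := by
  refine LogMap.ext' hb fun {V Y} t h₁ h₂ m => sec_ext _ fun x => ?_
  obtain ⟨Y₁, k, y, n, p, q, e₁, hd, e₂⟩ := z.exists_isDeg m (t x)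
  obtain ⟨V₁, g, v, t₁, e₃, -, e₄⟩ := exists_lift t k x y e₁
  obtain ⟨V₂, g₂, v₂, e₅, e₆⟩ := hq t₁ (over_square e₄ h₁) (over_square e₄ h₂) p q hd v
  refine ⟨V₂, g₂ ≫ g, v₂, by rw [← e₃, ← e₅]; rfl, ?_⟩
  rw [rs_comp, rs_comp, ← F.map_square e₄ h₁ (over_square e₄ h₁),
    ← G.map_square e₄ h₂ (over_square e₄ h₂), e₂, map_mul, map_mul, map_mul, map_mul, e₆,
    hπ _ _ (over_square e₄ h₂)]

lemma proj_map {V : z.base.Etale} (h) (n : sec z.log.M V) :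
    z.proj.map (U := V) (V := V) (𝟙 _) h n = ap z.π V n :=
  congrArg (ap z.π V) (rs_id z.log.M n)

variable {y : PLogPoint P} {up : z.upper ⟶ y.upper} {low : z.lower ⟶ y.lower}

lemma base_of_sq (w : up ≫ y.proj = z.proj ≫ low) : up.base = low.base := by
  have := congrArg LogMap.base w
  exact (Category.comp_id _).symm.trans (this.trans (Category.id_comp _))

lemma up_π (w : up ≫ y.proj = z.proj ≫ low) {V : z.base.Etale} {Y : y.base.Etale}
    (t : dom V ⟶ dom Y) (h : t ≫ str Y = str V ≫ up.base) (h' : t ≫ str Y = str V ≫ low.base)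
    (n : sec y.log.M Y) : up.map t h (ap y.π Y n) = ap z.π V (low.map t h' n) := by
  have e₀ : (𝟙 (dom Y)) ≫ str Y = str Y ≫ y.proj.base := by
    rw [Category.id_comp]; exact (Category.comp_id _).symm
  have e₁ : (𝟙 (dom V)) ≫ str V = str V ≫ z.proj.base := by
    rw [Category.id_comp]; exact (Category.comp_id _).symm
  have e₂ : (t ≫ 𝟙 _) ≫ str Y = str V ≫ (LogMap.comp up y.proj).base := by
    rw [Category.comp_id, h]; exact congrArg (str V ≫ ·) (Category.comp_id _).symm
  have e₃ : (𝟙 _ ≫ t) ≫ str Y = str V ≫ (LogMap.comp z.proj low).base := by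
    rw [Category.id_comp, h']; exact congrArg (str V ≫ ·) (Category.id_comp _).symm
  rw [← proj_map e₀, ← proj_map e₁, ← LogMap.comp_map up y.proj t (𝟙 _) h e₀ e₂,
    ← LogMap.comp_map z.proj low (𝟙 _) t e₁ h' e₃,
    LogMap.congr_map (show LogMap.comp up y.proj = LogMap.comp z.proj low from w)]
  exact LogMap.map_congr _ (by simp) _ _

/-- The square commutes if this holds for sections of `M_Y`. -/
lemma sq_of_up_π (hb : up.base = low.base) (H : ∀ {V : z.base.Etale} {Y : y.base.Etale}
    (t : dom V ⟶ dom Y) (h : t ≫ str Y = str V ≫ up.base) (h' : t ≫ str Y = str V ≫ low.base)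
    (n : sec y.log.M Y), up.map t h (ap y.π Y n) = ap z.π V (low.map t h' n)) :
    up ≫ y.proj = z.proj ≫ low := by
  refine LogMap.ext' ?_ ?_
  · exact (Category.comp_id _).trans (hb.trans (Category.id_comp _).symm)
  intro V Y t h₁ h₂ n
  have e₀ : (𝟙 (dom Y)) ≫ str Y = str Y ≫ y.proj.base := by
    rw [Category.id_comp]; exact (Category.comp_id _).symm
  have e₁ : (𝟙 (dom V)) ≫ str V = str V ≫ z.proj.base := by
    rw [Category.id_comp]; exact (Category.comp_id _).symm
  have h : t ≫ str Y = str V ≫ up.base :=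
    h₁.trans (congrArg (str V ≫ ·) (Category.comp_id _))
  have h' : t ≫ str Y = str V ≫ low.base := by rw [h, hb]
  have a₁ := LogMap.comp_map up y.proj t (𝟙 _) h e₀ (by rw [Category.comp_id]; exact h₁) n
  have a₂ := LogMap.comp_map z.proj low (𝟙 _) t e₁ h' (by rw [Category.id_comp]; exact h₂) n
  rw [proj_map] at a₁ a₂
  rw [H t h h'] at a₁
  refine Eq.trans ?_ ((a₁.trans a₂.symm).trans ?_)
  · exact LogMap.map_congr (LogMap.comp up y.proj) (Category.comp_id t).symm h₁ n
  · exact LogMap.map_congr (LogMap.comp z.proj low) (Category.id_comp t) _ n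

/-- A morphism `Z' ⟶ Y'` that preserves degrees. -/
def PreservesDeg (up : LogMap z.upper y.upper) : Prop :=
  ∀ {V : z.base.Etale} {Y : y.base.Etale} (t : dom V ⟶ dom Y) (h : t ≫ str Y = str V ≫ up.base)
    (p : P) (q : sec y.log'.M Y), y.IsDeg p q → z.IsDeg p (up.map t h q)

/-- Sections of one degree differ by units, so `q` is locally a unit multiple of the image of a
frame of `y` in the same degree. -/
lemma exists_deg_lift (hd : PreservesDeg up) {V : z.base.Etale} {p : P}
    {q : sec z.log'.M V} (hq : z.IsDeg p q) (x : dom V) : ∃ (W : z.base.Etale) (g : W ⟶ V)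
      (w : dom W) (Y : y.base.Etale) (s : dom W ⟶ dom Y) (hs : s ≫ str Y = str W ≫ up.base)
      (r : sec y.log'.M Y) (v : (fn (dom W))ˣ), mor g w = x ∧ y.IsDeg p r ∧
      rs z.log'.M g q = z.log'.unit W v * up.map s hs r := by
  obtain ⟨W, g, w, s, e, hs⟩ := exists_cover_lift up.base y.cover_surj x
  obtain ⟨v, hv⟩ := (hd s hs p _ (isDeg_frame' (𝟙 _) p)).exists_unit (hq.res g)
  exact ⟨W, g, w, _, s, hs, _, v, e, isDeg_frame' (𝟙 _) p, hv⟩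

variable {W : IntLogSch.{u}} {d : W ⟶ y.upper} {c : W ⟶ z.lower}

lemma cone_π (e : d ≫ y.proj = c ≫ low) {V : W.base.Etale} {V₁ : z.base.Etale} {Y : y.base.Etale}
    (t : dom V ⟶ dom V₁) (s : dom V₁ ⟶ dom Y) (h : (t ≫ s) ≫ str Y = str V ≫ d.base)
    (ht : t ≫ str V₁ = str V ≫ c.base) (hs : s ≫ str Y = str V₁ ≫ low.base)
    (n : sec y.log.M Y) : d.map (t ≫ s) h (ap y.π Y n) = c.map t ht (low.map s hs n) := by
  have e₀ : (𝟙 (dom Y)) ≫ str Y = str Y ≫ y.proj.base := by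
    rw [Category.id_comp]; exact (Category.comp_id _).symm
  have a₁ := LogMap.comp_map d y.proj (t ≫ s) (𝟙 _) h e₀ (by
    rw [Category.comp_id, h]; exact congrArg (str V ≫ ·) (Category.comp_id _).symm) n
  have hb : d.base = c.base ≫ low.base :=
    (Category.comp_id _).symm.trans (congrArg LogMap.base e)
  have h₂ : (t ≫ s) ≫ str Y = str V ≫ (LogMap.comp c low).base := h.trans (congrArg _ hb)
  rw [proj_map, LogMap.congr_map (show LogMap.comp d y.proj = LogMap.comp c low from e)] at a₁
  rw [← a₁, ← LogMap.comp_map c low t s ht hs h₂]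
  exact LogMap.map_congr _ (Category.comp_id _) _ _

/-- The lift is forced: it is `c` on `M_Z`, and `v · d(q')` on a section `v · up(q')` of `Q`. By
`exists_deg_lift` the latter presentation is always available locally, so `exists_family` applies.
-/
lemma exists_upper_lift (w : up ≫ y.proj = z.proj ≫ low) (hd : PreservesDeg up)
    (e : d ≫ y.proj = c ≫ low) : ∃ F : W ⟶ z.upper, F ≫ up = d ∧ F ≫ z.proj = c := by
  have hb : d.base = c.base ≫ low.base :=
    (Category.comp_id _).symm.trans (congrArg LogMap.base e)
  have hbu := base_of_sq w
  have hov : ∀ {V : W.base.Etale} {V₁ : z.base.Etale} {Y : y.base.Etale} {t : dom V ⟶ dom V₁}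
      {s : dom V₁ ⟶ dom Y}, t ≫ str V₁ = str V ≫ c.base → s ≫ str Y = str V₁ ≫ up.base →
      (t ≫ s) ≫ str Y = str V ≫ d.base := by
    intro V V₁ Y t s ht hs
    rw [Category.assoc, hs, ← Category.assoc, ht, hb, hbu, Category.assoc]
  obtain ⟨F, hFb, hFπ, hF⟩ := z.exists_family c
    (fun {V V₁} t ht q r => ∃ (Y : y.base.Etale) (s : dom V₁ ⟶ dom Y)
      (hs : s ≫ str Y = str V₁ ≫ up.base) (p : P) (q' : sec y.log'.M Y) (v : (fn (dom V₁))ˣ),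
      y.IsDeg p q' ∧ q = z.log'.unit V₁ v * up.map s hs q' ∧
      r = W.log.unit V (unitsMap t v) * d.map (t ≫ s) (hov ht hs) q')
    (by
      rintro V V' V₁ V₁' t t' g k h h' _ _ e ⟨Y, s, hs, p, q', v, hp, rfl, rfl⟩
      have hs' : (mor k ≫ s) ≫ str Y = str V₁' ≫ up.base := by
        rw [Category.assoc, hs, ← Category.assoc, mor_str]
      refine ⟨Y, mor k ≫ s, hs', p, q', unitsMap (mor k) v, hp, ?_, ?_⟩
      · rw [map_mul, z.log'.rs_unit, up.map_left k s hs]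
      · rw [map_mul, W.log.rs_unit, ← d.map_left g _ (hov h hs), ← unitsMap_comp, ← unitsMap_comp,
          e]
        congr 1
        refine d.map_congr ?_ _ _
        rw [← Category.assoc, ← Category.assoc, e])
    (by
      rintro V V₁ t h _ _ ⟨Y, s, hs, p, q', v, hp, rfl, rfl⟩
      exact ((hd s hs p q' hp).unit_mul v).isQ)
    (by
      intro V V₁ t h q hq x
      obtain ⟨V₂, k, v₂, p, e₁, hp⟩ := hq.exists_isDeg (t x)
      obtain ⟨V₃, k', v₃, Y, s, hs, r, v, e₂, hr, e₃⟩ := exists_deg_lift hd hp v₂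
      obtain ⟨V', g, v', t', e₄, -, e₅⟩ := exists_lift t (k' ≫ k) x v₃
        (by rw [← e₁, ← e₂]; rfl)
      have ht' := over_square e₅ h
      rw [← rs_comp] at e₃
      exact ⟨V', g, v', V₃, k' ≫ k, t', ht', _, e₄, e₅, Y, s, hs, p, r, v, hr, e₃, rfl⟩)
    (by
      rintro V V₁ t h _ _ _ ⟨Y, s, hs, p, q, v, hp, rfl, rfl⟩ ⟨Y', s', hs', p', q', v', hp', e', rfl⟩
      refine sec_ext _ fun x => ⟨V, 𝟙 _, x, rfl, congrArg _ ?_⟩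
      -- Two presentations of one section have the same degree, so `q' = u q` over a common
      -- refinement and then `v = v' u`; the same relation holds after applying `d`.
      obtain rfl : p = p' := ((hd s hs p q hp).unit_mul v).unique
        (e' ▸ (hd s' hs' p' q' hp').unit_mul v') (t x)
      obtain ⟨Y₃, l, l', s₃, e₁, e₂, e₃⟩ := exists_prod_lift s s' (hs.trans hs'.symm)
      have hs₃ := e₃.trans hs
      obtain ⟨u, hu⟩ := (hp.res l).exists_unit (hp'.res l')
      have e₄ : up.map s hs q = up.map s₃ hs₃ (rs y.log'.M l q) := by
        rw [← up.map_right, up.map_congr e₁]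
      have e₅ : up.map s' hs' q' = z.log'.unit V₁ (unitsMap s₃ u) * up.map s₃ hs₃ (rs _ l q) := by
        rw [← up.map_unit s₃ hs₃, ← map_mul, ← hu, ← up.map_right, up.map_congr e₂]
      rw [e₄, e₅, ← mul_assoc, ← map_mul] at e'
      have e₆ := z.log'.unit_injective _ (mul_right_cancel e')
      have e₇ : d.map (t ≫ s) (hov h hs) q = d.map (t ≫ s₃) (hov h hs₃) (rs _ l q) := by
        rw [← d.map_right]
        exact d.map_congr (by rw [Category.assoc, e₁]) _ _
      have e₈ : d.map (t ≫ s') (hov h hs') q' =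
          W.log.unit V (unitsMap (t ≫ s₃) u) * d.map (t ≫ s₃) (hov h hs₃) (rs _ l q) := by
        rw [← d.map_unit (t ≫ s₃) (hov h hs₃), ← map_mul, ← hu, ← d.map_right]
        exact d.map_congr (by rw [Category.assoc, e₂]) _ _
      rw [e₇, e₈, e₆, map_mul (unitsMap t), ← unitsMap_comp, map_mul (W.log.unit V), mul_assoc])
    (by
      rintro V V₁ t h v₀ _ ⟨Y, s, hs, p, q, v, hp, e', rfl⟩
      refine sec_ext _ fun x => ⟨V, 𝟙 _, x, rfl, congrArg _ ?_⟩
      obtain rfl : 1 = p := (isDeg_unit v₀).unique (e' ▸ (hd s hs p q hp).unit_mul v) (t x)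
      obtain ⟨u, rfl⟩ := hp.eq_unit
      rw [d.map_unit, up.map_unit, ← map_mul] at *
      rw [z.log'.unit_injective _ e', map_mul (unitsMap t), ← unitsMap_comp])
    (by
      rintro V V₁ t h _ _ _ _ ⟨Y, s, hs, p, q, v, hp, rfl, rfl⟩
        ⟨Y', s', hs', p', q', v', hp', rfl, rfl⟩
      obtain ⟨Y₃, l, l', s₃, e₁, e₂, e₃⟩ := exists_prod_lift s s' (hs.trans hs'.symm)
      have hs₃ := e₃.trans hs
      refine ⟨Y₃, s₃, hs₃, p * p', _, v * v', (hp.res l).mul (hp'.res l'), ?_, ?_⟩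
      · rw [map_mul, map_mul, ← up.map_right, ← up.map_right, up.map_congr e₁, up.map_congr e₂]
        exact mul_mul_mul_comm _ _ _ _
      · rw [map_mul, map_mul, map_mul, ← d.map_right _ _ (hov h hs₃),
          ← d.map_right _ _ (hov h hs₃), mul_mul_mul_comm]
        congr 2 <;> refine d.map_congr ?_ _ _ <;> rw [Category.assoc, ‹s₃ ≫ _ = _›])
    (by
      rintro V V₁ t h _ _ ⟨Y, s, hs, p, q, v, hp, rfl, rfl⟩
      rw [map_mul, map_mul, map_mul, W.log.al_unit, d.map_al, z.log'.al_unit, up.map_al, fnMap_comp]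
      rfl)
  refine ⟨F, ?_, ?_⟩
  · refine upper_hom_ext ((congrArg (· ≫ up.base) hFb).trans ((congrArg _ hbu).trans hb.symm)) ?_ ?_
    · intro V Y t h₁ h₂ n
      obtain ⟨V₁, t, s, ht, hs, rfl⟩ := LogMap.exists_factor F up t h₁
      refine (LogMap.comp_map F up t s ht hs h₁ _).trans ?_
      rw [up_π w s hs (hbu ▸ hs), hFπ t (hFb ▸ ht), cone_π e]
    · intro V Y t h₁ h₂ p q hp x
      obtain ⟨V₁, t, s, ht, hs, rfl⟩ := LogMap.exists_factor F up t h₁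
      refine ⟨V, 𝟙 _, x, rfl, congrArg _ ?_⟩
      refine (LogMap.comp_map F up t s ht hs h₁ _).trans ?_
      refine hF t (hFb ▸ ht) _ _ ⟨Y, s, hs, p, q, 1, hp, ?_, ?_⟩
      · rw [map_one, one_mul]
      · rw [map_one, map_one, one_mul]
  · refine LogMap.ext' ((Category.comp_id _).trans hFb) fun {V Y} t h₁ h₂ n => ?_
    have e₀ : (𝟙 (dom Y)) ≫ str Y = str Y ≫ z.proj.base := by
      rw [Category.id_comp]; exact (Category.comp_id _).symm
    have ht : t ≫ str Y = str V ≫ F.base := by rw [hFb]; exact h₂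
    refine (LogMap.map_congr (LogMap.comp F z.proj) (Category.comp_id t).symm h₁ n).trans ?_
    refine (LogMap.comp_map F z.proj t (𝟙 _) ht e₀ _ _).trans ?_
    rw [proj_map, hFπ t h₂]

lemma upper_hom_unique (hd : PreservesDeg up) {F G : W ⟶ z.upper} (h₁ : F ≫ up = G ≫ up)
    (h₂ : F ≫ z.proj = G ≫ z.proj) : F = G := by
  have hb : F.base = G.base :=
    (Category.comp_id _).symm.trans ((congrArg LogMap.base h₂).trans (Category.comp_id _))
  refine upper_hom_ext hb ?_ ?_
  · intro V Y t a₁ a₂ n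
    have e₀ : (𝟙 (dom Y)) ≫ str Y = str Y ≫ z.proj.base := by
      rw [Category.id_comp]; exact (Category.comp_id _).symm
    have b (H : W ⟶ z.upper) (ht : t ≫ str Y = str V ≫ H.base) :
        (t ≫ 𝟙 _) ≫ str Y = str V ≫ (LogMap.comp H z.proj).base := by
      rw [Category.comp_id, ht]; exact congrArg (str V ≫ ·) (Category.comp_id _).symm
    rw [← proj_map e₀, ← LogMap.comp_map F z.proj t (𝟙 _) a₁ e₀ (b F a₁),
      ← LogMap.comp_map G z.proj t (𝟙 _) a₂ e₀ (b G a₂)]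
    exact LogMap.congr_map h₂ _ _ _
  · intro V Y t a₁ a₂ p q hq x
    obtain ⟨Y₁, k, y₁, Y₂, s, hs, r, v, e₁, hr, e₂⟩ := exists_deg_lift hd hq (t x)
    obtain ⟨V₁, g, v₁, t', e₃, -, e₄⟩ := exists_lift t k x y₁ e₁
    have c₁ := over_square e₄ a₁
    have c₂ := over_square e₄ a₂
    have b (H : W ⟶ z.upper) (ht : t' ≫ str Y₁ = str V₁ ≫ H.base) :
        (t' ≫ s) ≫ str Y₂ = str V₁ ≫ (LogMap.comp H up).base := by
      rw [Category.assoc, hs, ← Category.assoc, ht]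
      exact Category.assoc _ _ _
    refine ⟨V₁, g, v₁, e₃, ?_⟩
    rw [← F.map_square e₄ a₁ c₁, ← G.map_square e₄ a₂ c₂, e₂, map_mul, map_mul, F.map_unit,
      G.map_unit, ← LogMap.comp_map F up t' s c₁ hs (b F c₁),
      ← LogMap.comp_map G up t' s c₂ hs (b G c₂)]
    congr 1
    exact LogMap.congr_map h₁ _ _ _

/-- A commutative square whose upper arrow preserves degrees is cartesian. -/
theorem isPullback_of_preservesDeg (w : up ≫ y.proj = z.proj ≫ low)
    (hd : PreservesDeg up) : IsPullback up z.proj y.proj low := by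
  refine ⟨⟨w⟩, ⟨PullbackCone.IsLimit.mk w (fun s => (exists_upper_lift w hd s.condition).choose)
    (fun s => (exists_upper_lift w hd s.condition).choose_spec.1)
    (fun s => (exists_upper_lift w hd s.condition).choose_spec.2) fun s m h₁ h₂ => ?_⟩⟩
  have := (exists_upper_lift w hd s.condition).choose_spec
  exact upper_hom_unique hd (h₁.trans this.1.symm) (h₂.trans this.2.symm)
end PLogPoint
end
end LogGeom

/-! ### Morphisms of log points from images of frames. -/

namespace LogGeom
noncomputable section

lemma exists_common {S : Scheme.{u}} {V W : S.Etale} (x : dom V) (y : dom W)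
    (h : str V x = str W y) : ∃ (Z : S.Etale) (g : Z ⟶ V) (k : Z ⟶ W) (z : dom Z),
      mor g z = x ∧ mor k z = y := by
  obtain ⟨Z, g, k, z, e₁, e₂, -⟩ := exists_refine (V := etMk (𝟙 S) inferInstance) (W := V)
    (W' := W) (etHom (str V) (Category.comp_id _)) (etHom (str W) (Category.comp_id _)) h
  exact ⟨Z, g, k, z, e₁, e₂⟩

namespace PLogPoint
variable {P : Type u} [CommMonoid P] {z y : PLogPoint P}

/-- Preservation of the degree `p` needs to be tested on one section only: any other differs from it
by a unit, and units go to units. -/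
lemma IsDeg.transport {up : LogMap z.upper y.upper} {V : z.base.Etale} {Y Y' : y.base.Etale}
    {t : dom V ⟶ dom Y} {t' : dom V ⟶ dom Y'} {h : t ≫ str Y = str V ≫ up.base}
    (h' : t' ≫ str Y' = str V ≫ up.base) {p : P} {q : sec y.log'.M Y} {q' : sec y.log'.M Y'}
    (hq : y.IsDeg p q) (hq' : y.IsDeg p q') (H : z.IsDeg p (up.map t h q)) :
    z.IsDeg p (up.map t' h' q') := by
  obtain ⟨Y₃, l, l', s, e₁, e₂, e₃⟩ := exists_prod_lift t t' (h.trans h'.symm)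
  have hs := e₃.trans h
  obtain ⟨v, hv⟩ := (hq.res l).exists_unit (hq'.res l')
  have : up.map t' h' q' = z.log'.unit V (unitsMap s v) * up.map t h q := by
    rw [← up.map_congr e₁ (by rw [e₁, h]), ← up.map_congr e₂ (by rw [e₂, h']), up.map_right _ _ hs,
      up.map_right _ _ hs, hv, map_mul, up.map_unit]
  rw [this]
  exact H.unit_mul _

/-- A morphism `Z' ⟶ Y'` over `Z ⟶ Y` is given by images of the sections `(1, p)` over the cover. -/
theorem exists_frame_map (low : z.lower ⟶ y.lower)
    (e : ∀ {V : z.base.Etale} (t : dom V ⟶ dom y.cover), t ≫ str y.cover = str V ≫ low.base →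
      P →* sec z.log'.M V)
    (deg : ∀ {V : z.base.Etale} (t : dom V ⟶ dom y.cover) (h : t ≫ str y.cover = str V ≫ low.base)
      (p : P), z.IsDeg p (e t h p))
    (res : ∀ {V W : z.base.Etale} (g : W ⟶ V) (t : dom V ⟶ dom y.cover)
      (h : t ≫ str y.cover = str V ≫ low.base) (h') (p : P),
      rs z.log'.M g (e t h p) = e (mor g ≫ t) h' p)
    (trans : ∀ {V : z.base.Etale} {Y : y.base.Etale} (t : dom V ⟶ dom Y) (a b : Y ⟶ y.cover)
      (h h') (p : P), e (t ≫ mor a) h p =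
        z.log'.unit V (unitsMap t (y.cocycle.u a b p)) * e (t ≫ mor b) h' p) :
    ∃ up : z.upper ⟶ y.upper, up ≫ y.proj = z.proj ≫ low ∧ PreservesDeg up ∧
      up.base = low.base ∧
      ∀ {V : z.base.Etale} (t : dom V ⟶ dom y.cover) (h h') (p : P),
        up.map t h (y.φ.frame (𝟙 _) p) = e t h' p := by
  have hb : (z.proj ≫ low).base = low.base := Category.id_comp _
  have hov : ∀ {V : z.base.Etale} {Y : y.base.Etale} {t : dom V ⟶ dom Y} (a : Y ⟶ y.cover),
      t ≫ str Y = str V ≫ (z.proj ≫ low).base → (t ≫ mor a) ≫ str y.cover = str V ≫ low.base := by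
    intro V Y t a h
    rw [Category.assoc, mor_str, h, hb]
  obtain ⟨F, hFb, hFπ, hF⟩ := y.exists_family (z.proj ≫ low)
    (fun {V Y} t ht q r => ∃ (a : Y ⟶ y.cover) (p : P) (v : (fn (dom Y))ˣ),
      q = y.log'.unit Y v * y.φ.frame a p ∧
      r = z.log'.unit V (unitsMap t v) * e (t ≫ mor a) (hov a ht) p)
    (by
      rintro V V' Y Y' t t' g k h h' _ _ e' ⟨a, p, v, rfl, rfl⟩
      refine ⟨k ≫ a, p, unitsMap (mor k) v, ?_, ?_⟩
      · rw [map_mul, y.log'.rs_unit, y.φ.rs_frame]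
      · have h₁ : (mor g ≫ t ≫ mor a) ≫ str y.cover = str V' ≫ low.base := by
          rw [Category.assoc, hov a h, ← Category.assoc, mor_str]
        rw [map_mul, z.log'.rs_unit, res _ _ _ h₁, ← unitsMap_comp, ← unitsMap_comp, e']
        congr 3
        rw [mor_comp, ← Category.assoc, ← Category.assoc, e'])
    (by
      rintro V Y t h _ _ ⟨a, p, v, rfl, rfl⟩
      exact isQ_frame a p v)
    (by
      intro V Y t h q hq x
      obtain ⟨Y', k, y', a, p, v, e₁, e₂⟩ := hq (t x)
      obtain ⟨V', g, v', t', e₃, -, e₄⟩ := exists_lift t k x y' e₁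
      exact ⟨V', g, v', Y', k, t', over_square e₄ h, _, e₃, e₄, a, p, v, e₂, rfl⟩)
    (by
      rintro V Y t h _ _ _ ⟨a, p, v, rfl, rfl⟩ ⟨a', p', v', e', rfl⟩
      refine sec_ext _ fun x => ⟨V, 𝟙 _, x, rfl, congrArg _ ?_⟩
      obtain rfl := (isDeg_frame a p v).unique (e' ▸ isDeg_frame a' p' v') (t x)
      rw [frame_eq y a a' p, ← mul_assoc, ← map_mul] at e'
      rw [trans t a a' (hov a h) (hov a' h), ← mul_assoc, ← map_mul, ← map_mul,
        y.log'.unit_injective _ (mul_right_cancel e')])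
    (by
      rintro V Y t h v₀ _ ⟨a, p, v, e', rfl⟩
      refine sec_ext _ fun x => ⟨V, 𝟙 _, x, rfl, congrArg _ ?_⟩
      obtain rfl := (isDeg_unit v₀).unique (e' ▸ isDeg_frame a p v) (t x)
      rw [frame_one, mul_one] at e'
      rw [map_one, mul_one, y.log'.unit_injective _ e'])
    (by
      rintro V Y t h _ _ _ _ ⟨a, p, v, rfl, rfl⟩ ⟨a', p', v', rfl, rfl⟩
      refine ⟨a', p * p', v * y.cocycle.u a a' p * v', ?_, ?_⟩
      · rw [frame_eq y a a' p, frame_mul, ← mul_assoc (y.log'.unit Y v), mul_mul_mul_comm,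
          ← map_mul, ← map_mul]
      · rw [trans t a a' (hov a h) (hov a' h), ← mul_assoc (z.log'.unit V (unitsMap t v)),
          mul_mul_mul_comm, ← map_mul, ← map_mul, ← map_mul, ← map_mul, ← map_mul])
    (by
      rintro V Y t h _ _ ⟨a, p, v, rfl, rfl⟩
      rw [map_mul, map_mul, map_mul]
      -- In degree `p ≠ 1` both structure maps vanish; in degree `1` only the unit `v` is left.
      by_cases hp : p = 1
      · subst hp
        rw [frame_one, map_one, map_one, map_one, map_one, mul_one, mul_one, y.log'.al_unit]
        exact z.log'.al_unit _ _
      · rw [show y.log'.al Y (y.φ.frame a p) = 0 from (isDeg_frame' a p).al_eq_zero hp,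
          show (z.upper).log.al V (e (t ≫ mor a) (hov a h) p) = 0 from (deg _ _ p).al_eq_zero hp,
          mul_zero, map_zero, mul_zero])
  have hFb' : F.base = low.base := hFb.trans hb
  have hFr : ∀ {V : z.base.Etale} (t : dom V ⟶ dom y.cover) (h h') (p : P),
      F.map t h (y.φ.frame (𝟙 _) p) = e t h' p := by
    intro V t h h' p
    refine hF t (hFb ▸ h) _ _ ⟨𝟙 _, p, 1, by rw [map_one, one_mul], ?_⟩
    rw [map_one, map_one, one_mul]
    congr 1
  refine ⟨F, sq_of_up_π hFb' fun {V Y} t h h' n => ?_, ?_, hFb', hFr⟩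
  · have e₁ : (𝟙 (dom V)) ≫ str V = str V ≫ z.proj.base := by
      rw [Category.id_comp]; exact (Category.comp_id _).symm
    rw [hFπ t (hFb ▸ h) n, ← proj_map e₁]
    refine (LogMap.map_congr (LogMap.comp z.proj low) (Category.id_comp t).symm _ n).trans ?_
    exact LogMap.comp_map z.proj low (𝟙 _) t e₁ h' _ n
  · intro V Y t h p q hq
    refine IsDeg.of_local fun x => ?_
    obtain ⟨V', g, v', s, e', hs⟩ := exists_cover_lift F.base y.cover_surj x
    refine ⟨V', g, v', e', ?_⟩
    rw [← F.map_left g t h]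
    refine IsDeg.transport (t := s) (h := hs) _ (isDeg_frame' (𝟙 _) p) hq ?_
    rw [hFr s hs (hFb' ▸ hs)]
    exact deg _ _ p

end PLogPoint

/-! ### Log points in `X` form a groupoid fibration. -/

namespace PLogPointIn
open PLogPoint
variable {P : Type u} [CommMonoid P] {X : IntLogSch.{u}} {z y : PLogPointIn P X}

/-- The local condition on a morphism sends a frame of degree `p` to a unit multiple of a frame of
degree `p`; `IsDeg.transport` carries this to all sections of degree `p`. -/
lemma Hom.preservesDeg (h : z ⟶ y) : PreservesDeg h.up := by
  intro V Y t ht p q hq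
  refine IsDeg.of_local fun x => ?_
  obtain ⟨V₁, v₁, hv₁, a, t₁, ht₁, u, hu⟩ := h.loc (str V x)
  obtain ⟨W, g, k, w, e₁, e₂⟩ := exists_common x v₁ hv₁.symm
  refine ⟨W, g, w, e₁, ?_⟩
  rw [← h.up.map_left g t ht]
  refine IsDeg.transport (t := mor k ≫ t₁)
    (h := by rw [Category.assoc, ht₁, ← Category.assoc, mor_str]) _ (isDeg_frame' (𝟙 _) p) hq ?_
  rw [h.up.map_left k t₁ ht₁, hu]
  exact (isDeg_frame a p _).res k

/-- A morphism of log points in `X` from a commutative square whose upper arrow preserves degrees. -/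
def homMk (up : z.upper ⟶ y.upper) (low : z.lower ⟶ y.lower) (w : up ≫ y.proj = z.proj ≫ low)
    (hd : PreservesDeg up) (f : up ≫ y.f = z.f) : z ⟶ y where
  up := up
  low := low
  isPullback := isPullback_of_preservesDeg w hd
  f := f
  loc x := by
    obtain ⟨v, hv⟩ := z.cover_surj x
    obtain ⟨V, a, v', t, e, ht⟩ := exists_cover_lift up.base y.cover_surj v
    have key (p : P) : ∃ u : (fn (dom V))ˣ,
        up.map t ht (y.φ.frame (𝟙 _) p) = z.log'.unit V u * z.φ.frame a p :=
      (isDeg_frame' a p).exists_unit (hd t ht p _ (isDeg_frame' (𝟙 _) p))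
    choose u hu using key
    refine ⟨V, v', ?_, a, t, ht, MonoidHom.mk' u ?_, hu⟩
    · rw [← hv, ← e, ← mor_str a]; rfl
    -- The frames are multiplicative in `p`, so cancelling them shows that the coefficients form a
    -- homomorphism.
    · intro p q
      refine z.log'.unit_injective V (mul_right_cancel (b := z.φ.frame a (p * q)) ?_)
      rw [← hu, frame_mul, map_mul, hu, hu, frame_mul, map_mul]
      exact mul_mul_mul_comm _ _ _ _

/-- Every morphism of log points in `X` is cartesian over log schemes. -/
theorem isStronglyCartesian (φ : z ⟶ y) :
    (logPoints P X).IsStronglyCartesian ((logPoints P X).map φ) φ where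
  universal_property' {w} g ψ hψ := by
    have hl := (IsHomLift.eq_of_isHomLift (logPoints P X) (g ≫ (logPoints P X).map φ) ψ).symm
    change w.lower ⟶ z.lower at g
    change ψ.low = g ≫ φ.low at hl
    have hw : ψ.up ≫ y.proj = (w.proj ≫ g) ≫ φ.low := by
      rw [Category.assoc, ← hl, ψ.isPullback.w]
    let up : w.upper ⟶ z.upper := φ.isPullback.lift ψ.up (w.proj ≫ g) hw
    have e₁ : up ≫ φ.up = ψ.up := φ.isPullback.lift_fst _ _ _
    have e₂ : up ≫ z.proj = w.proj ≫ g := φ.isPullback.lift_snd _ _ _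
    -- A section of degree `p` of `z` is locally a unit times some `φ.up r`, and the lift takes
    -- `φ.up r` to `ψ.up r`, which has degree `p`.
    have hd : PreservesDeg up := by
      intro V Y t h p q hq
      refine IsDeg.of_local fun x => ?_
      obtain ⟨Y₁, k, y₁, Y₂, s, hs, r, v, e₃, hr, e₄⟩ := exists_deg_lift φ.preservesDeg hq (t x)
      obtain ⟨V₁, l, v₁, t', e₅, -, e₆⟩ := exists_lift t k x y₁ e₃
      have h' := over_square e₆ h
      refine ⟨V₁, l, v₁, e₅, ?_⟩
      have hts : (t' ≫ s) ≫ str Y₂ = str V₁ ≫ (LogMap.comp up φ.up).base := by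
        rw [Category.assoc, hs, ← Category.assoc, h']
        exact Category.assoc _ _ _
      rw [← up.map_square e₆ h h', e₄, map_mul, up.map_unit, ← LogMap.comp_map up φ.up t' s h' hs hts,
        LogMap.congr_map (show LogMap.comp up φ.up = ψ.up from e₁)]
      exact (ψ.preservesDeg _ _ p r hr).unit_mul _
    refine ⟨homMk up g e₂ hd ?_, ⟨?_, ?_⟩, ?_⟩
    · rw [← φ.f, ← Category.assoc, e₁, ψ.f]
    · exact inferInstanceAs ((logPoints P X).IsHomLift ((logPoints P X).map (homMk up g e₂ hd _)) _)
    · exact Hom.ext e₁ hl.symm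
    · rintro χ ⟨h₁, h₂⟩
      have h₃ : χ.low = g := (IsHomLift.eq_of_isHomLift (logPoints P X) g χ).symm
      refine Hom.ext (φ.isPullback.hom_ext ?_ ?_) h₃
      · exact (congrArg Hom.up h₂).trans e₁.symm
      · rw [χ.isPullback.w, h₃]
        exact e₂.symm

variable [IsCancelMul P] [Subsingleton Pˣ]

/-- Log points in `X` can be pulled back along morphisms of log schemes. -/
theorem exists_lift_logPoints (z : PLogPointIn P X) {T : IntLogSch.{u}} (f : T ⟶ z.lower) :
    ∃ (w : PLogPointIn P X) (φ : w ⟶ z), (logPoints P X).IsStronglyCartesian f φ := by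
  have hU : Function.Surjective (str (etPb f.base z.cover)) := by
    intro x
    obtain ⟨u, hu⟩ := z.cover_surj (f.base x)
    obtain ⟨v, -, hv⟩ := Scheme.Pullback.exists_preimage_pullback (f := str z.cover) (g := f.base)
      u x hu
    exact ⟨v, hv⟩
  -- The base change is the twist of `M_T ⊕ P` by the pulled back cocycle. A frame of `z` seen along
  -- `t` goes to the frame of the twist at the induced section of the pulled back cover; equality of
  -- the cocycles is the compatibility with changes of frame.
  let c := z.cocycle.pb f.base
  let w : PLogPoint P := twistPoint T.log c hU
  let low : w.lower ⟶ z.lower := f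
  obtain ⟨up, h₁, h₂, h₃, -⟩ := exists_frame_map (z := w) (y := z.toPLogPoint) low
    (fun {V} t h => ⟨⟨w.φ.frame (etLift f.base t h), w.frame_one _⟩, w.frame_mul _⟩)
    (fun t h p => isDeg_frame' (z := w) _ p)
    (fun g t h h' p => (w.φ.rs_frame g _ p).trans
      (congrArg (fun a => w.φ.frame a p) (etPb_hom_ext f.base
        (((Category.assoc _ _ _).trans (congrArg (mor g ≫ ·) (etLift_fst f.base t h))).trans
          (etLift_fst f.base _ h').symm))))
    (fun {V Y} t a b h h' p => by
      refine (twistPoint_frame T.log c hU (etLift f.base (t ≫ mor a) h)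
        (etLift f.base (t ≫ mor b) h') p).trans ?_
      refine congrArg₂ (· * ·) (congrArg _ ?_) rfl
      exact congr($(Cocycle.uS_of (U := z.cover) z.cocycle t a b (etLift_fst _ _ _).symm
        (etLift_fst _ _ _).symm _) p))
  exact ⟨⟨w, up ≫ z.f⟩, homMk (z := ⟨w, up ≫ z.f⟩) up low h₁ h₂ rfl,
    isStronglyCartesian (homMk (z := ⟨w, up ≫ z.f⟩) up low h₁ h₂ rfl)⟩

theorem isGroupoidFibration : IsGroupoidFibration (logPoints P X) :=
  ⟨fun z _ f => exists_lift_logPoints z f, isStronglyCartesian⟩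

end PLogPointIn
end
end LogGeom

namespace LogGeom
noncomputable section

/-! ### Subsheaves cut out by local conditions. -/

section Subsheaf
variable {S : Scheme.{u}}

/-- The subsheaf of sections that satisfy a local multiplicative condition. -/
def subsheaf (F : MSheaf S) (R : ∀ V : S.Etale, Submonoid (sec F V))
    (res : ∀ {V W : S.Etale} (g : W ⟶ V) (m : sec F V), m ∈ R V → rs F g m ∈ R W)
    (loc : ∀ {V : S.Etale} (m : sec F V), (∀ x : dom V, ∃ (W : S.Etale) (g : W ⟶ V) (w : dom W),
      mor g w = x ∧ rs F g m ∈ R W) → m ∈ R V) : MSheaf S :=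
  ⟨{ obj V := CommMonCat.of (R V.unop)
     map g := CommMonCat.ofHom (((rs F g.unop).comp (R _).subtype).codRestrict _
       fun m => res g.unop m m.2)
     map_id V := CommMonCat.hom_ext (MonoidHom.ext fun m => Subtype.ext (rs_id F _))
     map_comp f g := CommMonCat.hom_ext (MonoidHom.ext fun m => Subtype.ext (rs_comp F _ _ _)) },
    isSheaf_of_glue _
      (fun m m' h => Subtype.ext (sec_ext F fun x => by
        obtain ⟨W, g, w, e, h⟩ := h x
        exact ⟨W, g, w, e, congrArg Subtype.val h⟩))
      (fun {V} C hC x hx => by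
        obtain ⟨s, hs⟩ := exists_amalg F C hC (fun {W} g hg => (x g hg : R W).1)
          (fun g hg k => congrArg Subtype.val (hx g hg k))
        refine ⟨⟨s, loc s fun y => ?_⟩, fun g hg => Subtype.ext (hs g hg)⟩
        obtain ⟨W, g, w, hg, e⟩ := (mem_smallEtale_iff C).1 hC y
        exact ⟨W, g, w, e, (hs g hg).symm ▸ (x g hg : R W).2⟩)⟩

end Subsheaf

/-! ### Geometric points and skyscraper sheaves. -/

section Skyscraper
variable {S : Scheme.{u}} {Ω : Type u} [Field Ω] [IsSepClosed Ω] (s : Spec (.of Ω) ⟶ S)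

/-- The geometric points of `V` over a geometric point `s`. -/
def GeomPt (V : S.Etale) : Type u := { l : Spec (.of Ω) ⟶ dom V // l ≫ str V = s }

variable {s}

/-- The image of a geometric point. -/
def GeomPt.map {V W : S.Etale} (g : V ⟶ W) (l : GeomPt s V) : GeomPt s W :=
  ⟨l.1 ≫ mor g, by rw [Category.assoc, mor_str, l.2]⟩

/-- Points with values in a separably closed field lift along étale morphisms. -/
lemma GeomPt.exists_map_eq {V W : S.Etale} (g : W ⟶ V) (l : GeomPt s V) (w : dom W)
    (h : mor g w = l.1 default) : ∃ l' : GeomPt s W, l'.map g = l := by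
  have := mor_etale g
  obtain ⟨l', h', -⟩ := Scheme.exists_fac_of_etale_of_isSepClosed (mor g) l.1 w h
  exact ⟨⟨l', by rw [← mor_str g, ← Category.assoc, h', l.2]⟩, Subtype.ext h'⟩

lemma GeomPt.exists_cover {V : S.Etale} (R : Sieve V) (hR : R ∈ S.smallEtaleTopology V)
    (l : GeomPt s V) : ∃ (W : S.Etale) (g : W ⟶ V) (_ : R g) (l' : GeomPt s W), l'.map g = l := by
  obtain ⟨W, g, w, hg, e⟩ := (mem_smallEtale_iff R).1 hR (l.1 default)
  obtain ⟨l', h⟩ := l.exists_map_eq g w e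
  exact ⟨W, g, hg, l', h⟩

variable (s) in
/-- The skyscraper sheaf of a commutative monoid at a geometric point. -/
def sky (A : CommMonCat.{u}) : MSheaf S :=
  ⟨{ obj V := CommMonCat.of (GeomPt s V.unop → A)
     map g := CommMonCat.ofHom
       { toFun := fun f l => f (l.map g.unop), map_one' := rfl, map_mul' := fun _ _ => rfl }
     map_id V := CommMonCat.hom_ext (MonoidHom.ext fun f => funext fun l =>
       congrArg f (Subtype.ext (Category.comp_id _)))
     map_comp g h := CommMonCat.hom_ext (MonoidHom.ext fun f => funext fun l =>
       congrArg f (Subtype.ext (Category.assoc l.1 (mor h.unop) (mor g.unop)).symm)) },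
    isSheaf_of_glue _
      (fun {V} m m' h => funext fun l => by
        obtain ⟨W, g, w, e, h⟩ := h (l.1 default)
        obtain ⟨l', rfl⟩ := l.exists_map_eq g w e
        exact congrFun h l')
      (fun {V} R hR x hx => by
        choose W g hg l' hl' using fun l : GeomPt s V => l.exists_cover R hR
        refine ⟨fun l => (x (g l) (hg l) : GeomPt s (W l) → A) (l' l), fun {W'} k hk => funext fun j => ?_⟩
        have e : (l' (j.map k)).1 ≫ mor (g (j.map k)) = j.1 ≫ mor k :=
          congrArg Subtype.val (hl' (j.map k))
        obtain ⟨Y, l₁, l₂, t, e₁, e₂, e₃⟩ := exists_pb_lift _ _ _ _ e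
        let i : GeomPt s Y := ⟨t, by rw [← mor_str l₁, ← Category.assoc, e₂, (l' _).2]⟩
        have a₁ := congrFun (hx _ (hg (j.map k)) l₁) i
        have a₂ := congrFun (hx _ hk l₂) i
        have i₁ : i.map l₁ = l' (j.map k) := Subtype.ext e₂
        have i₂ : i.map l₂ = j := Subtype.ext e₃
        have a₃ : (x _ (R.downward_closed (hg (j.map k)) l₁) : GeomPt s Y → A) i =
            (x _ (R.downward_closed hk l₂) : GeomPt s Y → A) i := by
          congr 2
        have b₁ := a₁.trans (a₃.trans a₂.symm)
        change (x _ (hg (j.map k)) : GeomPt s _ → A) (i.map l₁) =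
          (x _ hk : GeomPt s W' → A) (i.map l₂) at b₁
        rw [i₁, i₂] at b₁
        exact b₁)⟩

end Skyscraper

/-! ### Sections of the inverse image sheaf `b⁻¹ M`. -/

section InverseImage
variable {S T : Scheme.{u}} (b : S ⟶ T) (M : MSheaf T)

/-- The pullback of sections `M(V) ⟶ b⁻¹M(V ×_T S)`. -/
def etaPb (V : T.Etale) : sec M V →* sec ((invImage b).obj M) (etPb b V) :=
  ap ((invImageAdj b).unit.app M) V

lemma etaPb_rs {V W : T.Etale} (g : V ⟶ W) (m : sec M W) :
    etaPb b M V (rs M g m) = rs _ (etPbMap b g) (etaPb b M W m) :=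
  (rs_ap ((invImageAdj b).unit.app M) g m).symm

/-- The pullback of a section of `M` to `b⁻¹ M`. -/
def eta : Family b M ((invImage b).obj M) where
  map {U V} t h := (rs ((invImage b).obj M) (etLift b t h)).comp (etaPb b M V)
  map_left {U' U V} g t h m := by
    simp only [MonoidHom.comp_apply]
    rw [← rs_comp]
    refine congrArg (fun k => rs ((invImage b).obj M) k (etaPb b M V m)) ?_
    exact etPb_hom_ext b (by rw [etLift_fst, mor_comp, Category.assoc, etLift_fst])
  map_right {U V V'} t g h m := by
    simp only [MonoidHom.comp_apply]
    rw [etaPb_rs, ← rs_comp]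
    refine congrArg (fun k => rs ((invImage b).obj M) k (etaPb b M V' m)) ?_
    exact etPb_hom_ext b (by
      rw [etLift_fst, mor_comp, Category.assoc, map_etFst, ← Category.assoc, etLift_fst])

lemma eta_etFst (V : T.Etale) (m : sec M V) :
    (eta b M).map (etFst b V) (etFst_str _ _) m = etaPb b M V m := by
  change rs _ _ _ = _
  rw [show etLift b (etFst b V) (etFst_str _ _) = 𝟙 (etPb b V) from
    etPb_hom_ext b (by rw [etLift_fst, mor_id, Category.id_comp]), rs_id]

/-- The geometric point of `V` over `s ≫ b` given by a geometric point of `U` over `s` and a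
morphism `U ⟶ V` over `b`. -/
def GeomPt.over {Ω : Type u} [Field Ω] [IsSepClosed Ω] {s : Spec (.of Ω) ⟶ S} {U : S.Etale}
    {V : T.Etale} (l : GeomPt s U) (t : dom U ⟶ dom V) (h : t ≫ str V = str U ≫ b) :
    (Scheme.pointSmallEtale (s ≫ b)).fiber.obj V :=
  Over.homMk (l.1 ≫ t) (by
    refine (Category.assoc _ _ _).trans ((congrArg _ h).trans ?_)
    rw [← Category.assoc, l.2]
    rfl)

variable {b M} {A : MSheaf S}

/-- The map `M ⟶ b_* A` of a family. -/
def Family.toDirImage (G : Family b M A) : M ⟶ (dirImage b).obj A :=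
  ⟨{ app V := CommMonCat.ofHom (G.map (etFst b V.unop) (etFst_str _ _))
     naturality V W g := by
      ext m
      exact (G.map_right (etFst b _) g.unop (etFst_str _ _) m).symm.trans
       ((G.map_congr (map_etFst b g.unop).symm _ m).trans
         (G.map_left (etPbMap b g.unop) _ (etFst_str _ _) m)) }⟩

/-- The map `b⁻¹ M ⟶ A` of a family. -/
def Family.dagger (G : Family b M A) : (invImage b).obj M ⟶ A :=
  ((invImageAdj b).homEquiv _ _).symm G.toDirImage

lemma Family.ap_dagger_eta (G : Family b M A) {U : S.Etale} {V : T.Etale} (t : dom U ⟶ dom V)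
    (h : t ≫ str V = str U ≫ b) (m : sec M V) :
    ap G.dagger U ((eta b M).map t h m) = G.map t h m := by
  have e : (invImageAdj b).unit.app M ≫ (dirImage b).map G.dagger = G.toDirImage := by
    exact ((invImageAdj b).homEquiv_unit ..).symm.trans (Equiv.apply_symm_apply _ _)
  have e' : ap G.dagger (etPb b V) (etaPb b M V m) =
      G.map (etFst b V) (etFst_str _ _) m := congr(ap $e V m)
  refine (rs_ap G.dagger (etLift b t h) _).symm.trans ?_
  rw [e', ← G.map_left]
  exact G.map_congr (etLift_fst _ _ _) _ _

lemma invImage_hom_ext {f g : (invImage b).obj M ⟶ A} (h : ∀ {U : S.Etale} {V : T.Etale}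
    (t : dom U ⟶ dom V) (h : t ≫ str V = str U ≫ b) (m : sec M V),
    ap f U ((eta b M).map t h m) = ap g U ((eta b M).map t h m)) : f = g := by
  refine ((invImageAdj b).homEquiv _ _).injective ?_
  refine ((invImageAdj b).homEquiv_unit ..).trans
    (Eq.trans (hom_ext_sec fun V m => ?_) ((invImageAdj b).homEquiv_unit ..).symm)
  have := h (etFst b V) (etFst_str _ _) m
  rw [eta_etFst] at this
  exact this

variable (b M) in
/-- Every section of `b⁻¹ M` locally comes from a section of `M`. -/
theorem exists_eta {U : S.Etale} (x : sec ((invImage b).obj M) U) (v : dom U) :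
    ∃ (W : S.Etale) (g : W ⟶ U) (w : dom W) (V : T.Etale) (t : dom W ⟶ dom V)
      (h : t ≫ str V = str W ≫ b) (m : sec M V), mor g w = v ∧
      rs ((invImage b).obj M) g x = (eta b M).map t h m := by
  let F := (invImage b).obj M
  -- The sections locally coming from `M` form a subsheaf `G` of `b⁻¹ M` that receives all of `M`.
  -- By the universal property the inclusion `G ⟶ b⁻¹ M` has a section, so it is onto.
  let R (U : S.Etale) : Submonoid (sec F U) :=
    { carrier := { x | ∀ v : dom U, ∃ (W : S.Etale) (g : W ⟶ U) (w : dom W) (V : T.Etale)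
        (t : dom W ⟶ dom V) (h : t ≫ str V = str W ≫ b) (m : sec M V), mor g w = v ∧
        rs F g x = (eta b M).map t h m }
      one_mem' := fun v => ⟨U, 𝟙 _, v, etMk (𝟙 T) inferInstance, str U ≫ b, Category.comp_id _, 1,
        rfl, by rw [map_one, map_one]⟩
      mul_mem' := by
        intro x x' hx hx' v
        obtain ⟨W, g, w, V, t, h, m, e₁, e₂⟩ := hx v
        obtain ⟨W', g', w', V', t', h', m', e₁', e₂'⟩ := hx' v
        obtain ⟨W₂, k, k', w₂, e₃, e₄, e₅⟩ := exists_refine g g' (e₁.trans e₁'.symm)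
        have a₁ : (mor k ≫ t) ≫ str V = str W₂ ≫ b := by
          rw [Category.assoc, h, ← Category.assoc, mor_str]
        have a₂ : (mor k' ≫ t') ≫ str V' = str W₂ ≫ b := by
          rw [Category.assoc, h', ← Category.assoc, mor_str]
        obtain ⟨V₃, l, l', t₃, e₆, e₇, e₈⟩ :=
          exists_prod_lift (mor k ≫ t) (mor k' ≫ t') (a₁.trans a₂.symm)
        have h₃ := e₈.trans a₁
        refine ⟨W₂, k ≫ g, w₂, V₃, t₃, h₃, rs M l m * rs M l' m', by rw [← e₁, ← e₃]; rfl, ?_⟩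
        rw [map_mul, rs_comp, e₂, e₅, rs_comp, e₂', map_mul, ← (eta b M).map_left,
          ← (eta b M).map_left, ← (eta b M).map_right, ← (eta b M).map_right]
        congr 1 <;> refine (eta b M).map_congr ?_ _ _
        · exact e₆.symm
        · exact e₇.symm }
  let G : MSheaf S := subsheaf F R
    (by
      intro V W g m hm x
      obtain ⟨W', g', w', Y, t, h, n, e₁, e₂⟩ := hm (mor g x)
      obtain ⟨W₂, k, k', w₂, e₃, e₄, e₅⟩ := exists_refine g g' (w := x) e₁.symm
      refine ⟨W₂, k, w₂, Y, mor k' ≫ t, by rw [Category.assoc, h, ← Category.assoc, mor_str], n,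
        e₃, ?_⟩
      rw [← rs_comp, e₅, rs_comp, e₂, (eta b M).map_left])
    (by
      intro V m hm x
      obtain ⟨W, g, w, e, h⟩ := hm x
      obtain ⟨W', g', w', Y, t, h, n, e₁, e₂⟩ := h w
      exact ⟨W', g' ≫ g, w', Y, t, h, n, by rw [← e, ← e₁]; rfl, by rw [rs_comp, e₂]⟩)
  let i : G ⟶ F := ⟨{ app := fun U => CommMonCat.ofHom (R U.unop).subtype
                      naturality := fun _ _ _ => rfl }⟩
  let φ : Family b M G :=
    { map := fun {U V} t h => ((eta b M).map t h).codRestrict (R U)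
        fun m v => ⟨U, 𝟙 _, v, V, t, h, m, rfl, rs_id _ _⟩
      map_left := fun g t h m => Subtype.ext ((eta b M).map_left g t h m)
      map_right := fun t g h m => Subtype.ext ((eta b M).map_right t g h m) }
  have e : φ.dagger ≫ i = 𝟙 _ := invImage_hom_ext fun {U V} t h m =>
    congrArg (ap i U) (φ.ap_dagger_eta t h m)
  have e' : ap i U (ap φ.dagger U x) = x := congr(ap $e U x)
  rw [← e']
  exact (ap φ.dagger U x : R U).2 v

/-- Sections of `M` with the same image in `b⁻¹ M` agree locally. -/
theorem eta_injective {U : S.Etale} {V : T.Etale} (t : dom U ⟶ dom V)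
    (h : t ≫ str V = str U ≫ b) {m m' : sec M V}
    (e : (eta b M).map t h m = (eta b M).map t h m') (x : dom U) :
    ∃ (W : S.Etale) (g : W ⟶ U) (w : dom W) (V' : T.Etale) (k : V' ⟶ V) (t' : dom W ⟶ dom V'),
      mor g w = x ∧ t' ≫ mor k = mor g ≫ t ∧ rs M k m = rs M k m' := by
  -- Test at a geometric point over `x`: the stalk of `M` at its image in `T` gives a family from
  -- `M` to a skyscraper sheaf on `S`, hence a map from `b⁻¹ M`. So `m` and `m'` have the same germ
  -- there, and agree on an étale neighbourhood.
  let Ω := SeparableClosure ((dom U).residueField x)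
  let p : Spec (.of Ω) ⟶ dom U := (Scheme.SpecToEquivOfField Ω _).2
    ⟨x, CommRingCat.ofHom (algebraMap ((dom U).residueField x) _)⟩
  have hp : p default = x := by simp [p, Scheme.SpecToEquivOfField]
  let s := p ≫ str U
  let Φ := Scheme.pointSmallEtale (s ≫ b)
  let A := Φ.presheafFiber.obj M.obj
  let φ : Family b M (sky s A) :=
    { map := fun {U V} t h => MonoidHom.pi fun l => (Φ.toPresheafFiber V (l.over b t h) M.obj).hom
      map_left := fun g t h m => by
        funext l
        refine congrArg (fun k => (Φ.toPresheafFiber _ k M.obj).hom m) ?_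
        exact Over.OverMorphism.ext (Category.assoc _ _ _).symm
      map_right := fun t g h m => by
        funext l
        refine Eq.trans ?_ (Φ.toPresheafFiber_w_apply g _ M.obj m).symm
        refine congrArg (fun k => (Φ.toPresheafFiber _ k M.obj).hom m) ?_
        exact Over.OverMorphism.ext (Category.assoc _ _ _).symm }
  have e₁ := congrArg (ap φ.dagger U) e
  rw [φ.ap_dagger_eta, φ.ap_dagger_eta] at e₁
  have e₂ := congrFun e₁ ⟨p, rfl⟩
  obtain ⟨Y, f, y, e₃, e₄⟩ := (Φ.toPresheafFiber_eq_iff' V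
    (GeomPt.over b ⟨p, rfl⟩ t h) m m').1 e₂
  let y' : Spec (.of Ω) ⟶ dom Y := y.left
  have e₅ : y' ≫ mor f = p ≫ t := congrArg CommaMorphism.left e₃
  obtain ⟨W, g, w, t', e₆, -, e₇⟩ := exists_lift t f x (y' default)
    ((congr($e₅ default)).trans (congrArg t hp))
  exact ⟨W, g, w, Y, f, t', e₆, e₇, e₄⟩

lemma exists_eta_refine {U : S.Etale} {V : T.Etale} (t : dom U ⟶ dom V)
    (h : t ≫ str V = str U ≫ b) (x : sec ((invImage b).obj M) U) (v : dom U) :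
    ∃ (W : S.Etale) (g : W ⟶ U) (w : dom W) (V' : T.Etale) (k : V' ⟶ V) (t' : dom W ⟶ dom V')
      (h' : t' ≫ str V' = str W ≫ b) (m : sec M V'), mor g w = v ∧ t' ≫ mor k = mor g ≫ t ∧
      rs ((invImage b).obj M) g x = (eta b M).map t' h' m := by
  obtain ⟨W, g, w, V', t', h', m, e₁, e₂⟩ := exists_eta b M x v
  have a₁ : (mor g ≫ t) ≫ str V = str W ≫ b := by
    rw [Category.assoc, h, ← Category.assoc, mor_str]
  obtain ⟨V₃, l, l', t₃, e₆, e₇, e₈⟩ := exists_prod_lift (mor g ≫ t) t' (a₁.trans h'.symm)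
  refine ⟨W, g, w, V₃, l, t₃, e₈.trans a₁, rs M l' m, e₁, e₆, ?_⟩
  rw [e₂, ← (eta b M).map_right]
  exact (eta b M).map_congr e₇.symm _ _

/-- Two sections of `b⁻¹ M` locally come from sections of `M` over the same étale scheme. -/
lemma exists_eta_pair {U : S.Etale} (x y : sec ((invImage b).obj M) U) (v : dom U) :
    ∃ (W : S.Etale) (g : W ⟶ U) (w : dom W) (V : T.Etale) (t : dom W ⟶ dom V)
      (h : t ≫ str V = str W ≫ b) (m n : sec M V), mor g w = v ∧
      rs ((invImage b).obj M) g x = (eta b M).map t h m ∧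
      rs ((invImage b).obj M) g y = (eta b M).map t h n := by
  obtain ⟨W, g, w, V, t, h, m, e₁, e₂⟩ := exists_eta b M x v
  obtain ⟨W', g', w', V', k, t', h', n, e₁', e₂', e₃⟩ := exists_eta_refine t h (rs _ g y) w
  refine ⟨W', g' ≫ g, w', V', t', h', rs M k m, n, by rw [← e₁, ← e₁']; rfl, ?_, ?_⟩
  · rw [rs_comp, e₂, (eta b M).map_square e₂' h]
  · rw [rs_comp, e₃]

/-- All three sections come locally from `M` over one étale scheme; `eta_injective` brings the
equation back to `M`, where it can be cancelled. -/
lemma invImage_isCancelMul (hM : ∀ V, IsCancelMul (sec M V)) (U : S.Etale) :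
    IsCancelMul (sec ((invImage b).obj M) U) := by
  have key : ∀ a x y : sec ((invImage b).obj M) U, a * x = a * y → x = y := by
    intro a x y e
    refine sec_ext _ fun v => ?_
    obtain ⟨W, g, w, V, t, h, m, n, e₁, e₂, e₃⟩ := exists_eta_pair x y v
    obtain ⟨W', g', w', V', k, t', h', l, e₁', e₂', e₃'⟩ := exists_eta_refine t h (rs _ g a) w
    have e₄ := congrArg (rs ((invImage b).obj M) (g' ≫ g)) e
    rw [map_mul, map_mul, rs_comp, rs_comp, rs_comp, e₂, e₃, e₃', ← (eta b M).map_square e₂' h h',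
      ← (eta b M).map_square e₂' h h', ← map_mul, ← map_mul] at e₄
    obtain ⟨W₂, g₂, w₂, V₂, k₂, t₂, e₅, e₆, e₇⟩ := eta_injective t' h' e₄ w'
    rw [map_mul, map_mul] at e₇
    have := hM V₂
    refine ⟨W₂, g₂ ≫ g' ≫ g, w₂, by rw [← e₁, ← e₁', ← e₅]; rfl, ?_⟩
    have h₂ := over_square e₆ h'
    rw [rs_comp, rs_comp _ g' g, e₂, ← (eta b M).map_square e₂' h h', 
      ← (eta b M).map_square e₆ h' h₂, mul_left_cancel e₇, (eta b M).map_square e₆ h' h₂,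
      (eta b M).map_square e₂' h h', ← e₃, rs_comp, rs_comp]
  exact { mul_left_cancel := fun a x y h => key a x y h
          mul_right_cancel := fun a x y h => key a x y (by rwa [mul_comm a x, mul_comm a y]) }

end InverseImage
end
end LogGeom

namespace LogGeom
noncomputable section

/-! ### The log structure associated to a presheaf of cancellative monoids. -/

section Associated
variable {S : Scheme.{u}} (E : S.Etaleᵒᵖ ⥤ CommMonCat.{u}) (α : E ⟶ strPsh S)

/-- Restriction of sections of a presheaf. -/
abbrev prs {V W : S.Etale} (g : V ⟶ W) : E.obj (op W) →* E.obj (op V) := (E.map g.op).hom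

variable {E} in
/-- The structure map of a presheaf on sections. -/
def pal (V : S.Etale) : E.obj (op V) →* fn (dom V) := (α.app (op V)).hom

lemma pal_prs {V W : S.Etale} (g : V ⟶ W) (m : E.obj (op W)) :
    pal α V (prs E g m) = fnMap (mor g) (pal α W m) := NatTrans.naturality_apply α g.op m

/-- The congruence on `E ⊕ 𝒪^*` that identifies the invertible sections of `E` with their images in
`𝒪^*`. -/
def assocCon (V : S.Etale) : Con (E.obj (op V) × (fn (dom V))ˣ) where
  -- A section of `E` with invertible image need not be invertible in `E`. Hence multipliers on both
  -- sides; with these the relation is transitive without passing to a generated congruence.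
  r x y := ∃ (h h' : E.obj (op V)) (v v' : (fn (dom V))ˣ), pal α V h = v ∧ pal α V h' = v' ∧
    x.1 * h = y.1 * h' ∧ x.2 * v' = y.2 * v
  iseqv :=
    { refl := fun x => ⟨1, 1, 1, 1, map_one _, map_one _, rfl, rfl⟩
      symm := fun ⟨h, h', v, v', e₁, e₂, e₃, e₄⟩ => ⟨h', h, v', v, e₂, e₁, e₃.symm, e₄.symm⟩
      trans := fun {x y z} ⟨h, h', v, v', e₁, e₂, e₃, e₄⟩ ⟨k, k', w, w', a₁, a₂, a₃, a₄⟩ =>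
        ⟨h * k, k' * h', v * w, w' * v', by rw [map_mul, e₁, a₁, Units.val_mul],
          by rw [map_mul, e₂, a₂, Units.val_mul],
          by rw [← mul_assoc, e₃, mul_right_comm, a₃, mul_assoc],
          by rw [mul_comm w', ← mul_assoc, e₄, mul_right_comm, a₄, mul_right_comm, mul_assoc]⟩ }
  mul' := fun {x y z w} ⟨h, h', v, v', e₁, e₂, e₃, e₄⟩ ⟨k, k', u, u', a₁, a₂, a₃, a₄⟩ =>
    ⟨h * k, h' * k', v * u, v' * u', by rw [map_mul, e₁, a₁, Units.val_mul],
      by rw [map_mul, e₂, a₂, Units.val_mul],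
      by rw [Prod.fst_mul, Prod.fst_mul, mul_mul_mul_comm, e₃, a₃, mul_mul_mul_comm],
      by rw [Prod.snd_mul, Prod.snd_mul, mul_mul_mul_comm, e₄, a₄, mul_mul_mul_comm]⟩

/-- The presheaf `(E ⊕ 𝒪^*)/∼`. -/
def assocPsh : S.Etaleᵒᵖ ⥤ CommMonCat.{u} where
  obj V := CommMonCat.of (assocCon E α V.unop).Quotient
  map {V W} g := CommMonCat.ofHom ((assocCon E α V.unop).lift
    ((assocCon E α W.unop).mk'.comp ((prs E g.unop).prodMap (unitsMap (mor g.unop)))) (by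
      rintro x y ⟨h, h', v, v', e₁, e₂, e₃, e₄⟩
      refine ((assocCon E α W.unop).eq).2 ⟨prs E g.unop h, prs E g.unop h', unitsMap (mor g.unop) v,
        unitsMap (mor g.unop) v', ?_, ?_, ?_, ?_⟩
      · rw [pal_prs, e₁]; rfl
      · rw [pal_prs, e₂]; rfl
      · exact ((map_mul (prs E g.unop) _ _).symm.trans (congrArg _ e₃)).trans (map_mul _ _ _)
      · exact ((map_mul (unitsMap (mor g.unop)) _ _).symm.trans (congrArg _ e₄)).trans
          (map_mul _ _ _)))
  map_id V := by
    refine CommMonCat.hom_ext (MonoidHom.ext fun x => ?_)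
    obtain ⟨⟨m, v⟩, rfl⟩ := Con.mk'_surjective x
    refine congrArg (assocCon E α V.unop).mk' (Prod.ext ?_ (unitsMap_id v))
    exact congr($(E.map_id V) m)
  map_comp {V₁ V₂ V₃} f g := by
    refine CommMonCat.hom_ext (MonoidHom.ext fun x => ?_)
    obtain ⟨⟨m, v⟩, rfl⟩ := Con.mk'_surjective x
    refine congrArg (assocCon E α V₃.unop).mk' (Prod.ext ?_ (unitsMap_comp _ _ v))
    exact congr($(E.map_comp f g) m)

/-- The class of a pair. -/
def assocMk (V : S.Etale) : E.obj (op V) × (fn (dom V))ˣ →* (assocPsh E α).obj (op V) :=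
  (assocCon E α V).mk'

lemma assocMk_res {V W : S.Etale} (g : W ⟶ V) (x : E.obj (op V) × (fn (dom V))ˣ) :
    prs (assocPsh E α) g (assocMk E α V x) = assocMk E α W (prs E g x.1, unitsMap (mor g) x.2) := rfl

/-- The structure map of `(E ⊕ 𝒪^*)/∼`. -/
def assocα : assocPsh E α ⟶ strPsh S where
  app V := CommMonCat.ofHom ((assocCon E α V.unop).lift
    ((pal α V.unop).coprod (Units.coeHom (fn (dom V.unop)))) (by
      rintro ⟨m, g⟩ ⟨m', g'⟩ ⟨h, h', v, v', e₁, e₂, e₃, e₄⟩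
      change pal α V.unop m * (g : fn (dom V.unop)) = pal α V.unop m' * (g' : fn (dom V.unop))
      have e₅ : pal α V.unop m * v = pal α V.unop m' * v' := by
        rw [← e₁, ← e₂, ← map_mul, ← map_mul, e₃]
      have e₆ : (g : fn (dom V.unop)) * v' = g' * v := congrArg Units.val e₄
      refine v'.isUnit.mul_right_cancel (v.isUnit.mul_right_cancel ?_)
      calc _ = (pal α V.unop m * v) * (g * v') := by ring
        _ = _ := by rw [e₅, e₆]; ring))
  naturality V W g := by
    refine CommMonCat.hom_ext (MonoidHom.ext fun x => ?_)
    obtain ⟨⟨m, v⟩, rfl⟩ := Con.mk'_surjective x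
    change pal α W.unop (prs E g.unop m) * fnMap (mor g.unop) v =
      fnMap (mor g.unop) (pal α V.unop m * v)
    rw [map_mul, pal_prs]

/-- The map from a presheaf to its sheafification. -/
def toSh (Q : S.Etaleᵒᵖ ⥤ CommMonCat.{u}) (V : S.Etale) :
    Q.obj (op V) →* sec ((presheafToSheaf S.smallEtaleTopology CommMonCat.{u}).obj Q) V :=
  ((toSheafify S.smallEtaleTopology Q).app (op V)).hom

lemma rs_toSh (Q : S.Etaleᵒᵖ ⥤ CommMonCat.{u}) {V W : S.Etale} (g : V ⟶ W) (q : Q.obj (op W)) :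
    rs _ g (toSh Q W q) = toSh Q V (prs Q g q) :=
  (NatTrans.naturality_apply (toSheafify S.smallEtaleTopology Q) g.op q).symm

lemma toSh_locBij (Q : S.Etaleᵒᵖ ⥤ CommMonCat.{u}) :
    Presheaf.IsLocallyInjective S.smallEtaleTopology (toSheafify S.smallEtaleTopology Q) ∧
      Presheaf.IsLocallySurjective S.smallEtaleTopology (toSheafify S.smallEtaleTopology Q) :=
  (GrothendieckTopology.W_iff_isLocallyBijective _ _).1
    (GrothendieckTopology.W_toSheafify S.smallEtaleTopology Q)

lemma exists_toSh (Q : S.Etaleᵒᵖ ⥤ CommMonCat.{u}) {V : S.Etale}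
    (n : sec ((presheafToSheaf S.smallEtaleTopology CommMonCat.{u}).obj Q) V) (x : dom V) :
    ∃ (W : S.Etale) (g : W ⟶ V) (w : dom W) (q : Q.obj (op W)), mor g w = x ∧
      rs _ g n = toSh Q W q := by
  have := (toSh_locBij Q).2
  obtain ⟨W, g, w, ⟨q, hq⟩, e⟩ := (mem_smallEtale_iff _).1
    (Presheaf.imageSieve_mem S.smallEtaleTopology (toSheafify S.smallEtaleTopology Q) n) x
  exact ⟨W, g, w, q, e, hq.symm⟩

lemma toSh_injective (Q : S.Etaleᵒᵖ ⥤ CommMonCat.{u}) {V : S.Etale} {q q' : Q.obj (op V)}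
    (h : toSh Q V q = toSh Q V q') (x : dom V) :
    ∃ (W : S.Etale) (g : W ⟶ V) (w : dom W), mor g w = x ∧ prs Q g q = prs Q g q' := by
  have := (toSh_locBij Q).1
  obtain ⟨W, g, w, hg, e⟩ := (mem_smallEtale_iff _).1
    (Presheaf.equalizerSieve_mem S.smallEtaleTopology (toSheafify S.smallEtaleTopology Q) q q' h) x
  exact ⟨W, g, w, e, hg⟩

lemma exists_toSh_pair (Q : S.Etaleᵒᵖ ⥤ CommMonCat.{u}) {V : S.Etale}
    (n n' : sec ((presheafToSheaf S.smallEtaleTopology CommMonCat.{u}).obj Q) V) (x : dom V) :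
    ∃ (W : S.Etale) (g : W ⟶ V) (w : dom W) (q q' : Q.obj (op W)), mor g w = x ∧
      rs _ g n = toSh Q W q ∧ rs _ g n' = toSh Q W q' := by
  obtain ⟨W, g, w, q, e₁, e₂⟩ := exists_toSh Q n x
  obtain ⟨W', g', w', q', e₁', e₂'⟩ := exists_toSh Q (rs _ g n') w
  refine ⟨W', g' ≫ g, w', prs Q g' q, q', by rw [← e₁, ← e₁']; rfl, ?_, ?_⟩
  · rw [rs_comp, e₂, rs_toSh]
  · rw [rs_comp, e₂']

/-- The structure map of the associated log structure. -/
def assocShα : (presheafToSheaf S.smallEtaleTopology CommMonCat.{u}).obj (assocPsh E α) ⟶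
    strSheaf S :=
  ⟨sheafifyLift S.smallEtaleTopology (assocα E α) (strPsh_isSheaf S)⟩

lemma ap_assocShα (V : S.Etale) (x : E.obj (op V) × (fn (dom V))ˣ) :
    ap (assocShα E α) V (toSh _ V (assocMk E α V x)) = pal α V x.1 * (x.2 : fn (dom V)) :=
  congr(($(toSheafify_sheafifyLift S.smallEtaleTopology (assocα E α) (strPsh_isSheaf S))).app (op V)
    (assocMk E α V x))

/-- The integral log structure associated to a presheaf of cancellative monoids over `𝒪`. -/
def assocIntLog (hE : ∀ V, IsCancelMul (E.obj (op V))) : IntLog S where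
  M := (presheafToSheaf S.smallEtaleTopology CommMonCat.{u}).obj (assocPsh E α)
  α := assocShα E α
  existsUnique_unit V v := by
    refine ⟨toSh _ V (assocMk E α V (1, v)), (ap_assocShα E α V _).trans (by rw [map_one, one_mul]),
      fun n hn => sec_ext _ fun x => ?_⟩
    obtain ⟨W, g, w, q, e₁, e₂⟩ := exists_toSh _ n x
    obtain ⟨⟨m, t⟩, rfl⟩ := Con.mk'_surjective q
    refine ⟨W, g, w, e₁, ?_⟩
    have e₃ : pal α W m * (t : fn (dom W)) = fnMap (mor g) v := by
      rw [← show alphaAt (assocShα E α) V n = v from hn]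
      refine (ap_assocShα E α W (m, t)).symm.trans ?_
      exact (congrArg (ap (assocShα E α) W) e₂.symm).trans (rs_ap (assocShα E α) g n).symm
    rw [e₂, rs_toSh, assocMk_res]
    -- If `α(m) t = v`, then `m` has the invertible image `v t⁻¹`, so `(m, t)` and `(1, v)` are
    -- identified.
    refine congrArg (toSh (assocPsh E α) W) (((assocCon E α W).eq).2
      ⟨1, m, 1, unitsMap (mor g) v * t⁻¹, map_one _, ?_, ?_, ?_⟩)
    · rw [Units.val_mul, Units.eq_mul_inv_iff_mul_eq]
      exact e₃
    · rw [mul_one, map_one, one_mul]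
    · rw [mul_one, mul_comm, inv_mul_cancel_right]
  integral V := by
    have key : ∀ n m m' : sec ((presheafToSheaf S.smallEtaleTopology CommMonCat.{u}).obj
        (assocPsh E α)) V, n * m = n * m' → m = m' := by
      intro n m m' e
      refine sec_ext _ fun x => ?_
      obtain ⟨W, g, w, q, q', e₁, e₂, e₃⟩ := exists_toSh_pair _ m m' x
      obtain ⟨W', g', w', r, e₁', e₂'⟩ := exists_toSh _ (rs _ g n) w
      have e₄ := congrArg (rs _ (g' ≫ g)) e
      rw [map_mul, map_mul, rs_comp, rs_comp, rs_comp, e₂', e₂, e₃, rs_toSh, rs_toSh, ← map_mul,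
        ← map_mul] at e₄
      obtain ⟨W₂, g₂, w₂, e₅, e₆⟩ := toSh_injective _ e₄ w'
      refine ⟨W₂, g₂ ≫ g' ≫ g, w₂, by rw [← e₁, ← e₁', ← e₅]; rfl, ?_⟩
      rw [rs_comp, rs_comp _ g' g, e₂, rs_comp _ g₂ (g' ≫ g), rs_comp _ g' g, e₃, rs_toSh, rs_toSh,
        rs_toSh, rs_toSh]
      congr 1
      obtain ⟨⟨a, t⟩, rfl⟩ := Con.mk'_surjective q
      obtain ⟨⟨a', t'⟩, rfl⟩ := Con.mk'_surjective q'
      obtain ⟨⟨c, s⟩, rfl⟩ := Con.mk'_surjective r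
      -- Multipliers that identify `r q` with `r q'` also identify `q` with `q'`, after cancelling
      -- `c` in `E` and `s` among the units.
      obtain ⟨h, h', v, v', a₁, a₂, a₃, a₄⟩ := ((assocCon E α W₂).eq).1 e₆
      refine ((assocCon E α W₂).eq).2 ⟨h, h', v, v', a₁, a₂, ?_, ?_⟩
      · have := hE W₂
        change prs E g₂ (c * prs E g' a) * h = prs E g₂ (c * prs E g' a') * h' at a₃
        rw [map_mul, map_mul, mul_assoc, mul_assoc] at a₃
        exact mul_left_cancel a₃
      · change unitsMap (mor g₂) (s * unitsMap (mor g') t) * v' =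
          unitsMap (mor g₂) (s * unitsMap (mor g') t') * v at a₄
        rw [map_mul, map_mul, mul_assoc, mul_assoc] at a₄
        exact mul_left_cancel a₄
    exact { mul_left_cancel := fun a x y h => key a x y h
            mul_right_cancel := fun a x y h => key a x y (by rwa [mul_comm a x, mul_comm a y]) }

variable (hE : ∀ V, IsCancelMul (E.obj (op V)))

/-- The map from a presheaf to the associated log structure. -/
def assocMap (V : S.Etale) : E.obj (op V) →* sec (assocIntLog E α hE).M V :=
  ((toSh _ V).comp (assocMk E α V)).comp (MonoidHom.inl _ _)

lemma rs_assocMap {V W : S.Etale} (g : W ⟶ V) (m : E.obj (op V)) :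
    rs _ g (assocMap E α hE V m) = assocMap E α hE W (prs E g m) :=
  (rs_toSh _ g _).trans (congrArg (fun v => toSh _ W (assocMk E α W (prs E g m, v)))
    (map_one (unitsMap (mor g))))

lemma al_assocMap {V : S.Etale} (m : E.obj (op V)) :
    (assocIntLog E α hE).al V (assocMap E α hE V m) = pal α V m :=
  (ap_assocShα E α V (m, 1)).trans (mul_one _)

lemma toSh_assocMk {V : S.Etale} (m : E.obj (op V)) (v : (fn (dom V))ˣ) :
    (toSh _ V (assocMk E α V (m, v)) : sec (assocIntLog E α hE).M V) =
      (assocIntLog E α hE).unit V v * assocMap E α hE V m := by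
  have : (assocIntLog E α hE).unit V v = toSh _ V (assocMk E α V (1, v)) :=
    ((assocIntLog E α hE).eq_unit ((ap_assocShα E α V _).trans (by rw [map_one, one_mul]))).symm
  rw [this]
  refine Eq.trans ?_ (map_mul ((toSh _ V).comp (assocMk E α V)) (1, v) (m, 1))
  rw [Prod.mk_mul_mk, one_mul, mul_one]
  rfl

lemma exists_assocMap {V : S.Etale} (n : sec (assocIntLog E α hE).M V) (x : dom V) :
    ∃ (W : S.Etale) (g : W ⟶ V) (w : dom W) (m : E.obj (op W)) (v : (fn (dom W))ˣ), mor g w = x ∧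
      rs _ g n = (assocIntLog E α hE).unit W v * assocMap E α hE W m := by
  obtain ⟨W, g, w, q, e₁, e₂⟩ := exists_toSh _ n x
  obtain ⟨⟨m, t⟩, rfl⟩ := Con.mk'_surjective q
  exact ⟨W, g, w, m, t, e₁, e₂.trans (toSh_assocMk E α hE m t)⟩

lemma assocMap_eq {V : S.Etale} {m m' : E.obj (op V)} {v v' : (fn (dom V))ˣ}
    (e : (assocIntLog E α hE).unit V v * assocMap E α hE V m =
      (assocIntLog E α hE).unit V v' * assocMap E α hE V m') (x : dom V) :
    ∃ (W : S.Etale) (g : W ⟶ V) (w : dom W) (h h' : E.obj (op W)) (t t' : (fn (dom W))ˣ),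
      mor g w = x ∧ pal α W h = t ∧ pal α W h' = t' ∧ prs E g m * h = prs E g m' * h' := by
  rw [← toSh_assocMk, ← toSh_assocMk] at e
  obtain ⟨W, g, w, e₁, e₂⟩ := toSh_injective _ e x
  obtain ⟨h, h', t, t', a₁, a₂, a₃, -⟩ := ((assocCon E α W).eq).1 e₂
  exact ⟨W, g, w, h, h', t, t', e₁, a₁, a₂, a₃⟩

end Associated
end
end LogGeom

namespace LogGeom
noncomputable section

/-! ### Strict morphisms of log schemes on sections. -/

section Strict

/-- A function whose pullback along `t` is invertible is invertible near the image of `t`. -/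
lemma exists_unit_near {S T : Scheme.{u}} {V : S.Etale} {U : T.Etale} (t : dom V ⟶ dom U)
    {f : fn (dom U)} {v : (fn (dom V))ˣ} (e : fnMap t f = v) (x : dom V) :
    ∃ (U' : T.Etale) (k : U' ⟶ U) (y : dom U') (c : (fn (dom U'))ˣ), mor k y = t x ∧
      fnMap (mor k) f = c := by
  have hx : t x ∈ (dom U).basicOpen f := by
    have h := Scheme.preimage_basicOpen_top t f
    rw [show t.appTop f = (v : fn (dom V)) from e, Scheme.basicOpen_of_isUnit _ v.isUnit] at h
    exact h.ge (show x ∈ (⊤ : (dom V).Opens) from trivial)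
  obtain ⟨y, hy⟩ := exists_opn U _ _ hx
  have hu : IsUnit (fnMap (mor (opnHom U ((dom U).basicOpen f))) f) := by
    have h := RingedSpace.isUnit_res_basicOpen _ f
    have e' : (dom U).presheaf.map (homOfLE ((dom U).basicOpen_le f)).op ≫
        (dom U).presheaf.map (eqToHom (Scheme.Opens.ι_image_top ((dom U).basicOpen f))).op =
          ((dom U).basicOpen f).ι.appTop := by
      rw [Scheme.Opens.ι_appTop, ← Functor.map_comp]
      rfl
    have h' := h.map ((dom U).presheaf.map
      (eqToHom (Scheme.Opens.ι_image_top ((dom U).basicOpen f))).op).hom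
    exact (show _ = fnMap (mor (opnHom U ((dom U).basicOpen f))) f from congr($e' f)) ▸ h'
  exact ⟨_, opnHom U _, y, hu.unit, hy, rfl⟩

variable {Z Y X : IntLogSch.{u}}

/-- The elementwise form of strictness: `M_Y` is the log structure associated to `f⁻¹ M_X`. -/
structure LocStrict (f : LogMap Y X) : Prop where
  ex : ∀ {V : Y.base.Etale} (n : sec Y.log.M V) (x : dom V), ∃ (W : Y.base.Etale) (g : W ⟶ V)
    (w : dom W) (U : X.base.Etale) (t : dom W ⟶ dom U) (h : t ≫ str U = str W ≫ f.base)
    (m : sec X.log.M U) (v : (fn (dom W))ˣ), mor g w = x ∧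
    rs Y.log.M g n = Y.log.unit W v * f.map t h m
  inj : ∀ {V : Y.base.Etale} {U : X.base.Etale} (t : dom V ⟶ dom U)
    (h : t ≫ str U = str V ≫ f.base) (m m' : sec X.log.M U) (v v' : (fn (dom V))ˣ),
    Y.log.unit V v * f.map t h m = Y.log.unit V v' * f.map t h m' → ∀ x : dom V,
    ∃ (W : Y.base.Etale) (g : W ⟶ V) (w : dom W) (U' : X.base.Etale) (k : U' ⟶ U)
      (t' : dom W ⟶ dom U') (c : (fn (dom U'))ˣ), mor g w = x ∧ t' ≫ mor k = mor g ≫ t ∧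
      rs X.log.M k m = X.log.unit U' c * rs X.log.M k m'

lemma over_comp {S T : Scheme.{u}} {b : S ⟶ T} {V W : S.Etale} {U : T.Etale} (g : W ⟶ V)
    {t : dom V ⟶ dom U} (h : t ≫ str U = str V ≫ b) : (mor g ≫ t) ≫ str U = str W ≫ b := by
  rw [Category.assoc, h, ← Category.assoc, mor_str]

namespace LocStrict
variable {f : LogMap Y X}

/-- The relation defining the factorization of a morphism through a strict morphism. -/
def Rel (f : LogMap Y X) (ψ : LogMap Z X) {b : Z.base ⟶ Y.base} (hb : b ≫ f.base = ψ.base)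
    {V : Z.base.Etale} {U : Y.base.Etale} (t : dom V ⟶ dom U) (h : t ≫ str U = str V ≫ b)
    (n : sec Y.log.M U) (y : sec Z.log.M V) : Prop :=
  ∃ (T : X.base.Etale) (s : dom U ⟶ dom T) (hs : s ≫ str T = str U ≫ f.base)
    (m : sec X.log.M T) (v : (fn (dom U))ˣ), n = Y.log.unit U v * f.map s hs m ∧
    y = Z.log.unit V (unitsMap t v) * ψ.map (t ≫ s)
      (by rw [Category.assoc, hs, ← Category.assoc, h, Category.assoc, hb]) m

variable (ψ : LogMap Z X) {b : Z.base ⟶ Y.base}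

lemma Rel.pair {ψ : LogMap Z X} {hb : b ≫ f.base = ψ.base} {V : Z.base.Etale} {U : Y.base.Etale}
    {t : dom V ⟶ dom U} {h : t ≫ str U = str V ≫ b} {n n' : sec Y.log.M U} {y y' : sec Z.log.M V}
    (r : Rel f ψ hb t h n y) (r' : Rel f ψ hb t h n' y') :
    ∃ (T : X.base.Etale) (s : dom U ⟶ dom T) (hs : s ≫ str T = str U ≫ f.base)
      (hts : (t ≫ s) ≫ str T = str V ≫ ψ.base) (m m' : sec X.log.M T) (v v' : (fn (dom U))ˣ),
      n = Y.log.unit U v * f.map s hs m ∧ n' = Y.log.unit U v' * f.map s hs m' ∧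
      y = Z.log.unit V (unitsMap t v) * ψ.map (t ≫ s) hts m ∧
      y' = Z.log.unit V (unitsMap t v') * ψ.map (t ≫ s) hts m' := by
  obtain ⟨T, s, hs, m, v, e, e₂⟩ := r
  obtain ⟨T', s', hs', m', v', e', e₂'⟩ := r'
  obtain ⟨T₃, l, l', s₃, e₆, e₇, e₈⟩ := exists_prod_lift s s' (hs.trans hs'.symm)
  have hs₃ := e₈.trans hs
  refine ⟨T₃, s₃, hs₃, by rw [Category.assoc, hs₃, ← Category.assoc, h, Category.assoc, hb],
    rs _ l m, rs _ l' m', v, v', ?_, ?_, ?_, ?_⟩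
  · rw [e, ← f.map_right, f.map_congr e₆]
  · rw [e', ← f.map_right, f.map_congr e₇]
  · rw [e₂, ← ψ.map_right, ψ.map_congr (t := (t ≫ s₃) ≫ mor l) (by rw [Category.assoc, e₆])]
  · rw [e₂', ← ψ.map_right, ψ.map_congr (t := (t ≫ s₃) ≫ mor l') (by rw [Category.assoc, e₇])]

/-- From `v f(m) = v' f(m')`, the field `inj` gives `m = c m'` on `X`, and then `v c = v'` on `Y` by
cancellation. Applying `ψ` to the first and pulling back the second identifies the two values. -/
lemma Rel.uniq (hf : LocStrict f) {ψ : LogMap Z X} {hb : b ≫ f.base = ψ.base} {V : Z.base.Etale}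
    {U : Y.base.Etale} {t : dom V ⟶ dom U} {h : t ≫ str U = str V ≫ b} {n : sec Y.log.M U}
    {y y' : sec Z.log.M V} (r : Rel f ψ hb t h n y) (r' : Rel f ψ hb t h n y') : y = y' := by
  obtain ⟨T, s, hs, hts, m, m', v, v', e₁, e₂, e₃, e₄⟩ := r.pair r'
  have e₅ := e₁.symm.trans e₂
  refine sec_ext _ fun x => ?_
  obtain ⟨W, g, w, T', k, s', c, a₁, a₂, a₃⟩ := hf.inj s hs m m' v v' e₅ (t x)
  obtain ⟨V', l, v₁, t', b₁, -, b₂⟩ := exists_lift t g x w a₁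
  refine ⟨V', l, v₁, b₁, ?_⟩
  have hs' := over_square a₂ hs
  have e₆ := congrArg (rs Y.log.M g) e₅
  rw [map_mul, map_mul, ← f.map_square a₂ hs hs', ← f.map_square a₂ hs hs', a₃, map_mul,
    f.map_unit, Y.log.rs_unit, Y.log.rs_unit, ← mul_assoc, ← map_mul] at e₆
  have e₇ := Y.log.unit_injective _ (mul_right_cancel e₆)
  have a₄ : (t' ≫ s') ≫ mor k = mor l ≫ t ≫ s := by
    rw [Category.assoc, a₂, ← Category.assoc, b₂, Category.assoc]
  have hts' := over_square a₄ hts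
  rw [e₃, e₄, map_mul, map_mul, ← ψ.map_square a₄ hts hts', ← ψ.map_square a₄ hts hts', a₃, map_mul,
    ψ.map_unit, Z.log.rs_unit, Z.log.rs_unit, ← mul_assoc, ← map_mul]
  have e₈ := congrArg (unitsMap t') e₇
  rw [map_mul] at e₈
  change unitsMap t' (unitsMap (mor g) v) * unitsMap t' (unitsMap s' c) =
    unitsMap t' (unitsMap (mor g) v') at e₈
  rw [← unitsMap_comp, ← unitsMap_comp, ← unitsMap_comp, b₂] at e₈
  congr 2

lemma rel_map (χ : LogMap Z Y) (hχ : LogMap.comp χ f = ψ) {V : Z.base.Etale} {U : Y.base.Etale}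
    (t : dom V ⟶ dom U) (h : t ≫ str U = str V ≫ χ.base) (T : X.base.Etale) (s : dom U ⟶ dom T)
    (hs : s ≫ str T = str U ≫ f.base) (m : sec X.log.M T) (v : (fn (dom U))ˣ) :
    Rel f ψ (congrArg LogMap.base hχ) t h (Y.log.unit U v * f.map s hs m)
      (χ.map t h (Y.log.unit U v * f.map s hs m)) := by
  subst hχ
  refine ⟨T, s, hs, m, v, rfl, ?_⟩
  rw [map_mul, χ.map_unit, LogMap.comp_map χ f t s h hs]

/-- Morphisms factor uniquely through a strict morphism once the underlying morphism of schemes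
does. -/
theorem exists_factor (hf : LocStrict f) (hb : b ≫ f.base = ψ.base) :
    ∃ χ : LogMap Z Y, χ.base = b ∧ LogMap.comp χ f = ψ := by
  have hex : ∀ {V : Z.base.Etale} {U : Y.base.Etale} (t : dom V ⟶ dom U)
      (_ : t ≫ str U = str V ≫ b) (n : sec Y.log.M U) (x : dom V), ∃ (V' : Z.base.Etale)
      (g : V' ⟶ V) (v' : dom V') (U' : Y.base.Etale) (k : U' ⟶ U) (t' : dom V' ⟶ dom U')
      (h' : t' ≫ str U' = str V' ≫ b) (y : sec Z.log.M V'),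
      mor g v' = x ∧ t' ≫ mor k = mor g ≫ t ∧ Rel f ψ hb t' h' (rs Y.log.M k n) y := by
    intro V U t h n x
    obtain ⟨W, g, w, T, s, hs, m, v, e₁, e₂⟩ := hf.ex n (t x)
    obtain ⟨V', k, v', t', e₃, -, e₅⟩ := exists_lift t g x w e₁
    exact ⟨V', k, v', W, g, t', over_square e₅ h, _, e₃, e₅, T, s, hs, m, v, e₂, rfl⟩
  obtain ⟨F, hF⟩ := Family.exists_of_rel (b := b) (B := Y.log.M) (A := Z.log.M)
    (fun t h n y => Rel f ψ hb t h n y)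
    (by
      rintro V V' U U' t t' g k h h' n y e ⟨T, s, hs, m, v, rfl, rfl⟩
      refine ⟨T, mor k ≫ s, over_comp k hs, m, unitsMap (mor k) v, ?_, ?_⟩
      · rw [map_mul, Y.log.rs_unit, f.map_left k s hs]
      · rw [map_mul, Z.log.rs_unit, ← ψ.map_left]
        congr 1
        · refine congrArg _ ?_
          change unitsMap (mor g) (unitsMap t v) = _
          rw [← unitsMap_comp, ← unitsMap_comp, e]
        · exact ψ.map_congr (by rw [← Category.assoc, ← e, Category.assoc]) _ _)
    hex
    (fun t h n y y' r r' => r.uniq hf r')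
    (by
      intro V U t h y r
      refine r.uniq hf ⟨etMk (𝟙 X.base) inferInstance, str U ≫ f.base, Category.comp_id _, 1, 1, ?_, ?_⟩
      · rw [map_one, map_one, one_mul]
      · rw [map_one, map_one, map_one, one_mul])
    (by
      intro V U t h n n' y y' r r'
      obtain ⟨T, s, hs, hts, m, m', v, v', e₁, e₂, e₃, e₄⟩ := r.pair r'
      refine ⟨T, s, hs, m * m', v * v', ?_, ?_⟩
      · rw [e₁, e₂, map_mul, map_mul, mul_mul_mul_comm]
      · rw [e₃, e₄, map_mul, map_mul, map_mul, mul_mul_mul_comm])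
  refine ⟨F.logMap fun {V U} t h n => ?_, rfl, LogMap.ext' hb ?_⟩
  · refine sec_ext (strSheaf _) fun x => ?_
    obtain ⟨V', g, v', U', k, t', h', y, e₁, e₂, T, s, hs, m, v, e₃, e₄⟩ := hex t h n x
    refine ⟨V', g, v', e₁, ?_⟩
    change fnMap (mor g) _ = fnMap (mor g) _
    rw [← Z.log.al_rs, ← F.map_square e₂ h h', hF t' h' _ y ⟨T, s, hs, m, v, e₃, e₄⟩, ← fnMap_comp,
      ← e₂, fnMap_comp, ← Y.log.al_rs, e₃, e₄, map_mul, map_mul, map_mul, ψ.map_al, f.map_al,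
      fnMap_comp, Z.log.al_unit, Y.log.al_unit]
    rfl
  · intro V T t h₁ h₂ m
    obtain ⟨U, t, s, ht, hs, rfl⟩ := LogMap.exists_factor _ f t h₁
    rw [LogMap.comp_map _ _ _ _ ht hs]
    refine hF t ht _ _ ⟨T, s, hs, m, 1, ?_, ?_⟩
    · rw [map_one, one_mul]
    · rw [map_one, map_one, one_mul]

/-- A morphism to the source of a strict morphism is determined by the underlying morphism of schemes
and its composite with the strict morphism. -/
lemma hom_unique (hf : LocStrict f) {χ χ' : LogMap Z Y} (hb : χ.base = χ'.base)
    (e : LogMap.comp χ f = LogMap.comp χ' f) : χ = χ' := by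
  refine LogMap.ext' hb fun {V U} t h h' n => sec_ext _ fun x => ?_
  obtain ⟨W, g, w, T, s, hs, m, v, e₁, e₂⟩ := hf.ex n (t x)
  obtain ⟨V', k, v', t', e₃, -, e₅⟩ := exists_lift t g x w e₁
  refine ⟨V', k, v', e₃, ?_⟩
  have h₁ := over_square e₅ h
  rw [← χ.map_square e₅ h h₁, ← χ'.map_square e₅ h' (hb ▸ h₁), e₂]
  have r := rel_map _ χ rfl t' h₁ T s hs m v
  have r' := rel_map _ χ' e.symm t' (hb ▸ h₁) T s hs m v
  obtain ⟨T₁, s₁, hs₁, m₁, v₁, a₁, a₂⟩ := r'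
  exact r.uniq hf ⟨T₁, s₁, hs₁, m₁, v₁, a₁, a₂⟩

theorem isStrict {f : Y ⟶ X} (hf : LocStrict f) : IsStrict f where
  universal_property' {Z} g ψ hψ := by
    have hb : g ≫ f.base = ψ.base :=
      IsHomLift.eq_of_isHomLift underlying (g ≫ underlying.map f) ψ
    obtain ⟨χ, h₁, h₂⟩ := exists_factor ψ hf hb
    let χ' : Z ⟶ Y := χ
    refine ⟨χ', ⟨?_, h₂⟩, ?_⟩
    · have : g = underlying.map χ' := h₁.symm
      rw [this]
      infer_instance
    · rintro θ ⟨a₁, a₂⟩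
      have h₃ : g = underlying.map θ := IsHomLift.eq_of_isHomLift underlying g θ
      exact hom_unique hf (h₃.symm.trans h₁.symm) (a₂.trans h₂.symm)

lemma comp {g : LogMap Z Y} (hg : LocStrict g) (hf : LocStrict f) :
    LocStrict (LogMap.comp g f) where
  ex {V} n x := by
    obtain ⟨W, k, w, U, t, h, l, v, e₁, e₂⟩ := hg.ex n x
    obtain ⟨W', k', w', T, s, hs, m, v', e₃, e₄⟩ := hf.ex l (t w)
    obtain ⟨W₂, j, w₂, t', e₅, -, e₆⟩ := exists_lift t k' w w' e₃
    have h' := over_square e₆ h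
    have hts : (t' ≫ s) ≫ str T = str W₂ ≫ (LogMap.comp g f).base := by
      rw [Category.assoc, hs, ← Category.assoc, h']
      exact Category.assoc _ _ _
    refine ⟨W₂, j ≫ k, w₂, T, t' ≫ s, hts, m, unitsMap (mor j) v * unitsMap t' v',
      by rw [← e₁, ← e₅]; rfl, ?_⟩
    rw [rs_comp, e₂, map_mul, ← g.map_square e₆ h h', e₄, map_mul, g.map_unit, Z.log.rs_unit,
      LogMap.comp_map g f t' s h' hs, map_mul, mul_assoc]
  inj {V T} r hr m m' v v' e x := by
    obtain ⟨U, t, s, ht, hs, rfl⟩ := LogMap.exists_factor g f r hr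
    rw [LogMap.comp_map g f t s ht hs, LogMap.comp_map g f t s ht hs] at e
    obtain ⟨W, k, w, U', l, t', c, e₁, e₂, e₃⟩ := hg.inj t ht _ _ _ _ e x
    rw [← f.map_left l s hs, ← f.map_left l s hs, ← one_mul (f.map _ _ m), ← map_one (Y.log.unit _)]
      at e₃
    obtain ⟨W', k', w', T', j, s', c', e₄, e₅, e₆⟩ := hf.inj _ _ _ _ _ _ e₃ (t' w)
    obtain ⟨W₂, i, w₂, t₂, e₇, -, e₈⟩ := exists_lift t' k' w w' e₄
    refine ⟨W₂, i ≫ k, w₂, T', j, t₂ ≫ s', c', by rw [← e₁, ← e₇]; rfl, ?_, e₆⟩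
    rw [Category.assoc, e₅, ← Category.assoc, e₈, Category.assoc, ← Category.assoc t', e₂, mor_comp]
    simp only [Category.assoc]

lemma of_isIso (f : Y ⟶ X) [IsIso f] : LocStrict f := by
  obtain ⟨g, h₁, h₂⟩ := IsIso.out (f := f)
  have b₁ : f.base ≫ g.base = 𝟙 _ := congrArg LogMap.base h₁
  have b₂ : g.base ≫ f.base = 𝟙 _ := congrArg LogMap.base h₂
  have hb : IsIso f.base := ⟨g.base, b₁, b₂⟩
  -- As `f.base` is an isomorphism, an étale `Y`-scheme is also an étale `X`-scheme, and `f` and `g`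
  -- are mutually inverse on its sections.
  have key (V : Y.base.Etale) : ∃ (V' : X.base.Etale) (i : dom V ⟶ dom V') (j : dom V' ⟶ dom V),
      i ≫ j = 𝟙 _ ∧ j ≫ i = 𝟙 _ ∧ i ≫ str V' = str V ≫ f.base ∧ j ≫ str V = str V' ≫ g.base :=
    ⟨etMk (str V ≫ f.base) (etale_comp (str_etale V) inferInstance), 𝟙 (dom V), 𝟙 (dom V),
      Category.id_comp _, Category.id_comp _, Category.id_comp _, by
        refine (Category.id_comp _).trans ((Category.comp_id _).symm.trans ?_)
        rw [← b₁]
        exact (Category.assoc _ _ _).symm⟩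
  have hl {V : Y.base.Etale} {V' : X.base.Etale} {i : dom V ⟶ dom V'} {j : dom V' ⟶ dom V}
      (e : i ≫ j = 𝟙 _) (h : i ≫ str V' = str V ≫ f.base) (h' : j ≫ str V = str V' ≫ g.base)
      (n : sec Y.log.M V) : f.map i h (g.map j h' n) = n := by
    refine (LogMap.comp_map f g i j h h' (by
      rw [e, show (LogMap.comp f g).base = 𝟙 _ from b₁, Category.id_comp, Category.comp_id]) n).symm.trans
      ((LogMap.congr_map h₁ _ _ _).trans ?_)
    exact (LogMap.map_congr (LogMap.id Y) e _ n).trans (rs_id _ n)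
  have hr {V : Y.base.Etale} {V' : X.base.Etale} {i : dom V ⟶ dom V'} {j : dom V' ⟶ dom V}
      (e : j ≫ i = 𝟙 _) (h : i ≫ str V' = str V ≫ f.base) (h' : j ≫ str V = str V' ≫ g.base)
      (n : sec X.log.M V') : g.map j h' (f.map i h n) = n := by
    refine (LogMap.comp_map g f j i h' h (by
      rw [e, show (LogMap.comp g f).base = 𝟙 _ from b₂, Category.id_comp, Category.comp_id]) n).symm.trans
      ((LogMap.congr_map h₂ _ _ _).trans ?_)
    exact (LogMap.map_congr (LogMap.id X) e _ n).trans (rs_id _ n)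
  refine ⟨fun {V} n x => ?_, fun {V U} t h m m' v v' e x => ?_⟩
  · obtain ⟨V', i, j, e₁, e₂, a₁, a₂⟩ := key V
    refine ⟨V, 𝟙 _, x, V', i, a₁, g.map j a₂ n, 1, rfl, ?_⟩
    rw [rs_id, hl e₁, map_one, one_mul]
  · obtain ⟨V', i, j, e₁, e₂, a₁, a₂⟩ := key V
    let k : V' ⟶ U := etHom (j ≫ t) (by
      rw [Category.assoc, h, ← Category.assoc, a₂, Category.assoc, b₂, Category.comp_id])
    have hk : i ≫ mor k = t := by
      rw [mor_etHom, ← Category.assoc, e₁, Category.id_comp]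
    have hk' (m : sec X.log.M U) : f.map t h m = f.map i a₁ (rs _ k m) := by
      rw [← f.map_right, f.map_congr hk]
    rw [hk', hk'] at e
    have e' := congrArg (g.map j a₂) e
    rw [map_mul, map_mul, g.map_unit, g.map_unit, hr e₂, hr e₂] at e'
    refine ⟨V, 𝟙 _, x, V', k, i, (unitsMap j v)⁻¹ * unitsMap j v', rfl,
      by rw [hk, mor_id, Category.id_comp], ?_⟩
    refine mul_left_cancel (a := X.log.unit V' (unitsMap j v)) (e'.trans ?_)
    rw [← mul_assoc, ← map_mul, mul_inv_cancel_left]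

end LocStrict

/-! ### The inverse image log structure `b^* M_X`. -/

section Inverse
variable (X : IntLogSch.{u}) {S : Scheme.{u}} (b : S ⟶ X.base)

/-- The structure map of `M_X`, pulled back along `b`. -/
def alFamily : Family b X.log.M (strSheaf S) where
  map t h := (fnMap t).toMonoidHom.comp (X.log.al _)
  map_left g t h m := fnMap_comp (mor g) t _
  map_right {U V V'} t g h m := by
    change fnMap (t ≫ mor g) (X.log.al V' m) = fnMap t (X.log.al V (rs X.log.M g m))
    rw [X.log.al_rs, fnMap_comp]

lemma pal_alFamily {V : S.Etale} {U : X.base.Etale} (t : dom V ⟶ dom U)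
    (h : t ≫ str U = str V ≫ b) (m : sec X.log.M U) :
    pal (alFamily X b).dagger.hom V ((eta b X.log.M).map t h m) = fnMap t (X.log.al U m) :=
  (alFamily X b).ap_dagger_eta t h m

/-- The inverse image log structure `b^* M_X`. -/
def pullbackLog : IntLog S :=
  assocIntLog ((invImage b).obj X.log.M).obj (alFamily X b).dagger.hom
    (invImage_isCancelMul X.log.integral)

/-- The map `b⁻¹ M_X ⟶ b^* M_X`. -/
def pullbackMk (V : S.Etale) : sec ((invImage b).obj X.log.M) V →* sec (pullbackLog X b).M V :=
  assocMap _ _ (invImage_isCancelMul X.log.integral) V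

lemma rs_pullbackMk {V W : S.Etale} (g : V ⟶ W) (m : sec ((invImage b).obj X.log.M) W) :
    rs (pullbackLog X b).M g (pullbackMk X b W m) = pullbackMk X b V (rs _ g m) :=
  rs_assocMap ((invImage b).obj X.log.M).obj (alFamily X b).dagger.hom
    (invImage_isCancelMul X.log.integral) g m

lemma al_pullbackMk {V : S.Etale} {U : X.base.Etale} (t : dom V ⟶ dom U)
    (h : t ≫ str U = str V ≫ b) (m : sec X.log.M U) :
    (pullbackLog X b).al V (pullbackMk X b V ((eta b X.log.M).map t h m)) =
      fnMap t (X.log.al U m) :=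
  (al_assocMap ((invImage b).obj X.log.M).obj (alFamily X b).dagger.hom
    (invImage_isCancelMul X.log.integral) _).trans (pal_alFamily X b t h m)

/-- The projection from the base change of a log scheme. -/
def pullbackMap : LogMap ⟨S, pullbackLog X b⟩ X where
  base := b
  map {U _} t h := (pullbackMk X b U).comp ((eta b X.log.M).map t h)
  map_left g t h m := (congrArg (pullbackMk X b _) ((eta b X.log.M).map_left g t h m)).trans
    (rs_pullbackMk X b g _).symm
  map_right t g h m := congrArg (pullbackMk X b _) ((eta b X.log.M).map_right t g h m)
  map_al t h m := al_pullbackMk X b t h m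

/-- Invertibility of a function is an open condition, so `α(l)` is already invertible near the image
of `x`; there `l` itself is a unit of the log structure. -/
lemma exists_eq_unit {V : S.Etale} {U : X.base.Etale} (t : dom V ⟶ dom U) (l : sec X.log.M U)
    {c : (fn (dom V))ˣ} (e : fnMap t (X.log.al U l) = c) (x : dom V) :
    ∃ (W : S.Etale) (g : W ⟶ V) (w : dom W) (U' : X.base.Etale) (k : U' ⟶ U) (t' : dom W ⟶ dom U')
      (d : (fn (dom U'))ˣ), mor g w = x ∧ t' ≫ mor k = mor g ≫ t ∧
      rs X.log.M k l = X.log.unit U' d := by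
  obtain ⟨U', k, y, d, e₁, e₂⟩ := exists_unit_near t e x
  obtain ⟨W, g, w, t', e₃, -, e₄⟩ := exists_lift t k x y e₁
  exact ⟨W, g, w, U', k, t', d, e₃, e₄, X.log.eq_unit (by rw [X.log.al_rs, e₂])⟩

lemma pal_alFamily_rs {V W : S.Etale} (g : V ⟶ W) (m : sec ((invImage b).obj X.log.M) W) :
    pal (alFamily X b).dagger.hom V (rs _ g m) =
      fnMap (mor g) (pal (alFamily X b).dagger.hom W m) :=
  pal_prs (E := ((invImage b).obj X.log.M).obj) (alFamily X b).dagger.hom g m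

/-- Equality in the associated log structure yields multipliers `y`, `y'` with invertible images.
These come from sections `l`, `l'` of `M_X`, which are units near the image, so `m` and `m'` differ
by a unit already on `X`. -/
lemma exists_eq_unit_mul {V : S.Etale} {U : X.base.Etale} (t : dom V ⟶ dom U)
    (h : t ≫ str U = str V ≫ b) {m m' : sec X.log.M U} {y y' : sec ((invImage b).obj X.log.M) V}
    {c c' : (fn (dom V))ˣ} (hc : pal (alFamily X b).dagger.hom V y = c)
    (hc' : pal (alFamily X b).dagger.hom V y' = c')
    (e : (eta b X.log.M).map t h m * y = (eta b X.log.M).map t h m' * y') (x : dom V) :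
    ∃ (W : S.Etale) (g : W ⟶ V) (w : dom W) (U' : X.base.Etale) (k : U' ⟶ U) (t' : dom W ⟶ dom U')
      (d : (fn (dom U'))ˣ), mor g w = x ∧ t' ≫ mor k = mor g ≫ t ∧
      rs X.log.M k m = X.log.unit U' d * rs X.log.M k m' := by
  obtain ⟨W₁, g₁, w₁, U₁, k₁, t₁, h₁, l, a₁, a₂, a₃⟩ := exists_eta_refine t h y x
  obtain ⟨W₂, g₂, w₂, U₂, k₂, t₂, h₂, l', b₁, b₂, b₃⟩ := exists_eta_refine t₁ h₁ (rs _ g₁ y') w₁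
  have a₅ : rs _ (g₂ ≫ g₁) y = (eta b X.log.M).map t₂ h₂ (rs _ k₂ l) := by
    rw [rs_comp, a₃, (eta b X.log.M).map_square b₂ h₁]
  have a₆ : rs _ (g₂ ≫ g₁) y' = (eta b X.log.M).map t₂ h₂ l' := by rw [rs_comp, b₃]
  have a₄ : t₂ ≫ mor (k₂ ≫ k₁) = mor (g₂ ≫ g₁) ≫ t := by
    rw [mor_comp, ← Category.assoc, b₂, Category.assoc, a₂, mor_comp, Category.assoc]
  have c₁ : fnMap t₂ (X.log.al U₂ (rs _ k₂ l)) = unitsMap (mor (g₂ ≫ g₁)) c := by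
    rw [← pal_alFamily X b t₂ h₂, ← a₅, pal_alFamily_rs, hc]
    rfl
  have c₂ : fnMap t₂ (X.log.al U₂ l') = unitsMap (mor (g₂ ≫ g₁)) c' := by
    rw [← pal_alFamily X b t₂ h₂, ← a₆, pal_alFamily_rs, hc']
    rfl
  have e₅ := congrArg (rs ((invImage b).obj X.log.M) (g₂ ≫ g₁)) e
  rw [map_mul, map_mul, a₅, a₆, ← (eta b X.log.M).map_square a₄ h h₂,
    ← (eta b X.log.M).map_square a₄ h h₂, ← map_mul, ← map_mul] at e₅
  obtain ⟨W₃, g₃, w₃, U₃, k₃, t₃, d₁, d₂, d₃⟩ := eta_injective t₂ h₂ e₅ w₂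
  have c₃ : fnMap t₃ (X.log.al U₃ (rs _ (k₃ ≫ k₂) l)) = unitsMap (mor g₃ ≫ mor (g₂ ≫ g₁)) c := by
    rw [rs_comp, X.log.al_rs, ← fnMap_comp, d₂, fnMap_comp, c₁, unitsMap_comp]
    rfl
  obtain ⟨W₄, g₄, w₄, U₄, k₄, t₄, u, f₁, f₂, f₃⟩ := exists_eq_unit X t₃ _ c₃ w₃
  have c₄ : fnMap t₄ (X.log.al U₄ (rs _ (k₄ ≫ k₃) l')) =
      unitsMap (mor g₄ ≫ mor g₃ ≫ mor (g₂ ≫ g₁)) c' := by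
    rw [X.log.al_rs, ← fnMap_comp, show t₄ ≫ mor (k₄ ≫ k₃) = mor g₄ ≫ mor g₃ ≫ t₂ by
      rw [mor_comp, ← Category.assoc, f₂, Category.assoc, d₂], fnMap_comp, fnMap_comp, c₂,
      unitsMap_comp, unitsMap_comp]
    rfl
  obtain ⟨W₅, g₅, w₅, U₅, k₅, t₅, u', i₁, i₂, i₃⟩ := exists_eq_unit X t₄ _ c₄ w₄
  -- From `m l = m' l'` with `l = u` and `l' = u'` comes `m = u⁻¹ u' m'`.
  refine ⟨W₅, g₅ ≫ g₄ ≫ g₃ ≫ g₂ ≫ g₁, w₅, U₅, k₅ ≫ k₄ ≫ k₃ ≫ k₂ ≫ k₁, t₅,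
    (unitsMap (mor k₅) u)⁻¹ * u', ?_, ?_, ?_⟩
  · rw [← a₁, ← b₁, ← d₁, ← f₁, ← i₁]; rfl
  · simp only [mor_comp]
    rw [← Category.assoc, i₂, Category.assoc, ← Category.assoc t₄, f₂, Category.assoc,
      ← Category.assoc t₃, d₂, Category.assoc, ← Category.assoc t₂, b₂, Category.assoc, a₂]
    simp only [Category.assoc]
  · have j := congrArg (rs X.log.M (k₅ ≫ k₄)) d₃
    rw [← rs_comp, ← rs_comp, map_mul, map_mul, ← rs_comp, ← rs_comp, ← rs_comp] at j
    rw [← rs_comp] at i₃ f₃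
    have f₄ := congrArg (rs X.log.M k₅) f₃
    rw [X.log.rs_unit, ← rs_comp] at f₄
    simp only [Category.assoc] at j i₃ f₄ ⊢
    rw [i₃, f₄] at j
    refine mul_left_cancel (a := X.log.unit U₅ (unitsMap (mor k₅) u)) ?_
    rw [← mul_assoc, ← map_mul, mul_inv_cancel_left, mul_comm, j, mul_comm]

theorem locStrict_pullbackMap : LocStrict (pullbackMap X b) where
  ex n x := by
    obtain ⟨W, g, w, m, v, e₁, e₂⟩ := exists_assocMap _ _ (invImage_isCancelMul X.log.integral) n x
    obtain ⟨W', g', w', U, t, h, l, e₃, e₄⟩ := exists_eta b X.log.M m w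
    refine ⟨W', g' ≫ g, w', U, t, h, l, unitsMap (mor g') v, by rw [← e₁, ← e₃]; rfl, ?_⟩
    refine (rs_comp (pullbackLog X b).M g' g n).trans ((congrArg _ e₂).trans ?_)
    refine (map_mul _ _ _).trans (congrArg₂ (· * ·) ((pullbackLog X b).rs_unit g' v) ?_)
    exact (rs_pullbackMk X b g' m).trans (congrArg (pullbackMk X b W') e₄)
  inj {V U} t h m m' v v' e x := by
    obtain ⟨W, g, w, y, y', c, c', e₁, e₂, e₃, e₄⟩ := assocMap_eq ((invImage b).obj X.log.M).obj
      (alFamily X b).dagger.hom (invImage_isCancelMul X.log.integral) e x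
    have h' : (mor g ≫ t) ≫ str U = str W ≫ b := over_comp g h
    have e₅ : (eta b X.log.M).map (mor g ≫ t) h' m * y =
        (eta b X.log.M).map (mor g ≫ t) h' m' * y' :=
      (congrArg (· * y) ((eta b X.log.M).map_left g t h m)).trans
        (e₄.trans (congrArg (· * y') ((eta b X.log.M).map_left g t h m').symm))
    obtain ⟨W₁, g₁, w₁, U₁, k, t₁, d, a₁, a₂, a₃⟩ := exists_eq_unit_mul X b _ h' e₂ e₃ e₅ w
    exact ⟨W₁, g₁ ≫ g, w₁, U₁, k, t₁, d, by rw [← e₁, ← a₁]; rfl,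
      by rw [a₂, mor_comp, Category.assoc], a₃⟩
end Inverse

/-- The elementwise form of strictness is implied by strictness. -/
theorem IsStrict.locStrict {f : Y ⟶ X} (hf : IsStrict f) : LocStrict f := by
  let L : IntLogSch := ⟨Y.base, pullbackLog X f.base⟩
  let p : L ⟶ X := pullbackMap X f.base
  have hp : IsStrict p := (locStrict_pullbackMap X f.base).isStrict
  have hp' : underlying.IsStronglyCartesian (underlying.map f) p := hp
  have hf' : underlying.IsStronglyCartesian (underlying.map f) f := hf
  have h : underlying.map f = (Iso.refl (underlying.obj Y)).hom ≫ underlying.map f :=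
    (Category.id_comp _).symm
  -- Cartesian lifts of one morphism are isomorphic, so `f` is an isomorphism followed by the
  -- projection from the inverse image.
  let φ := Functor.IsStronglyCartesian.domainIsoOfBaseIso underlying h p f
  have e : φ.hom ≫ p = f := Functor.IsStronglyCartesian.fac underlying (underlying.map f) p h f
  rw [← e]
  exact (LocStrict.of_isIso φ.hom).comp (locStrict_pullbackMap X f.base)
end Strict
end
end LogGeom

namespace LogGeom
noncomputable section

/-! ### Basic log points on sections, and strict arrows to them. -/

namespace PLogPoint
variable {P : Type u} [CommMonoid P] {z y : PLogPoint P}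

lemma PreservesDeg.isQ {up : LogMap z.upper y.upper} (hd : PreservesDeg up) {V : z.base.Etale}
    {Y : y.base.Etale} (t : dom V ⟶ dom Y) (h : t ≫ str Y = str V ≫ up.base)
    {q : sec y.log'.M Y} (hq : y.IsQ q) : z.IsQ (up.map t h q) := by
  refine IsQ.of_local fun x => ?_
  obtain ⟨W, g, w, p, e, hp⟩ := hq.exists_isDeg (t x)
  obtain ⟨V', k, v, t', e₁, -, e₂⟩ := exists_lift t g x w e
  refine ⟨V', k, v, e₁, ?_⟩
  rw [← up.map_square e₂ h (over_square e₂ h)]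
  exact (hd _ _ p _ hp).isQ

lemma IsQ.unit_mul {V : z.base.Etale} {q : sec z.log'.M V} (h : z.IsQ q) (v : (fn (dom V))ˣ) :
    z.IsQ (z.log'.unit V v * q) := (isQ_unit v).mul h
end PLogPoint

namespace PLogPointIn
open PLogPoint
variable {P : Type u} [CommMonoid P] {X : IntLogSch.{u}} {w z : PLogPointIn P X}

lemma Hom.f_map (i : w ⟶ z) {V : w.base.Etale} {U : z.base.Etale} {T : X.base.Etale}
    (t : dom V ⟶ dom U) (s : dom U ⟶ dom T) (ht : t ≫ str U = str V ≫ i.up.base)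
    (hs : s ≫ str T = str U ≫ z.f.base) (h : (t ≫ s) ≫ str T = str V ≫ w.f.base)
    (m : sec X.log.M T) : w.f.map (t ≫ s) h m = i.up.map t ht (z.f.map s hs m) := by
  have e : LogMap.comp i.up z.f = w.f := i.f
  rw [← LogMap.congr_map e (t ≫ s) (by rw [e]; exact h), LogMap.comp_map i.up z.f t s ht hs]

lemma Hom.over_f (i : w ⟶ z) {V : w.base.Etale} {U : z.base.Etale} {T : X.base.Etale}
    {t : dom V ⟶ dom U} {s : dom U ⟶ dom T} (ht : t ≫ str U = str V ≫ i.up.base)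
    (hs : s ≫ str T = str U ≫ z.f.base) : (t ≫ s) ≫ str T = str V ≫ w.f.base := by
  have e : i.up.base ≫ z.f.base = w.f.base := congrArg LogMap.base i.f
  rw [Category.assoc, hs, ← Category.assoc, ht, Category.assoc, e]

lemma Hom.isQ (i : w ⟶ z) {V : w.base.Etale} {Y : z.base.Etale} (t : dom V ⟶ dom Y)
    (h : t ≫ str Y = str V ≫ i.up.base) {q : sec z.log'.M Y} (hq : z.IsQ q) :
    w.IsQ (i.up.map t h q) := PreservesDeg.isQ (up := i.up) i.preservesDeg t h hq

lemma Hom.up_π (i : w ⟶ z) {V : w.base.Etale} {Y : z.base.Etale}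
    (t : dom V ⟶ dom Y) (h : t ≫ str Y = str V ≫ i.up.base) (h' : t ≫ str Y = str V ≫ i.low.base)
    (n : sec z.log.M Y) : i.up.map t h (ap z.π Y n) = ap w.π V (i.low.map t h' n) :=
  PLogPoint.up_π i.isPullback.w t h h' n

/-- The elementwise form of the condition that a log point is basic. -/
structure LocBasic (z : PLogPointIn P X) : Prop where
  ex : ∀ {V : z.base.Etale} (n : sec z.log.M V) (x : dom V), ∃ (W : z.base.Etale) (g : W ⟶ V)
    (w : dom W) (U : X.base.Etale) (t : dom W ⟶ dom U) (h : t ≫ str U = str W ≫ z.f.base)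
    (m : sec X.log.M U) (q : sec z.log'.M W), mor g w = x ∧ z.IsQ q ∧
    z.f.map t h m = ap z.π W (rs z.log.M g n) * q
  -- Membership of `f(l)` in `Q` says that the `M_Z`-component of `l` is invertible: these are the
  -- multipliers that become units in the associated log structure.
  inj : ∀ {V : z.base.Etale} {U : X.base.Etale} (t : dom V ⟶ dom U)
    (h : t ≫ str U = str V ≫ z.f.base) (m m' : sec X.log.M U) (n : sec z.log.M V)
    (q q' : sec z.log'.M V), z.IsQ q → z.IsQ q' → z.f.map t h m = ap z.π V n * q →
    z.f.map t h m' = ap z.π V n * q' → ∀ x : dom V, ∃ (W : z.base.Etale) (g : W ⟶ V) (w : dom W)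
      (U' : X.base.Etale) (k : U' ⟶ U) (t' : dom W ⟶ dom U') (h' : t' ≫ str U' = str W ≫ z.f.base)
      (l l' : sec X.log.M U'), mor g w = x ∧ t' ≫ mor k = mor g ≫ t ∧ z.IsQ (z.f.map t' h' l) ∧
      z.IsQ (z.f.map t' h' l') ∧ rs X.log.M k m * l = rs X.log.M k m' * l'

/-- The source of a strict arrow to a basic log point is basic. -/
theorem LocBasic.of_locStrict (i : w ⟶ z) (hz : LocBasic z) (hi : LocStrict i.low) :
    LocBasic w where
  ex {V} n x := by
    obtain ⟨W, g, w₀, Y, t, h, l, v, e₁, e₂⟩ := hi.ex n x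
    obtain ⟨W₁, g₁, w₁, T, s, hs, m, q, a₁, hq, a₂⟩ := hz.ex l (t w₀)
    obtain ⟨W₂, g₂, w₂, t₂, b₁, -, b₂⟩ := exists_lift t g₁ w₀ w₁ a₁
    have h₂ := over_square b₂ h
    have h₂' : t₂ ≫ str W₁ = str W₂ ≫ i.up.base := by rw [h₂, i.base_eq]
    refine ⟨W₂, g₂ ≫ g, w₂, T, t₂ ≫ s, i.over_f h₂' hs, m,
      w.log'.unit W₂ (unitsMap (mor g₂) v)⁻¹ * i.up.map t₂ h₂' q, by rw [← e₁, ← b₁]; rfl,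
      (i.isQ _ _ hq).unit_mul _, ?_⟩
    rw [i.f_map t₂ s h₂' hs, a₂, map_mul, i.up_π t₂ h₂' h₂, i.low.map_square b₂ h h₂, rs_comp, e₂,
      map_mul, map_mul, w.log.rs_unit, w.π_unit, mul_mul_mul_comm, ← map_mul]
    change _ = w.log'.unit W₂ (unitsMap (mor g₂) v * (unitsMap (mor g₂) v)⁻¹) * _
    rw [mul_inv_cancel, map_one, one_mul]
  inj {V T} r hr m m' n q q' hq hq' e e' x := by
    have ef : LogMap.comp i.up z.f = w.f := i.f
    obtain ⟨Y, t, s, ht, hs, rfl⟩ := LogMap.exists_factor i.up z.f r (by rw [ef]; exact hr)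
    have ht' : t ≫ str Y = str V ≫ i.low.base := by rw [ht, i.base_eq]
    rw [i.f_map t s ht hs] at e e'
    -- Decompose `f(m) = n₁ q₁` and `f(m') = n₂ q₂` already over `z`. Over `w` both sections have
    -- the component `n`, so the images of `n₁` and `n₂` agree up to units; strictness turns this
    -- into `n₁ = c n₂` over `z`. After moving `c` into `q₁` the components are equal and basicness
    -- of `z` applies.
    obtain ⟨Y₁, k₁, y₁, n₁, q₁, a₁, hq₁, a₂⟩ := z.exists_isQ (z.f.map s hs m) (t x)
    obtain ⟨Y₂, k₂, y₂, n₂, q₂, a₃, hq₂, a₄⟩ := z.exists_isQ (rs z.log'.M k₁ (z.f.map s hs m')) y₁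
    obtain ⟨V₂, g₂, v₂, t₂, b₁, -, b₂⟩ := exists_lift t (k₂ ≫ k₁) x y₂ (by rw [← a₁, ← a₃]; rfl)
    have h₂ := over_square b₂ ht
    have h₂' := over_square b₂ ht'
    rw [← rs_comp] at a₄
    have a₅ := congrArg (rs z.log'.M k₂) a₂
    rw [← rs_comp, map_mul, rs_ap] at a₅
    have c₁ := congrArg (rs w.log'.M g₂) e
    have c₂ := congrArg (rs w.log'.M g₂) e'
    rw [← i.up.map_square b₂ ht h₂, a₅, map_mul, i.up_π t₂ h₂ h₂', map_mul, rs_ap] at c₁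
    rw [← i.up.map_square b₂ ht h₂, a₄, map_mul, i.up_π t₂ h₂ h₂', map_mul, rs_ap] at c₂
    obtain ⟨V₃, g₃, v₃, u₁, d₁, d₂, d₃⟩ := (i.isQ _ h₂ (hq₁.res k₂)).cancel
      (hq.res g₂) c₁ v₂
    obtain ⟨V₄, g₄, v₄, u₂, d₄, d₅, d₆⟩ := ((i.isQ _ h₂ hq₂).res g₃).cancel
      ((hq'.res g₂).res g₃) (by
        have := congrArg (rs w.log'.M g₃) c₂
        rwa [map_mul, map_mul, rs_ap, rs_ap] at this) v₃
    have d₇ := congrArg (rs w.log.M g₄) d₃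
    rw [map_mul, w.log.rs_unit] at d₇
    have d₈ : w.log.unit V₄ u₂ * i.low.map (mor (g₄ ≫ g₃) ≫ t₂) (over_comp (g₄ ≫ g₃) h₂')
          (rs z.log.M k₂ n₁) = w.log.unit V₄ (unitsMap (mor g₄) u₁) *
        i.low.map (mor (g₄ ≫ g₃) ≫ t₂) (over_comp (g₄ ≫ g₃) h₂') n₂ := by
      have f₁ := i.low.map_left (g₄ ≫ g₃) t₂ h₂' (rs z.log.M k₂ n₁)
      have f₂ := i.low.map_left (g₄ ≫ g₃) t₂ h₂' n₂
      rw [rs_comp] at f₁ f₂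
      rw [f₁, f₂, d₇, d₆, ← mul_assoc, ← mul_assoc, mul_comm (w.log.unit V₄ u₂)]
    obtain ⟨V₅, g₅, v₅, Y₅, k₅, t₅, c, f₁, f₂, f₃⟩ := hi.inj _ _ _ _ _ _ d₈ v₄
    have f₂' : t₅ ≫ mor k₅ = mor (g₅ ≫ g₄ ≫ g₃) ≫ t₂ := by
      rw [f₂]; simp only [mor_comp, Category.assoc]
    have h₅ := over_square f₂' h₂
    have A₁ := congrArg (rs z.log'.M k₅) a₅
    have A₂ := congrArg (rs z.log'.M k₅) a₄
    rw [map_mul, ← rs_comp, rs_ap, f₃, map_mul, z.π_unit, mul_comm (z.log'.unit Y₅ c),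
      mul_assoc, ← z.f.map_left _ s hs] at A₁
    rw [map_mul, ← rs_comp, rs_ap, ← z.f.map_left _ s hs] at A₂
    obtain ⟨Y₆, k₆, y₆, T', k, s', hs', l, l', j₁, j₂, j₃, j₄, j₅⟩ := hz.inj _ _ _ _ _ _ _
      (((hq₁.res k₂).res k₅).unit_mul c) (hq₂.res k₅) A₁ A₂ (t₅ v₅)
    obtain ⟨V₆, g₆, v₆, t₆, l₁, -, l₂⟩ := exists_lift t₅ k₆ v₅ y₆ j₁
    have h₆ := over_square l₂ h₅
    refine ⟨V₆, g₆ ≫ g₅ ≫ g₄ ≫ g₃ ≫ g₂, v₆, T', k, t₆ ≫ s', i.over_f h₆ hs', l, l', ?_, ?_, ?_, ?_,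
      j₅⟩
    · rw [← b₁, ← d₁, ← d₄, ← f₁, ← l₁]; rfl
    · rw [Category.assoc, j₂, ← Category.assoc, l₂]
      have e₁ := congrArg (· ≫ s) b₂
      have e₂ := congrArg (· ≫ mor k₂ ≫ mor k₁ ≫ s) f₂'
      simp only [mor_comp, Category.assoc] at e₁ e₂ ⊢
      rw [e₂, e₁]
    · rw [i.f_map t₆ s' h₆ hs']
      exact i.isQ _ _ j₃
    · rw [i.f_map t₆ s' h₆ hs']
      exact i.isQ _ _ j₄

end PLogPointIn
end
end LogGeom

namespace LogGeom
noncomputable section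

/-! ### Identifying the sheaves `Q` of `w` and `z` through `w'`. -/

namespace PLogPointIn
open PLogPoint
variable {P : Type u} [CommMonoid P] {X : IntLogSch.{u}} {w' w z : PLogPointIn P X}

/-- The sections `q` of `M_{Z'}` and `r` of `M_{W'}` have the same image in `W''`. -/
structure Match (i : w' ⟶ w) (j : w' ⟶ z) {V : w.base.Etale} {Y : z.base.Etale} (t : dom V ⟶ dom Y)
    (q : sec z.log'.M Y) (r : sec w.log'.M V) : Prop where
  eq : ∀ {V' : w'.base.Etale} (k : dom V' ⟶ dom V) (hk : k ≫ str V = str V' ≫ i.up.base)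
    (hkt : (k ≫ t) ≫ str Y = str V' ≫ j.up.base), i.up.map k hk r = j.up.map (k ≫ t) hkt q

section
variable {i : w' ⟶ w} {j : w' ⟶ z} {b : w.base ⟶ z.base}

lemma over_match (hb : i.up.base ≫ b = j.up.base) {V : w.base.Etale} {Y : z.base.Etale}
    {t : dom V ⟶ dom Y} (h : t ≫ str Y = str V ≫ b) {V' : w'.base.Etale} {k : dom V' ⟶ dom V}
    (hk : k ≫ str V = str V' ≫ i.up.base) : (k ≫ t) ≫ str Y = str V' ≫ j.up.base := by
  rw [Category.assoc, h, ← Category.assoc, hk, Category.assoc, hb]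

lemma Match.res {V V' : w.base.Etale} {Y Y' : z.base.Etale} {t : dom V ⟶ dom Y}
    {t' : dom V' ⟶ dom Y'} {g : V' ⟶ V} {k : Y' ⟶ Y} (e : t' ≫ mor k = mor g ≫ t)
    {q : sec z.log'.M Y} {r : sec w.log'.M V} (H : Match i j t q r) :
    Match i j t' (rs _ k q) (rs _ g r) := by
  refine ⟨fun {V₁} l hl hlt => ?_⟩
  have a₁ : (l ≫ mor g) ≫ str V = str V₁ ≫ i.up.base := by rw [Category.assoc, mor_str, hl]
  have a₂ : (l ≫ mor g) ≫ t = (l ≫ t') ≫ mor k := by rw [Category.assoc, ← e, Category.assoc]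
  rw [← i.up.map_right l g hl, ← j.up.map_right (l ≫ t') k hlt]
  refine (H.eq (l ≫ mor g) a₁ ?_).trans (j.up.map_congr a₂ _ _)
  rw [a₂, Category.assoc, mor_str, hlt]

lemma Match.mul {V : w.base.Etale} {Y : z.base.Etale} {t : dom V ⟶ dom Y} {q q' : sec z.log'.M Y}
    {r r' : sec w.log'.M V} (H : Match i j t q r) (H' : Match i j t q' r') :
    Match i j t (q * q') (r * r') := by
  refine ⟨fun {V₁} l hl hlt => ?_⟩
  rw [map_mul, map_mul, H.eq l hl hlt, H'.eq l hl hlt]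

lemma match_unit {V : w.base.Etale} {Y : z.base.Etale} (t : dom V ⟶ dom Y) (v : (fn (dom Y))ˣ) :
    Match i j t (z.log'.unit Y v) (w.log'.unit V (unitsMap t v)) := by
  refine ⟨fun {V₁} l hl hlt => ?_⟩
  rw [i.up.map_unit, j.up.map_unit]
  exact congrArg _ (unitsMap_comp _ _ _).symm

lemma match_one {V : w.base.Etale} {Y : z.base.Etale} (t : dom V ⟶ dom Y) :
    Match i j t 1 1 := by
  refine ⟨fun {V₁} l hl hlt => ?_⟩
  rw [map_one, map_one]

/-- Both sections become the image of `m` under `w'.f`, as `i` and `j` are arrows of log points in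
`X`. -/
lemma match_f {V : w.base.Etale} {Y : z.base.Etale} {T : X.base.Etale} (t : dom V ⟶ dom Y)
    (s : dom Y ⟶ dom T) (hs : s ≫ str T = str Y ≫ z.f.base)
    (hts : (t ≫ s) ≫ str T = str V ≫ w.f.base) (m : sec X.log.M T) :
    Match i j t (z.f.map s hs m) (w.f.map (t ≫ s) hts m) := by
  refine ⟨fun {V₁} l hl hlt => ?_⟩
  rw [← j.f_map _ s hlt hs (j.over_f hlt hs), ← i.f_map l _ hl hts (i.over_f hl hts)]
  exact w'.f.map_congr (Category.assoc _ _ _).symm _ _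

lemma exists_point_above [IsIso i.up.base] {V : w.base.Etale} (x : dom V) :
    ∃ (V' : w'.base.Etale) (k : dom V' ⟶ dom V) (_ : dom V'), k ≫ str V = str V' ≫ i.up.base ∧
      IsIso k := by
  have : IsIso (etFst i.up.base V) :=
    inferInstanceAs (IsIso (pullback.fst (str V) i.up.base))
  exact ⟨etPb i.up.base V, etFst i.up.base V, inv (etFst i.up.base V) x, etFst_str _ _, this⟩

variable [IsIso i.up.base]

/-- If `q` and `r` have the same degree, then `r` can be changed by a unit to match `q`. -/
lemma exists_match (hb : i.up.base ≫ b = j.up.base) {V : w.base.Etale} {Y : z.base.Etale}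
    {t : dom V ⟶ dom Y} (h : t ≫ str Y = str V ≫ b) {q : sec z.log'.M Y} {r : sec w.log'.M V}
    {p : P} (hq : z.IsDeg p q) (hr : w.IsDeg p r) :
    ∃ v : (fn (dom V))ˣ, Match i j t q (w.log'.unit V v * r) := by
  have : IsIso (etFst i.up.base V) :=
    inferInstanceAs (IsIso (pullback.fst (str V) i.up.base))
  -- In `w'` the images of `r` and `q` have the same degree and differ by a unit, which is carried
  -- back to `V` by the isomorphism `k`.
  let k := etFst i.up.base V
  have hk : k ≫ str V = str (etPb i.up.base V) ≫ i.up.base := etFst_str _ _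
  have hkt := over_match hb h hk
  obtain ⟨v, hv⟩ := (i.preservesDeg k hk p r hr).exists_unit (j.preservesDeg _ hkt p q hq)
  refine ⟨unitsMap (inv k) v, ⟨fun {V'} l hl hlt => ?_⟩⟩
  have e : mor (etLift i.up.base l hl) ≫ k = l := etLift_fst _ _ _
  have e' : mor (etLift i.up.base l hl) ≫ k ≫ t = l ≫ t := by rw [← Category.assoc, e]
  rw [← j.up.map_congr e' (over_comp _ hkt), ← i.up.map_congr e (over_comp _ hk), i.up.map_left _ k hk,
    j.up.map_left _ (k ≫ t) hkt, hv, map_mul, i.up.map_unit]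
  change _ = rs w'.log'.M _ (w'.log'.unit _ v * _)
  congr 3
  change unitsMap k (unitsMap (inv k) v) = v
  rw [← unitsMap_comp, IsIso.hom_inv_id, unitsMap_id]

/-- On `Q` the map `i.up` is injective: it preserves degrees, so `r` and `r'` have one degree and
differ by a unit, and that unit becomes `1` under an isomorphism of schemes. -/
lemma Match.uniq (hb : i.up.base ≫ b = j.up.base) {V : w.base.Etale} {Y : z.base.Etale}
    {t : dom V ⟶ dom Y} (h : t ≫ str Y = str V ≫ b) {q : sec z.log'.M Y} {r r' : sec w.log'.M V}
    (hr : w.IsQ r) (hr' : w.IsQ r') (H : Match i j t q r) (H' : Match i j t q r') : r = r' := by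
  refine sec_ext _ fun x => ?_
  obtain ⟨W, g, w₁, p, e₁, h₁⟩ := hr.exists_isDeg x
  obtain ⟨W', g', w₂, p', e₂, h₂⟩ := (hr'.res g).exists_isDeg w₁
  refine ⟨W', g' ≫ g, w₂, by rw [← e₁, ← e₂]; rfl, ?_⟩
  have h₁ := h₁.res g'
  rw [← rs_comp] at h₁ h₂
  have K := H.res (t' := mor (g' ≫ g) ≫ t) (k := 𝟙 Y) (g := g' ≫ g)
    (by rw [mor_id, Category.comp_id])
  have K' := H'.res (t' := mor (g' ≫ g) ≫ t) (k := 𝟙 Y) (g := g' ≫ g)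
    (by rw [mor_id, Category.comp_id])
  have : IsIso (etFst i.up.base W') :=
    inferInstanceAs (IsIso (pullback.fst (str W') i.up.base))
  let k := etFst i.up.base W'
  have hk : k ≫ str W' = str (etPb i.up.base W') ≫ i.up.base := etFst_str _ _
  have hkt := over_match hb (over_comp (g' ≫ g) h) hk
  have e := (K.eq k hk hkt).trans (K'.eq k hk hkt).symm
  have a₁ := i.preservesDeg k hk p _ h₁
  rw [e] at a₁
  obtain rfl := a₁.unique (i.preservesDeg k hk p' _ h₂) (inv k w₂)
  obtain ⟨v, hv⟩ := h₁.exists_unit h₂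
  rw [hv, map_mul, i.up.map_unit] at e
  have e' : w'.log'.unit _ 1 * i.up.map k hk (rs w.log'.M (g' ≫ g) r) =
    w'.log'.unit _ (unitsMap k v) * i.up.map k hk (rs w.log'.M (g' ≫ g) r) := by
      rw [map_one, one_mul]; exact e
  have e'' := w'.log'.unit_injective _ (mul_right_cancel e')
  have : v = 1 := by
    rw [← unitsMap_id v, ← IsIso.inv_hom_id k, unitsMap_comp, ← e'', map_one]
  rw [hv, this, map_one, one_mul]

/-- The degree of `f_w(m)` is that of `f_z(m)`, since both are seen in `w'`; a unit then adjusts the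
`Q`-part of any decomposition of `f_w(m)` to match `q`. -/
lemma exists_decomp_match (hb : i.up.base ≫ b = j.up.base) {V : w.base.Etale} {Y : z.base.Etale}
    {t : dom V ⟶ dom Y} (h : t ≫ str Y = str V ≫ b) {T : X.base.Etale}
    {s : dom Y ⟶ dom T} (hs : s ≫ str T = str Y ≫ z.f.base)
    (hts : (t ≫ s) ≫ str T = str V ≫ w.f.base) {m : sec X.log.M T} {n : sec z.log.M Y} {p : P}
    {q : sec z.log'.M Y} (hq : z.IsDeg p q) (e : z.f.map s hs m = ap z.π Y n * q) (x : dom V) :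
    ∃ (V' : w.base.Etale) (g : V' ⟶ V) (x' : dom V') (y : sec w.log.M V') (r : sec w.log'.M V'),
      mor g x' = x ∧ w.IsQ r ∧ Match i j (mor g ≫ t) q r ∧
      rs _ g (w.f.map (t ≫ s) hts m) = ap w.π V' y * r := by
  obtain ⟨V', g, x', y, p', r, e₁, hr, e₂⟩ := w.exists_isDeg (w.f.map (t ≫ s) hts m) x
  have h' := over_comp g h
  obtain ⟨V'', k, x'', hk, -⟩ := exists_point_above (i := i) x'
  have hkt := over_match hb h' hk
  have H := ((match_f (i := i) (j := j) t s hs hts m).res (t' := mor g ≫ t) (k := 𝟙 Y) (g := g)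
    (by rw [mor_id, Category.comp_id])).eq k hk hkt
  rw [rs_id, e, e₂, map_mul, map_mul, i.up_π k hk (by rw [hk, i.base_eq]),
    j.up_π _ hkt (by rw [hkt, j.base_eq])] at H
  obtain rfl := (i.preservesDeg k hk p' _ hr).deg_eq (j.preservesDeg _ hkt p _ hq) H x''
  obtain ⟨v, hv⟩ := exists_match hb h' hq hr
  refine ⟨V', g, x', w.log.unit V' v⁻¹ * y, _, e₁, hr.isQ.unit_mul v, hv, ?_⟩
  rw [e₂, map_mul, w.π_unit, mul_mul_mul_comm, ← map_mul, inv_mul_cancel, map_one, one_mul]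

end
end PLogPointIn
end
end LogGeom

namespace LogGeom
noncomputable section

/-! ### Basic log points are minimal. -/

namespace PLogPointIn
open PLogPoint
variable {P : Type u} [CommMonoid P] {X : IntLogSch.{u}} {w' w z : PLogPointIn P X}
variable {i : w' ⟶ w} {j : w' ⟶ z} {b : w.base ⟶ z.base}

lemma base_f_eq [IsIso i.up.base] (hb : i.up.base ≫ b = j.up.base) : b ≫ z.f.base = w.f.base := by
  rw [← cancel_epi i.up.base, ← Category.assoc, hb]
  exact (congrArg LogMap.base j.f).trans (congrArg LogMap.base i.f).symm

/-- The relation defining the map of log structures from a basic log point. -/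
def LowRel (i : w' ⟶ w) (j : w' ⟶ z) {V : w.base.Etale} {Y : z.base.Etale} (t : dom V ⟶ dom Y)
    (n : sec z.log.M Y) (y : sec w.log.M V) : Prop :=
  ∃ (T : X.base.Etale) (s : dom Y ⟶ dom T) (hs : s ≫ str T = str Y ≫ z.f.base)
    (hts : (t ≫ s) ≫ str T = str V ≫ w.f.base) (m : sec X.log.M T) (q : sec z.log'.M Y)
    (r : sec w.log'.M V), z.IsQ q ∧ w.IsQ r ∧ Match i j t q r ∧
    z.f.map s hs m = ap z.π Y n * q ∧ w.f.map (t ≫ s) hts m = ap w.π V y * r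

lemma LowRel.pair {V : w.base.Etale} {Y : z.base.Etale} {t : dom V ⟶ dom Y}
    {n n' : sec z.log.M Y} {y y' : sec w.log.M V} (R : LowRel i j t n y) (R' : LowRel i j t n' y') :
    ∃ (T : X.base.Etale) (s : dom Y ⟶ dom T) (hs : s ≫ str T = str Y ≫ z.f.base)
      (hts : (t ≫ s) ≫ str T = str V ≫ w.f.base) (m m' : sec X.log.M T) (q q' : sec z.log'.M Y)
      (r r' : sec w.log'.M V), (z.IsQ q ∧ w.IsQ r ∧ Match i j t q r ∧
      z.f.map s hs m = ap z.π Y n * q ∧ w.f.map (t ≫ s) hts m = ap w.π V y * r) ∧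
      z.IsQ q' ∧ w.IsQ r' ∧ Match i j t q' r' ∧
      z.f.map s hs m' = ap z.π Y n' * q' ∧ w.f.map (t ≫ s) hts m' = ap w.π V y' * r' := by
  obtain ⟨T, s, hs, hts, m, q, r, h₁, h₂, h₃, h₄, h₅⟩ := R
  obtain ⟨T', s', hs', hts', m', q', r', h₁', h₂', h₃', h₄', h₅'⟩ := R'
  obtain ⟨T₃, l, l', s₃, e₆, e₇, e₈⟩ := exists_prod_lift s s' (hs.trans hs'.symm)
  have a₁ : (t ≫ s₃) ≫ mor l = t ≫ s := by rw [Category.assoc, e₆]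
  have a₂ : (t ≫ s₃) ≫ mor l' = t ≫ s' := by rw [Category.assoc, e₇]
  refine ⟨T₃, s₃, e₈.trans hs, by rw [← mor_str l, ← Category.assoc, a₁, hts], rs _ l m, rs _ l' m',
    q, q', r, r', ⟨h₁, h₂, h₃, ?_, ?_⟩, h₁', h₂', h₃', ?_, ?_⟩
  · rw [← z.f.map_right, z.f.map_congr e₆, h₄]
  · rw [← w.f.map_right, w.f.map_congr a₁, h₅]
  · rw [← z.f.map_right, z.f.map_congr e₇, h₄']
  · rw [← w.f.map_right, w.f.map_congr a₂, h₅']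

lemma LowRel.res {V V' : w.base.Etale} {Y Y' : z.base.Etale} {t : dom V ⟶ dom Y}
    {t' : dom V' ⟶ dom Y'} {g : V' ⟶ V} {k : Y' ⟶ Y} (e : t' ≫ mor k = mor g ≫ t)
    {n : sec z.log.M Y} {y : sec w.log.M V} (R : LowRel i j t n y) :
    LowRel i j t' (rs _ k n) (rs _ g y) := by
  obtain ⟨T, s, hs, hts, m, q, r, h₁, h₂, h₃, h₄, h₅⟩ := R
  have a : t' ≫ mor k ≫ s = mor g ≫ t ≫ s := by rw [← Category.assoc, e, Category.assoc]
  refine ⟨T, mor k ≫ s, over_comp k hs, by rw [a]; exact over_comp g hts, m, _, _, h₁.res k, h₂.res g,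
    h₃.res e, ?_, ?_⟩
  · rw [z.f.map_left k s hs, h₄, map_mul, rs_ap]
  · rw [w.f.map_congr a, w.f.map_left g _ hts, h₅, map_mul, rs_ap]

lemma LowRel.map_eq {V : w.base.Etale} {Y : z.base.Etale} {t : dom V ⟶ dom Y}
    {n : sec z.log.M Y} {y : sec w.log.M V} (R : LowRel i j t n y) {V' : w'.base.Etale}
    (k : dom V' ⟶ dom V) (hk : k ≫ str V = str V' ≫ i.low.base)
    (hkt : (k ≫ t) ≫ str Y = str V' ≫ j.low.base) : i.low.map k hk y = j.low.map (k ≫ t) hkt n := by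
  obtain ⟨T, s, hs, hts, m, q, r, h₁, h₂, h₃, h₄, h₅⟩ := R
  have hk' : k ≫ str V = str V' ≫ i.up.base := by rw [hk, i.base_eq]
  have hkt' : (k ≫ t) ≫ str Y = str V' ≫ j.up.base := by rw [hkt, j.base_eq]
  have e := (match_f (i := i) (j := j) t s hs hts m).eq k hk' hkt'
  rw [h₄, h₅, map_mul, map_mul, i.up_π k hk' hk, j.up_π _ hkt' hkt, h₃.eq k hk' hkt'] at e
  exact w'.π_injective (mul_right_cancel e)

/-- Being a unit is detected by `α`, which `i` respects, and `k` does not change functions. -/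
lemma unit_of_map_unit {V : w.base.Etale} {V' : w'.base.Etale} {k : dom V' ⟶ dom V} [IsIso k]
    {hk : k ≫ str V = str V' ≫ i.low.base} {a : sec w.log.M V} {c : (fn (dom V'))ˣ}
    (e : i.low.map k hk a = w'.log.unit V' c) : a = w.log.unit V (unitsMap (inv k) c) := by
  refine w.log.eq_unit ?_
  have h := i.low.map_al k hk a
  rw [e, show w'.lower.log.al V' (w'.log.unit V' c) = c from w'.log.al_unit V' c] at h
  change _ = fnMap (inv k) (c : fn (dom V'))
  rw [h, ← fnMap_comp, IsIso.inv_hom_id, fnMap_id]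

variable [IsIso i.up.base]

/-- If `f` maps a section of `M_X` to a section with trivial component in `M_Z`, then it has trivial
component in `M_W`. -/
lemma isQ_f (hb : i.up.base ≫ b = j.up.base) {V : w.base.Etale} {Y : z.base.Etale}
    {t : dom V ⟶ dom Y} (h : t ≫ str Y = str V ≫ b) {T : X.base.Etale} {s : dom Y ⟶ dom T}
    (hs : s ≫ str T = str Y ≫ z.f.base) (hts : (t ≫ s) ≫ str T = str V ≫ w.f.base)
    {l : sec X.log.M T} (hl : z.IsQ (z.f.map s hs l)) : w.IsQ (w.f.map (t ≫ s) hts l) := by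
  refine IsQ.of_local fun x => ?_
  obtain ⟨V₁, g, v₁, a, r, e₁, hr, e₂⟩ := w.exists_isQ (w.f.map (t ≫ s) hts l) x
  have h' := over_comp g h
  obtain ⟨V₂, k, v₂, hk, hi⟩ := exists_point_above (i := i) v₁
  have hkt := over_match hb h' hk
  have hk' : k ≫ str V₁ = str V₂ ≫ i.low.base := by rw [hk, i.base_eq]
  have H := ((match_f (i := i) (j := j) t s hs hts l).res (t' := mor g ≫ t) (k := 𝟙 Y) (g := g)
    (by rw [mor_id, Category.comp_id])).eq k hk hkt
  rw [rs_id, e₂, map_mul, i.up_π k hk hk'] at H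
  have hQ := j.isQ _ hkt hl
  rw [← H] at hQ
  -- In `w'` the product of the image of `a` with a section of `Q` lies in `Q` again, because it is
  -- also the image of `f_z(l)`. So the image of `a` is a unit, and hence so is `a`.
  have hu : w'.IsDeg 1 (ap w'.π V₂ (i.low.map k hk' a)) := IsDeg.of_local fun y => by
    obtain ⟨V₃, g₃, v₃, c, e₃, e₄⟩ := (i.isQ k hk hr).unit_of_mul hQ y
    refine ⟨V₃, g₃, v₃, e₃, ?_⟩
    rw [rs_ap, e₄, w'.π_unit]
    exact isDeg_unit c
  obtain ⟨c, hc⟩ := hu.eq_unit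
  rw [← w'.π_unit] at hc
  refine ⟨V₁, g, v₁, e₁, ?_⟩
  rw [e₂, unit_of_map_unit (w'.π_injective hc), w.π_unit]
  exact hr.unit_mul _

/-- Basicness of `z` gives `m l = m' l'` with `f(l)`, `f(l')` in `Q`. Over `z`, cancelling `n`
leaves `q f(l) = q' f(l')`; by uniqueness of matches `r f(l) = r' f(l')` over `w`. In `y r f(l) = y'
r' f(l')` these factors cancel. -/
lemma LowRel.uniq (hz : LocBasic z) (hb : i.up.base ≫ b = j.up.base) {V : w.base.Etale}
    {Y : z.base.Etale} {t : dom V ⟶ dom Y} (h : t ≫ str Y = str V ≫ b) {n : sec z.log.M Y}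
    {y y' : sec w.log.M V} (R : LowRel i j t n y) (R' : LowRel i j t n y') : y = y' := by
  obtain ⟨T, s, hs, hts, m, m', q, q', r, r', ⟨h₁, h₂, h₃, h₄, h₅⟩, h₁', h₂', h₃', h₄', h₅'⟩ := R.pair R'
  refine sec_ext _ fun x => ?_
  obtain ⟨W, g, w₁, T', k, s', hs', l, l', e₁, e₂, hl, hl', e₃⟩ :=
    hz.inj s hs m m' n q q' h₁ h₁' h₄ h₄' (t x)
  obtain ⟨V', g', v', t', a₁, -, a₂⟩ := exists_lift t g x w₁ e₁
  have h' := over_square a₂ h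
  have a₃ : (t' ≫ s') ≫ mor k = mor g' ≫ t ≫ s := by
    rw [Category.assoc, e₂, ← Category.assoc, a₂, Category.assoc]
  have hts' := over_square a₃ hts
  refine ⟨V', g', v', a₁, w.π_injective ?_⟩
  have E := congrArg (z.f.map s' hs') e₃
  rw [map_mul, map_mul, z.f.map_square e₂ hs, z.f.map_square e₂ hs, h₄, h₄', map_mul, map_mul,
    mul_assoc, mul_assoc] at E
  have E' := congrArg (w.f.map _ hts') e₃
  rw [map_mul, map_mul, w.f.map_square a₃ hts, w.f.map_square a₃ hts, h₅, h₅', map_mul, map_mul,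
    mul_assoc, mul_assoc, rs_ap, rs_ap] at E'
  have K := (h₃.res a₂).mul (match_f (i := i) (j := j) t' s' hs' hts' l)
  have K' := (h₃'.res a₂).mul (match_f (i := i) (j := j) t' s' hs' hts' l')
  rw [← mul_left_cancel E] at K'
  have := K.uniq hb h' ((h₂.res g').mul (isQ_f hb h' hs' hts' hl))
    ((h₂'.res g').mul (isQ_f hb h' hs' hts' hl')) K'
  rw [this] at E'
  exact mul_right_cancel E'

lemma exists_lowRel (hz : LocBasic z) (hb : i.up.base ≫ b = j.up.base) {V : w.base.Etale}
    {Y : z.base.Etale} (t : dom V ⟶ dom Y) (h : t ≫ str Y = str V ≫ b) (n : sec z.log.M Y)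
    (x : dom V) : ∃ (V' : w.base.Etale) (g : V' ⟶ V) (v' : dom V') (Y' : z.base.Etale) (k : Y' ⟶ Y)
      (t' : dom V' ⟶ dom Y') (_ : t' ≫ str Y' = str V' ≫ b) (y : sec w.log.M V'),
      mor g v' = x ∧ t' ≫ mor k = mor g ≫ t ∧ LowRel i j t' (rs _ k n) y := by
  obtain ⟨Y₁, k₁, y₁, T, s, hs, m, q₁, e₁, hq₁, e₂⟩ := hz.ex n (t x)
  obtain ⟨Y₂, k₂, y₂, p, e₃, hp⟩ := hq₁.exists_isDeg y₁
  obtain ⟨V₁, g₁, v₁, t₁, a₁, -, a₂⟩ := exists_lift t (k₂ ≫ k₁) x y₂ (by rw [← e₁, ← e₃]; rfl)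
  have h₁ := over_square a₂ h
  have e₄ : z.f.map (mor k₂ ≫ s) (over_comp k₂ hs) m =
      ap z.π Y₂ (rs _ (k₂ ≫ k₁) n) * rs _ k₂ q₁ := by
    rw [z.f.map_left k₂ s hs, e₂, map_mul, rs_ap, rs_comp]
  have hts : (t₁ ≫ mor k₂ ≫ s) ≫ str T = str V₁ ≫ w.f.base := by
    rw [Category.assoc, over_comp k₂ hs, ← Category.assoc, h₁, Category.assoc, base_f_eq hb]
  obtain ⟨V₂, g₂, v₂, y, r, b₁, hr, H, b₂⟩ := exists_decomp_match hb h₁ (over_comp k₂ hs) hts hp e₄ v₁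
  have a₃ : (mor g₂ ≫ t₁) ≫ mor (k₂ ≫ k₁) = mor (g₂ ≫ g₁) ≫ t := by
    rw [Category.assoc, a₂, mor_comp, Category.assoc]
  refine ⟨V₂, g₂ ≫ g₁, v₂, Y₂, k₂ ≫ k₁, mor g₂ ≫ t₁, over_comp g₂ h₁, y, by rw [← a₁, ← b₁]; rfl, a₃,
    T, mor k₂ ≫ s, over_comp k₂ hs, by rw [Category.assoc]; exact over_comp g₂ hts, m, _, r, hp.isQ,
    hr, H, e₄, ?_⟩
  rw [w.f.map_congr (Category.assoc _ _ _), w.f.map_left g₂ _ hts, b₂]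

theorem exists_low (hz : LocBasic z) (hb : i.up.base ≫ b = j.up.base) :
    ∃ low : w.lower ⟶ z.lower, low.base = b ∧ ∀ {V : w.base.Etale} {Y : z.base.Etale}
      (t : dom V ⟶ dom Y) (h : t ≫ str Y = str V ≫ low.base) (n : sec z.log.M Y) (y : sec w.log.M V),
      LowRel i j t n y → low.map t h n = y := by
  obtain ⟨F, hF⟩ := Family.exists_of_rel (b := b) (B := z.log.M) (A := w.log.M)
    (fun t h n y => LowRel i j t n y)
    (fun t t' g k h h' x y e R => R.res e)
    (fun t h n x => exists_lowRel hz hb t h n x)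
    (fun t h n y y' R R' => R.uniq hz hb h R')
    (by
      intro V Y t h y R
      have hY : t ≫ str Y ≫ z.f.base = str V ≫ w.f.base := by
        rw [← Category.assoc, h, Category.assoc, base_f_eq hb]
      refine R.uniq hz hb h ⟨etMk (𝟙 X.base) inferInstance, str Y ≫ z.f.base, Category.comp_id _, ?_,
        1, 1, 1, isQ_one, isQ_one, match_one t, ?_, ?_⟩
      · exact (Category.comp_id _).trans hY
      · rw [map_one, map_one, one_mul]
      · rw [map_one, map_one, one_mul])
    (by
      intro V Y t h n n' y y' R R'
      obtain ⟨T, s, hs, hts, m, m', q, q', r, r', ⟨h₁, h₂, h₃, h₄, h₅⟩, h₁', h₂', h₃', h₄', h₅'⟩ :=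
        R.pair R'
      refine ⟨T, s, hs, hts, m * m', q * q', r * r', h₁.mul h₁', h₂.mul h₂', h₃.mul h₃', ?_, ?_⟩
      · rw [map_mul, map_mul, h₄, h₄', mul_mul_mul_comm]
      · rw [map_mul, map_mul, h₅, h₅', mul_mul_mul_comm])
  let low : LogMap w.lower z.lower := F.logMap (Y := w.lower) (X := z.lower) fun {V Y} t h n => by
    refine sec_ext (strSheaf _) fun x => ?_
    obtain ⟨V₁, g₁, v₁, Y₁, k₁, t₁, h₁, y, a₁, a₂, R⟩ := exists_lowRel hz hb t h n x
    refine ⟨V₁, g₁, v₁, a₁, ?_⟩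
    change fnMap (mor g₁) _ = fnMap (mor g₁) _
    rw [← w.log.al_rs, ← F.map_square a₂ h h₁, hF t₁ h₁ _ y R, ← fnMap_comp, ← a₂, fnMap_comp,
      ← z.log.al_rs]
    -- Compatibility with `α` is checked in `w'`, where `y` and `n` have the same image, and
    -- transported back along the isomorphism `k`.
    obtain ⟨V₂, k, v₂, hk, hi⟩ := exists_point_above (i := i) v₁
    have hk' : k ≫ str V₁ = str V₂ ≫ i.low.base := by rw [hk, i.base_eq]
    have hkt : (k ≫ t₁) ≫ str Y₁ = str V₂ ≫ j.low.base := by rw [over_match hb h₁ hk, j.base_eq]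
    have e := congrArg (w'.log.al V₂) (R.map_eq k hk' hkt)
    have e₁ := i.low.map_al k hk' y
    have e₂ := j.low.map_al (k ≫ t₁) hkt (rs _ k₁ n)
    have e₃ := congrArg (fnMap (inv k)) ((e₁.symm.trans e).trans e₂)
    rw [← fnMap_comp, ← fnMap_comp, IsIso.inv_hom_id, IsIso.inv_hom_id_assoc, fnMap_id] at e₃
    exact e₃
  exact ⟨low, rfl, fun t h n y R => hF t h n y R⟩


/-- A basic log point receives an arrow extending a given one. -/
theorem exists_extend (hz : LocBasic z) (hb : i.up.base ≫ b = j.up.base) :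
    ∃ φ : w ⟶ z, i ≫ φ = j := by
  obtain ⟨low, hlb, hlow⟩ := exists_low hz hb
  let c : LogMap w.upper z.lower := LogMap.comp w.proj low
  have hc : c.base = b := (Category.id_comp _).trans hlb
  have hcm {V : w.base.Etale} {Y : z.base.Etale} (t : dom V ⟶ dom Y) (h : t ≫ str Y = str V ≫ c.base)
      (h' : t ≫ str Y = str V ≫ low.base) (n : sec z.log.M Y) :
      c.map t h n = ap w.π V (low.map t h' n) := by
    have e₁ : (𝟙 (dom V)) ≫ str V = str V ≫ w.proj.base := by
      rw [Category.id_comp]; exact (Category.comp_id _).symm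
    rw [← proj_map e₁, ← LogMap.comp_map w.proj low (𝟙 _) t e₁ h' (by rwa [Category.id_comp])]
    exact LogMap.map_congr (LogMap.comp w.proj low) (Category.id_comp t).symm _ n
  -- On `M_Z` the arrow is `low`; on `Q` it is the identification through `w'`. The two agree on
  -- units, so they define a morphism to `Z'`.
  obtain ⟨up, hub, hπ, hq⟩ := exists_family z.toPLogPoint (W := w.upper) c
    (fun {V Y} t h q r => z.IsQ q ∧ w.IsQ r ∧ Match i j t q r)
    (fun t t' g k h h' q r e R => ⟨R.1.res k, R.2.1.res g, R.2.2.res e⟩)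
    (fun t h q r R => R.1)
    (by
      intro V Y t h q hq x
      rw [hc] at h
      obtain ⟨Y₁, k₁, y₁, p, e₁, hp⟩ := hq.exists_isDeg (t x)
      obtain ⟨V₁, g₁, v₁, t₁, a₁, -, a₂⟩ := exists_lift t k₁ x y₁ e₁
      obtain ⟨V₂, g₂, v₂, a, b₁⟩ := exists_section w.cover_surj v₁
      have h₁ := over_square a₂ h
      obtain ⟨v, H⟩ := exists_match hb (over_comp g₂ h₁) hp (isDeg_frame' (z := w.toPLogPoint) a p)
      refine ⟨V₂, g₂ ≫ g₁, v₂, Y₁, k₁, mor g₂ ≫ t₁, by rw [hc]; exact over_comp g₂ h₁, _,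
        by rw [← a₁, ← b₁]; rfl, ?_, hp.isQ, isQ_frame (z := w.toPLogPoint) a p v, H⟩
      rw [Category.assoc, a₂, mor_comp, Category.assoc])
    (by
      rintro V Y t h q r r' ⟨-, h₁, h₂⟩ ⟨-, h₁', h₂'⟩
      rw [hc] at h
      exact h₂.uniq hb h h₁ h₁' h₂')
    (by
      rintro V Y t h v r ⟨-, h₁, h₂⟩
      rw [hc] at h
      exact h₂.uniq hb h h₁ (isQ_unit _) (match_unit t v))
    (fun t h q q' r r' R R' => ⟨R.1.mul R'.1, R.2.1.mul R'.2.1, R.2.2.mul R'.2.2⟩)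
    (by
      rintro V Y t h q r ⟨-, -, H⟩
      rw [hc] at h
      have : IsIso (etFst i.up.base V) :=
        inferInstanceAs (IsIso (pullback.fst (str V) i.up.base))
      let k := etFst i.up.base V
      have hk : k ≫ str V = str (etPb i.up.base V) ≫ i.up.base := etFst_str _ _
      have hkt := over_match hb h hk
      have e := congrArg (w'.log'.al _) (H.eq k hk hkt)
      have e₁ := i.up.map_al k hk r
      have e₂ := j.up.map_al (k ≫ t) hkt q
      have e₃ := congrArg (fnMap (inv k)) ((e₁.symm.trans e).trans e₂)
      rw [← fnMap_comp, ← fnMap_comp, IsIso.inv_hom_id, IsIso.inv_hom_id_assoc, fnMap_id] at e₃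
      exact e₃)
  have hub' : up.base = low.base := hub.trans (hc.trans hlb.symm)
  have hupπ : ∀ {V : w.base.Etale} {Y : z.base.Etale}
    (t : dom V ⟶ dom Y) (h : t ≫ str Y = str V ≫ up.base) (h' : t ≫ str Y = str V ≫ low.base)
    (n : sec z.log.M Y), up.map t h (ap z.π Y n) = ap w.π V (low.map t h' n) :=
    fun t h h' n => (hπ t (hub ▸ h) n).trans (hcm t _ h' n)
  have hupq : ∀ {V : w.base.Etale} {Y : z.base.Etale} (t : dom V ⟶ dom Y)
      (h : t ≫ str Y = str V ≫ up.base) {q : sec z.log'.M Y} {r : sec w.log'.M V}, z.IsQ q →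
      w.IsQ r → Match i j t q r → up.map t h q = r :=
    fun t h q r h₁ h₂ h₃ => hq t (hub ▸ h) q r ⟨h₁, h₂, h₃⟩
  have hupb : up.base = b := hub'.trans hlb
  have hloc : ∀ {V : w.base.Etale} {Y : z.base.Etale} (t : dom V ⟶ dom Y)
      (_ : t ≫ str Y = str V ≫ b) {p : P} {q : sec z.log'.M Y}, z.IsDeg p q → ∀ x : dom V,
      ∃ (V' : w.base.Etale) (g : V' ⟶ V) (v : dom V') (r : sec w.log'.M V'), mor g v = x ∧
        w.IsDeg p r ∧ Match i j (mor g ≫ t) q r := by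
    intro V Y t h p q hq x
    obtain ⟨V₂, g₂, v₂, a, b₁⟩ := exists_section w.cover_surj x
    obtain ⟨v, H⟩ := exists_match hb (over_comp g₂ h) hq (isDeg_frame' (z := w.toPLogPoint) a p)
    exact ⟨V₂, g₂, v₂, _, b₁, isDeg_frame (z := w.toPLogPoint) a p v, H⟩
  have hd : PreservesDeg (z := w.toPLogPoint) (y := z.toPLogPoint) up := by
    intro V Y t h p q hq
    refine IsDeg.of_local fun x => ?_
    obtain ⟨V', g, v, r, e₁, hr, H⟩ := hloc t (hupb ▸ h) hq x
    refine ⟨V', g, v, e₁, ?_⟩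
    rw [← up.map_left g t h, hupq _ _ hq.isQ hr.isQ H]
    exact hr
  -- Locally `f_z(m) = n q` goes to `y r`, and `y` was defined so that `y r = f_w(m)`.
  have hf : up ≫ z.f = w.f := by
    refine LogMap.ext' ((congrArg (· ≫ z.f.base) hupb).trans (base_f_eq hb)) ?_
    intro V T r h₁ h₂ m
    obtain ⟨Y, t, s, ht, hs, rfl⟩ := LogMap.exists_factor up z.f r h₁
    refine (LogMap.comp_map up z.f t s ht hs _ m).trans (sec_ext _ fun x => ?_)
    obtain ⟨Y₁, k₁, y₁, n, p, q, e₁, hp, e₂⟩ := z.exists_isDeg (z.f.map s hs m) (t x)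
    obtain ⟨V₁, g₁, v₁, t₁, a₁, -, a₂⟩ := exists_lift t k₁ x y₁ e₁
    have ht₁ := over_square a₂ ht
    have ht₁' : t₁ ≫ str Y₁ = str V₁ ≫ b := hupb ▸ ht₁
    have a₃ : t₁ ≫ mor k₁ ≫ s = mor g₁ ≫ t ≫ s := by
      rw [← Category.assoc, a₂, Category.assoc]
    have hts : (t₁ ≫ mor k₁ ≫ s) ≫ str T = str V₁ ≫ w.f.base := by
      rw [a₃]; exact over_comp g₁ h₂
    rw [← z.f.map_left k₁ s hs] at e₂
    obtain ⟨V₂, g₂, v₂, y, r, b₁, hr, H, b₂⟩ :=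
      exists_decomp_match hb ht₁' (over_comp k₁ hs) hts hp e₂ v₁
    refine ⟨V₂, g₂ ≫ g₁, v₂, by rw [← a₁, ← b₁]; rfl, ?_⟩
    have R : LowRel i j (mor g₂ ≫ t₁) n y := ⟨T, mor k₁ ≫ s, over_comp k₁ hs,
      by rw [Category.assoc]; exact over_comp g₂ hts, m, q, r, hp.isQ, hr, H, e₂,
      by rw [w.f.map_congr (Category.assoc _ _ _), w.f.map_left g₂ _ hts, b₂]⟩
    have hl : (mor g₂ ≫ t₁) ≫ str Y₁ = str V₂ ≫ low.base := hub' ▸ over_comp g₂ ht₁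
    rw [rs_comp, rs_comp, ← w.f.map_left g₁ _ h₂, ← w.f.map_congr a₃ hts, b₂,
      ← up.map_square a₂ ht ht₁, ← z.f.map_left k₁ s hs, e₂, ← up.map_left g₂ t₁ ht₁, map_mul,
      hupπ _ _ hl, hlow _ hl _ _ R, hupq _ _ hp.isQ hr H]
  have hsq : up ≫ z.proj = w.proj ≫ low := sq_of_up_π hub' hupπ
  have hlj : i.low ≫ low = j.low := by
    refine LogMap.ext' ((congrArg (i.low.base ≫ ·) hlb).trans
      (by rw [← i.base_eq, ← j.base_eq, hb])) ?_
    intro V Y r h₁ h₂ n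
    obtain ⟨W, t, s, ht, hs, rfl⟩ := LogMap.exists_factor i.low low r h₁
    refine (LogMap.comp_map i.low low t s ht hs _ n).trans (sec_ext _ fun x => ?_)
    obtain ⟨W₁, g₁, w₁, Y₁, k₁, s₁, hs₁, y, a₁, a₂, R⟩ := exists_lowRel hz hb s (hlb ▸ hs) n (t x)
    obtain ⟨V₁, l, v₁, t₁, c₁, -, c₂⟩ := exists_lift t g₁ x w₁ a₁
    have ht₁ := over_square c₂ ht
    have a₃ : (t₁ ≫ s₁) ≫ mor k₁ = mor l ≫ t ≫ s := by
      rw [Category.assoc, a₂, ← Category.assoc, c₂, Category.assoc]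
    refine ⟨V₁, l, v₁, c₁, ?_⟩
    rw [← i.low.map_square c₂ ht ht₁, ← low.map_square a₂ hs (hlb ▸ hs₁), hlow _ _ _ _ R,
      ← j.low.map_square a₃ h₂ (over_square a₃ h₂), R.map_eq t₁ ht₁ (over_square a₃ h₂)]
  refine ⟨homMk up low hsq hd hf, Hom.ext ?_ hlj⟩
  refine upper_hom_ext ((congrArg (i.up.base ≫ ·) hupb).trans hb) ?_ ?_
  · intro V Y r h₁ h₂ n
    obtain ⟨W, t, s, ht, hs, rfl⟩ := LogMap.exists_factor i.up up r h₁
    have ht' : t ≫ str W = str V ≫ i.low.base := by rw [ht, i.base_eq]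
    have hs' : s ≫ str Y = str W ≫ low.base := by rw [hs, hub']
    have h₂' : (t ≫ s) ≫ str Y = str V ≫ j.low.base := by rw [h₂, j.base_eq]
    refine (LogMap.comp_map i.up up t s ht hs _ _).trans ?_
    rw [hupπ s hs hs', i.up_π t ht ht', j.up_π _ h₂ h₂', ← LogMap.congr_map hlj (t ≫ s) (by
      rw [hlj]; exact h₂')]
    exact congrArg (ap w'.π V) (LogMap.comp_map i.low low t s ht' hs' _ n).symm
  · intro V Y r h₁ h₂ p q hq x
    obtain ⟨W, t, s, ht, hs, rfl⟩ := LogMap.exists_factor i.up up r h₁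
    obtain ⟨W₁, g, w₁, r, e₁, hr, H⟩ := hloc s (hupb ▸ hs) hq (t x)
    obtain ⟨V₁, l, v₁, t₁, c₁, -, c₂⟩ := exists_lift t g x w₁ e₁
    have ht₁ := over_square c₂ ht
    have a₃ : t₁ ≫ mor g ≫ s = mor l ≫ t ≫ s := by
      rw [← Category.assoc, c₂, Category.assoc]
    have h₃ : (t₁ ≫ mor g ≫ s) ≫ str Y = str V₁ ≫ j.up.base := by
      rw [a₃]; exact over_comp l h₂
    refine ⟨V₁, l, v₁, c₁, (congrArg (rs w'.log'.M l) (LogMap.comp_map i.up up t s ht hs h₁ q)).trans ?_⟩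
    rw [← i.up.map_square c₂ ht ht₁, ← up.map_left g s hs, hupq _ _ hq.isQ hr.isQ H,
      H.eq t₁ ht₁ h₃, ← j.up.map_left l _ h₂, j.up.map_congr a₃]

/-- Arrows to a basic log point are determined by their composite with an arrow over an isomorphism
of schemes. -/
theorem hom_ext_of_locBasic (hz : LocBasic z) {φ ψ : w ⟶ z} (e : i ≫ φ = i ≫ ψ) : φ = ψ := by
  have eu : i.up ≫ φ.up = i.up ≫ ψ.up := congrArg Hom.up e
  have hb : φ.up.base = ψ.up.base := by
    rw [← cancel_epi i.up.base]
    exact congrArg LogMap.base eu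
  have hm (χ : w ⟶ z) (hχ : i ≫ χ = i ≫ φ) {V : w.base.Etale} {Y : z.base.Etale} (t : dom V ⟶ dom Y)
      (h : t ≫ str Y = str V ≫ χ.up.base) (q : sec z.log'.M Y) :
      Match i (i ≫ φ) t q (χ.up.map t h q) := ⟨fun {V'} k hk hkt => by
    refine (LogMap.comp_map i.up χ.up k t hk h ?_ q).symm.trans
      (LogMap.congr_map (congrArg Hom.up hχ) _ _ _)
    rw [hkt]
    exact congrArg (str V' ≫ ·) (congrArg (fun f => f.up.base) hχ.symm)⟩
  -- Every arrow with the given composite satisfies the relations that defined the extension, on `Q`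
  -- and on components; their uniqueness determines it.
  have hR (χ : w ⟶ z) (hχ : i ≫ χ = i ≫ φ) {V : w.base.Etale} {Y : z.base.Etale} (t : dom V ⟶ dom Y)
      (h : t ≫ str Y = str V ≫ χ.up.base) (h' : t ≫ str Y = str V ≫ χ.low.base) {T : X.base.Etale}
      (s : dom Y ⟶ dom T) (hs : s ≫ str T = str Y ≫ z.f.base) (m : sec X.log.M T)
      (n : sec z.log.M Y) (q : sec z.log'.M Y) (hq : z.IsQ q) (e : z.f.map s hs m = ap z.π Y n * q) :
      LowRel i (i ≫ φ) t n (χ.low.map t h' n) :=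
    ⟨T, s, hs, χ.over_f h hs, m, q, χ.up.map t h q, hq, χ.isQ t h hq, hm χ hχ t h q, e, by
      rw [χ.f_map t s h hs, e, map_mul, χ.up_π t h h']⟩
  have hlb : φ.low.base = ψ.low.base := by rw [← φ.base_eq, ← ψ.base_eq, hb]
  have hl : φ.low = ψ.low := by
    refine LogMap.ext' hlb fun {V Y} t h₁ h₂ n => sec_ext _ fun x => ?_
    obtain ⟨W, g, w₁, T, s, hs, m, q, e₁, hq, e₂⟩ := hz.ex n (t x)
    obtain ⟨V₁, l, v₁, t₁, c₁, -, c₂⟩ := exists_lift t g x w₁ e₁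
    have h₁' := over_square c₂ h₁
    have h₂' := over_square c₂ h₂
    have h₃ : t₁ ≫ str W = str V₁ ≫ φ.up.base := by rw [h₁', φ.base_eq]
    have h₄ : t₁ ≫ str W = str V₁ ≫ ψ.up.base := by rw [h₂', ψ.base_eq]
    refine ⟨V₁, l, v₁, c₁, ?_⟩
    rw [← φ.low.map_square c₂ h₁ h₁', ← ψ.low.map_square c₂ h₂ h₂']
    exact (hR φ rfl t₁ h₃ h₁' s hs m _ q hq e₂).uniq hz (b := φ.up.base) rfl h₃
      (hR ψ e.symm t₁ h₄ h₂' s hs m _ q hq e₂)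
  refine Hom.ext (upper_hom_ext hb ?_ ?_) hl
  · intro V Y t h₁ h₂ n
    have h₁' : t ≫ str Y = str V ≫ φ.low.base := by rw [h₁, φ.base_eq]
    have h₂' : t ≫ str Y = str V ≫ ψ.low.base := by rw [h₂, ψ.base_eq]
    rw [φ.up_π t h₁ h₁', ψ.up_π t h₂ h₂', LogMap.congr_map hl]
  · intro V Y t h₁ h₂ p q hq x
    refine ⟨V, 𝟙 _, x, rfl, congrArg _ ?_⟩
    exact (hm φ rfl t h₁ q).uniq (b := φ.up.base) rfl h₁ (φ.isQ t h₁ hq.isQ) (ψ.isQ t h₂ hq.isQ)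
      (hm ψ e.symm t h₂ q)

end PLogPointIn

lemma OverId.isIso {𝒵 : Type*} [Category* 𝒵] {F : 𝒵 ⥤ IntLogSch.{u}} {w z : 𝒵} {i : w ⟶ z}
    (h : OverId F i) : IsIso (F.map i).base := by
  have h' : (F ⋙ underlying).IsHomLift (𝟙 ((F ⋙ underlying).obj w)) i := h
  have : IsIso ((F ⋙ underlying).map i) := by
    rw [IsHomLift.fac' (F ⋙ underlying) (𝟙 ((F ⋙ underlying).obj w)) i]
    infer_instance
  exact this

theorem PLogPointIn.LocBasic.isMinimal {P : Type u} [CommMonoid P] {X : IntLogSch.{u}}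
    {z : PLogPointIn P X} (hz : z.LocBasic) : IsMinimal (logPoints P X) z := by
  intro w w' i j hi hj
  have h₁ : IsIso i.up.base := by
    rw [i.base_eq]
    exact hi.isIso
  obtain ⟨φ, hφ⟩ := PLogPointIn.exists_extend (i := i) (j := j) hz (IsIso.hom_inv_id_assoc i.up.base _)
  exact ⟨φ, hφ, fun ψ hψ => PLogPointIn.hom_ext_of_locBasic hz (hψ.trans hφ.symm)⟩

end
end LogGeom

namespace LogGeom
noncomputable section

/-! ### Transporting a log point along a map of log structures. -/

section OfHom
variable {S : Scheme.{u}} {L N : IntLog S}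

/-- The morphism of log schemes over an identity given by a map of log structures. -/
def LogMap.ofHom (φ : N.M ⟶ L.M) (hφ : φ ≫ L.α = N.α) : LogMap ⟨S, L⟩ ⟨S, N⟩ where
  base := 𝟙 S
  map {U V} t h := (ap φ U).comp (rs N.M (etHom t (h.trans (Category.comp_id _))))
  map_left g t h m := by
    simp only [MonoidHom.comp_apply]
    refine Eq.trans ?_ (rs_ap φ g _).symm
    rw [← rs_comp]; rfl
  map_right t g h m := by
    simp only [MonoidHom.comp_apply]
    rw [← rs_comp]; rfl
  map_al {U V} t h m := by
    have e (x : sec N.M U) : L.al U (ap φ U x) = N.al U x := congr(ap $hφ U x)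
    simp only [MonoidHom.comp_apply]
    rw [e]
    exact N.al_rs _ m

lemma LogMap.ofHom_id {φ : N.M ⟶ L.M} {hφ : φ ≫ L.α = N.α} {V : S.Etale} (h) (n : sec N.M V) :
    (LogMap.ofHom φ hφ).map (U := V) (V := V) (𝟙 _) h n = ap φ V n :=
  congrArg (ap φ V) (rs_id N.M n)

lemma LogMap.exists_ofHom (f : LogMap ⟨S, L⟩ ⟨S, N⟩) (hb : f.base = 𝟙 S) :
    ∃ (φ : N.M ⟶ L.M) (hφ : φ ≫ L.α = N.α), f = LogMap.ofHom φ hφ := by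
  obtain ⟨b, m, ml, mr, al⟩ := f
  obtain rfl : b = 𝟙 S := hb
  let F : Family (𝟙 S) N.M L.M := ⟨m, ml, mr⟩
  have hF {V : S.Etale} (n : sec N.M V) : L.al V (ap F.hom V n) = N.al V n :=
    (al _ _ n).trans (fnMap_id _ _)
  refine ⟨F.hom, hom_ext_sec fun V n => hF n, LogMap.ext' rfl ?_⟩
  intro U V t h _ n
  have ht : t = 𝟙 (dom U) ≫ mor (etHom t (h.trans (Category.comp_id _))) := (Category.id_comp t).symm
  exact (F.map_congr ht h n).trans (F.map_right _ _ _ n)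

end OfHom

namespace PLogPoint
variable {P : Type u} [CommMonoid P]

/-- A log point over `(S, N)` that induces `z` along a map of log structures `φ : N ⟶ M_Y`. -/
structure Push (z : PLogPoint P) {N : IntLog z.base} (φ : N.M ⟶ z.log.M) where
  N' : IntLog z.base
  π : N.M ⟶ N'.M
  π_α : π ≫ N'.α = N.α
  T : Triv P π z.cover
  transition : ∀ {V : z.base.Etale} (a b : V ⟶ z.cover) (p : P),
    T.frame a p = N'.unit V (z.cocycle.u a b p) * T.frame b p
  ψ : N'.M ⟶ z.log'.M
  ψ_α : ψ ≫ z.log'.α = N'.α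
  π_ψ : π ≫ ψ = φ ≫ z.π
  ψ_frame : ∀ {V : z.base.Etale} (a : V ⟶ z.cover) (p : P),
    ap ψ V (T.frame a p) = z.φ.frame a p

variable {z : PLogPoint P} {N : IntLog z.base} {φ : N.M ⟶ z.log.M}

/-- The log point over `(S, N)`. -/
abbrev Push.point (B : z.Push φ) : PLogPoint P where
  base := z.base
  log := N
  log' := B.N'
  π := B.π
  π_α := B.π_α
  cover := z.cover
  cover_surj := z.cover_surj
  φ := B.T
  transition a b := ⟨z.cocycle.u a b, B.transition a b⟩

/-- Twist `N ⊕ P` by the transition cocycle of `z`. Its frames change exactly like those of `z`, so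
they can be sent to them. -/
theorem exists_push [IsCancelMul P] [Subsingleton Pˣ] (z : PLogPoint P) {N : IntLog z.base}
    (φ : N.M ⟶ z.log.M) (hφ : φ ≫ z.log.α = N.α) : Nonempty (z.Push φ) := by
  let y : PLogPoint P := twistPoint N z.cocycle z.cover_surj
  let low : z.lower ⟶ y.lower := LogMap.ofHom φ hφ
  have hov : ∀ {V : z.base.Etale} {t : dom V ⟶ dom z.cover},
      t ≫ str z.cover = str V ≫ low.base → t ≫ str z.cover = str V :=
    fun h => h.trans (Category.comp_id _)
  have trans : ∀ {V Y : z.base.Etale} (t : dom V ⟶ dom Y) (a b : Y ⟶ z.cover)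
      (h : (t ≫ mor a) ≫ str z.cover = str V) (h' : (t ≫ mor b) ≫ str z.cover = str V) (p : P),
      z.φ.frame (etHom (t ≫ mor a) h) p = z.log'.unit V (unitsMap t (z.cocycle.u a b p)) *
        z.φ.frame (etHom (t ≫ mor b) h') p := by
    intro V Y t a b h h' p
    rw [Category.assoc, mor_str] at h
    have := congr($(z.cocycle.res (etHom t h) a b) p)
    exact (z.frame_eq (etHom t h ≫ a) (etHom t h ≫ b) p).trans
      (congrArg (fun v => z.log'.unit V v * _) this)
  obtain ⟨up, h₁, -, h₃, h₄⟩ := exists_frame_map (z := z) (y := y) low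
    (fun {V} t h => ⟨⟨z.φ.frame (etHom t (hov h)), z.frame_one _⟩, z.frame_mul _⟩)
    (fun t h p => isDeg_frame' (z := z) _ p)
    (fun g t h h' p => z.φ.rs_frame g _ p)
    (fun {V Y} t a b h h' p => by
      have e : y.cocycle.u a b = z.cocycle.u a b := y.frame_unique a b (y.frame_eq a b)
        (twistPoint_frame N z.cocycle z.cover_surj a b)
      rw [e]
      exact trans t a b (hov h) (hov h') p)
  obtain ⟨ψ, hψ, rfl⟩ := LogMap.exists_ofHom (L := z.log') (N := y.log') up h₃
  refine ⟨⟨y.log', y.π, y.π_α, y.φ, twistPoint_frame N z.cocycle z.cover_surj, ψ, hψ, ?_, ?_⟩⟩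
  · refine hom_ext_sec fun V n => ?_
    have h : 𝟙 (dom V) ≫ str V = str V ≫ 𝟙 z.base := by rw [Category.id_comp, Category.comp_id]
    have := up_π (z := z) (y := y) h₁ (V := V) (Y := V) (𝟙 _) h h n
    exact (LogMap.ofHom_id (φ := ψ) h _).symm.trans
      (this.trans (congrArg (ap z.π V) (LogMap.ofHom_id h _)))
  · intro V a p
    have h : mor a ≫ str z.cover = str V ≫ 𝟙 z.base := by rw [Category.comp_id, mor_str]
    have := h₄ (mor a) h h p
    refine Eq.trans (congrArg (ap ψ V) ?_) this
    refine Eq.symm ((y.φ.rs_frame (V := z.cover) (V' := V) _ _ p).trans ?_)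
    exact congrArg (fun b => y.φ.frame (V := V) b p) (et_ext (Category.comp_id _))

end PLogPoint
end
end LogGeom

namespace LogGeom
noncomputable section

lemma ap_unit {S : Scheme.{u}} {L N : IntLog S} {φ : N.M ⟶ L.M} (hφ : φ ≫ L.α = N.α) {V : S.Etale}
    (v : (fn (dom V))ˣ) : ap φ V (N.unit V v) = L.unit V v :=
  L.eq_unit (Eq.trans congr(ap $hφ V (N.unit V v)) (N.al_unit V v))

/-! ### The transported log point has the same sections `(u, p)`. -/

namespace PLogPoint.Push
variable {P : Type u} [CommMonoid P] {z : PLogPoint P} {N : IntLog z.base} {φ : N.M ⟶ z.log.M}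
  (B : z.Push φ)

lemma ap_ψ_π {V : z.base.Etale} (n : sec N.M V) : ap B.ψ V (ap B.π V n) = ap z.π V (ap φ V n) :=
  congr(ap $B.π_ψ V n)

lemma isDeg_ψ {V : z.base.Etale} {p : P} {q : sec B.N'.M V} (h : B.point.IsDeg p q) :
    z.IsDeg p (ap B.ψ V q) := by
  intro x
  obtain ⟨W, g, w, a, v, e, hq⟩ := h x
  refine ⟨W, g, w, a, v, e, ?_⟩
  rw [rs_ap, hq, map_mul, B.ψ_frame, ap_unit B.ψ_α]

lemma exists_isQ_lift {V : z.base.Etale} {q : sec z.log'.M V} (h : z.IsQ q) (x : dom V) :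
    ∃ (W : z.base.Etale) (g : W ⟶ V) (w : dom W) (r : sec B.N'.M W), mor g w = x ∧
      B.point.IsQ r ∧ ap B.ψ W r = rs z.log'.M g q := by
  obtain ⟨W, g, w, a, p, v, e, hq⟩ := h x
  refine ⟨W, g, w, B.N'.unit W v * B.T.frame a p, e, isQ_frame (z := B.point) a p v, ?_⟩
  rw [hq, map_mul, B.ψ_frame, ap_unit B.ψ_α]

/-- On sections `(u, p)` the map `ψ` changes neither the unit nor the degree. -/
lemma ψ_inj {V : z.base.Etale} {q q' : sec B.N'.M V} (h : B.point.IsQ q) (h' : B.point.IsQ q')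
    (e : ap B.ψ V q = ap B.ψ V q') : q = q' := by
  refine sec_ext _ fun x => ?_
  obtain ⟨W, g, w, p, a, hp⟩ := h.exists_isDeg x
  obtain ⟨W', g', w', p', a', hp'⟩ := (h'.res g).exists_isDeg w
  have e' := congrArg (rs z.log'.M (g' ≫ g)) e
  rw [rs_ap, rs_ap] at e'
  rw [← rs_comp] at hp'
  have hp₂ := hp.res g'
  rw [← rs_comp] at hp₂
  have h₁ := B.isDeg_ψ hp₂
  have h₂ := B.isDeg_ψ hp'
  obtain rfl := h₁.unique (e' ▸ h₂) w'
  obtain ⟨v, hv⟩ := hp₂.exists_unit hp'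
  refine ⟨W', g' ≫ g, w', by rw [← a, ← a']; rfl, ?_⟩
  change _ = B.N'.unit W' v * rs B.N'.M (g' ≫ g) q at hv
  rw [hv, map_mul, ap_unit B.ψ_α] at e'
  have e₂ : z.log'.unit W' v * ap B.ψ W' (rs B.N'.M (g' ≫ g) q) =
    z.log'.unit W' 1 * ap B.ψ W' (rs B.N'.M (g' ≫ g) q) := by rw [← e', map_one, one_mul]
  rw [hv, z.log'.unit_injective _ (mul_right_cancel e₂), map_one, one_mul]

end PLogPoint.Push

/-! ### Decompositions and the basic log structure. -/

namespace PLogPointIn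
open PLogPoint
variable {P : Type u} [CommMonoid P] {X : IntLogSch.{u}} (z : PLogPointIn P X)

/-- The sheaf `f⁻¹ M_X`. -/
abbrev inv : MSheaf z.base := (invImage z.f.base).obj X.log.M

lemma dagger_eta {U : z.base.Etale} {V : X.base.Etale} (t : dom U ⟶ dom V)
    (h : t ≫ str V = str U ≫ z.f.base) (m : sec X.log.M V) :
    ap z.f.dagger U ((eta z.f.base X.log.M).map t h m) = z.f.map t h m :=
  z.f.family.ap_dagger_eta t h m

/-- The triples `(x, n, q)` of a section `x` of `f⁻¹ M_X` and a decomposition `n q` of its image in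
`M_{Y'}`, where `n` is a section of `M_Y` and `q` is locally of the form `(u, p)`. -/
def decomp (V : z.base.Etale) : Submonoid (sec z.inv V × sec z.log.M V × sec z.log'.M V) where
  carrier := { e | z.IsQ e.2.2 ∧ ap z.f.dagger V e.1 = ap z.π V e.2.1 * e.2.2 }
  one_mem' := ⟨isQ_one, by simp only [Prod.fst_one, Prod.snd_one, map_one, one_mul]⟩
  mul_mem' := fun {e e'} h h' => ⟨h.1.mul h'.1, by
    rw [Prod.fst_mul, Prod.snd_mul, Prod.fst_mul, Prod.snd_mul, map_mul, map_mul, h.2, h'.2,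
      mul_mul_mul_comm]⟩

/-- The presheaf of decompositions. -/
def decompPsh : z.base.Etaleᵒᵖ ⥤ CommMonCat.{u} where
  obj V := CommMonCat.of (z.decomp V.unop)
  map {V W} g := CommMonCat.ofHom ((((rs z.inv g.unop).prodMap ((rs z.log.M g.unop).prodMap
    (rs z.log'.M g.unop))).comp (z.decomp V.unop).subtype).codRestrict (z.decomp W.unop)
      fun e => ⟨e.2.1.res g.unop, by
        have := congrArg (rs z.log'.M g.unop) e.2.2
        rw [map_mul, rs_ap, rs_ap] at this
        exact this⟩)
  map_id V := CommMonCat.hom_ext (MonoidHom.ext fun e => Subtype.ext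
    (Prod.ext (rs_id _ _) (Prod.ext (rs_id _ _) (rs_id _ _))))
  map_comp f g := CommMonCat.hom_ext (MonoidHom.ext fun e => Subtype.ext
    (Prod.ext (rs_comp _ _ _ _) (Prod.ext (rs_comp _ _ _ _) (rs_comp _ _ _ _))))

/-- Restriction of decompositions. -/
def decompRes {V W : z.base.Etale} (g : W ⟶ V) : z.decomp V →* z.decomp W :=
  prs z.decompPsh g

/-- The prelog structure `(x, n, q) ↦ α n`. -/
def decompα : z.decompPsh ⟶ strPsh z.base where
  app V := CommMonCat.ofHom ((z.log.al V.unop).comp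
    ((MonoidHom.fst _ _).comp ((MonoidHom.snd _ _).comp (z.decomp V.unop).subtype)))
  naturality _ _ g := CommMonCat.hom_ext (MonoidHom.ext fun e => z.log.al_rs g.unop e.1.2.1)

lemma decomp_isCancelMul (V : z.base.Etale) : IsCancelMul (z.decompPsh.obj (op V)) := by
  have h : IsCancelMul (z.decomp V) := by
    have := invImage_isCancelMul (b := z.f.base) X.log.integral V
    refine { mul_left_cancel := fun a b d h => ?_, mul_right_cancel := fun a b d h => ?_ }
    · exact Subtype.ext (Prod.ext (mul_left_cancel (congr(($h).1.1)))
        (Prod.ext (mul_left_cancel (congr(($h).1.2.1))) (mul_left_cancel (congr(($h).1.2.2)))))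
    · exact Subtype.ext (Prod.ext (mul_right_cancel (congr(($h).1.1)))
        (Prod.ext (mul_right_cancel (congr(($h).1.2.1))) (mul_right_cancel (congr(($h).1.2.2)))))
  exact h

/-- The basic log structure. -/
def basicLog : IntLog z.base := assocIntLog z.decompPsh z.decompα z.decomp_isCancelMul

/-- The section of the basic log structure given by a decomposition. -/
def basicMk (V : z.base.Etale) : z.decomp V →* sec z.basicLog.M V :=
  assocMap z.decompPsh z.decompα z.decomp_isCancelMul V

lemma rs_basicMk {V W : z.base.Etale} (g : W ⟶ V) (e : z.decomp V) :
    rs z.basicLog.M g (z.basicMk V e) = z.basicMk W (z.decompRes g e) :=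
  rs_assocMap z.decompPsh z.decompα z.decomp_isCancelMul g e

lemma al_basicMk {V : z.base.Etale} (e : z.decomp V) :
    z.basicLog.al V (z.basicMk V e) = z.log.al V e.1.2.1 :=
  al_assocMap z.decompPsh z.decompα z.decomp_isCancelMul e

lemma exists_basicMk {V : z.base.Etale} (n : sec z.basicLog.M V) (x : dom V) :
    ∃ (W : z.base.Etale) (g : W ⟶ V) (w : dom W) (e : z.decomp W) (v : (fn (dom W))ˣ), mor g w = x ∧
      rs z.basicLog.M g n = z.basicLog.unit W v * z.basicMk W e :=
  exists_assocMap z.decompPsh z.decompα z.decomp_isCancelMul n x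

/-- This unwinds equality in the associated log structure: the multipliers are decompositions whose
component is a unit. The equation between units is recovered by applying `basicMk` to the equation
of decompositions and cancelling. -/
lemma basicMk_eq {V : z.base.Etale} {e e' : z.decomp V} {v v' : (fn (dom V))ˣ}
    (H : z.basicLog.unit V v * z.basicMk V e = z.basicLog.unit V v' * z.basicMk V e') (x : dom V) :
    ∃ (W : z.base.Etale) (g : W ⟶ V) (w : dom W) (h h' : z.decomp W) (t t' : (fn (dom W))ˣ),
      mor g w = x ∧ h.1.2.1 = z.log.unit W t ∧ h'.1.2.1 = z.log.unit W t' ∧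
      z.decompRes g e * h = z.decompRes g e' * h' ∧
      unitsMap (mor g) v * t' = unitsMap (mor g) v' * t := by
  obtain ⟨W, g, w, h, h', t, t', e₁, e₂, e₃, e₄⟩ :=
    assocMap_eq z.decompPsh z.decompα z.decomp_isCancelMul H x
  let k : z.decomp W := h
  let k' : z.decomp W := h'
  have e₄' : z.decompRes g e * k = z.decompRes g e' * k' := e₄
  refine ⟨W, g, w, k, k', t, t', e₁, z.log.eq_unit e₂, z.log.eq_unit e₃, e₄',
    z.basicLog.unit_injective W (mul_right_cancel (b := z.basicMk W (z.decompRes g e)) ?_)⟩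
  have b₁ : z.basicMk W k = z.basicLog.unit W t :=
    z.basicLog.eq_unit ((z.al_basicMk h).trans e₂)
  have b₂ : z.basicMk W k' = z.basicLog.unit W t' :=
    z.basicLog.eq_unit ((z.al_basicMk h').trans e₃)
  have b₃ := congrArg (z.basicMk W) e₄'
  have b₄ := congrArg (rs z.basicLog.M g) H
  rw [map_mul, map_mul, b₁, b₂] at b₃
  rw [map_mul, map_mul, z.basicLog.rs_unit, z.basicLog.rs_unit, rs_basicMk, rs_basicMk] at b₄
  change z.basicLog.unit W (unitsMap (mor g) v) * _ = z.basicLog.unit W (unitsMap (mor g) v') * _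
    at b₄
  rw [map_mul, map_mul, mul_right_comm, b₄, mul_right_comm _ (z.basicLog.unit W t), mul_assoc,
    mul_assoc, b₃]

/-- This is `z†`: the map is prescribed on decompositions and on units, which generate the basic log
structure. -/
theorem exists_basicHom : ∃ φ : z.basicLog.M ⟶ z.log.M, φ ≫ z.log.α = z.basicLog.α ∧
    ∀ {V : z.base.Etale} (e : z.decomp V), ap φ V (z.basicMk V e) = e.1.2.1 := by
  have uniq : ∀ {V : z.base.Etale} {e e' : z.decomp V} {v v' : (fn (dom V))ˣ},
      z.basicLog.unit V v * z.basicMk V e = z.basicLog.unit V v' * z.basicMk V e' →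
      z.log.unit V v * e.1.2.1 = z.log.unit V v' * e'.1.2.1 := by
    intro V e e' v v' H
    refine sec_ext _ fun x => ?_
    obtain ⟨W, g, w, h, h', t, t', e₁, e₂, e₃, e₄, e₆⟩ := z.basicMk_eq H x
    refine ⟨W, g, w, e₁, ?_⟩
    have e₅ : rs z.log.M g e.1.2.1 * h.1.2.1 = rs z.log.M g e'.1.2.1 * h'.1.2.1 :=
      congr(($e₄).1.2.1)
    rw [e₂, e₃] at e₅
    rw [map_mul, map_mul, z.log.rs_unit, z.log.rs_unit]
    change z.log.unit W (unitsMap (mor g) v) * _ = z.log.unit W (unitsMap (mor g) v') * _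
    refine mul_right_cancel (b := z.log.unit W t) ?_
    rw [mul_assoc, e₅, mul_left_comm, ← map_mul, e₆, map_mul, mul_left_comm, mul_assoc]
  obtain ⟨φ, hφ⟩ := exists_hom_of_rel (B := z.basicLog.M) (A := z.log.M)
    (fun {V} x y => ∃ (e : z.decomp V) (v : (fn (dom V))ˣ),
      x = z.basicLog.unit V v * z.basicMk V e ∧ y = z.log.unit V v * e.1.2.1)
    (by
      rintro V W g _ _ ⟨e, v, rfl, rfl⟩
      refine ⟨z.decompRes g e, unitsMap (mor g) v, ?_, ?_⟩
      · rw [map_mul, z.basicLog.rs_unit, rs_basicMk]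
      · rw [map_mul, z.log.rs_unit]; rfl)
    (by
      intro V x v
      obtain ⟨W, g, w, e, v, e₁, e₂⟩ := z.exists_basicMk x v
      exact ⟨W, g, w, _, e₁, e, v, e₂, rfl⟩)
    (by
      rintro V _ _ _ ⟨e, v, rfl, rfl⟩ ⟨e', v', H, rfl⟩
      exact uniq H)
    (by
      rintro V _ ⟨e, v, H, rfl⟩
      rw [uniq (e' := 1) (v' := 1) (H.symm.trans (by rw [map_one, map_one, one_mul])), map_one,
        one_mul]
      rfl)
    (by
      rintro V _ _ _ _ ⟨e, v, rfl, rfl⟩ ⟨e', v', rfl, rfl⟩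
      exact ⟨e * e', v * v', by rw [map_mul, map_mul, mul_mul_mul_comm],
        by rw [map_mul, mul_mul_mul_comm]; rfl⟩)
  have hφ' : ∀ {V : z.base.Etale} (e : z.decomp V), ap φ V (z.basicMk V e) = e.1.2.1 :=
    fun e => hφ _ _ ⟨e, 1, by rw [map_one, one_mul], by rw [map_one, one_mul]⟩
  refine ⟨φ, hom_ext_sec fun V n => sec_ext (strSheaf _) fun x => ?_, hφ'⟩
  obtain ⟨W, g, w, e, v, e₁, e₂⟩ := z.exists_basicMk n x
  refine ⟨W, g, w, e₁, (rs_ap _ g n).trans (Eq.trans ?_ (rs_ap _ g n).symm)⟩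
  rw [e₂]
  change z.log.al W (ap φ W _) = z.basicLog.al W _
  rw [hφ _ _ ⟨e, v, rfl, rfl⟩, map_mul, map_mul, z.log.al_unit, z.basicLog.al_unit, al_basicMk]

end PLogPointIn
end
end LogGeom

namespace LogGeom
noncomputable section

/-! ### Lifting the morphism to `X` to the basic log structure. -/

namespace PLogPointIn
open PLogPoint
variable {P : Type u} [CommMonoid P] {X : IntLogSch.{u}} {z : PLogPointIn P X}

lemma exists_decomp {V : z.base.Etale} (x : sec z.inv V) (v : dom V) : ∃ (W : z.base.Etale)
    (g : W ⟶ V) (w : dom W) (e : z.decomp W), mor g w = v ∧ e.1.1 = rs z.inv g x := by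
  obtain ⟨W, g, w, n, q, e, hq, h⟩ := z.exists_isQ (ap z.f.dagger V x) v
  exact ⟨W, g, w, ⟨(rs z.inv g x, n, q), hq, (rs_ap _ _ _).symm.trans h⟩, e, rfl⟩

/-- The decomposition of a section is unique up to units. -/
lemma decomp_unique {V : z.base.Etale} {e e' : z.decomp V} (h : e.1.1 = e'.1.1) (x : dom V) :
    ∃ (W : z.base.Etale) (g : W ⟶ V) (w : dom W) (v : (fn (dom W))ˣ), mor g w = x ∧
      (z.decompRes g e').1.2.2 = z.log'.unit W v * (z.decompRes g e).1.2.2 ∧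
      z.basicMk W (z.decompRes g e) = z.basicLog.unit W v * z.basicMk W (z.decompRes g e') := by
  obtain ⟨W, g, w, v, e₁, e₂, e₃⟩ := e.2.1.cancel e'.2.1 (by rw [← e.2.2, ← e'.2.2, h]) x
  refine ⟨W, g, w, v, e₁, e₂, ?_⟩
  -- The decomposition `1 = v · v⁻¹` of the section `1`; its class is the unit `v`, and multiplying
  -- by it passes from `e'` to `e`.
  let c : z.decomp W := ⟨(1, z.log.unit W v, z.log'.unit W v⁻¹), isQ_unit _, by
    rw [map_one, z.π_unit, ← map_mul, mul_inv_cancel, map_one]⟩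
  have hc : z.basicMk W c = z.basicLog.unit W v :=
    z.basicLog.eq_unit ((z.al_basicMk c).trans (z.log.al_unit W v))
  have he : z.decompRes g e = c * z.decompRes g e' := by
    refine Subtype.ext (Prod.ext ?_ (Prod.ext e₃ ?_))
    · refine Eq.trans ?_ (one_mul (rs z.inv g e'.1.1)).symm
      exact congrArg _ h
    · change rs z.log'.M g e.1.2.2 = z.log'.unit W v⁻¹ * rs z.log'.M g e'.1.2.2
      rw [e₂, ← mul_assoc, ← map_mul, inv_mul_cancel, map_one, one_mul]
  rw [he, map_mul, hc]

variable {φ : z.basicLog.M ⟶ z.log.M} (B : z.Push φ)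

/-- The relation that defines the morphism to `X` from the basic log point. -/
def BasicRel {V : z.base.Etale} {U : X.base.Etale} (t : dom V ⟶ dom U)
    (h : t ≫ str U = str V ≫ z.f.base) (m : sec X.log.M U) (y : sec B.N'.M V) : Prop :=
  ∃ (e : z.decomp V) (r : sec B.N'.M V), e.1.1 = (eta z.f.base X.log.M).map t h m ∧
    B.point.IsQ r ∧ ap B.ψ V r = e.1.2.2 ∧ y = ap B.π V (z.basicMk V e) * r

variable {B}

lemma BasicRel.res {V V' : z.base.Etale} {U U' : X.base.Etale} {t : dom V ⟶ dom U}
    {t' : dom V' ⟶ dom U'} {g : V' ⟶ V} {k : U' ⟶ U} {h : t ≫ str U = str V ≫ z.f.base}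
    (h' : t' ≫ str U' = str V' ≫ z.f.base) {m : sec X.log.M U} {y : sec B.N'.M V}
    (e : t' ≫ mor k = mor g ≫ t) (H : BasicRel B t h m y) :
    BasicRel B t' h' (rs X.log.M k m) (rs B.N'.M g y) := by
  obtain ⟨d, r, h₁, h₂, h₃, rfl⟩ := H
  refine ⟨z.decompRes g d, rs B.N'.M g r, ?_, IsQ.res (z := B.point) g h₂, ?_, ?_⟩
  · rw [(eta z.f.base X.log.M).map_square e h h', ← h₁]; rfl
  · rw [← rs_ap, h₃]; rfl
  · rw [map_mul, rs_ap, rs_basicMk]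

/-- Two decompositions of one section differ by a unit that enters the class and its inverse the
`Q`-part, so the product is unchanged. -/
lemma BasicRel.uniq {V : z.base.Etale} {U : X.base.Etale} {t : dom V ⟶ dom U}
    {h : t ≫ str U = str V ≫ z.f.base} {m : sec X.log.M U} {y y' : sec B.N'.M V}
    (H : BasicRel B t h m y) (H' : BasicRel B t h m y') : y = y' := by
  obtain ⟨e, r, h₁, h₂, h₃, rfl⟩ := H
  obtain ⟨e', r', h₁', h₂', h₃', rfl⟩ := H'
  refine sec_ext _ fun x => ?_
  obtain ⟨W, g, w, v, a₁, a₂, a₃⟩ := decomp_unique (h₁.trans h₁'.symm) x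
  refine ⟨W, g, w, a₁, ?_⟩
  have hr : rs B.N'.M g r' = B.N'.unit W v * rs B.N'.M g r := by
    refine B.ψ_inj (IsQ.res (z := B.point) g h₂')
      (IsQ.unit_mul (z := B.point) (IsQ.res (z := B.point) g h₂) v) ?_
    rw [map_mul, ap_unit B.ψ_α, ← rs_ap, ← rs_ap, h₃, h₃']
    exact a₂
  rw [map_mul, map_mul, rs_ap, rs_ap, rs_basicMk, rs_basicMk, a₃, hr, map_mul, ap_unit B.π_α,
    mul_assoc, mul_left_comm]

lemma exists_basicRel {V : z.base.Etale} {U : X.base.Etale} (t : dom V ⟶ dom U)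
    (h : t ≫ str U = str V ≫ z.f.base) (m : sec X.log.M U) (v : dom V) : ∃ (W : z.base.Etale)
      (g : W ⟶ V) (w : dom W) (y : sec B.N'.M W), mor g w = v ∧
      BasicRel B (mor g ≫ t) (over_comp g h) m y := by
  obtain ⟨W, g, w, e, e₁, e₂⟩ := exists_decomp ((eta z.f.base X.log.M).map t h m) v
  obtain ⟨W', g', w', r, e₃, hr, e₄⟩ := B.exists_isQ_lift e.2.1 w
  refine ⟨W', g' ≫ g, w', _, by rw [← e₁, ← e₃]; rfl, z.decompRes g' e, r, ?_, hr, e₄, rfl⟩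
  rw [(eta z.f.base X.log.M).map_left (g' ≫ g) t h, rs_comp, ← e₂]
  rfl

lemma basicRel_eta {V : z.base.Etale} {U : X.base.Etale} (t : dom V ⟶ dom U)
    (h : t ≫ str U = str V ≫ z.f.base) (m : sec X.log.M U) {e : z.decomp V}
    (he : e.1.1 = (eta z.f.base X.log.M).map t h m) (x : dom V) : ∃ (W : z.base.Etale)
      (g : W ⟶ V) (w : dom W) (r : sec B.N'.M W), mor g w = x ∧ B.point.IsQ r ∧
      BasicRel B (mor g ≫ t) (over_comp g h) m (ap B.π W (rs _ g (z.basicMk V e)) * r) := by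
  obtain ⟨W, g, w, r, e₃, hr, e₄⟩ := B.exists_isQ_lift e.2.1 x
  refine ⟨W, g, w, r, e₃, hr, z.decompRes g e, r, ?_, hr, e₄, by rw [rs_basicMk]⟩
  rw [(eta z.f.base X.log.M).map_left g t h, ← he]
  rfl

variable (B) in
-- With `f(m) = n q`, the lift takes `m` to the class of `(m, n, q)` times the section `r` of `Q`
-- above `q`; `ψ` maps this back to `n q`.
theorem exists_basicFamily (hφ : ∀ {V : z.base.Etale} (e : z.decomp V),
    ap φ V (z.basicMk V e) = e.1.2.1) : ∃ G : Family z.f.base X.log.M B.N'.M,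
      (∀ {V : z.base.Etale} {U : X.base.Etale} (t : dom V ⟶ dom U)
        (h : t ≫ str U = str V ≫ z.f.base) (m : sec X.log.M U) (y : sec B.N'.M V),
        BasicRel B t h m y → G.map t h m = y) ∧
      ∀ {V : z.base.Etale} {U : X.base.Etale} (t : dom V ⟶ dom U)
        (h : t ≫ str U = str V ≫ z.f.base) (m : sec X.log.M U),
        ap B.ψ V (G.map t h m) = z.f.map t h m := by
  obtain ⟨G, hG⟩ := Family.exists_of_rel (b := z.f.base) (B := X.log.M) (A := B.N'.M) (BasicRel B)
    (fun t t' g k h h' x y e H => H.res h' e)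
    (fun {V Y} t h m v => by
      obtain ⟨W, g, w, y, e₁, H⟩ := exists_basicRel (B := B) t h m v
      exact ⟨W, g, w, Y, 𝟙 _, mor g ≫ t, over_comp g h, y, e₁, Category.comp_id _,
        by rwa [rs_id]⟩)
    (fun t h x y y' H H' => H.uniq H')
    (fun t h y H => H.uniq ⟨1, 1, (map_one _).symm, isQ_one (z := B.point), map_one _,
      by rw [map_one, map_one, one_mul]⟩)
    (by
      rintro V Y t h m m' _ _ ⟨e, r, h₁, h₂, h₃, rfl⟩ ⟨e', r', h₁', h₂', h₃', rfl⟩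
      refine ⟨e * e', r * r', ?_, IsQ.mul (z := B.point) h₂ h₂', ?_, ?_⟩
      · rw [map_mul, ← h₁, ← h₁']; rfl
      · rw [map_mul, h₃, h₃']; rfl
      · rw [map_mul, map_mul, mul_mul_mul_comm])
  refine ⟨G, hG, fun {V U} t h m => sec_ext _ fun x => ?_⟩
  obtain ⟨W, g, w, y, e₁, H⟩ := exists_basicRel (B := B) t h m x
  refine ⟨W, g, w, e₁, ?_⟩
  rw [rs_ap, ← G.map_left g t h, hG _ _ _ _ H, ← z.f.map_left g t h, ← dagger_eta]
  obtain ⟨e, r, h₁, h₂, h₃, rfl⟩ := H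
  rw [map_mul, B.ap_ψ_π, hφ, h₃, ← e.2.2, h₁]

end PLogPointIn
end
end LogGeom

namespace LogGeom
noncomputable section

/-- An equation between products with pullbacks of sections of `M` locally comes from one in `M`. -/
lemma eta_mul_eq {S T : Scheme.{u}} {b : S ⟶ T} {M : MSheaf T} {V : S.Etale} {U : T.Etale}
    (t : dom V ⟶ dom U) (h : t ≫ str U = str V ≫ b) {m m' : sec M U}
    {y y' : sec ((invImage b).obj M) V}
    (e : (eta b M).map t h m * y = (eta b M).map t h m' * y') (x : dom V) :
    ∃ (W : S.Etale) (g : W ⟶ V) (w : dom W) (U' : T.Etale) (k : U' ⟶ U) (t' : dom W ⟶ dom U')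
      (h' : t' ≫ str U' = str W ≫ b) (l l' : sec M U'), mor g w = x ∧ t' ≫ mor k = mor g ≫ t ∧
      rs _ g y = (eta b M).map t' h' l ∧ rs _ g y' = (eta b M).map t' h' l' ∧
      rs M k m * l = rs M k m' * l' := by
  obtain ⟨W₁, g₁, w₁, U₁, k₁, t₁, h₁, l, a₁, a₂, a₃⟩ := exists_eta_refine t h y x
  obtain ⟨W₂, g₂, w₂, U₂, k₂, t₂, h₂, l', b₁, b₂, b₃⟩ := exists_eta_refine t₁ h₁ (rs _ g₁ y') w₁
  have a₄ : t₂ ≫ mor (k₂ ≫ k₁) = mor (g₂ ≫ g₁) ≫ t := by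
    rw [mor_comp, ← Category.assoc, b₂, Category.assoc, a₂, mor_comp, Category.assoc]
  have a₅ : rs _ (g₂ ≫ g₁) y = (eta b M).map t₂ h₂ (rs _ k₂ l) := by
    rw [rs_comp, a₃, (eta b M).map_square b₂ h₁]
  have a₆ : rs _ (g₂ ≫ g₁) y' = (eta b M).map t₂ h₂ l' := by rw [rs_comp, b₃]
  have e₅ := congrArg (rs ((invImage b).obj M) (g₂ ≫ g₁)) e
  rw [map_mul, map_mul, a₅, a₆, ← (eta b M).map_square a₄ h h₂,
    ← (eta b M).map_square a₄ h h₂, ← map_mul, ← map_mul] at e₅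
  obtain ⟨W₃, g₃, w₃, U₃, k₃, t₃, d₁, d₂, d₃⟩ := eta_injective t₂ h₂ e₅ w₂
  have h₃ := over_square d₂ h₂
  refine ⟨W₃, g₃ ≫ g₂ ≫ g₁, w₃, U₃, k₃ ≫ k₂ ≫ k₁, t₃, h₃, rs M k₃ (rs M k₂ l), rs M k₃ l',
    by rw [← a₁, ← b₁, ← d₁]; rfl, ?_, ?_, ?_, ?_⟩
  · rw [mor_comp, ← Category.assoc, d₂, Category.assoc, a₄]
    simp only [mor_comp, Category.assoc]
  · rw [rs_comp, a₅, (eta b M).map_square d₂ h₂]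
  · rw [rs_comp, a₆, (eta b M).map_square d₂ h₂]
  · rw [map_mul, map_mul, ← rs_comp, ← rs_comp _ k₃ (k₂ ≫ k₁)] at d₃
    exact d₃

/-! ### Every log point factors through a basic one. -/

namespace PLogPointIn
open PLogPoint
variable {P : Type u} [CommMonoid P] {X : IntLogSch.{u}} {z : PLogPointIn P X}

/-- A factorization of a log point in `X` over a map of log structures `N ⟶ M_Y`. -/
structure Factorization (z : PLogPointIn P X) where
  N : IntLog z.base
  φ : N.M ⟶ z.log.M
  φ_α : φ ≫ z.log.α = N.α
  B : z.Push φ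
  G : Family z.f.base X.log.M B.N'.M
  ap_ψ_G : ∀ {V : z.base.Etale} {U : X.base.Etale} (t : dom V ⟶ dom U)
    (h : t ≫ str U = str V ≫ z.f.base) (m : sec X.log.M U),
    ap B.ψ V (G.map t h m) = z.f.map t h m

namespace Factorization
variable (D : Factorization z)

/-- The log point over `(S, N)` in `X`. -/
abbrev point : PLogPointIn P X where
  toPLogPoint := D.B.point
  f := D.G.logMap (Y := D.B.point.upper) (fun {U V} t h m => by
    refine Eq.trans ?_ (z.f.map_al t h m)
    rw [← D.ap_ψ_G]
    exact (congr(ap $D.B.ψ_α U (D.G.map t h m))).symm)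

/-- The morphism to the log point over `(S, N)`. -/
def arrow : z ⟶ D.point :=
  homMk (y := D.point) (LogMap.ofHom D.B.ψ D.B.ψ_α) (LogMap.ofHom D.φ D.φ_α)
    (sq_of_up_π (z := z.toPLogPoint) (y := D.B.point) (up := LogMap.ofHom D.B.ψ D.B.ψ_α)
      (low := LogMap.ofHom D.φ D.φ_α) rfl fun {V Y} t h h' n => by
        refine (congrArg (ap D.B.ψ V) (rs_ap D.B.π _ n)).trans ?_
        exact D.B.ap_ψ_π _)
    (fun {V Y} t h p q hq => D.B.isDeg_ψ (IsDeg.res (z := D.B.point) _ hq))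
    (LogMap.ext' (Category.id_comp _) fun {V U} t h h' m => by
      have h₁ : 𝟙 (dom V) ≫ str V = str V ≫ 𝟙 z.base := by rw [Category.id_comp, Category.comp_id]
      refine (LogMap.map_congr (LogMap.comp (LogMap.ofHom D.B.ψ D.B.ψ_α) D.point.f)
        (Category.id_comp t).symm h m).trans ?_
      refine (LogMap.comp_map (LogMap.ofHom D.B.ψ D.B.ψ_α) D.point.f (𝟙 _) t h₁ h' _ m).trans ?_
      exact (LogMap.ofHom_id (φ := D.B.ψ) h₁ _).trans (D.ap_ψ_G t h' m))

lemma overId_arrow : OverId (logPoints P X) D.arrow :=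
  inferInstanceAs ((logPoints P X ⋙ underlying).IsHomLift
    ((logPoints P X ⋙ underlying).map D.arrow) D.arrow)

end Factorization

/-- Every log point in `X` factors through a basic one over the same scheme. -/
theorem exists_factorization [IsCancelMul P] [Subsingleton Pˣ] (z : PLogPointIn P X) :
    ∃ D : Factorization z, D.point.LocBasic := by
  obtain ⟨φ, hφ, hφe⟩ := z.exists_basicHom
  obtain ⟨B⟩ := exists_push z.toPLogPoint φ hφ
  obtain ⟨G, hG, hψ⟩ := exists_basicFamily B hφe
  let D : Factorization z := ⟨z.basicLog, φ, hφ, B, G, hψ⟩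
  -- By uniqueness of decompositions up to units, the component of the lift of `m` in any
  -- decomposition is, up to a unit, the class of a triple starting with `m`.
  have key : ∀ {V : z.base.Etale} {U : X.base.Etale} (t : dom V ⟶ dom U)
      (h : t ≫ str U = str V ≫ z.f.base) (m : sec X.log.M U) {n : sec z.basicLog.M V}
      {q : sec B.N'.M V}, B.point.IsQ q → G.map t h m = ap B.π V n * q → ∀ x : dom V,
      ∃ (W : z.base.Etale) (g : W ⟶ V) (w : dom W) (e : z.decomp W) (v : (fn (dom W))ˣ),
        mor g w = x ∧ e.1.1 = (eta z.f.base X.log.M).map (mor g ≫ t) (over_comp g h) m ∧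
        z.basicMk W e = z.basicLog.unit W v * rs _ g n := by
    intro V U t h m n q hq e x
    obtain ⟨W, g, w, y, e₁, H⟩ := exists_basicRel (B := B) t h m x
    have e₂ := (hG _ _ _ _ H).symm.trans (G.map_left g t h m)
    obtain ⟨d, r, h₁, h₂, h₃, rfl⟩ := H
    rw [e, map_mul, rs_ap] at e₂
    obtain ⟨W', g', w', v, a₁, a₂, a₃⟩ := IsQ.cancel (z := B.point) h₂
      (IsQ.res (z := B.point) g hq) e₂ w
    refine ⟨W', g' ≫ g, w', z.decompRes g' d, v, by rw [← e₁, ← a₁]; rfl, ?_, ?_⟩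
    · have := (eta z.f.base X.log.M).map_left g' (mor g ≫ t) (over_comp g h) m
      rw [← h₁] at this
      refine this.symm.trans ((eta z.f.base X.log.M).map_congr ?_ _ _)
      rw [mor_comp, Category.assoc]
    · rw [← rs_basicMk, rs_comp]
      exact a₃
  have hQ : ∀ {V : z.base.Etale} {U : X.base.Etale} (t : dom V ⟶ dom U)
      (h : t ≫ str U = str V ≫ z.f.base) (m : sec X.log.M U) {e : z.decomp V} {s : (fn (dom V))ˣ},
      e.1.2.1 = z.log.unit V s → e.1.1 = (eta z.f.base X.log.M).map t h m →
      B.point.IsQ (G.map t h m) := by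
    intro V U t h m e s hs he
    refine IsQ.of_local fun x => ?_
    obtain ⟨W, g, w, r, e₁, hr, H⟩ := basicRel_eta (B := B) t h m he x
    refine ⟨W, g, w, e₁, ?_⟩
    have h₁ := (G.map_left g t h m).symm.trans (hG _ _ _ _ H)
    have h₂ : z.basicMk V e = z.basicLog.unit V s :=
      z.basicLog.eq_unit (by rw [al_basicMk, hs, z.log.al_unit])
    rw [h₂, z.basicLog.rs_unit, ap_unit B.π_α] at h₁
    rw [h₁]
    exact IsQ.unit_mul (z := B.point) hr _
  refine ⟨D, ⟨fun {V} n x => ?_, fun {V U} t h m m' n q q' hq hq' e e' x => ?_⟩⟩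
  · change sec z.basicLog.M V at n
    obtain ⟨W, g, w, e, v, e₁, e₂⟩ := z.exists_basicMk n x
    obtain ⟨W₁, g₁, w₁, U, t, h, m, e₃, e₄⟩ := exists_eta z.f.base X.log.M e.1.1 w
    obtain ⟨W₂, g₂, w₂, r, e₅, hr, H⟩ := basicRel_eta (B := B) t h m (e := z.decompRes g₁ e) e₄ w₁
    refine ⟨W₂, g₂ ≫ g₁ ≫ g, w₂, U, mor g₂ ≫ t, over_comp g₂ h, m,
      B.N'.unit W₂ (unitsMap (mor (g₂ ≫ g₁)) v)⁻¹ * r, by rw [← e₁, ← e₃, ← e₅]; rfl,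
      IsQ.unit_mul (z := B.point) hr _, (hG _ _ _ _ H).trans ?_⟩
    have e₆ : rs z.basicLog.M (g₂ ≫ g₁ ≫ g) n = z.basicLog.unit W₂ (unitsMap (mor (g₂ ≫ g₁)) v) *
        rs z.basicLog.M g₂ (z.basicMk W₁ (z.decompRes g₁ e)) := by
      rw [← rs_basicMk, ← rs_comp, ← Category.assoc]
      refine (rs_comp z.basicLog.M (g₂ ≫ g₁) g n).trans ?_
      rw [e₂, map_mul, z.basicLog.rs_unit]
    refine Eq.trans ?_ (congrArg (fun n => ap B.π W₂ n * _) e₆).symm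
    rw [map_mul, ap_unit B.π_α, mul_mul_mul_comm, ← map_mul, mul_inv_cancel, map_one, one_mul]
  · change G.map t h m = ap B.π V n * q at e
    change G.map t h m' = ap B.π V n * q' at e'
    change sec z.basicLog.M V at n
    obtain ⟨W₁, g₁, w₁, d, v, a₁, a₂, a₃⟩ := key t h m hq e x
    obtain ⟨W₂, g₂, w₂, d', v', b₁, b₂, b₃⟩ := key (mor g₁ ≫ t) (over_comp g₁ h) m'
      (n := rs _ g₁ n) (IsQ.res (z := B.point) g₁ hq') (by
        have := congrArg (rs B.N'.M g₁) e'
        rwa [map_mul, rs_ap, ← G.map_left g₁ t h] at this) w₁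
    have a₄ := congrArg (rs z.basicLog.M g₂) a₃
    rw [rs_basicMk, map_mul, z.basicLog.rs_unit] at a₄
    -- The classes of the triples of `m` and `m'` both equal `n` up to units, so `basicMk_eq`
    -- provides multipliers in `f⁻¹ M_X` with unit components; `eta_mul_eq` descends them to
    -- sections of `M_X`.
    have c₁ : z.basicLog.unit W₂ v' * z.basicMk W₂ (z.decompRes g₂ d) =
        z.basicLog.unit W₂ (unitsMap (mor g₂) v) * z.basicMk W₂ d' := by
      rw [a₄, b₃, mul_left_comm]
    obtain ⟨W₃, g₃, w₃, k, k', s, s', f₁, f₂, f₃, f₄, -⟩ := z.basicMk_eq c₁ w₂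
    let F := eta z.f.base X.log.M
    have hT := over_comp g₃ (over_comp g₂ (over_comp g₁ h))
    have c₂ : F.map (mor g₃ ≫ mor g₂ ≫ mor g₁ ≫ t) hT m * k.1.1 =
        F.map (mor g₃ ≫ mor g₂ ≫ mor g₁ ≫ t) hT m' * k'.1.1 := by
      have f₅ : rs z.inv g₃ (rs z.inv g₂ d.1.1) * k.1.1 = rs z.inv g₃ d'.1.1 * k'.1.1 :=
        congr(($f₄).1.1)
      rw [a₂, b₂, ← F.map_left, ← F.map_left, ← F.map_left] at f₅
      exact f₅
    obtain ⟨W₄, g₄, w₄, U₄, k₄, t₄, h₄, l, l', j₁, j₂, j₃, j₄, j₅⟩ := eta_mul_eq _ hT c₂ w₃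
    have hn {c : z.decomp W₃} {s : (fn (dom W₃))ˣ} (hc : c.1.2.1 = z.log.unit W₃ s) :
        (z.decompRes g₄ c).1.2.1 = z.log.unit W₄ (unitsMap (mor g₄) s) :=
      (congrArg (rs z.log.M g₄) hc).trans (z.log.rs_unit g₄ s)
    refine ⟨W₄, g₄ ≫ g₃ ≫ g₂ ≫ g₁, w₄, U₄, k₄, t₄, h₄, l, l', ?_, ?_,
      hQ t₄ h₄ l (e := z.decompRes g₄ k) (hn f₂) j₃,
      hQ t₄ h₄ l' (e := z.decompRes g₄ k') (hn f₃) j₄, j₅⟩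
    · rw [← a₁, ← b₁, ← f₁, ← j₁]; rfl
    · rw [j₂]
      simp only [mor_comp, Category.assoc]

end PLogPointIn
end
end LogGeom

namespace LogGeom
noncomputable section

/-! ### Minimal log points are basic, and there are enough of them. -/

section Minimal
variable {𝒵 : Type*} [Category* 𝒵] {F : 𝒵 ⥤ IntLogSch.{u}}

lemma overId_id (w : 𝒵) : OverId F (𝟙 w) := by
  unfold OverId
  rw [← (F ⋙ underlying).map_id w]
  infer_instance

/-- An arrow of minimal objects over an identity of schemes is an isomorphism. -/
theorem IsMinimal.isIso {w z : 𝒵} (hw : IsMinimal F w) (hz : IsMinimal F z) (i : w ⟶ z)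
    (hi : OverId F i) : IsIso i := by
  obtain ⟨k, hk, -⟩ := hw i (𝟙 w) hi (overId_id w)
  obtain ⟨l, -, hl⟩ := hz i i hi hi
  refine ⟨k, hk, ?_⟩
  rw [hl (k ≫ i) (show i ≫ k ≫ i = i by rw [reassoc_of% hk]), hl (𝟙 z) (Category.comp_id i)]

end Minimal

namespace PLogPointIn
variable {P : Type u} [CommMonoid P] {X : IntLogSch.{u}} [IsCancelMul P] [Subsingleton Pˣ]

/-- A minimal point has an arrow over an identity to a basic, hence minimal, point; this arrow is an
isomorphism, and basicness passes back along it. -/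
theorem isMinimal_iff_locBasic (z : PLogPointIn P X) :
    IsMinimal (logPoints P X) z ↔ z.LocBasic := by
  refine ⟨fun hz => ?_, fun h => h.isMinimal⟩
  obtain ⟨D, hD⟩ := z.exists_factorization
  have := hz.isIso hD.isMinimal D.arrow D.overId_arrow
  have : IsIso D.arrow.low := inferInstanceAs (IsIso ((logPoints P X).map D.arrow))
  exact hD.of_locStrict D.arrow (LocStrict.of_isIso (Y := z.lower) D.arrow.low)

theorem enoughMinimals : EnoughMinimals (logPoints P X) := fun z => by
  obtain ⟨D, hD⟩ := z.exists_factorization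
  exact ⟨D.point, D.arrow, hD.isMinimal, D.overId_arrow⟩

end PLogPointIn

/-! ### Restriction to an étale scheme, and sections of fibre products. -/

section Restriction
variable {S : Scheme.{u}} (U : S.Etale)

/-- A morphism of étale schemes over `U`, viewed as a morphism over `S`. -/
def resHom {V W : (dom U).Etale} (g : V ⟶ W) : overObj U V ⟶ overObj U W :=
  (etMap (str U) (str_etale U)).map g

variable {U}

lemma exists_resHom {V : (dom U).Etale} {W : S.Etale} (g : W ⟶ overObj U V) (w : dom W) :
    ∃ (V' : (dom U).Etale) (k : V' ⟶ V) (v : dom V') (j : overObj U V' ⟶ W),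
      mor k v = mor g w ∧ j ≫ g = resHom U k := by
  let V' : (dom U).Etale := etMk (S := dom U) (mor g ≫ str (S := dom U) V)
    (etale_comp (mor_etale g) (str_etale V))
  let k : V' ⟶ V := etHom (W := V) (show dom V' ⟶ dom V from mor (S := S) g) rfl
  let j : overObj U V' ⟶ W := etHom (𝟙 (dom W)) ((Category.id_comp _).trans
    ((mor_str g).symm.trans (Category.assoc _ _ _).symm))
  exact ⟨V', k, w, j, rfl, et_ext (Category.id_comp _)⟩

lemma exists_overObj {W : S.Etale} (a : W ⟶ U) (w : dom W) :
    ∃ (V : (dom U).Etale) (j : overObj U V ⟶ W) (v : dom (overObj U V)), mor j v = w ∧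
      j ≫ a = overHom U V := by
  let V : (dom U).Etale := etMk (mor a) (mor_etale a)
  let j : overObj U V ⟶ W := etHom (𝟙 (dom W)) ((Category.id_comp _).trans (mor_str a).symm)
  exact ⟨V, j, w, rfl, et_ext (Category.id_comp _)⟩

/-- Sections of a fibre product of sheaves. -/
lemma exists_pullback_sec {A B C : MSheaf S} (f : A ⟶ C) (g : B ⟶ C) {V : S.Etale} {x : sec A V}
    {y : sec B V} (h : ap f V x = ap g V y) :
    ∃ w : sec (pullback f g) V, ap (pullback.fst f g) V w = x ∧ ap (pullback.snd f g) V w = y := by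
  let Γ : MSheaf S ⥤ Type u := sheafToPresheaf _ _ ⋙ (evaluation _ _).obj (op V) ⋙ forget _
  let e := PreservesPullback.iso Γ f g
  let w' := (Types.pullbackIsoPullback (Γ.map f) (Γ.map g)).inv ⟨(x, y), h⟩
  refine ⟨e.inv w', ?_, ?_⟩
  · refine (congr($(PreservesPullback.iso_inv_fst Γ f g) w')).trans ?_
    exact congr($(Types.pullbackIsoPullback_inv_fst (Γ.map f) (Γ.map g)) ⟨(x, y), h⟩)
  · refine (congr($(PreservesPullback.iso_inv_snd Γ f g) w')).trans ?_
    exact congr($(Types.pullbackIsoPullback_inv_snd (Γ.map f) (Γ.map g)) ⟨(x, y), h⟩)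

end Restriction

/-! ### The associated log structure as a pushout, tested on sections. -/

section Assoc
variable {S : Scheme.{u}}

lemma ap_comp {A B C : MSheaf S} (f : A ⟶ B) (g : B ⟶ C) (V : S.Etale) (x : sec A V) :
    ap (f ≫ g) V x = ap g V (ap f V x) := rfl

section
variable {F : MSheaf S} (α : F ⟶ strSheaf S)

/-- The map from a prelog structure to the associated log structure. -/
def assocInl : F ⟶ assocLog α := pushout.inl _ _
/-- The inclusion of the units in the associated log structure. -/
def assocInr : unitSheaf S ⟶ assocLog α := pushout.inr _ _

variable {α}

lemma assocLog_hom_ext {A : MSheaf S} {f g : assocLog α ⟶ A}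
    (h₁ : assocInl α ≫ f = assocInl α ≫ g) (h₂ : assocInr α ≫ f = assocInr α ≫ g) : f = g :=
  pushout.hom_ext h₁ h₂

lemma exists_assocLog_desc {L : IntLog S} (c : F ⟶ L.M) (h : c ≫ L.α = α) :
    ∃ r : assocLog α ⟶ L.M, assocInl α ≫ r = c ∧ assocInr α ≫ r = L.unitHom :=
  ⟨pushout.desc c L.unitHom (L.eq_unitHom _ _ (by rw [Category.assoc, h, pullback.condition])),
    pushout.inl_desc _ _ _, pushout.inr_desc _ _ _⟩

lemma assocInl_desc (L : IntLog S) (a : F ⟶ L.M) :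
    assocInl (a ≫ L.α) ≫ assocLogDesc L a = a := pushout.inl_desc _ _ _
lemma assocInr_desc (L : IntLog S) (a : F ⟶ L.M) :
    assocInr (a ≫ L.α) ≫ assocLogDesc L a = L.unitHom := pushout.inr_desc _ _ _

end

/-- A map of log structures that is compatible with maps from a prelog structure inducing both is an
isomorphism. -/
lemma isIso_of_assocLogDesc {L N : IntLog S} {F : MSheaf S} {c : F ⟶ N.M} {a : F ⟶ L.M}
    {φ : N.M ⟶ L.M} (hφ : φ ≫ L.α = N.α) (ha : c ≫ φ = a) (hN : IsIso (assocLogDesc N c))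
    (hL : IsIso (assocLogDesc L a)) : IsIso φ := by
  have hu : N.unitHom ≫ φ = L.unitHom := hom_ext_sec fun V v => ap_unit hφ v
  obtain ⟨r, r₁, r₂⟩ := exists_assocLog_desc (L := N) (α := a ≫ L.α) c
    (by rw [← ha, ← hφ, Category.assoc])
  have d₁ := assocInl_desc L a
  have d₂ := assocInr_desc L a
  have c₁ := assocInl_desc N c
  have c₂ := assocInr_desc N c
  have hr : r ≫ φ = assocLogDesc L a := by
    refine assocLog_hom_ext ?_ ?_
    · rw [reassoc_of% r₁, ha, d₁]
    · rw [reassoc_of% r₂, hu, d₂]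
  have ha' : a ≫ inv (assocLogDesc L a) = assocInl _ := by
    rw [IsIso.comp_inv_eq, d₁]
  have hu' : L.unitHom ≫ inv (assocLogDesc L a) = assocInr _ := by
    rw [IsIso.comp_inv_eq, d₂]
  refine ⟨inv (assocLogDesc L a) ≫ r, ?_, ?_⟩
  · rw [← cancel_epi (assocLogDesc N c)]
    refine assocLog_hom_ext ?_ ?_
    · rw [reassoc_of% c₁, reassoc_of% ha, reassoc_of% ha', r₁, Category.comp_id, c₁]
    · rw [reassoc_of% c₂, reassoc_of% hu, reassoc_of% hu', r₂, Category.comp_id, c₂]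
  · rw [Category.assoc, hr, IsIso.inv_hom_id]

/-- A log structure is associated to a prelog structure if this holds locally on sections. -/
lemma isIso_assocLogDesc {L : IntLog S} {F : MSheaf S} (a : F ⟶ L.M)
    (ex : ∀ {V : S.Etale} (n : sec L.M V) (x : dom V), ∃ (W : S.Etale) (g : W ⟶ V) (w : dom W)
      (y : sec F W) (v : (fn (dom W))ˣ), mor g w = x ∧ rs L.M g n = L.unit W v * ap a W y)
    (inj : ∀ {V : S.Etale} (y y' : sec F V) (v v' : (fn (dom V))ˣ),
      L.unit V v * ap a V y = L.unit V v' * ap a V y' → ∀ x : dom V, ∃ (W : S.Etale) (g : W ⟶ V)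
        (w : dom W) (h h' : sec F W) (s s' : (fn (dom W))ˣ), mor g w = x ∧
        ap a W h = L.unit W s ∧ ap a W h' = L.unit W s' ∧ rs F g y * h = rs F g y' * h') :
    IsIso (assocLogDesc L a) := by
  let p : F ⟶ assocLog (a ≫ L.α) := assocInl _
  let r : unitSheaf S ⟶ assocLog (a ≫ L.α) := assocInr _
  have d₁ : p ≫ assocLogDesc L a = a := assocInl_desc L a
  have d₂ : r ≫ assocLogDesc L a = L.unitHom := assocInr_desc L a
  obtain ⟨ρ, hρ, hρr, hρL⟩ : ∃ ρ : ∀ V : S.Etale, (fn (dom V))ˣ →* sec (assocLog (a ≫ L.α)) V,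
      (∀ V v, ρ V v = ap r V v) ∧ (∀ {V W : S.Etale} (g : W ⟶ V) (v : (fn (dom V))ˣ),
        rs _ g (ρ V v) = ρ W (unitsMap (mor g) v)) ∧
      ∀ V v, ap (assocLogDesc L a) V (ρ V v) = L.unit V v :=
    ⟨fun V => ap r V, fun _ _ => rfl, fun g v => rs_ap r g v, fun V v => congr(ap $d₂ V v)⟩
  -- A section with unit image comes from the fibre product `F ×_𝒪 𝒪^*`, on which the two maps to
  -- the pushout agree.
  have hpr : ∀ {V : S.Etale} {h : sec F V} {s : (fn (dom V))ˣ}, ap a V h = L.unit V s →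
      ap p V h = ρ V s := by
    intro V h s e
    obtain ⟨w, rfl, rfl⟩ := exists_pullback_sec (a ≫ L.α) (unitIncl S) (x := h) (y := s)
      ((congrArg (L.al V) e).trans (L.al_unit V s))
    exact Eq.trans congr(ap $(pushout.condition) V w) (hρ V _).symm
  have uniq : ∀ {V : S.Etale} (y y' : sec F V) (v v' : (fn (dom V))ˣ),
      L.unit V v * ap a V y = L.unit V v' * ap a V y' →
      ρ V v * ap p V y = ρ V v' * ap p V y' := by
    intro V y y' v v' e
    refine sec_ext _ fun x => ?_
    obtain ⟨W, g, w, h, h', s, s', e₁, e₂, e₃, e₄⟩ := inj y y' v v' e x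
    refine ⟨W, g, w, e₁, ?_⟩
    have e₅ := congrArg (rs L.M g) e
    have e₆ := congrArg (ap a W) e₄
    have e₇ := congrArg (ap p W) e₄
    rw [map_mul, map_mul, L.rs_unit, L.rs_unit, rs_ap, rs_ap] at e₅
    change L.unit W (unitsMap (mor g) v) * _ = L.unit W (unitsMap (mor g) v') * _ at e₅
    rw [map_mul, map_mul, e₂, e₃] at e₆
    rw [map_mul, map_mul, hpr e₂, hpr e₃] at e₇
    have e₈ : unitsMap (mor g) v * s' = unitsMap (mor g) v' * s := by
      refine L.unit_injective W (mul_right_cancel (b := ap a W (rs F g y)) ?_)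
      rw [map_mul, map_mul, mul_right_comm, e₅, mul_right_comm _ (L.unit W s), mul_assoc, mul_assoc,
        e₆]
    have e₉ : ρ W s * ρ W s⁻¹ = 1 := by
      rw [← map_mul, mul_inv_cancel, map_one]
    have e₁₀ : ρ W (unitsMap (mor g) v) * ρ W s' = ρ W (unitsMap (mor g) v') * ρ W s := by
      rw [← map_mul, e₈, map_mul]
    rw [map_mul, map_mul, rs_ap, rs_ap, hρr, hρr]
    calc _ = ρ W (unitsMap (mor g) v) * (ap p W (rs F g y) * ρ W s) * ρ W s⁻¹ := by
          rw [mul_assoc, mul_assoc, e₉, mul_one]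
      _ = (ρ W (unitsMap (mor g) v) * ρ W s') * ap p W (rs F g y') * ρ W s⁻¹ := by
          rw [e₇, mul_assoc _ (ρ W s'), mul_comm (ρ W s')]
      _ = ρ W (unitsMap (mor g) v') * ap p W (rs F g y') * (ρ W s * ρ W s⁻¹) := by
          rw [e₁₀, mul_right_comm _ (ρ W s), mul_assoc _ (ρ W s)]
      _ = _ := by rw [e₉, mul_one]
  -- The inverse sends `v · a(y)` to the class of `(y, v)`: `ex` makes it defined locally and `inj`,
  -- through `uniq`, single valued.
  obtain ⟨σ, hσ⟩ := exists_hom_of_rel (B := L.M) (A := assocLog (a ≫ L.α))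
    (fun {V} n t => ∃ (y : sec F V) (v : (fn (dom V))ˣ), n = L.unit V v * ap a V y ∧
      t = ρ V v * ap p V y)
    (by
      rintro V W g _ _ ⟨y, v, rfl, rfl⟩
      refine ⟨rs F g y, unitsMap (mor g) v, ?_, ?_⟩
      · rw [map_mul, L.rs_unit, rs_ap]
      · rw [map_mul, rs_ap, hρr])
    (by
      intro V n x
      obtain ⟨W, g, w, y, v, e₁, e₂⟩ := ex n x
      exact ⟨W, g, w, _, e₁, y, v, e₂, rfl⟩)
    (by
      rintro V _ _ _ ⟨y, v, rfl, rfl⟩ ⟨y', v', e, rfl⟩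
      exact uniq _ _ _ _ e)
    (by
      rintro V _ ⟨y, v, e, rfl⟩
      refine (uniq y 1 v 1 (by rw [← e, map_one, map_one, one_mul])).trans ?_
      rw [map_one, map_one, mul_one])
    (by
      rintro V _ _ _ _ ⟨y, v, rfl, rfl⟩ ⟨y', v', rfl, rfl⟩
      exact ⟨y * y', v * v', by rw [map_mul, map_mul, mul_mul_mul_comm],
        by rw [map_mul, map_mul, mul_mul_mul_comm]⟩)
  refine ⟨σ, assocLog_hom_ext ?_ ?_, hom_ext_sec fun V n => sec_ext _ fun x => ?_⟩
  · change p ≫ _ ≫ σ = p ≫ _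
    rw [reassoc_of% d₁, Category.comp_id]
    refine hom_ext_sec fun V y => hσ _ _ ⟨y, 1, ?_, ?_⟩
    · rw [map_one, one_mul]; rfl
    · rw [map_one, one_mul]
  · change r ≫ _ ≫ σ = r ≫ _
    rw [reassoc_of% d₂, Category.comp_id]
    refine hom_ext_sec fun V v => hσ _ _ ⟨1, v, ?_, ?_⟩
    · rw [map_one, mul_one]; rfl
    · rw [map_one, mul_one]
      exact (hρ V v).symm
  · obtain ⟨W, g, w, y, v, e₁, e₂⟩ := ex n x
    refine ⟨W, g, w, e₁, ?_⟩
    rw [rs_ap, e₂]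
    change ap (assocLogDesc L a) W (ap σ W _) = _
    rw [hσ _ _ ⟨y, v, rfl, rfl⟩, map_mul, ← ap_comp, hρL, d₁, ← e₂]
    rfl

end Assoc
end
end LogGeom

namespace LogGeom
noncomputable section

lemma resHom_comp {S : Scheme.{u}} (U : S.Etale) {V V' V'' : (dom U).Etale} (g : V ⟶ V')
    (h : V' ⟶ V'') : resHom U (g ≫ h) = resHom U g ≫ resHom U h :=
  (etMap (str U) (str_etale U)).map_comp g h

/-- The inclusion of units on sections of the restriction to an étale scheme. -/
def IntLog.overUnit {S : Scheme.{u}} (L : IntLog S) (U : S.Etale) (V : (dom U).Etale) :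
    (fn (dom V))ˣ →* sec L.M (overObj U V) :=
  L.unit (overObj U V)

lemma IntLog.rs_overUnit {S : Scheme.{u}} (L : IntLog S) {U : S.Etale} {V W : (dom U).Etale}
    (k : W ⟶ V) (v : (fn (dom V))ˣ) :
    rs L.M (resHom U k) (L.overUnit U V v) = L.overUnit U W (unitsMap (mor k) v) :=
  L.rs_unit _ _

/-! ### Basicness of the trivialized prelog structure is basicness on sections. -/

namespace PLogPointIn
open PLogPoint
variable {P : Type u} [CommMonoid P] {X : IntLogSch.{u}} (z : PLogPointIn P X)

/-- The first component `a` of `f†` on sections. -/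
def aSec (V : (dom z.cover).Etale) : sec z.inv (overObj z.cover V) →* sec z.log.M (overObj z.cover V) :=
  ap z.a V

lemma rs_aSec {V W : (dom z.cover).Etale} (g : W ⟶ V) (x : sec z.inv (overObj z.cover V)) :
    rs z.log.M (resHom z.cover g) (z.aSec V x) = z.aSec W (rs z.inv (resHom z.cover g) x) :=
  rs_ap z.a g x

/-- Over the cover the trivialization picks one decomposition `n q` of `f†(x)`, namely with `n =
a(x)`; all others differ from it by units. -/
lemma exists_dagger_eq {V : (dom z.cover).Etale} (x : sec z.inv (overObj z.cover V)) :
    ∃ q, z.IsQ q ∧ ap z.f.dagger _ x = ap z.π _ (z.aSec V x) * q := by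
  obtain ⟨⟨m, p⟩, h⟩ := (z.φ.iso (overHom z.cover V)).surjective (ap z.f.dagger _ x)
  have ha : z.aSec V x = m := by
    change ((z.φ.iso (overHom z.cover V)).symm (ap z.f.dagger _ x)).1 = m
    rw [← h, MulEquiv.symm_apply_apply]
  exact ⟨_, isQ_iso (overHom z.cover V) p, by rw [ha, ← h, z.iso_eq]⟩

variable {z}

lemma exists_eq_unit_mul_over {V : (dom z.cover).Etale} {n n' : sec z.log.M (overObj z.cover V)}
    {q q' : sec z.log'.M (overObj z.cover V)} (hq : z.IsQ q) (hq' : z.IsQ q')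
    (h : ap z.π _ n * q = ap z.π _ n' * q') (x : dom V) : ∃ (W : (dom z.cover).Etale) (k : W ⟶ V)
      (w : dom W) (v : (fn (dom W))ˣ), mor k w = x ∧ rs z.log.M (resHom z.cover k) n =
        z.log.overUnit z.cover W v * rs z.log.M (resHom z.cover k) n' := by
  obtain ⟨W, g, w, v, e₁, -, e₂⟩ := hq.cancel hq' h x
  obtain ⟨V', k, v', j, e₃, e₄⟩ := exists_resHom g w
  refine ⟨V', k, v', unitsMap (mor j) v, e₃.trans e₁, ?_⟩
  rw [← e₄, rs_comp, e₂, map_mul, z.log.rs_unit, rs_comp]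
  rfl

lemma exists_aSec_eq_unit {V : (dom z.cover).Etale} {y : sec z.inv (overObj z.cover V)}
    (hy : z.IsQ (ap z.f.dagger _ y)) (x : dom V) : ∃ (W : (dom z.cover).Etale) (k : W ⟶ V)
      (w : dom W) (v : (fn (dom W))ˣ), mor k w = x ∧
        z.aSec W (rs z.inv (resHom z.cover k) y) = z.log.overUnit z.cover W v := by
  obtain ⟨q, hq, h⟩ := z.exists_dagger_eq y
  obtain ⟨W, k, w, v, e₁, e₂⟩ := exists_eq_unit_mul_over (n := z.aSec V y) (n' := 1) hq hy
    (by rw [map_one, one_mul, h]) x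
  refine ⟨W, k, w, v, e₁, ?_⟩
  rw [← rs_aSec, e₂, map_one, mul_one]

lemma LocBasic.exists_eq_overUnit_mul (hz : z.LocBasic) {V : (dom z.cover).Etale}
    (n : sec z.log.M (overObj z.cover V)) (x : dom V) : ∃ (W : (dom z.cover).Etale) (k : W ⟶ V)
      (w : dom W) (y : sec z.inv (overObj z.cover W)) (v : (fn (dom W))ˣ), mor k w = x ∧
        rs z.log.M (resHom z.cover k) n = z.log.overUnit z.cover W v * z.aSec W y := by
  let U := z.cover
  let F := eta z.f.base X.log.M
  obtain ⟨W, g, w, T, t, h, m, q, e₁, hq, e₂⟩ := hz.ex n x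
  obtain ⟨V₁, k, v₁, j, e₃, e₄⟩ := exists_resHom g w
  obtain ⟨q', hq', e₅⟩ := z.exists_dagger_eq (F.map (mor j ≫ t) (over_comp j h) m)
  have e₆ := congrArg (rs z.log'.M j) e₂
  rw [← z.f.map_left j t h, map_mul, rs_ap, ← rs_comp, e₄, ← dagger_eta z _ (over_comp j h),
    e₅] at e₆
  obtain ⟨V₂, k₂, v₂, u, e₇, e₈⟩ := exists_eq_unit_mul_over (hq.res j) hq' e₆.symm v₁
  refine ⟨V₂, k₂ ≫ k, v₂, rs z.inv (resHom U k₂) (F.map (mor j ≫ t) (over_comp j h) m), u,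
    by rw [← e₁, ← e₃, ← e₇]; rfl, ?_⟩
  rw [rs_aSec, ← rs_comp, ← resHom_comp] at e₈
  exact e₈

/-- After refinement `y` and `y'` come from sections `m`, `m'` over one étale `X`-scheme. Moving `v`
and `v'` from the `Q`-parts into the components makes the components equal, and the field `inj` of
`LocBasic` supplies the multipliers. -/
lemma LocBasic.exists_units (hz : z.LocBasic) {V : (dom z.cover).Etale}
    (y y' : sec z.inv (overObj z.cover V)) (v v' : (fn (dom V))ˣ)
    (e : z.log.overUnit z.cover V v * z.aSec V y = z.log.overUnit z.cover V v' * z.aSec V y')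
    (x : dom V) : ∃ (W : (dom z.cover).Etale) (k : W ⟶ V) (w : dom W)
      (c c' : sec z.inv (overObj z.cover W)) (s s' : (fn (dom W))ˣ), mor k w = x ∧
        z.aSec W c = z.log.overUnit z.cover W s ∧ z.aSec W c' = z.log.overUnit z.cover W s' ∧
        rs z.inv (resHom z.cover k) y * c = rs z.inv (resHom z.cover k) y' * c' := by
  let U := z.cover
  let F := eta z.f.base X.log.M
  obtain ⟨W, g, w, T, t₀, h₀, m, m', e₁, e₂, e₃⟩ := exists_eta_pair y y' x
  obtain ⟨V₁, k₁, v₁, j₁, e₄, e₅⟩ := exists_resHom g w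
  have h := over_comp j₁ h₀
  have a₁ : rs z.inv (resHom U k₁) y = F.map (mor j₁ ≫ t₀) h m := by
    rw [← e₅, rs_comp, e₂]
    exact (F.map_left j₁ t₀ h₀ m).symm
  have a₂ : rs z.inv (resHom U k₁) y' = F.map (mor j₁ ≫ t₀) h m' := by
    rw [← e₅, rs_comp, e₃]
    exact (F.map_left j₁ t₀ h₀ m').symm
  generalize mor j₁ ≫ t₀ = t at h a₁ a₂
  have e₆ := congrArg (rs z.log.M (resHom U k₁)) e
  rw [map_mul, map_mul, z.log.rs_overUnit, z.log.rs_overUnit, rs_aSec, rs_aSec, a₁, a₂] at e₆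
  obtain ⟨q, hq, b₁⟩ := z.exists_dagger_eq (F.map t h m)
  obtain ⟨q', hq', b₂⟩ := z.exists_dagger_eq (F.map t h m')
  rw [dagger_eta] at b₁ b₂
  have hN : ∀ (n : sec z.log.M (overObj U V₁)) (q) (u : (fn (dom (overObj U V₁)))ˣ),
      ap z.π _ n * q = ap z.π _ (z.log.unit _ u * n) * (z.log'.unit _ u⁻¹ * q) := by
    intro n q u
    rw [map_mul, z.π_unit, mul_mul_mul_comm, ← map_mul, mul_inv_cancel, map_one, one_mul]
  obtain ⟨W₂, g₂, w₂, T', k, t', h', l, l', c₁, c₂, c₃, c₄, c₅⟩ := hz.inj t h m m' _ _ _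
    (hq.unit_mul _) (hq'.unit_mul _) (b₁.trans (hN _ _ (unitsMap (mor k₁) v)))
    ((b₂.trans (hN _ _ (unitsMap (mor k₁) v'))).trans (congrArg (fun n => ap z.π _ n * _) e₆.symm)) v₁
  obtain ⟨V₂, k₂, v₂, j₂, c₆, c₇⟩ := exists_resHom g₂ w₂
  have h₂ := over_comp j₂ h'
  have hl : z.IsQ (ap z.f.dagger _ (F.map (mor j₂ ≫ t') h₂ l)) := by
    rw [dagger_eta, z.f.map_left j₂ t' h']
    exact c₃.res j₂
  have hl' : z.IsQ (ap z.f.dagger _ (F.map (mor j₂ ≫ t') h₂ l')) := by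
    rw [dagger_eta, z.f.map_left j₂ t' h']
    exact c₄.res j₂
  obtain ⟨V₃, k₃, v₃, s, d₁, d₂⟩ := exists_aSec_eq_unit hl v₂
  obtain ⟨V₄, k₄, v₄, s', d₃, d₄⟩ := exists_aSec_eq_unit (z := z) (V := V₃)
    (y := rs z.inv (resHom U k₃) (F.map (mor j₂ ≫ t') h₂ l'))
    (by rw [← rs_ap]; exact hl'.res _) v₃
  have d₅ := congrArg (rs z.log.M (resHom U k₄)) d₂
  rw [rs_aSec, z.log.rs_overUnit] at d₅
  refine ⟨V₄, k₄ ≫ k₃ ≫ k₂ ≫ k₁, v₄, rs z.inv (resHom U k₄) (rs z.inv (resHom U k₃)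
    (F.map (mor j₂ ≫ t') h₂ l)), rs z.inv (resHom U k₄) (rs z.inv (resHom U k₃)
    (F.map (mor j₂ ≫ t') h₂ l')), unitsMap (mor k₄) s, s', ?_, d₅, d₄, ?_⟩
  · have : mor k₁ v₁ = x := e₄.trans e₁
    rw [← this, ← c₁, ← c₆, ← d₁, ← d₃]; rfl
  · have c₈ : (mor j₂ ≫ t') ≫ mor k = mor (resHom U k₂) ≫ t := by
      rw [Category.assoc, c₂, ← c₇, mor_comp, Category.assoc]
    have hs : ∀ x, rs z.inv (resHom U (k₄ ≫ k₃)) (rs z.inv (resHom U k₂)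
        (rs z.inv (resHom U k₁) x)) = rs z.inv (resHom U (k₄ ≫ k₃ ≫ k₂ ≫ k₁)) x := by
      intro x
      rw [← rs_comp, ← rs_comp, ← resHom_comp, ← resHom_comp]
      exact congrArg (fun k => rs z.inv (resHom U k) x) (Category.assoc _ _ _)
    have f₁ := congrArg (F.map (mor j₂ ≫ t') h₂) c₅
    rw [map_mul, map_mul, F.map_square c₈ h h₂, F.map_square c₈ h h₂, ← a₁, ← a₂] at f₁
    have f₂ := congrArg (rs z.inv (resHom U (k₄ ≫ k₃))) f₁
    rw [map_mul, map_mul] at f₂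
    rw [← rs_comp, ← rs_comp, ← resHom_comp]
    exact (congrArg (· * _) (hs y)).symm.trans (f₂.trans (congrArg (· * _) (hs y')))

theorem LocBasic.isBasic (hz : z.LocBasic) : z.IsBasic :=
  isIso_assocLogDesc z.a (fun {_} => hz.exists_eq_overUnit_mul) (fun {_} => hz.exists_units)

lemma _root_.LogGeom.PLogPoint.Push.ap_ψ_iso {w : PLogPoint P} {N : IntLog w.base}
    {φ : N.M ⟶ w.log.M} (B : w.Push φ) {V : w.base.Etale} (a : V ⟶ w.cover) (n : sec N.M V)
    (p : LocallyConstant (dom V) P) :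
    ap B.ψ V (B.T.iso a (n, p)) = w.φ.iso a (ap φ V n, p) := by
  refine sec_ext _ fun x => ?_
  obtain ⟨W, g, w', e, hp⟩ := exists_const p x
  refine ⟨W, g, w', e, ?_⟩
  rw [rs_ap, B.T.iso_res, w.φ.iso_res, hp, w.iso_const, ← B.ψ_frame, rs_ap, ← B.ap_ψ_π, ← map_mul]
  exact congrArg (ap B.ψ W) (B.point.iso_const (g ≫ a) _ _)

namespace Factorization
variable (D : Factorization z)

lemma dagger_ψ : D.point.f.dagger ≫ D.B.ψ = z.f.dagger := by
  refine invImage_hom_ext fun {V T} t h m => ?_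
  refine (congrArg (ap D.B.ψ V) (dagger_eta D.point t h m)).trans ?_
  exact (D.ap_ψ_G t h m).trans (dagger_eta z t h m).symm

lemma ap_φ_aSec (V : (dom z.cover).Etale) (x : sec z.inv (overObj z.cover V)) :
    ap D.φ (overObj z.cover V) (D.point.aSec V x) = z.aSec V x := by
  change ap D.φ (overObj z.cover V) ((D.B.T.iso (overHom z.cover V)).symm
    (ap D.point.f.dagger _ x)).1 = ((z.φ.iso (overHom z.cover V)).symm (ap z.f.dagger _ x)).1
  obtain ⟨⟨m, p⟩, e⟩ := (D.B.T.iso (overHom z.cover V)).surjective (ap D.point.f.dagger _ x)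
  have e' : ap z.f.dagger (overObj z.cover V) x = z.φ.iso (overHom z.cover V) (ap D.φ _ m, p) := by
    rw [← D.B.ap_ψ_iso, e]
    exact congr(ap $(D.dagger_ψ.symm) _ x)
  rw [← e, e', MulEquiv.symm_apply_apply, MulEquiv.symm_apply_apply]

end Factorization

variable [IsCancelMul P] [Subsingleton Pˣ]

/-- Over the cover, the log structures of `z` and of the basic point `D.point` are associated to the
same prelog structure on `f⁻¹ M_X`, compatibly with `D.φ`. So `D.φ` is an isomorphism there, the
arrow to `D.point` is strict, and basicness passes back along strict arrows. -/
theorem IsBasic.locBasic (hz : z.IsBasic) : z.LocBasic := by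
  obtain ⟨D, hD⟩ := z.exists_factorization
  let U := z.cover
  let φ : (D.N.res U).M ⟶ (z.log.res U).M := (resSheaf U).map D.φ
  have hφ : IsIso φ := isIso_of_assocLogDesc (c := D.point.a) (a := z.a)
    (hom_ext_sec fun V n => congr(ap $D.φ_α (overObj U V) n))
    (hom_ext_sec fun V x => D.ap_φ_aSec V x) hD.isBasic hz
  have hb : ∀ V : (dom U).Etale, Function.Bijective (ap D.φ (overObj U V)) := by
    intro V
    have := (sheafToPresheaf _ _).map_isIso φ
    exact (ConcreteCategory.isIso_iff_bijective _).1
      ((NatTrans.isIso_iff_isIso_app ((sheafToPresheaf _ _).map φ)).1 this (op V))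
  refine hD.of_locStrict D.arrow ⟨fun {V} n x => ?_, fun {V Y} t h m m' v v' e x => ?_⟩
  · change sec z.log.M V at n
    obtain ⟨W, g, w, a, e⟩ := exists_section z.cover_surj x
    obtain ⟨T, j, w', e', -⟩ := exists_overObj a w
    obtain ⟨m, hm⟩ := (hb T).2 (rs z.log.M (j ≫ g) n)
    have h : 𝟙 (dom (overObj U T)) ≫ str (overObj U T) = str (overObj U T) ≫ 𝟙 z.base := by
      rw [Category.id_comp, Category.comp_id]
    refine ⟨overObj U T, j ≫ g, w', overObj U T, 𝟙 _, h, m, 1, by rw [← e, ← e']; rfl, ?_⟩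
    refine hm.symm.trans ?_
    rw [map_one, one_mul]
    exact (LogMap.ofHom_id (hφ := D.φ_α) h m).symm
  · obtain ⟨W, g, w, a, e₁⟩ := exists_section z.cover_surj x
    obtain ⟨T, j, w', e₂, -⟩ := exists_overObj a w
    change sec D.N.M Y at m m'
    change (fn (dom V))ˣ at v v'
    let s : V ⟶ Y := etHom t (h.trans (Category.comp_id _))
    have e₃ : ap D.φ V (D.N.unit V v * rs D.N.M s m) = ap D.φ V (D.N.unit V v' * rs D.N.M s m') := by
      rw [map_mul, map_mul, ap_unit D.φ_α, ap_unit D.φ_α]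
      exact e
    have e₄ := congrArg (rs z.log.M (j ≫ g)) e₃
    rw [rs_ap, rs_ap] at e₄
    have e₅ := (hb T).1 e₄
    rw [map_mul, map_mul, D.N.rs_unit, D.N.rs_unit, ← rs_comp, ← rs_comp] at e₅
    refine ⟨overObj U T, j ≫ g, w', overObj U T, (j ≫ g) ≫ s, 𝟙 _,
      (unitsMap (mor (j ≫ g)) v)⁻¹ * unitsMap (mor (j ≫ g)) v', by rw [← e₁, ← e₂]; rfl,
      Category.id_comp _, ?_⟩
    change rs D.N.M ((j ≫ g) ≫ s) m = D.N.unit _ _ * rs D.N.M ((j ≫ g) ≫ s) m'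
    rw [map_mul, mul_assoc, ← e₅, ← mul_assoc, ← map_mul, inv_mul_cancel, map_one, one_mul]

theorem isMinimal_iff_isBasic : IsMinimal (logPoints P X) z ↔ z.IsBasic :=
  z.isMinimal_iff_locBasic.trans ⟨LocBasic.isBasic, IsBasic.locBasic⟩

end PLogPointIn
end
end LogGeom

namespace LogGeom
noncomputable section

/-! ### Composites and full subcategories of cartesian arrows. -/

section Cartesian
variable {𝒳 𝒴 𝒮 : Type*} [Category* 𝒳] [Category* 𝒴] [Category* 𝒮]

lemma isStronglyCartesian_comp (p : 𝒳 ⥤ 𝒴) (q : 𝒴 ⥤ 𝒮) {a b : 𝒳} (φ : a ⟶ b)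
    (h₁ : p.IsStronglyCartesian (p.map φ) φ)
    (h₂ : q.IsStronglyCartesian (q.map (p.map φ)) (p.map φ)) :
    (p ⋙ q).IsStronglyCartesian ((p ⋙ q).map φ) φ where
  universal_property' {c} g ψ hψ := by
    have e := IsHomLift.eq_of_isHomLift (p ⋙ q) (g ≫ (p ⋙ q).map φ) ψ
    change q.obj (p.obj c) ⟶ q.obj (p.obj a) at g
    change g ≫ q.map (p.map φ) = q.map (p.map ψ) at e
    have hq : q.IsHomLift (g ≫ q.map (p.map φ)) (p.map ψ) := by rw [e]; infer_instance
    obtain ⟨k, ⟨hk, e₁⟩, hk'⟩ := h₂.universal_property' g (p.map ψ)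
    have hp : p.IsHomLift (k ≫ p.map φ) ψ := by rw [e₁]; infer_instance
    obtain ⟨χ, ⟨hχ, e₂⟩, hχ'⟩ := h₁.universal_property' k ψ
    obtain rfl := IsHomLift.eq_of_isHomLift p k χ
    obtain rfl := IsHomLift.eq_of_isHomLift q g (p.map χ)
    refine ⟨χ, ⟨inferInstanceAs ((p ⋙ q).IsHomLift ((p ⋙ q).map χ) χ), e₂⟩, ?_⟩
    rintro χ' ⟨h, e₃⟩
    have e₄ : q.map (p.map χ) = q.map (p.map χ') :=
      IsHomLift.eq_of_isHomLift (p ⋙ q) (q.map (p.map χ)) χ'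
    have e₅ := hk' (p.map χ') ⟨by rw [e₄]; infer_instance, by rw [← p.map_comp, e₃]⟩
    exact hχ' χ' ⟨by rw [← e₅]; infer_instance, e₃⟩

lemma isStronglyCartesian_fullSubcategory (p : 𝒳 ⥤ 𝒮) (Q : ObjectProperty 𝒳)
    {a b : Q.FullSubcategory} {R : 𝒮} (f : R ⟶ p.obj b.obj) (φ : a ⟶ b)
    (h : p.IsStronglyCartesian f φ.hom) : (Q.ι ⋙ p).IsStronglyCartesian f φ := by
  obtain rfl := IsHomLift.domain_eq p f φ.hom
  obtain rfl := IsHomLift.eq_of_isHomLift p f φ.hom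
  have h₀ : (Q.ι ⋙ p).IsHomLift (p.map φ.hom) φ := .map φ
  refine ⟨fun {c} g ψ hψ => ?_⟩
  have e := IsHomLift.eq_of_isHomLift (Q.ι ⋙ p) (g ≫ p.map φ.hom) ψ
  have hψ' : p.IsHomLift (g ≫ p.map φ.hom) ψ.hom := by rw [e]; exact .map ψ.hom
  obtain ⟨χ, ⟨hχ, e₁⟩, hχ'⟩ := h.universal_property' g ψ.hom
  obtain rfl := IsHomLift.eq_of_isHomLift p g χ
  refine ⟨⟨χ⟩, ⟨.map (p := Q.ι ⋙ p) (⟨χ⟩ : c ⟶ a), by ext1; exact e₁⟩, ?_⟩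
  rintro χ' ⟨h', e₂⟩
  ext1
  refine hχ' χ'.hom ⟨?_, congr(($e₂).hom)⟩
  have e₃ := IsHomLift.eq_of_isHomLift (Q.ι ⋙ p) (p.map χ) χ'
  rw [e₃]
  exact .map χ'.hom
end Cartesian

/-! ### Minimal objects in a groupoid fibration over log schemes. -/

section Minimal
variable {𝒵 : Type*} [Category* 𝒵] {F : 𝒵 ⥤ IntLogSch.{u}} {w z z' : 𝒵}

lemma IsGroupoidFibration.isStronglyCartesian (hF : IsGroupoidFibration F) (i : w ⟶ z)
    (hi : IsStrict (F.map i)) :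
    (F ⋙ underlying).IsStronglyCartesian ((F ⋙ underlying).map i) i :=
  isStronglyCartesian_comp F underlying i (hF.cartesian i) hi

lemma exists_strict (X : IntLogSch.{u}) {S : Scheme.{u}} (b : S ⟶ underlying.obj X) :
    ∃ (Y : IntLogSch.{u}) (p : Y ⟶ X), underlying.IsStronglyCartesian b p :=
  ⟨_, pullbackMap X b, (locStrict_pullbackMap X b).isStrict⟩

lemma IsGroupoidFibration.exists_strict_lift (hF : IsGroupoidFibration F) (z : 𝒵) {S : Scheme.{u}}
    (b : S ⟶ (F ⋙ underlying).obj z) : ∃ (w : 𝒵) (φ : w ⟶ z),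
      (F ⋙ underlying).IsStronglyCartesian b φ ∧ IsStrict (F.map φ) := by
  change S ⟶ underlying.obj (F.obj z) at b
  obtain ⟨Y, p, hp⟩ := exists_strict (F.obj z) b
  obtain rfl := IsHomLift.domain_eq underlying b p
  obtain rfl := IsHomLift.eq_of_isHomLift underlying b p
  obtain ⟨w, φ, hφ⟩ := hF.exists_lift z p
  obtain rfl := IsHomLift.domain_eq F p φ
  obtain rfl := IsHomLift.eq_of_isHomLift F p φ
  exact ⟨w, φ, hF.isStronglyCartesian φ hp, hp⟩

/-- Every arrow `f` to an object over `(Sch)` factors through an arrow over an identity followed by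
a strict arrow. -/
lemma IsGroupoidFibration.exists_factor (hF : IsGroupoidFibration F) (f : w ⟶ z) :
    ∃ (v : 𝒵) (k : w ⟶ v) (φ : v ⟶ z), OverId F k ∧ IsStrict (F.map φ) ∧ k ≫ φ = f := by
  obtain ⟨v, φ, hφ, hs⟩ := hF.exists_strict_lift z ((F ⋙ underlying).map f)
  obtain ⟨k, ⟨hk, e⟩, -⟩ := Functor.IsStronglyCartesian.universal_property (F ⋙ underlying)
    ((F ⋙ underlying).map f) φ (𝟙 _) _ (Category.id_comp _).symm f
  exact ⟨v, k, φ, hk, hs, e⟩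

/-- For an arrow of minimal objects, factor it as `k` over an identity followed by a strict `φ`. The
middle object is minimal by `h`, so `k` is an isomorphism and the composite is strict. -/
theorem IsGroupoidFibration.strictMinimalCompat (hF : IsGroupoidFibration F)
    (h : ∀ {w z : 𝒵} (i : w ⟶ z), IsMinimal F z → IsStrict (F.map i) → IsMinimal F w) :
    StrictMinimalCompat F := by
  refine fun {w z} i hz => ⟨h i hz, fun hw => ?_⟩
  obtain ⟨v, k, φ, hk, hs, rfl⟩ := hF.exists_factor i
  have := hw.isIso (h φ hz hs) k hk
  rw [F.map_comp]
  exact ((LocStrict.of_isIso (F.map k)).comp hs.locStrict).isStrict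

/-- Existence: factor `f` as `k` over an identity followed by a strict arrow to `z'`; the middle
object is minimal, so `k` extends along `i`. Uniqueness: an arrow `a` of minimal objects is strict,
hence cartesian over schemes. A second arrow with the same underlying morphism is therefore `l ≫ a`
with `i ≫ l = i`, and minimality of `z` gives `l = 𝟙 z`. -/
theorem IsGroupoidFibration.existsUnique_factor (hF : IsGroupoidFibration F)
    (hc : StrictMinimalCompat F) (i : w ⟶ z) (hi : OverId F i) (hz : IsMinimal F z)
    (hz' : IsMinimal F z') (f : w ⟶ z') : ∃! a : z ⟶ z', i ≫ a = f := by
  have hm : ∀ a a' : z ⟶ z', i ≫ a = i ≫ a' → a' = a := by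
    intro a a' e
    have : IsIso ((F ⋙ underlying).map i) := hi.isIso
    have e₁ : (F ⋙ underlying).map a' = (F ⋙ underlying).map a := by
      rw [← cancel_epi ((F ⋙ underlying).map i), ← Functor.map_comp, ← Functor.map_comp, e]
    have ha := hF.isStronglyCartesian a ((hc a hz').2 hz)
    obtain ⟨l, ⟨hl, e₂⟩, -⟩ := Functor.IsStronglyCartesian.universal_property (F ⋙ underlying)
      ((F ⋙ underlying).map a) a (𝟙 _) _ (e₁.trans (Category.id_comp _).symm) a'
    have h₁ : (F ⋙ underlying).IsHomLift ((F ⋙ underlying).map i) (i ≫ l) := inferInstance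
    have e₃ : i ≫ l = i := Functor.IsStronglyCartesian.ext (F ⋙ underlying)
      ((F ⋙ underlying).map a) a ((F ⋙ underlying).map i) (by rw [Category.assoc, e₂, e])
    obtain ⟨k, -, hk⟩ := hz i i hi hi
    rw [← e₂, hk l e₃, ← hk (𝟙 z) (Category.comp_id i), Category.id_comp]
  obtain ⟨v, k, φ, hk, hs, rfl⟩ := hF.exists_factor f
  obtain ⟨l, hl, -⟩ := (hc φ hz').1 hs i k hi hk
  have e : i ≫ l ≫ φ = k ≫ φ := by rw [← Category.assoc, hl]
  exact ⟨l ≫ φ, e, fun a ha => hm _ _ (e.trans ha.symm)⟩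
end Minimal

namespace PLogPointIn
variable {P : Type u} [CommMonoid P] [IsCancelMul P] [Subsingleton Pˣ] {X : IntLogSch.{u}}

theorem strictMinimalCompat : StrictMinimalCompat (logPoints P X) :=
  isGroupoidFibration.strictMinimalCompat fun {w z} i hz hi =>
    (isMinimal_iff_locBasic w).2 (((isMinimal_iff_locBasic z).1 hz).of_locStrict i
      (IsStrict.locStrict (Y := w.lower) (X := z.lower) hi))

end PLogPointIn
end
end LogGeom

namespace LogGeom
noncomputable section

/-! ### Fully faithful functors over a base. -/

section Based
variable {𝒮 : Type*} [Category* 𝒮]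

variable {𝒳 : Type*} [Category* 𝒳] {𝒴 : Type*} [Category* 𝒴] {p : 𝒳 ⥤ 𝒮} {q : 𝒴 ⥤ 𝒮}

/-- A fully faithful functor over `𝒮` that is essentially surjective up to isomorphisms over
identities has an inverse over `𝒮`. -/
lemma exists_based_inverse (H : 𝒳 ⥤ 𝒴) (w : H ⋙ q = p) [H.Full] [H.Faithful]
    (hs : ∀ y : 𝒴, ∃ (x : 𝒳) (e : H.obj x ≅ y), q.IsHomLift (𝟙 (q.obj y)) e.hom) :
    ∃ (G : 𝒴 ⥤ 𝒳) (_ : G ⋙ p = q) (η : 𝟭 𝒳 ≅ H ⋙ G) (ε : G ⋙ H ≅ 𝟭 𝒴),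
      (∀ x, p.IsHomLift (𝟙 (p.obj x)) (η.hom.app x)) ∧
        ∀ y, q.IsHomLift (𝟙 (q.obj y)) (ε.hom.app y) := by
  subst w
  choose o e he using hs
  let G : 𝒴 ⥤ 𝒳 :=
    { obj := o
      map := fun {y y'} g => H.preimage ((e y).hom ≫ g ≫ (e y').inv)
      map_id := fun y => H.map_injective (by simp)
      map_comp := fun f g => H.map_injective (by simp) }
  let ε : G ⋙ H ≅ 𝟭 𝒴 := NatIso.ofComponents e (fun {y y'} g => by simp [G])
  let η : 𝟭 𝒳 ≅ H ⋙ G := NatIso.ofComponents (fun x => (H.preimageIso (e (H.obj x))).symm)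
    (fun {x x'} f => H.map_injective (by simp [G]))
  have hi (y : 𝒴) : q.IsHomLift (𝟙 (q.obj y)) (e y).inv := by
    have := he y
    exact IsHomLift.lift_id_inv q (q.obj y) (e y)
  refine ⟨G, ?_, η, ε, fun x => ?_, he⟩
  · refine CategoryTheory.Functor.ext (F := G ⋙ H ⋙ q) (G := q) (fun (y : 𝒴) => IsHomLift.domain_eq q (𝟙 (q.obj y)) (e y).hom) fun y y' g => ?_
    have h₁ := he y
    have h₂ := hi y'
    have h₃ : q.IsHomLift (q.map g) ((e y).hom ≫ g ≫ (e y').inv) := by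
      have := IsHomLift.comp q (𝟙 (q.obj y)) (q.map g ≫ 𝟙 _) (e y).hom (g ≫ (e y').inv)
      rwa [Category.id_comp, Category.comp_id] at this
    refine Eq.trans (congrArg q.map (H.map_preimage _)) (IsHomLift.fac' q (q.map g) _)
  · have h₁ : q.IsHomLift (𝟙 (q.obj (H.obj x))) (H.map (η.hom.app x)) := by
      have : H.map (η.hom.app x) = (e (H.obj x)).inv := H.map_preimage _
      rw [this]
      exact hi _
    have hf := IsHomLift.fac q (𝟙 (q.obj (H.obj x))) (H.map (η.hom.app x))
    exact IsHomLift.of_fac (H ⋙ q) _ _ rfl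
      (IsHomLift.codomain_eq q (𝟙 (q.obj (H.obj x))) (H.map (η.hom.app x))) hf
end Based

lemma fibEquiv_of_fullyFaithful {𝒵 𝒲 : Type (u + 1)} [Category.{u + 1} 𝒵] [Category.{u + 1} 𝒲]
    {F : 𝒵 ⥤ IntLogSch.{u}} {G : 𝒲 ⥤ IntLogSch.{u}} (H : 𝒵 ⥤ 𝒲) (w : H ⋙ G = F) [H.Full]
    [H.Faithful] (hs : ∀ y : 𝒲, ∃ (x : 𝒵) (e : H.obj x ≅ y), G.IsHomLift (𝟙 (G.obj y)) e.hom) :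
    FibEquiv F G := by
  obtain ⟨K, w', η, ε, hη, hε⟩ := exists_based_inverse H w hs
  let A := BasedCategory.ofFunctor F
  let B := BasedCategory.ofFunctor G
  let f : BasedFunctor A B := ⟨H, w⟩
  let g : BasedFunctor B A := ⟨K, w'⟩
  let η' : BasedFunctor.id A ≅ f.comp g := BasedNatIso.mkNatIso η hη
  let ε' : g.comp f ≅ BasedFunctor.id B := BasedNatIso.mkNatIso ε hε
  exact ⟨Bicategory.Equivalence.mkOfAdjointifyCounit (a := A) (b := B) (f := f) (g := g) η' ε'⟩

/-! ### The fibration of minimal objects and the equivalence. -/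

section Minimal
variable {𝒵 : Type (u + 1)} [Category.{u + 1} 𝒵] {F : 𝒵 ⥤ IntLogSch.{u}}

/-- The fibration of minimal objects, with its log structure. -/
def minimalFibration (hF : IsGroupoidFibration F) (hc : StrictMinimalCompat F) :
    LogFibration.{u} where
  obj := ObjectProperty.FullSubcategory fun z : 𝒵 => IsMinimal F z
  M := ObjectProperty.ι _ ⋙ F
  strict {x y} f := (hc f.hom y.property).2 x.property
  fibration :=
    { exists_lift := fun z S b => by
        obtain ⟨w, φ, hφ, hs⟩ := hF.exists_strict_lift z.obj b
        exact ⟨⟨w, (hc φ z.property).1 hs⟩, ⟨φ⟩,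
          isStronglyCartesian_fullSubcategory (F ⋙ underlying) _ b _ hφ⟩
      cartesian := fun {w z} φ => isStronglyCartesian_fullSubcategory (F ⋙ underlying) _ _ φ
        (hF.isStronglyCartesian φ.hom ((hc φ.hom z.property).2 w.property)) }

lemma overId_map_iff {w z : 𝒵} (i : w ⟶ z) :
    underlying.IsHomLift (𝟙 (underlying.obj (F.obj w))) (F.map i) ↔ OverId F i := by
  constructor <;> intro h
  · exact IsHomLift.of_fac (F ⋙ underlying) _ i rfl
      (IsHomLift.codomain_eq underlying (𝟙 (underlying.obj (F.obj w))) (F.map i))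
      (IsHomLift.fac underlying (𝟙 (underlying.obj (F.obj w))) (F.map i))
  · have h' : (F ⋙ underlying).IsHomLift (𝟙 ((F ⋙ underlying).obj w)) i := h
    exact IsHomLift.of_fac underlying _ (F.map i) rfl
      (IsHomLift.codomain_eq (F ⋙ underlying) (𝟙 ((F ⋙ underlying).obj w)) i)
      (IsHomLift.fac (F ⋙ underlying) (𝟙 ((F ⋙ underlying).obj w)) i)

lemma IsMinimal.exists_iso {w z z' : 𝒵} (hz : IsMinimal F z) (hz' : IsMinimal F z') (i : w ⟶ z)
    (j : w ⟶ z') (hi : OverId F i) (hj : OverId F j) : ∃ e : z ≅ z', i ≫ e.hom = j := by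
  obtain ⟨k, hk, -⟩ := hz' i j hi hj
  obtain ⟨l, hl, -⟩ := hz j i hj hi
  have h₁ : k ≫ l = 𝟙 z := (hz i i hi hi).unique
    (by rw [← Category.assoc, hk, hl]) (Category.comp_id i)
  have h₂ : l ≫ k = 𝟙 z' := (hz' j j hj hj).unique
    (by rw [← Category.assoc, hl, hk]) (Category.comp_id j)
  exact ⟨⟨k, l, h₁, h₂⟩, hk⟩

section Equivalence
variable (hF : IsGroupoidFibration F) (hc : StrictMinimalCompat F) (m : 𝒵 → 𝒵) (i : ∀ w, w ⟶ m w)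
  (him : ∀ w, IsMinimal F (m w)) (hi : ∀ w, OverId F (i w)) (a : ∀ {w w' : 𝒵}, (w ⟶ w') → (m w ⟶ m w'))
  (ha : ∀ {w w' : 𝒵} (f : w ⟶ w'), i w ≫ a f = f ≫ i w')
  (ha' : ∀ {w w' : 𝒵} (f : w ⟶ w') (b : m w ⟶ m w'), i w ≫ b = f ≫ i w' → b = a f)

/-- The functor sending `w` to the log structure `F w` over a minimal object under `w`. -/
def toMinimalFibration : 𝒵 ⥤ (minimalFibration hF hc).overId.FullSubcategory where
  obj w := ⟨⟨F.obj w, ⟨m w, him w⟩, F.map (i w)⟩, (overId_map_iff (i w)).2 (hi w)⟩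
  map {w w'} f := ObjectProperty.homMk
    { left := F.map f
      right := ObjectProperty.homMk (a f)
      w := by
        change F.map f ≫ F.map (i w') = F.map (i w) ≫ F.map (a f)
        rw [← F.map_comp, ← F.map_comp, ha] }
  map_id w := by
    ext1
    refine CommaMorphism.ext (F.map_id w) ?_
    refine ObjectProperty.hom_ext _ ?_
    exact (ha' (𝟙 w) (𝟙 (m w)) (by rw [Category.comp_id, Category.id_comp])).symm
  map_comp {w w' w''} f g := by
    ext1
    refine CommaMorphism.ext (F.map_comp f g) ?_
    refine ObjectProperty.hom_ext _ ?_
    exact (ha' (f ≫ g) (a f ≫ a g) (by rw [← Category.assoc, ha, Category.assoc, ha,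
      Category.assoc])).symm

end Equivalence

/-- The functor sends `w` to `F w ⟶ F (m w)` for a chosen arrow `i w : w ⟶ m w` to a minimal object.
It is fully faithful because `i w'` is cartesian over log schemes: an arrow `w ⟶ w'` is the same as
its image under `F` with a compatible arrow `m w ⟶ m w'`. An object `f : T ⟶ F x` is reached by
pulling `x` back along `f` to some `w`; then `x` and `m w` are both minimal under `w`, hence
isomorphic. -/
theorem fibEquiv_minimalFibration (hF : IsGroupoidFibration F) (hc : StrictMinimalCompat F)
    (hm : EnoughMinimals F) : FibEquiv F (minimalFibration hF hc).proj := by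
  choose m i him hi using hm
  have hu : ∀ (w w' : 𝒵) (f : w ⟶ w'), ∃! a : m w ⟶ m w', i w ≫ a = f ≫ i w' := fun w w' f =>
    hF.existsUnique_factor hc (i w) (hi w) (him w) (him w') (f ≫ i w')
  choose a ha ha' using hu
  let H := toMinimalFibration hF hc m i him hi (fun {w w'} => a w w')
    (fun {w w'} => ha w w') (fun {w w'} => ha' w w')
  have h₁ : H.Full := ⟨fun {w w'} g => by
    let l : F.obj w ⟶ F.obj w' := g.hom.left
    let r : m w ⟶ m w' := g.hom.right.hom
    have e : l ≫ F.map (i w') = F.map (i w) ≫ F.map r := g.hom.w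
    have hl : F.IsHomLift (l ≫ F.map (i w')) (i w ≫ r) := by
      rw [e, ← F.map_comp]; infer_instance
    obtain ⟨f, ⟨hf, e'⟩, -⟩ := (hF.cartesian (i w')).universal_property' l (i w ≫ r)
    have e₁ : F.map f = l := (IsHomLift.eq_of_isHomLift F l f).symm
    have e₂ : a w w' f = r := (ha' w w' f r e'.symm).symm
    refine ⟨f, ?_⟩
    ext1
    refine CommaMorphism.ext e₁ ?_
    refine ObjectProperty.hom_ext _ ?_
    exact e₂⟩
  have h₂ : H.Faithful := ⟨fun {w w'} f g e => by
    have e₁ : F.map f = F.map g := congr(($e).hom.left)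
    have e₂ : a w w' f = a w w' g := congr(($e).hom.right.hom)
    have := hF.cartesian (i w')
    have h : F.IsHomLift (F.map f) g := by rw [e₁]; infer_instance
    exact Functor.IsStronglyCartesian.ext F (F.map (i w')) (i w') (F.map f)
      (by rw [← ha, ← ha, e₂])⟩
  refine fibEquiv_of_fullyFaithful H rfl ?_
  rintro ⟨⟨T, x, f⟩, h⟩
  obtain ⟨x, hx⟩ := x
  change T ⟶ F.obj x at f
  obtain ⟨w, ψ, hψ⟩ := hF.exists_lift x f
  obtain rfl := IsHomLift.domain_eq F f ψ
  obtain rfl := IsHomLift.eq_of_isHomLift F f ψ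
  obtain ⟨e, he⟩ := IsMinimal.exists_iso (@him w) @hx (i w) ψ (hi w) ((overId_map_iff ψ).1 h)
  let E : H.obj w ≅ ⟨⟨F.obj w, ⟨x, hx⟩, F.map ψ⟩, h⟩ := ObjectProperty.isoMk _
    (Comma.isoMk (Iso.refl _) (ObjectProperty.isoMk _ e) (by
      change 𝟙 (F.obj w) ≫ F.map ψ = F.map (i w) ≫ F.map e.hom
      rw [Category.id_comp, ← F.map_comp, he]))
  exact ⟨w, E, Functor.IsHomLift.map (p := (minimalFibration hF hc).proj) E.hom⟩
end Minimal
end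
end LogGeom


theorem mainTheorem5 (P : Type u) [CommMonoid P] [IsCancelMul P] [Subsingleton Pˣ]
    (X : LogGeom.IntLogSch.{u}) :
    LogGeom.IsGroupoidFibration (LogGeom.logPoints P X) ∧
    (∀ z : LogGeom.PLogPointIn P X, LogGeom.IsMinimal (LogGeom.logPoints P X) z ↔ z.IsBasic) ∧
    LogGeom.EnoughMinimals (LogGeom.logPoints P X) ∧
    LogGeom.StrictMinimalCompat (LogGeom.logPoints P X) ∧
    ∃ 𝒳 : LogGeom.LogFibration.{u}, LogGeom.FibEquiv (LogGeom.logPoints P X) 𝒳.proj :=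
  ⟨LogGeom.PLogPointIn.isGroupoidFibration, fun _ => LogGeom.PLogPointIn.isMinimal_iff_isBasic,
    LogGeom.PLogPointIn.enoughMinimals, LogGeom.PLogPointIn.strictMinimalCompat,
    LogGeom.minimalFibration LogGeom.PLogPointIn.isGroupoidFibration
      LogGeom.PLogPointIn.strictMinimalCompat,
    LogGeom.fibEquiv_minimalFibration LogGeom.PLogPointIn.isGroupoidFibration
      LogGeom.PLogPointIn.strictMinimalCompat LogGeom.PLogPointIn.enoughMinimals⟩
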